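/- **Setting.** Let $V=\mathbb C^N$. For $X\in\mathrm{End}(V\otimes V)$, $X_{mr}$ denotes $X$ acting in the factors $m,r$ of $V^{\otimes n}$, and $X_m:=X_{m,m+1}$; $P$ is the flip. $X$ is *skew invertible* if there is $\Psi_X$ with $\mathrm{Tr}_{(2)}X_{12}(\Psi_X)_{23}=\mathrm{Tr}_{(2)}(\Psi_X)_{12}X_{23}=P_{13}$; put $C_X=\mathrm{Tr}_{(1)}\Psi_X$, $D_X=\mathrm{Tr}_{(2)}\Psi_X$; $X$ is *strict skew invertible* if in addition $C_X$ or $D_X$ is invertible. An *R-matrix* is an invertible $X$ with $X_1X_2X_1=X_2X_1X_2$. A pair $\{R,F\}$ is *compatible* if $R_1F_2F_1=F_2F_1R_2$ and $R_2F_1F_2=F_1F_2R_1$. For a skew invertible R-matrix $R$, the R-trace of a matrix $Y$ is $\mathrm{Tr}_R\,Y=\mathrm{Tr}(D_RY)$; $\mathrm{Tr}_{R(i,\dots,j)}$ is the R-trace over the factors $i,\dots,j$. Let $q\in\mathbb C\setminus\{0,\pm1\}$, $\mu\in\mathbb C\setminus\{0,q,-q^{-1}\}$. An R-matrix $R$ is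 of *BMW type* if its minimal polynomial is $(x-q)(x+q^{-1})(x-\mu)$ and $K:=\mu^{-1}(q-q^{-1})^{-1}(q-R)(q^{-1}+R)$ satisfies $K_2K_1=R_1^{\pm1}R_2^{\pm1}K_1$ and $K_1K_2K_1=K_1$. Let $\rho_R$ be the representation of the braid groups $\mathcal B_n$ on $V^{\otimes n}$ sending the standard generator $\sigma_i$ to $R_i$; write $\alpha^{\uparrow n}$ for $\alpha$ with all $\sigma_i$ replaced by $\sigma_{i+n}$. Put $i_q=(q^i-q^{-i})/(q-q^{-1})$, $\eta=\frac{(q-\mu)(q^{-1}+\mu)}{\mu(q-q^{-1})}$, and define the antisymmetrizers $a^{(i)}$ by $$a^{(1)}=1,\quad a^{(i+1)}=\tfrac{q^i}{(i+1)_q}\,a^{(i)}\sigma_i^-(q^{-2i})\,a^{(i)},\quad \sigma_i^-(x)=1+\tfrac{x-1}{q-q^{-1}}\sigma_i+\tfrac{x-1}{q\mu^{-1}x+1}\kappa_i,\quad \rho_R(\kappa_i)=K_i .$$ For $k\ge2$, $R$ is of *$O(k)$-type* if it is a skew invertible BMW-type R-matrix with $i_q\ne0$ and $\mathrm{rk}\,\rho_R(a^{(i)})\neq0$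 for $2\le i\le k$, $\rho_R\bigl(a^{(k)\uparrow1}\sigma_1^-(q^{-2k})a^{(k)\uparrow1}\bigr)=0$, $\mu=q^{1-k}$ and $\mathrm{rk}\,\rho_R(a^{(k)})=1$. **The algebras.** Let $\ell\ge1$ and let $\{R,F\}$ be a compatible pair of R-matrices, $R$ of $O(2\ell)$-type and $F$ strict skew invertible. For an $N\times N$ matrix $M$ put $M_{\bar1}=M_1$, $M_{\overline{i+1}}=F_iM_{\bar i}F_i^{-1}$, and $$ch(\alpha)=\mathrm{Tr}_{R(1,\dots,n)}\bigl(M_{\bar1}\cdots M_{\bar n}\rho_R(\alpha)\bigr),\qquad (M^{\alpha})_1=\mathrm{Tr}_{R(2,\dots,n)}\bigl(M_{\bar1}\cdots M_{\bar n}\rho_R(\alpha)\bigr)\qquad(\alpha\in\mathbb C\mathcal B_n),$$ $a_0=1$, $a_i=ch(a^{(i)})$, $g=\eta^{-1}\mathrm{Tr}_{R(1,2)}(M_{\bar1}M_{\bar2}K_1)$. Let $G_1=\mathrm{Tr}_{(2,3)}K_2F_1^{-1}F_2^{-1}$ (ordinary traces). The *component* $O^{\pm}(2\ell)$ is the unital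 associative $\mathbb C$-algebra generated by the entries of $M$ and by $g^{-1}$, with relations $$R_1M_{\bar1}M_{\bar2}=M_{\bar1}M_{\bar2}R_1,\qquad g^{-1}g=gg^{-1}=1,\qquad g^{-1}M=(G^{-1}MG)g^{-1},\qquad a_{2\ell}=\pm g^{\ell}.$$ In it, $a_{\ell+i}=\pm g^ia_{\ell-i}$ for $0\le i\le\ell$ (the reciprocal relations). Let $\mathcal C^\pm$ be its subalgebra generated by $g^{-1}$ and all $ch(\alpha)$. On matrices put $$\phi(Y)_1=\mathrm{Tr}_{R(2)}(F_{12}Y_1F_{12}^{-1}R_{12}),\qquad \xi(Y)_1=\mathrm{Tr}_{R(2)}(F_{12}Y_1F_{12}^{-1}K_{12})$$ and $M^{-1}=\mu\,\xi(M)g^{-1}$. Put $M^{\bar0}=I$, $M^{\overline{n+1}}=M\cdot\phi(M^{\bar n})$ and $M^{\overline{-n-1}}=\phi^{-1}(M^{-1}\cdot M^{\overline{-n}})$ for $n\ge0$. Let $\mathcal P^\pm$ be the right $\mathcal C^\pm$-module (entrywise multiplication) of matrices generated by all $M^\alpha$, $M^{\bar n}$ and $M\cdot\xi(M^{\bar n})$,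 $n\in\mathbb Z$. There is a unique associative bilinear product $\star$ on $\mathcal P^\pm$ with $$M^\alpha\star M^\beta=M^{\alpha\star\beta},\quad \alpha\star\beta=\alpha\,\beta^{\uparrow n}\sigma_n\cdots\sigma_2\sigma_1\sigma_2^{-1}\cdots\sigma_n^{-1}\quad(\alpha\in\mathbb C\mathcal B_n,\ \beta\in\mathbb C\mathcal B_i),$$ $$(Ic)\star Y=Y\star(Ic)=Yc\quad (c\in\mathcal C^\pm),\qquad M^{\overline{-1}}\star Y=Y\star M^{\overline{-1}}=\phi^{-1}(M^{-1}\cdot Y).$$ For $m\ge0$ let $\mathcal E^\bullet_{2m}$ be the commutative $\mathbb C$-algebra generated by $\nu_0^{\pm1},\nu_1,\dots,\nu_{2m}$ with relations $\nu_0\nu_0^{-1}=1$ and $\nu_{m+j}\nu_{m+1-j}=\nu_0^2$, $1\le j\le m$. Let $e_i$ denote the elementary symmetric functions. **Statement.** Assume $q^{2\ell+2}\ne-1$. For each of the two components assume that $a_1,\dots,a_{2\ell}$ satisfy no algebraic relations (over $\mathbb C[g]$) in that component other than the consequences of the reciprocal relations. Then there are unique algebra homomorphisms $$\pi_{O^+(2\ell)}:\mathcal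 C^+\to\mathcal E^\bullet_{2\ell},\quad g\mapsto\nu_0^2,\ a_i\mapsto e_i(\nu_1,\dots,\nu_{2\ell});\qquad \pi_{O^-(2\ell)}:\mathcal C^-\to\mathcal E^\bullet_{2\ell-2},\quad g\mapsto\nu_0^2,\ a_i\mapsto e_i(\nu_0,-\nu_0,\nu_1,\dots,\nu_{2\ell-2})$$ ($1\le i\le2\ell$). On the completions $\mathcal P^+\otimes_{\mathcal C^+}\mathcal E^\bullet_{2\ell}$ and $\mathcal P^-\otimes_{\mathcal C^-}\mathcal E^\bullet_{2\ell-2}$ formed by means of these homomorphisms, there is a unique bilinear product with $(Y\otimes e)\star(Y'\otimes e')=(Y\star Y')\otimes(ee')$. In these completions (with $M=M\otimes1$, $eI=I\otimes e$) the left hand sides of the Cayley–Hamilton identities of the two components factorize and vanish: $$\sum_{i=0}^{2\ell}(-q)^iM^{\overline{2\ell-i}}a_i\;=\;\mathop{\prod\nolimits^{\star}}_{i=1}^{2\ell}(M-q\nu_iI)\;=\;0\qquad\text{for }O^+(2\ell),$$ $$\bigl(M^{\bar2}-gI\bigr)\star\sum_{i=0}^{2\ell-2}(-q)^iM^{\overline{2\ell-2-i}}\epsilon_i\;=\;(M-\nu_0I)\star(M+\nu_0I)\star\mathop{\prod\nolimits^{\star}}_{i=1}^{2\ell-2}(M-q\nu_iI)\;=\;0\qquad\text{for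 }O^-(2\ell),$$ where $\epsilon_i=\sum_{0\le j\le i/2}a_{i-2j}g^j$ for $0\le i\le\ell-1$ and $\epsilon_{\ell-1+r}=\epsilon_{\ell-1-r}g^r$ for $0\le r\le\ell-1$. -/

import Mathlib

open scoped TensorProduct

noncomputable section

namespace OrthQM

/-! ## Operators on tensor powers of `V = ℂ^N`

An operator on `V^{⊗n}` with entries in a `ℂ`-algebra `A` is a square matrix indexed by
`Fin n → Fin N`.  Tensor factors are numbered from `0` here, so that the operator usually written
`X_{i+1}` (acting on factors `i+1, i+2`) is `legs n X i`. -/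

/-- Operators on `V^{⊗n}` with entries in `A`. -/
abbrev Op (N n : ℕ) (A : Type) := Matrix (Fin n → Fin N) (Fin n → Fin N) A

/-- Operators on `V ⊗ V`. -/
abbrev Op2 (N : ℕ) := Matrix (Fin N × Fin N) (Fin N × Fin N) ℂ

/-- `X ∈ End(V ⊗ V)` acting on the tensor factors `i` and `i+1` of `V^{⊗n}`
(only meaningful for `i + 1 < n`). -/
def legs {N : ℕ} (n : ℕ) (X : Op2 N) (i : ℕ) : Op N n ℂ := fun s t =>
  if h : i + 1 < n then
    if ∀ k : Fin n, k.1 ≠ i → k.1 ≠ i + 1 → s k = t k then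
      X (s ⟨i, by omega⟩, s ⟨i + 1, h⟩) (t ⟨i, by omega⟩, t ⟨i + 1, h⟩)
    else 0
  else 0

/-- `M ⊗ I ⊗ ⋯ ⊗ I`, i.e. the matrix `M` placed in the first factor of `V^{⊗(n+1)}`. -/
def firstLeg {N : ℕ} {A : Type} [Ring A] (n : ℕ) (M : Matrix (Fin N) (Fin N) A) :
    Op N (n + 1) A := fun s t =>
  if ∀ k : Fin n, s k.succ = t k.succ then M (s 0) (t 0) else 0

/-- The operator `X ⊗ Y` on `V^{⊗(m+n)} = V^{⊗m} ⊗ V^{⊗n}`. -/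
def opTensor {N m n : ℕ} (X : Op N m ℂ) (Y : Op N n ℂ) : Op N (m + n) ℂ := fun s t =>
  X (s ∘ Fin.castAdd n) (t ∘ Fin.castAdd n) * Y (s ∘ Fin.natAdd m) (t ∘ Fin.natAdd m)

/-- A complex matrix viewed as a matrix with entries in `A`. -/
def toA {ι : Type} (A : Type) [Ring A] [Algebra ℂ A] (X : Matrix ι ι ℂ) : Matrix ι ι A :=
  X.map (algebraMap ℂ A)

/-- `Tr_{(2,…,n+1)} (D_2 ⋯ D_{n+1} Y)`: the trace over all factors but the first one, weighted by
the matrix `D` in each of these factors. -/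
def tailTrace {N n : ℕ} {A : Type} [Ring A] [Algebra ℂ A] (D : Matrix (Fin N) (Fin N) ℂ)
    (Y : Op N (n + 1) A) : Matrix (Fin N) (Fin N) A := fun a b =>
  ∑ u : Fin n → Fin N, ∑ v : Fin n → Fin N,
    (∏ k, D (u k) (v k)) • Y (Matrix.vecCons a v) (Matrix.vecCons b u)

/-- `Tr_{(1,…,n)} (D_1 ⋯ D_n Y)`. -/
def fullTrace {N n : ℕ} {A : Type} [Ring A] [Algebra ℂ A] (D : Matrix (Fin N) (Fin N) ℂ)
    (Y : Op N n A) : A :=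
  ∑ u : Fin n → Fin N, ∑ v : Fin n → Fin N, (∏ k, D (u k) (v k)) • Y v u

/-! ## Skew invertibility, R-matrices, compatible pairs -/

/-- `Ψ` is a skew inverse of `X`: `Tr_{(2)} X_{12} Ψ_{23} = Tr_{(2)} Ψ_{12} X_{23} = P_{13}`,
written in coordinates. Such a `Ψ` is unique. -/
def IsSkewInverse {N : ℕ} (X Ψ : Op2 N) : Prop :=
  (∀ a c e f : Fin N, ∑ b, ∑ m, X (a, b) (c, m) * Ψ (m, e) (b, f)
      = if a = f ∧ e = c then 1 else 0) ∧
  (∀ a c e f : Fin N, ∑ b, ∑ m, Ψ (a, b) (c, m) * X (m, e) (b, f)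
      = if a = f ∧ e = c then 1 else 0)

def SkewInvertible {N : ℕ} (X : Op2 N) : Prop := ∃ Ψ, IsSkewInverse X Ψ

open Classical in
/-- The skew inverse `Ψ_X` (zero if `X` is not skew invertible). -/
def skewInverse {N : ℕ} (X : Op2 N) : Op2 N :=
  if h : SkewInvertible X then h.choose else 0

/-- `C_X = Tr_{(1)} Ψ_X`. -/
def matC {N : ℕ} (X : Op2 N) : Matrix (Fin N) (Fin N) ℂ := fun b d =>
  ∑ a, skewInverse X (a, b) (a, d)

/-- `D_X = Tr_{(2)} Ψ_X`. -/
def matD {N : ℕ} (X : Op2 N) : Matrix (Fin N) (Fin N) ℂ := fun a c =>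
  ∑ b, skewInverse X (a, b) (c, b)

def StrictSkewInvertible {N : ℕ} (X : Op2 N) : Prop :=
  SkewInvertible X ∧ (IsUnit (matC X) ∨ IsUnit (matD X))

/-- `X` is an R-matrix: invertible, with `X₁ X₂ X₁ = X₂ X₁ X₂` on `V^{⊗3}`. -/
def IsRMatrix {N : ℕ} (X : Op2 N) : Prop :=
  IsUnit X ∧ legs 3 X 0 * legs 3 X 1 * legs 3 X 0 = legs 3 X 1 * legs 3 X 0 * legs 3 X 1

/-- The twist relations for the ordered pair `{X, Y}`. -/
def Compatible {N : ℕ} (X Y : Op2 N) : Prop :=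
  legs 3 X 0 * legs 3 Y 1 * legs 3 Y 0 = legs 3 Y 1 * legs 3 Y 0 * legs 3 X 1 ∧
  legs 3 X 1 * legs 3 Y 0 * legs 3 Y 1 = legs 3 Y 0 * legs 3 Y 1 * legs 3 X 0

/-! ## The data of a quantum matrix algebra -/

/-- The raw data: the two parameters `q, μ` and two operators `R, F` on `V ⊗ V`, `V = ℂ^N`. -/
structure QMData (N : ℕ) where
  q : ℂ
  μ : ℂ
  R : Op2 N
  F : Op2 N

namespace QMData

variable {N : ℕ} (𝒟 : QMData N)

/-- `q - q⁻¹`. -/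
def lam : ℂ := 𝒟.q - 𝒟.q⁻¹

/-- The `q`-number `i_q = (q^i - q^{-i}) / (q - q⁻¹)`. -/
def qnum (i : ℕ) : ℂ := (𝒟.q ^ i - (𝒟.q ^ i)⁻¹) / 𝒟.lam

/-- `η = (q - μ)(q⁻¹ + μ) / (μ (q - q⁻¹))`. -/
def eta : ℂ := (𝒟.q - 𝒟.μ) * (𝒟.q⁻¹ + 𝒟.μ) / (𝒟.μ * 𝒟.lam)

/-- The image of the `i`-th braid generator (counted from `0`) on `V^{⊗n}`. -/
def Rop (n i : ℕ) : Op N n ℂ := legs n 𝒟.R i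

/-- The image of its inverse. -/
def RopInv (n i : ℕ) : Op N n ℂ := legs n 𝒟.R⁻¹ i

/-- `K_i = (q - R_i)(q⁻¹ + R_i) / (μ (q - q⁻¹))`. -/
def Kop (n i : ℕ) : Op N n ℂ :=
  (𝒟.μ * 𝒟.lam)⁻¹ • ((𝒟.q • 1 - 𝒟.Rop n i) * (𝒟.q⁻¹ • 1 + 𝒟.Rop n i))

/-- The image of the baxterized element
`σ⁻_i(x) = 1 + (x - 1)/(q - q⁻¹) σ_i + (x - 1)/(q μ⁻¹ x + 1) κ_i`. -/
def bax (n i : ℕ) (x : ℂ) : Op N n ℂ :=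
  1 + ((x - 1) / 𝒟.lam) • 𝒟.Rop n i + ((x - 1) / (𝒟.q * 𝒟.μ⁻¹ * x + 1)) • 𝒟.Kop n i

/-- `asym n s i` is the operator `ρ_R(a^{(i)})` on `V^{⊗n}`, acting on the `i` consecutive tensor
factors `s, …, s+i-1`, that is `ρ_R(a^{(i)↑s})`:
`a^{(1)} = 1`, `a^{(i+1)} = q^i / (i+1)_q · a^{(i)} σ⁻_i(q^{-2i}) a^{(i)}`. -/
def asym (n s : ℕ) : ℕ → Op N n ℂ
  | 0 => 1
  | 1 => 1
  | (i + 2) => (𝒟.q ^ (i + 1) / 𝒟.qnum (i + 2)) •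
      (asym n s (i + 1) * 𝒟.bax n (s + i) ((𝒟.q ^ (2 * (i + 1)))⁻¹) * asym n s (i + 1))

/-- `R` is a BMW-type R-matrix with parameters `q, μ`. -/
def IsBMW : Prop :=
  𝒟.q ≠ 0 ∧ 𝒟.q ≠ 1 ∧ 𝒟.q ≠ -1 ∧ 𝒟.μ ≠ 0 ∧ 𝒟.μ ≠ 𝒟.q ∧ 𝒟.μ ≠ -𝒟.q⁻¹ ∧
  IsRMatrix 𝒟.R ∧
  minpoly ℂ 𝒟.R = (Polynomial.X - Polynomial.C 𝒟.q) * (Polynomial.X + Polynomial.C 𝒟.q⁻¹) *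
    (Polynomial.X - Polynomial.C 𝒟.μ) ∧
  𝒟.Kop 3 1 * 𝒟.Kop 3 0 = 𝒟.Rop 3 0 * 𝒟.Rop 3 1 * 𝒟.Kop 3 0 ∧
  𝒟.Kop 3 1 * 𝒟.Kop 3 0 = 𝒟.RopInv 3 0 * 𝒟.RopInv 3 1 * 𝒟.Kop 3 0 ∧
  𝒟.Kop 3 0 * 𝒟.Kop 3 1 * 𝒟.Kop 3 0 = 𝒟.Kop 3 0

/-- `R` is an `O(k)`-type R-matrix: skew invertible of BMW type, `i_q ≠ 0` for `2 ≤ i ≤ k`,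
`rk ρ_R(a^{(i)}) ≠ 0` for `2 ≤ i ≤ k`, the unnormalized antisymmetrizer of order `k+1` vanishes,
`μ = q^{1-k}` and `rk ρ_R(a^{(k)}) = 1`.  (With this value of `μ` the denominators in the
definition of the antisymmetrizers involved are automatically nonzero.) -/
def IsOrthogonal (k : ℕ) : Prop :=
  SkewInvertible 𝒟.R ∧ 𝒟.IsBMW ∧
  (∀ i, 2 ≤ i → i ≤ k → 𝒟.qnum i ≠ 0) ∧
  (∀ i, 2 ≤ i → i ≤ k → (𝒟.asym i 0 i).rank ≠ 0) ∧
  𝒟.asym (k + 1) 1 k * 𝒟.bax (k + 1) 0 ((𝒟.q ^ (2 * k))⁻¹) * 𝒟.asym (k + 1) 1 k = 0 ∧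
  𝒟.μ = 𝒟.q ^ (1 - (k : ℤ)) ∧
  (𝒟.asym k 0 k).rank = 1

/-- The image `ρ_R(ℂ B_n)` of the group algebra of the braid group on `n` strands in
`End(V^{⊗n})`: the algebra generated by the `R_i^{±1}`. -/
def braidAlg (n : ℕ) : Subalgebra ℂ (Op N n ℂ) :=
  Algebra.adjoin ℂ ({X | ∃ i, i + 1 < n ∧ X = 𝒟.Rop n i} ∪
    {X | ∃ i, i + 1 < n ∧ X = 𝒟.RopInv n i})

/-- The constant matrix `G = Tr_{(2,3)} K_2 F_1⁻¹ F_2⁻¹` (ordinary traces). -/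
def matG : Matrix (Fin N) (Fin N) ℂ :=
  tailTrace (n := 2) 1 (𝒟.Kop 3 1 * legs 3 𝒟.F⁻¹ 0 * legs 3 𝒟.F⁻¹ 1)

/-! ### Constructions with a matrix `M` over an arbitrary algebra -/

section Generic

variable {A : Type} [Ring A] [Algebra ℂ A]

/-- The copies of a matrix on `V^{⊗n}`: `copy n M 0 = M_1` and
`copy n M (i+1) = F_{i+1} (copy n M i) F_{i+1}⁻¹`. -/
def copy (n : ℕ) (M : Matrix (Fin N) (Fin N) A) : ℕ → Op N (n + 1) A
  | 0 => firstLeg n M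
  | (i + 1) => toA A (legs (n + 1) 𝒟.F i) * copy n M i * toA A (legs (n + 1) 𝒟.F⁻¹ i)

/-- The product of the first `j` copies on `V^{⊗(n+1)}`. -/
def copyProd (n : ℕ) (M : Matrix (Fin N) (Fin N) A) : ℕ → Op N (n + 1) A
  | 0 => 1
  | (j + 1) => copyProd n M j * 𝒟.copy n M j

/-- `ch(α) = Tr_R{(1,…,n)} (M_{\bar 1} ⋯ M_{\bar n} X)` for `X = ρ_R(α)`, `α ∈ ℂ B_n`; the R-trace
is the trace weighted by `D_R` in each factor.  For `n = 0` this is the scalar `X`. -/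
def ch (M : Matrix (Fin N) (Fin N) A) : (n : ℕ) → Op N n ℂ → A
  | 0, X => fullTrace (matD 𝒟.R) (toA A X)
  | (n + 1), X => fullTrace (matD 𝒟.R) (𝒟.copyProd n M (n + 1) * toA A X)

/-- The matrix `M^α`, `(M^α)_1 = Tr_R{(2,…,n+1)} (M_{\bar 1} ⋯ M_{\overline{n+1}} X)`, for
`X = ρ_R(α)`, `α ∈ ℂ B_{n+1}`. -/
def matPow (M : Matrix (Fin N) (Fin N) A) (n : ℕ) (X : Op N (n + 1) ℂ) :
    Matrix (Fin N) (Fin N) A :=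
  tailTrace (matD 𝒟.R) (𝒟.copyProd n M (n + 1) * toA A X)

/-- The 2-contraction `g = η⁻¹ Tr_R{(1,2)} (M_{\bar 1} M_{\bar 2} K_1)`. -/
def gElt (M : Matrix (Fin N) (Fin N) A) : A := 𝒟.eta⁻¹ • 𝒟.ch M 2 (𝒟.Kop 2 0)

/-- `a_i = ch(a^{(i)})`, with `a_0 = 1`. -/
def aElt (M : Matrix (Fin N) (Fin N) A) (i : ℕ) : A := 𝒟.ch M i (𝒟.asym i 0 i)

/-- `φ(Y)_1 = Tr_R{(2)} (F_{12} Y_1 F_{12}⁻¹ R_{12})`. -/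
def phi (Y : Matrix (Fin N) (Fin N) A) : Matrix (Fin N) (Fin N) A :=
  tailTrace (matD 𝒟.R) (𝒟.copy 1 Y 1 * toA A (𝒟.Rop 2 0))

/-- `ξ(Y)_1 = Tr_R{(2)} (F_{12} Y_1 F_{12}⁻¹ K_{12})`. -/
def xi (Y : Matrix (Fin N) (Fin N) A) : Matrix (Fin N) (Fin N) A :=
  tailTrace (matD 𝒟.R) (𝒟.copy 1 Y 1 * toA A (𝒟.Kop 2 0))

end Generic

/-! ### The components `O^±(k)` of the extended quantum matrix algebra -/

/-- The free algebra on the matrix entries (`some (a, b)`) and one more generator (`none`). -/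
abbrev Free (_ : QMData N) := FreeAlgebra ℂ (Option (Fin N × Fin N))

/-- The matrix of free generators. -/
def freeM : Matrix (Fin N) (Fin N) 𝒟.Free := fun a b => FreeAlgebra.ι ℂ (some (a, b))

/-- The free generator which becomes `g⁻¹`. -/
def freeInv : 𝒟.Free := FreeAlgebra.ι ℂ none

/-- Defining relations: those of the quantum matrix algebra (`quad`), those of its extension by
`g⁻¹` (`inv_mul`, `mul_inv`, `conj`), and the relation `a_{2ℓ} = ε g^ℓ` (`sign`). -/
inductive ComponentRel (ℓ : ℕ) (ε : ℂ) : 𝒟.Free → 𝒟.Free → Prop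
  | quad (s t : Fin 2 → Fin N) : ComponentRel ℓ ε
      ((toA 𝒟.Free (𝒟.Rop 2 0) * 𝒟.copy 1 𝒟.freeM 0 * 𝒟.copy 1 𝒟.freeM 1) s t)
      ((𝒟.copy 1 𝒟.freeM 0 * 𝒟.copy 1 𝒟.freeM 1 * toA 𝒟.Free (𝒟.Rop 2 0)) s t)
  | inv_mul : ComponentRel ℓ ε (𝒟.freeInv * 𝒟.gElt 𝒟.freeM) 1
  | mul_inv : ComponentRel ℓ ε (𝒟.gElt 𝒟.freeM * 𝒟.freeInv) 1
  | conj (a b : Fin N) : ComponentRel ℓ ε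
      (𝒟.freeInv * 𝒟.freeM a b)
      ((toA 𝒟.Free 𝒟.matG⁻¹ * 𝒟.freeM * toA 𝒟.Free 𝒟.matG) a b * 𝒟.freeInv)
  | sign : ComponentRel ℓ ε (𝒟.aElt 𝒟.freeM (2 * ℓ)) (ε • 𝒟.gElt 𝒟.freeM ^ ℓ)

/-- The component `O^+(2ℓ)` (`ε = 1`) or `O^-(2ℓ)` (`ε = -1`) of the extended quantum matrix
algebra. -/
abbrev Component (ℓ : ℕ) (ε : ℂ) := RingQuot (𝒟.ComponentRel ℓ ε)

section Component

variable (ℓ : ℕ) (ε : ℂ)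

/-- The matrix `M` of generators of the component. -/
def genM : Matrix (Fin N) (Fin N) (𝒟.Component ℓ ε) := fun a b =>
  RingQuot.mkAlgHom ℂ (𝒟.ComponentRel ℓ ε) (𝒟.freeM a b)

/-- The generator `g⁻¹`. -/
def gInv : 𝒟.Component ℓ ε := RingQuot.mkAlgHom ℂ (𝒟.ComponentRel ℓ ε) 𝒟.freeInv

/-- The (extended) characteristic subalgebra `𝒞^±` of the component: it is generated by `g⁻¹` and
all the elements `ch(α)`, `α ∈ ℂ B_n`, `n ≥ 0`. -/
def charAlg : Subalgebra ℂ (𝒟.Component ℓ ε) :=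
  Algebra.adjoin ℂ ({x | ∃ n, ∃ X ∈ 𝒟.braidAlg n, x = 𝒟.ch (𝒟.genM ℓ ε) n X} ∪ {𝒟.gInv ℓ ε})

/-- The inverse matrix `M⁻¹ = μ ξ(M) g⁻¹`. -/
def genMInv : Matrix (Fin N) (Fin N) (𝒟.Component ℓ ε) :=
  𝒟.μ • (𝒟.xi (𝒟.genM ℓ ε)).map (· * 𝒟.gInv ℓ ε)

/-- `Y ↦ M ⋆ Y = M · φ(Y)`. -/
def starM (Y : Matrix (Fin N) (Fin N) (𝒟.Component ℓ ε)) :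
    Matrix (Fin N) (Fin N) (𝒟.Component ℓ ε) :=
  𝒟.genM ℓ ε * 𝒟.phi Y

/-- `Y ↦ M^{\overline{-1}} ⋆ Y = φ⁻¹(M⁻¹ · Y)`. -/
def starMInv (Y : Matrix (Fin N) (Fin N) (𝒟.Component ℓ ε)) :
    Matrix (Fin N) (Fin N) (𝒟.Component ℓ ε) :=
  Function.invFun 𝒟.phi (𝒟.genMInv ℓ ε * Y)

/-- The `⋆`-powers `M^{\bar n}`, `n ∈ ℤ`. -/
def starPow : ℤ → Matrix (Fin N) (Fin N) (𝒟.Component ℓ ε)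
  | Int.ofNat n => (𝒟.starM ℓ ε)^[n] 1
  | Int.negSucc n => (𝒟.starMInv ℓ ε)^[n + 1] 1

/-- The "multiplication with a transposition" `Y ↦ M · ξ(Y)`. -/
def transM (Y : Matrix (Fin N) (Fin N) (𝒟.Component ℓ ε)) :
    Matrix (Fin N) (Fin N) (𝒟.Component ℓ ε) :=
  𝒟.genM ℓ ε * 𝒟.xi Y

/-- Generators of `𝒫^±` as a right module over the characteristic subalgebra: the matrices
`M^α`, and the matrices `M^{\bar n}` and `M · ξ(M^{\bar n})`, `n ∈ ℤ`. -/
def powGens : Set (Matrix (Fin N) (Fin N) (𝒟.Component ℓ ε)) :=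
  {Y | ∃ n, ∃ X ∈ 𝒟.braidAlg (n + 1), Y = 𝒟.matPow (𝒟.genM ℓ ε) n X} ∪
  {Y | ∃ n : ℤ, Y = 𝒟.starPow ℓ ε n} ∪
  {Y | ∃ n : ℤ, Y = 𝒟.transM ℓ ε (𝒟.starPow ℓ ε n)}

/-- The space `𝒫^±` of descendants of the matrix `M`: the right `𝒞^±`-module (for entrywise right
multiplication) generated by `powGens`. -/
def powMod : Submodule ℂ (Matrix (Fin N) (Fin N) (𝒟.Component ℓ ε)) :=
  Submodule.span ℂ {Z | ∃ Y ∈ 𝒟.powGens ℓ ε, ∃ c ∈ 𝒟.charAlg ℓ ε, Z = Y.map (· * c)}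

/-! Membership facts, so that the elements above can be regarded as elements of `𝒞^±`, `𝒫^±`. -/

theorem Rop_mem {n i : ℕ} (h : i + 1 < n) : 𝒟.Rop n i ∈ 𝒟.braidAlg n :=
  Algebra.subset_adjoin (Or.inl ⟨i, h, rfl⟩)

theorem Kop_mem {n i : ℕ} (h : i + 1 < n) : 𝒟.Kop n i ∈ 𝒟.braidAlg n := by
  have hR := 𝒟.Rop_mem h
  have h1 := (𝒟.braidAlg n).one_mem
  exact (𝒟.braidAlg n).smul_mem (mul_mem (sub_mem ((𝒟.braidAlg n).smul_mem h1 _) hR)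
    (add_mem ((𝒟.braidAlg n).smul_mem h1 _) hR)) _

theorem asym_mem (n s : ℕ) : ∀ i, s + i ≤ n → 𝒟.asym n s i ∈ 𝒟.braidAlg n
  | 0, _ => (𝒟.braidAlg n).one_mem
  | 1, _ => (𝒟.braidAlg n).one_mem
  | (i + 2), h => by
    have ih := asym_mem n s (i + 1) (by omega)
    have hi : s + i + 1 < n := by omega
    have hb : ∀ x, 𝒟.bax n (s + i) x ∈ 𝒟.braidAlg n := fun x =>
      add_mem (add_mem (𝒟.braidAlg n).one_mem ((𝒟.braidAlg n).smul_mem (𝒟.Rop_mem hi) _))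
        ((𝒟.braidAlg n).smul_mem (𝒟.Kop_mem hi) _)
    exact (𝒟.braidAlg n).smul_mem (mul_mem (mul_mem ih (hb _)) ih) _

/-- `g` as an element of the characteristic subalgebra. -/
def gC : 𝒟.charAlg ℓ ε := ⟨𝒟.gElt (𝒟.genM ℓ ε), (𝒟.charAlg ℓ ε).smul_mem
  (Algebra.subset_adjoin (Or.inl ⟨2, _, 𝒟.Kop_mem (by omega), rfl⟩)) _⟩

/-- `a_i` as an element of the characteristic subalgebra. -/
def aC (i : ℕ) : 𝒟.charAlg ℓ ε := ⟨𝒟.aElt (𝒟.genM ℓ ε) i,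
  Algebra.subset_adjoin (Or.inl ⟨i, _, 𝒟.asym_mem i 0 i (by omega), rfl⟩)⟩

/-- Right multiplication of an element of `𝒫^±` by an element of `𝒞^±`. -/
def rmul (Y : 𝒟.powMod ℓ ε) (c : 𝒟.charAlg ℓ ε) : 𝒟.powMod ℓ ε :=
  ⟨Y.1.map (· * c.1), by
    obtain ⟨Y, hY⟩ := Y
    simp only [powMod] at hY ⊢
    induction hY using Submodule.span_induction with
    | mem Z hZ =>
      obtain ⟨W, hW, d, hd, rfl⟩ := hZ
      refine Submodule.subset_span ⟨W, hW, d * c.1, mul_mem hd c.2, ?_⟩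
      ext a b
      simp [mul_assoc]
    | zero =>
      convert Submodule.zero_mem _ using 1
      ext a b
      simp
    | add X Z _ _ hX hZ =>
      convert Submodule.add_mem _ hX hZ using 1
      ext a b
      simp [add_mul]
    | smul r X _ hX =>
      convert Submodule.smul_mem _ r hX using 1
      ext a b
      simp⟩

/-- `M^{\bar n}` as an element of `𝒫^±`. -/
def powP (n : ℤ) : 𝒟.powMod ℓ ε :=
  ⟨𝒟.starPow ℓ ε n, Submodule.subset_span
    ⟨_, Or.inl (Or.inr ⟨n, rfl⟩), 1, one_mem _, by ext a b; simp⟩⟩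

/-- `M^α` as an element of `𝒫^±`. -/
def matPowP (n : ℕ) (X : 𝒟.braidAlg (n + 1)) : 𝒟.powMod ℓ ε :=
  ⟨𝒟.matPow (𝒟.genM ℓ ε) n X.1, Submodule.subset_span
    ⟨_, Or.inl (Or.inl ⟨n, X.1, X.2, rfl⟩), 1, one_mem _, by ext a b; simp⟩⟩

/-- The unit matrix `I = M^{\bar 0}`. -/
abbrev oneP : 𝒟.powMod ℓ ε := 𝒟.powP ℓ ε 0

/-! ### The `⋆`-product -/

/-- `σ_n ⋯ σ_2 σ_1 σ_2⁻¹ ⋯ σ_n⁻¹` on `V^{⊗(n+p+1)}`, `n = m + 1` (here `σ_j` is `Rop _ (j-1)`). -/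
def twistWord (m p : ℕ) : Op N (m + 1 + (p + 1)) ℂ :=
  ((List.range (m + 1)).reverse.map (𝒟.Rop (m + 1 + (p + 1)))).prod *
    ((List.range m).map fun i => 𝒟.RopInv (m + 1 + (p + 1)) (i + 1)).prod

/-- `ρ_R(α ⋆ β)` for `X = ρ_R(α)`, `Y = ρ_R(β)`, `α ∈ ℂ B_n`, `β ∈ ℂ B_i`, where
`α ⋆ β = α β^{↑n} σ_n ⋯ σ_2 σ_1 σ_2⁻¹ ⋯ σ_n⁻¹`. -/
def expStar {m p : ℕ} (X : Op N (m + 1) ℂ) (Y : Op N (p + 1) ℂ) :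
    Op N (m + 1 + p + 1) ℂ :=
  opTensor X Y * 𝒟.twistWord m p

/-- The `⋆`-product on `𝒫^±`: the associative bilinear product with `M^α ⋆ M^β = M^{α ⋆ β}`,
`(I c) ⋆ Y = Y ⋆ (I c) = Y c` for `c ∈ 𝒞^±`, and
`M^{\overline{-1}} ⋆ Y = Y ⋆ M^{\overline{-1}} = φ⁻¹(M⁻¹ · Y)`. -/
structure IsStarProduct
    (star : 𝒟.powMod ℓ ε →ₗ[ℂ] 𝒟.powMod ℓ ε →ₗ[ℂ] 𝒟.powMod ℓ ε) : Prop where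
  assoc : ∀ X Y Z, star (star X Y) Z = star X (star Y Z)
  matPow_matPow : ∀ (m p : ℕ) (X : 𝒟.braidAlg (m + 1)) (Y : 𝒟.braidAlg (p + 1)),
    (star (𝒟.matPowP ℓ ε m X) (𝒟.matPowP ℓ ε p Y) : Matrix (Fin N) (Fin N) (𝒟.Component ℓ ε)) =
      𝒟.matPow (𝒟.genM ℓ ε) (m + 1 + p) (𝒟.expStar X.1 Y.1)
  scalar_left : ∀ c Y, star (𝒟.rmul ℓ ε (𝒟.oneP ℓ ε) c) Y = 𝒟.rmul ℓ ε Y c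
  scalar_right : ∀ c Y, star Y (𝒟.rmul ℓ ε (𝒟.oneP ℓ ε) c) = 𝒟.rmul ℓ ε Y c
  inv_left : ∀ Y, (star (𝒟.powP ℓ ε (-1)) Y : Matrix (Fin N) (Fin N) (𝒟.Component ℓ ε)) =
    𝒟.starMInv ℓ ε Y
  inv_right : ∀ Y, (star Y (𝒟.powP ℓ ε (-1)) : Matrix (Fin N) (Fin N) (𝒟.Component ℓ ε)) =
    𝒟.starMInv ℓ ε Y

/-! ### Independence of the coefficients -/

/-- The variable for `a_j` in `ℂ[g, a_1, …, a_{2ℓ}]` (`g` is the variable number `0`), with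
`a_0 = 1`. -/
def aVar (j : ℕ) : MvPolynomial (Fin (2 * ℓ + 1)) ℂ :=
  if j = 0 then 1 else MvPolynomial.X (Fin.ofNat (2 * ℓ + 1) j)

/-- The ideal generated by the reciprocal relations `a_{ℓ+i} = ε g^i a_{ℓ-i}`, `0 ≤ i ≤ ℓ`. -/
def recipIdeal : Ideal (MvPolynomial (Fin (2 * ℓ + 1)) ℂ) :=
  Ideal.span {P | ∃ i ≤ ℓ,
    P = aVar ℓ (ℓ + i) - MvPolynomial.C ε * MvPolynomial.X 0 ^ i * aVar ℓ (ℓ - i)}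

/-- The elements `a_1, …, a_{2ℓ}` satisfy no algebraic relations (with `g`) in the component other
than the consequences of the reciprocal relations: every polynomial expression in `g` and the `a_i`
that vanishes belongs, as a commutative polynomial, to the ideal of the reciprocal relations.
(Polynomial expressions are written as elements of a free algebra, so that the formulation does not
presuppose that the characteristic subalgebra is commutative.) -/
def OnlyReciprocal : Prop :=
  ∀ P : FreeAlgebra ℂ (Fin (2 * ℓ + 1)),
    FreeAlgebra.lift ℂ (fun j : Fin (2 * ℓ + 1) =>
      if j = 0 then 𝒟.gC ℓ ε else 𝒟.aC ℓ ε j) P = 0 →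
    FreeAlgebra.lift ℂ (fun j : Fin (2 * ℓ + 1) =>
      (MvPolynomial.X j : MvPolynomial (Fin (2 * ℓ + 1)) ℂ)) P ∈ recipIdeal ℓ ε

end Component

end QMData

/-! ### The algebra of spectral variables -/

/-- The relations `ν_{m+j} ν_{m+1-j} = ν_0²`, `1 ≤ j ≤ m`, and `ν_0 ν_0⁻¹ = 1`
(`some j` is `ν_j`, `none` is `ν_0⁻¹`; below `j` is shifted by one). -/
def specIdeal (m : ℕ) : Ideal (MvPolynomial (Option (Fin (2 * m + 1))) ℂ) :=
  Ideal.span ({P | ∃ j : Fin m, P =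
      MvPolynomial.X (some ⟨m + 1 + j, by omega⟩) * MvPolynomial.X (some ⟨m - j, by omega⟩) -
        MvPolynomial.X (some 0) ^ 2} ∪
    {MvPolynomial.X (some 0) * MvPolynomial.X none - 1})

/-- The algebra `ℰ^•_{2m}` of orthosymplectic spectral variables `ν_0, …, ν_{2m}`, with `ν_0`
inverted. -/
abbrev Spec (m : ℕ) := MvPolynomial (Option (Fin (2 * m + 1))) ℂ ⧸ specIdeal m

/-- The spectral variable `ν_j`, `0 ≤ j ≤ 2m`. -/
def nu (m : ℕ) (j : Fin (2 * m + 1)) : Spec m :=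
  Ideal.Quotient.mk (specIdeal m) (MvPolynomial.X (some j))

/-- The multiset `ν_1, …, ν_{2m}`. -/
def nuMultiset (m : ℕ) : Multiset (Spec m) :=
  (Finset.univ : Finset (Fin (2 * m))).val.map fun i => nu m i.succ

namespace QMData

variable {N : ℕ} (𝒟 : QMData N) (ℓ : ℕ) (ε : ℂ) {m : ℕ}

/-- `π` is the algebra homomorphism `𝒞^± → ℰ^•_{2m}` with `g ↦ ν_0²` and
`a_i ↦ e_i(w)`, `1 ≤ i ≤ 2ℓ`. -/
def IsSpectralHom (w : Multiset (Spec m)) (π : 𝒟.charAlg ℓ ε →ₐ[ℂ] Spec m) : Prop :=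
  π (𝒟.gC ℓ ε) = nu m 0 ^ 2 ∧ ∀ i, 1 ≤ i → i ≤ 2 * ℓ → π (𝒟.aC ℓ ε i) = w.esymm i

variable {ℓ ε}

/-- The additive group structure of the tensor product over `ℂ`. -/
instance : AddCommGroup (𝒟.powMod ℓ ε ⊗[ℂ] Spec m) :=
  Module.addCommMonoidToAddCommGroup ℂ

/-- The relations `(Y c) ⊗ e = Y ⊗ π(c) e` defining the tensor product over `𝒞^±`. -/
def balanced (π : 𝒟.charAlg ℓ ε →ₐ[ℂ] Spec m) : Submodule ℂ (𝒟.powMod ℓ ε ⊗[ℂ] Spec m) :=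
  Submodule.span ℂ {z | ∃ (Y : 𝒟.powMod ℓ ε) (c : 𝒟.charAlg ℓ ε) (e : Spec m),
    z = 𝒟.rmul ℓ ε Y c ⊗ₜ[ℂ] e - Y ⊗ₜ[ℂ] (π c * e)}

/-- The completion `𝒫^± ⊗_{𝒞^±} ℰ^•_{2m}`, where `ℰ^•_{2m}` is a left `𝒞^±`-module through `π`. -/
abbrev Completion (π : 𝒟.charAlg ℓ ε →ₐ[ℂ] Spec m) :=
  (𝒟.powMod ℓ ε ⊗[ℂ] Spec m) ⧸ 𝒟.balanced π

/-- The element `Y ⊗ e` of the completion. -/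
def pure (π : 𝒟.charAlg ℓ ε →ₐ[ℂ] Spec m) (Y : 𝒟.powMod ℓ ε) (e : Spec m) : 𝒟.Completion π :=
  (𝒟.balanced π).mkQ (Y ⊗ₜ[ℂ] e)

/-- `s` is the product on the completion given by `(Y ⊗ e) ⋆ (Y' ⊗ e') = (Y ⋆ Y') ⊗ (e e')`. -/
def IsCompletedStar (star : 𝒟.powMod ℓ ε →ₗ[ℂ] 𝒟.powMod ℓ ε →ₗ[ℂ] 𝒟.powMod ℓ ε)
    (π : 𝒟.charAlg ℓ ε →ₐ[ℂ] Spec m)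
    (s : 𝒟.Completion π →ₗ[ℂ] 𝒟.Completion π →ₗ[ℂ] 𝒟.Completion π) : Prop :=
  ∀ Y Y' e e', s (𝒟.pure π Y e) (𝒟.pure π Y' e') = 𝒟.pure π (star Y Y') (e * e')

/-- The factor `M - e I` in the completion. -/
def factor (π : 𝒟.charAlg ℓ ε →ₐ[ℂ] Spec m) (e : Spec m) : 𝒟.Completion π :=
  𝒟.pure π (𝒟.powP ℓ ε 1) 1 - 𝒟.pure π (𝒟.oneP ℓ ε) e

/-- The product, with respect to `s`, of a list of elements of the completion. -/
def listProd {π : 𝒟.charAlg ℓ ε →ₐ[ℂ] Spec m}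
    (s : 𝒟.Completion π →ₗ[ℂ] 𝒟.Completion π →ₗ[ℂ] 𝒟.Completion π)
    (L : List (𝒟.Completion π)) : 𝒟.Completion π :=
  L.foldr (fun x y => s x y) (𝒟.pure π (𝒟.oneP ℓ ε) 1)

/-- The list of the factors `M - q ν_i I`, `i = 1, …, 2m`. -/
def factors (π : 𝒟.charAlg ℓ ε →ₐ[ℂ] Spec m) : List (𝒟.Completion π) :=
  List.ofFn fun i : Fin (2 * m) => 𝒟.factor π (𝒟.q • nu m i.succ)

variable (ℓ)

/-- The left hand side `∑_{i=0}^{2ℓ} (-q)^i M^{\overline{2ℓ-i}} a_i` of the Cayley–Hamilton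
identity of the component `O^+(2ℓ)`. -/
def chPlus : 𝒟.powMod ℓ 1 :=
  ∑ i ∈ Finset.range (2 * ℓ + 1),
    (-𝒟.q) ^ i • 𝒟.rmul ℓ 1 (𝒟.powP ℓ 1 ((2 * ℓ - i : ℕ) : ℤ)) (𝒟.aC ℓ 1 i)

/-- `∑_{0 ≤ j ≤ i/2} a_{i-2j} g^j`. -/
def epsLow (i : ℕ) : 𝒟.charAlg ℓ (-1) :=
  ∑ j ∈ Finset.range (i / 2 + 1), 𝒟.aC ℓ (-1) (i - 2 * j) * 𝒟.gC ℓ (-1) ^ j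

/-- The coefficients `ϵ_i`, `0 ≤ i ≤ 2ℓ-2`: `ϵ_i = ∑_j a_{i-2j} g^j` for `i ≤ ℓ-1`, and
`ϵ_{ℓ-1+r} = ϵ_{ℓ-1-r} g^r` for `0 ≤ r ≤ ℓ-1`. -/
def epsC (i : ℕ) : 𝒟.charAlg ℓ (-1) :=
  if i ≤ ℓ - 1 then 𝒟.epsLow ℓ i
  else 𝒟.epsLow ℓ (2 * ℓ - 2 - i) * 𝒟.gC ℓ (-1) ^ (i - (ℓ - 1))

/-- The left hand side
`(M^{\bar 2} - g I) ⋆ ∑_{i=0}^{2ℓ-2} (-q)^i M^{\overline{2ℓ-2-i}} ϵ_i` of the Cayley–Hamilton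
identity of the component `O^-(2ℓ)`. -/
def chMinus (star : 𝒟.powMod ℓ (-1) →ₗ[ℂ] 𝒟.powMod ℓ (-1) →ₗ[ℂ] 𝒟.powMod ℓ (-1)) :
    𝒟.powMod ℓ (-1) :=
  star (𝒟.powP ℓ (-1) 2 - 𝒟.rmul ℓ (-1) (𝒟.oneP ℓ (-1)) (𝒟.gC ℓ (-1)))
    (∑ i ∈ Finset.range (2 * ℓ - 1),
      (-𝒟.q) ^ i • 𝒟.rmul ℓ (-1) (𝒟.powP ℓ (-1) ((2 * ℓ - 2 - i : ℕ) : ℤ)) (𝒟.epsC ℓ i))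

end QMData

end OrthQM

end

noncomputable section

namespace OrthQM

/-- Matrix units in infinitely many commuting tensor factors ("legs") of a `ℂ`-algebra `E` which
contains `A` as scalars, together with the shift of the legs by one. -/
structure LegSystem (N : ℕ) (A : Type) [Ring A] [Algebra ℂ A] (E : Type) [Ring E] [Algebra ℂ E] where
  u : ℕ → Fin N → Fin N → E
  scal : A →ₐ[ℂ] E
  sh : E →ₐ[ℂ] E
  u_mul_u : ∀ k a b c, u k a b * u k b c = u k a c
  u_mul_u_ne : ∀ k a b c d, b ≠ c → u k a b * u k c d = 0
  sum_u : ∀ k, ∑ a, u k a a = 1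
  u_comm : ∀ k l a b c d, k ≠ l → u k a b * u l c d = u l c d * u k a b
  scal_comm : ∀ x k a b, scal x * u k a b = u k a b * scal x
  sh_u : ∀ k a b, sh (u k a b) = u (k + 1) a b
  sh_injective : Function.Injective sh
  faithful : ∀ x k a b, scal x * u k a b = 0 → x = 0

section Concrete

variable (N : ℕ) (A : Type) [Ring A] [Algebra ℂ A]

/-- Linear operators on `A`-valued functions on `(Fin N)^ℕ`. -/
abbrev FunOp := Module.End ℂ ((ℕ → Fin N) → A)

variable {N A}

/-- The matrix unit `e_{ab}` in the leg `k`. -/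
def unitOp (k : ℕ) (a b : Fin N) : FunOp N A where
  toFun f s := if s k = a then f (Function.update s k b) else 0
  map_add' f g := by ext s; by_cases h : s k = a <;> simp [h]
  map_smul' c f := by ext s; by_cases h : s k = a <;> simp [h]

theorem unitOp_apply (k : ℕ) (a b : Fin N) (f : (ℕ → Fin N) → A) (s : ℕ → Fin N) :
    unitOp k a b f s = if s k = a then f (Function.update s k b) else 0 := rfl

/-- Left multiplication of the values by elements of `A`. -/
def scalOp : A →ₐ[ℂ] FunOp N A where
  toFun x :=
    { toFun f s := x * f s
      map_add' f g := by ext s; simp [mul_add]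
      map_smul' c f := by ext s; simp }
  map_one' := by ext; simp
  map_mul' x y := by ext; simp [mul_assoc]
  map_zero' := by ext; simp
  map_add' x y := by ext; simp [add_mul]
  commutes' r := by ext; simp [Algebra.algebraMap_eq_smul_one]

theorem scalOp_apply (x : A) (f : (ℕ → Fin N) → A) (s : ℕ → Fin N) :
    scalOp x f s = x * f s := rfl

/-- Prepend a letter. -/
def consSeq (a : Fin N) (t : ℕ → Fin N) : ℕ → Fin N
  | 0 => a
  | k + 1 => t k

/-- Drop the first letter. -/
def tailSeq (s : ℕ → Fin N) : ℕ → Fin N := fun k => s (k + 1)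

@[simp] theorem consSeq_zero (a : Fin N) (t : ℕ → Fin N) : consSeq a t 0 = a := rfl
@[simp] theorem consSeq_succ (a : Fin N) (t : ℕ → Fin N) (k : ℕ) : consSeq a t (k + 1) = t k := rfl
@[simp] theorem tailSeq_apply (s : ℕ → Fin N) (k : ℕ) : tailSeq s k = s (k + 1) := rfl
@[simp] theorem tailSeq_consSeq (a : Fin N) (t : ℕ → Fin N) : tailSeq (consSeq a t) = t := rfl
@[simp] theorem consSeq_tailSeq (s : ℕ → Fin N) : consSeq (s 0) (tailSeq s) = s := by
  ext k; cases k <;> rfl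

theorem update_consSeq_succ (a : Fin N) (t : ℕ → Fin N) (k : ℕ) (b : Fin N) :
    Function.update (consSeq a t) (k + 1) b = consSeq a (Function.update t k b) := by
  ext j
  cases j with
  | zero => simp [Function.update]
  | succ j =>
    by_cases h : j = k
    · subst h; simp
    · simp [Function.update, h]

/-- The shift of all legs by one. -/
def shiftOp : FunOp N A →ₐ[ℂ] FunOp N A where
  toFun Z :=
    { toFun f s := Z (fun t => f (consSeq (s 0) t)) (tailSeq s)
      map_add' f g := by
        ext s
        exact congrFun (map_add Z (fun t => f (consSeq (s 0) t)) fun t => g (consSeq (s 0) t)) _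
      map_smul' c f := by
        ext s
        exact congrFun (map_smul Z c fun t => f (consSeq (s 0) t)) _ }
  map_one' := by ext; simp
  map_mul' Z W := by
    ext f s
    simp only [LinearMap.coe_mk, AddHom.coe_mk, Module.End.mul_apply]
    congr 1
  map_zero' := by ext; simp
  map_add' Z W := by ext; simp
  commutes' r := by ext f s; simp [Algebra.algebraMap_eq_smul_one]

theorem shiftOp_apply (Z : FunOp N A) (f : (ℕ → Fin N) → A) (s : ℕ → Fin N) :
    shiftOp Z f s = Z (fun t => f (consSeq (s 0) t)) (tailSeq s) := rfl

theorem update_comm' {k l : ℕ} (h : k ≠ l) (s : ℕ → Fin N) (a b : Fin N) :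
    Function.update (Function.update s k a) l b = Function.update (Function.update s l b) k a :=
  Function.update_comm h a b s

variable (N A) in
/-- The concrete leg system. -/
def funLegs : LegSystem N A (FunOp N A) where
  u := unitOp
  scal := scalOp
  sh := shiftOp
  u_mul_u k a b c := by
    ext f s; by_cases h : s k = a <;> simp [unitOp_apply, h]
  u_mul_u_ne k a b c d hbc := by
    ext f s; by_cases h : s k = a <;> simp [unitOp_apply, h, hbc]
  sum_u k := by
    ext f s
    simp [LinearMap.sum_apply, Finset.sum_apply, unitOp_apply]
  u_comm k l a b c d hkl := by
    ext f s
    by_cases h : s k = a <;> by_cases h' : s l = c <;>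
      simp [unitOp_apply, h, h', Function.update_of_ne hkl, Function.update_of_ne hkl.symm,
        update_comm' hkl]
  scal_comm x k a b := by
    ext f s; by_cases h : s k = a <;> simp [unitOp_apply, scalOp_apply, h]
  sh_u k a b := by
    ext f s
    by_cases h : s (k + 1) = a
    · simp only [shiftOp_apply, unitOp_apply, tailSeq_apply, h, if_true]
      rw [← update_consSeq_succ, consSeq_tailSeq]
    · simp [shiftOp_apply, unitOp_apply, h]
  sh_injective := by
    intro Z W h
    ext f s
    rcases isEmpty_or_nonempty (Fin N) with hN | ⟨⟨a⟩⟩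
    · exact (hN.false (s 0)).elim
    · have := congrFun (LinearMap.congr_fun h fun t => f (tailSeq t)) (consSeq a s)
      simpa [shiftOp_apply] using this
  faithful x k a b h := by
    have := congrFun (LinearMap.congr_fun h fun _ => 1) (fun _ => a)
    simpa [unitOp_apply, scalOp_apply] using this

end Concrete

/-- The algebra homomorphism from matrices determined by a system of matrix units commuting with
the image of the coefficients. -/
def matrixUnitHom {ι B E : Type} [Fintype ι] [DecidableEq ι] [Ring B] [Algebra ℂ B] [Ring E]
    [Algebra ℂ E] (f : B →ₐ[ℂ] E) (e : ι → ι → E) (he : ∀ i j k, e i j * e j k = e i k)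
    (he' : ∀ i j k l, j ≠ k → e i j * e k l = 0) (h1 : ∑ i, e i i = 1)
    (hc : ∀ x i j, f x * e i j = e i j * f x) : Matrix ι ι B →ₐ[ℂ] E where
  toFun Y := ∑ i, ∑ j, f (Y i j) * e i j
  map_one' := by
    have : ∀ i : ι, ∑ j, f ((1 : Matrix ι ι B) i j) * e i j = e i i := fun i => by
      rw [Finset.sum_eq_single i]
      · simp
      · intro j _ hj; simp [Matrix.one_apply_ne hj.symm]
      · simp
    simp [this, h1]
  map_zero' := by simp
  map_add' Y Z := by simp [add_mul, Finset.sum_add_distrib]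
  commutes' r := by
    have : ∀ i : ι, ∑ j, f ((algebraMap ℂ (Matrix ι ι B) r) i j) * e i j =
        algebraMap ℂ E r * e i i := fun i => by
      rw [Finset.sum_eq_single i]
      · simp [Matrix.algebraMap_matrix_apply]
      · intro j _ hj; simp [Matrix.algebraMap_matrix_apply, hj.symm]
      · simp
    simp [this, ← Finset.mul_sum, h1]
  map_mul' Y Z := by
    have key : ∀ i j : ι, (f (Y i j) * e i j) * (∑ k, ∑ l, f (Z k l) * e k l) =
        ∑ l, f (Y i j * Z j l) * e i l := fun i j => by
      rw [Finset.mul_sum, Finset.sum_eq_single j]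
      · rw [Finset.mul_sum]
        refine Finset.sum_congr rfl fun l _ => ?_
        rw [mul_assoc, ← mul_assoc (e i j), ← hc, mul_assoc, he, map_mul, mul_assoc]
      · intro k _ hk
        rw [Finset.mul_sum]
        refine Finset.sum_eq_zero fun l _ => ?_
        rw [mul_assoc, ← mul_assoc (e i j), ← hc, mul_assoc, he' _ _ _ _ hk.symm, mul_zero,
          mul_zero]
      · simp
    rw [Finset.sum_mul]
    refine Finset.sum_congr rfl fun i _ => ?_
    rw [Finset.sum_mul]
    simp only [key, Matrix.mul_apply, map_sum, Finset.sum_mul]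
    rw [Finset.sum_comm]

namespace LegSystem

variable {N : ℕ} {A E : Type} [Ring A] [Algebra ℂ A] [Ring E] [Algebra ℂ E]
variable (L : LegSystem N A E)

/-- A matrix over `A` placed in the leg `0`. -/
def mat : Matrix (Fin N) (Fin N) A →ₐ[ℂ] E :=
  matrixUnitHom L.scal (L.u 0) (L.u_mul_u 0) (L.u_mul_u_ne 0) (L.sum_u 0) fun x => L.scal_comm x 0

theorem mat_apply (Y : Matrix (Fin N) (Fin N) A) :
    L.mat Y = ∑ a, ∑ b, L.scal (Y a b) * L.u 0 a b := rfl

/-- A complex matrix placed in the leg `k`. -/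
def leg1 (k : ℕ) : Matrix (Fin N) (Fin N) ℂ →ₐ[ℂ] E :=
  matrixUnitHom (Algebra.ofId ℂ E) (L.u k) (L.u_mul_u k) (L.u_mul_u_ne k) (L.sum_u k)
    fun x _ _ => Algebra.commutes x _

theorem leg1_apply (k : ℕ) (W : Matrix (Fin N) (Fin N) ℂ) :
    L.leg1 k W = ∑ a, ∑ b, W a b • L.u k a b := by
  simp only [Algebra.smul_def]; rfl

/-- An operator on `V ⊗ V` placed in the legs `k, k+1`. -/
def leg2 (k : ℕ) : Op2 N →ₐ[ℂ] E :=
  matrixUnitHom (Algebra.ofId ℂ E) (fun x y => L.u k x.1 y.1 * L.u (k + 1) x.2 y.2)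
    (fun x y z => by
      rw [mul_assoc, ← mul_assoc (L.u (k + 1) _ _), ← L.u_comm k (k + 1) _ _ _ _ (by omega),
        mul_assoc, ← mul_assoc, L.u_mul_u, L.u_mul_u])
    (fun x y z w h => by
      rw [mul_assoc, ← mul_assoc (L.u (k + 1) _ _), ← L.u_comm k (k + 1) _ _ _ _ (by omega),
        mul_assoc, ← mul_assoc]
      by_cases h1 : y.1 = z.1
      · rw [L.u_mul_u_ne (k + 1) _ _ _ _ fun h2 => h (Prod.ext h1 h2), mul_zero]
      · rw [L.u_mul_u_ne k _ _ _ _ h1, zero_mul])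
    (by rw [Fintype.sum_prod_type]; simp [← Finset.mul_sum, L.sum_u])
    fun x _ _ => Algebra.commutes x _

theorem leg2_apply (k : ℕ) (X : Op2 N) :
    L.leg2 k X = ∑ x, ∑ y, X x y • (L.u k x.1 y.1 * L.u (k + 1) x.2 y.2) := by
  simp only [Algebra.smul_def]; rfl

/-- The elements acting trivially in the leg `k`. -/
def away (k : ℕ) : Subalgebra ℂ E := Subalgebra.centralizer ℂ {z | ∃ a b, z = L.u k a b}

theorem mem_away {k : ℕ} {Z : E} : Z ∈ L.away k ↔ ∀ a b, L.u k a b * Z = Z * L.u k a b := by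
  simp only [away, Subalgebra.mem_centralizer_iff, Set.mem_ofPred_eq]
  constructor
  · intro h a b; exact h _ ⟨a, b, rfl⟩
  · rintro h _ ⟨a, b, rfl⟩; exact h a b

theorem u_mem_away {k l : ℕ} (h : k ≠ l) (a b : Fin N) : L.u k a b ∈ L.away l :=
  L.mem_away.2 fun c d => L.u_comm l k c d a b h.symm

theorem scal_mem_away (x : A) (k : ℕ) : L.scal x ∈ L.away k :=
  L.mem_away.2 fun a b => (L.scal_comm x k a b).symm

theorem mat_mem_away (Y : Matrix (Fin N) (Fin N) A) {k : ℕ} (h : 0 ≠ k) : L.mat Y ∈ L.away k := by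
  rw [mat_apply]
  exact sum_mem fun _ _ => sum_mem fun _ _ => mul_mem (L.scal_mem_away _ _) (L.u_mem_away h _ _)

theorem leg1_mem_away {k l : ℕ} (h : k ≠ l) (W : Matrix (Fin N) (Fin N) ℂ) :
    L.leg1 k W ∈ L.away l := by
  rw [leg1_apply]
  exact sum_mem fun _ _ => sum_mem fun _ _ => Subalgebra.smul_mem _ (L.u_mem_away h _ _) _

theorem leg2_mem_away {k l : ℕ} (h : k ≠ l) (h' : k + 1 ≠ l) (X : Op2 N) :
    L.leg2 k X ∈ L.away l := by
  rw [leg2_apply]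
  exact sum_mem fun _ _ => sum_mem fun _ _ => Subalgebra.smul_mem _
    (mul_mem (L.u_mem_away h _ _) (L.u_mem_away h' _ _)) _

theorem leg1_comm_of_away {k : ℕ} {Z : E} (hZ : Z ∈ L.away k) (W : Matrix (Fin N) (Fin N) ℂ) :
    L.leg1 k W * Z = Z * L.leg1 k W := by
  rw [mem_away] at hZ
  simp only [leg1_apply, Finset.sum_mul, Finset.mul_sum, smul_mul_assoc, mul_smul_comm, hZ]

theorem leg2_comm_of_away {k : ℕ} {Z : E} (hZ : Z ∈ L.away k) (hZ' : Z ∈ L.away (k + 1))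
    (X : Op2 N) : L.leg2 k X * Z = Z * L.leg2 k X := by
  rw [mem_away] at hZ hZ'
  simp only [leg2_apply, Finset.sum_mul, Finset.mul_sum, smul_mul_assoc, mul_smul_comm, mul_assoc,
    hZ']
  simp only [← mul_assoc, hZ]

theorem sh_leg1 (k : ℕ) (W : Matrix (Fin N) (Fin N) ℂ) :
    L.sh (L.leg1 k W) = L.leg1 (k + 1) W := by
  simp [leg1_apply, L.sh_u]

theorem sh_leg2 (k : ℕ) (X : Op2 N) : L.sh (L.leg2 k X) = L.leg2 (k + 1) X := by
  simp [leg2_apply, L.sh_u]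

theorem scal_injective (hN : 0 < N) : Function.Injective L.scal := by
  refine (injective_iff_map_eq_zero L.scal).2 fun x hx => ?_
  exact L.faithful x 0 ⟨0, hN⟩ ⟨0, hN⟩ (by simp [hx])

/-- The ordinary partial trace over the leg `k`. -/
def tr (k : ℕ) : E →ₗ[ℂ] E :=
  ∑ a, ∑ b, LinearMap.mulLeft ℂ (L.u k a b) ∘ₗ LinearMap.mulRight ℂ (L.u k b a)

theorem tr_apply (k : ℕ) (Z : E) : L.tr k Z = ∑ a, ∑ b, L.u k a b * Z * L.u k b a := by
  simp [tr, mul_assoc]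

theorem tr_mul_left {k : ℕ} {X : E} (hX : X ∈ L.away k) (Z : E) :
    L.tr k (X * Z) = X * L.tr k Z := by
  rw [mem_away] at hX
  simp only [tr_apply, Finset.mul_sum]
  refine Finset.sum_congr rfl fun a _ => Finset.sum_congr rfl fun b _ => ?_
  rw [← mul_assoc, hX]; simp only [mul_assoc]

theorem tr_mul_right {k : ℕ} {X : E} (hX : X ∈ L.away k) (Z : E) :
    L.tr k (Z * X) = L.tr k Z * X := by
  rw [mem_away] at hX
  simp only [tr_apply, Finset.sum_mul]
  refine Finset.sum_congr rfl fun a _ => Finset.sum_congr rfl fun b _ => ?_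
  simp only [mul_assoc]; rw [hX]

theorem tr_mem_away_self (k : ℕ) (Z : E) : L.tr k Z ∈ L.away k := by
  rw [mem_away]
  intro p r
  simp only [tr_apply, Finset.mul_sum, Finset.sum_mul]
  have h1 : ∀ a, ∑ b, L.u k p r * (L.u k a b * Z * L.u k b a) =
      if r = a then ∑ b, L.u k p b * Z * L.u k b r else 0 := fun a => by
    by_cases h : r = a
    · subst h; simp [← mul_assoc, L.u_mul_u]
    · simp [← mul_assoc, L.u_mul_u_ne k _ _ _ _ h, h]
  have h2 : ∀ a, ∑ b, (L.u k a b * Z * L.u k b a) * L.u k p r =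
      if a = p then ∑ b, L.u k p b * Z * L.u k b r else 0 := fun a => by
    by_cases h : a = p
    · subst h; simp [mul_assoc, L.u_mul_u]
    · simp [mul_assoc, L.u_mul_u_ne k _ _ _ _ h, h]
  simp [h1, h2]

theorem tr_mem_away {k l : ℕ} {Z : E} (hZ : Z ∈ L.away l) : L.tr k Z ∈ L.away l := by
  by_cases h : k = l
  · subst h; exact L.tr_mem_away_self k Z
  · rw [tr_apply]
    exact sum_mem fun _ _ => sum_mem fun _ _ =>
      mul_mem (mul_mem (L.u_mem_away h _ _) hZ) (L.u_mem_away h _ _)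

theorem tr_comm (k l : ℕ) (Z : E) : L.tr k (L.tr l Z) = L.tr l (L.tr k Z) := by
  by_cases h : k = l
  · subst h; rfl
  · rw [L.tr_apply l, L.tr_apply l]
    simp only [map_sum]
    refine Finset.sum_congr rfl fun a _ => Finset.sum_congr rfl fun b _ => ?_
    rw [L.tr_mul_right (L.u_mem_away (Ne.symm h) _ _), L.tr_mul_left (L.u_mem_away (Ne.symm h) _ _)]

theorem tr_u (k : ℕ) (a b : Fin N) : L.tr k (L.u k a b) = if a = b then 1 else 0 := by
  rw [tr_apply]
  have h1 : ∀ c d, L.u k c d * L.u k a b * L.u k d c =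
      if d = a then (if b = d then L.u k c c else 0) else 0 := fun c d => by
    by_cases h : d = a
    · subst h
      by_cases h' : b = d
      · subst h'; simp [L.u_mul_u]
      · simp [L.u_mul_u, L.u_mul_u_ne k _ _ _ _ h', h']
    · simp [L.u_mul_u_ne k _ _ _ _ h, h]
  simp only [h1, Finset.sum_ite_eq', Finset.mem_univ, if_true]
  by_cases h : a = b
  · subst h; simp [L.sum_u]
  · simp [h, Ne.symm h]

theorem tr_u_mul (k : ℕ) (p r : Fin N) (Z : E) :
    L.tr k (L.u k p r * Z) = L.tr k (Z * L.u k p r) := by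
  simp only [tr_apply]
  have h1 : ∀ a b, L.u k a b * (L.u k p r * Z) * L.u k b a =
      if b = p then L.u k a r * Z * L.u k p a else 0 := fun a b => by
    by_cases h : b = p
    · subst h; simp [← mul_assoc, L.u_mul_u]
    · simp [← mul_assoc, L.u_mul_u_ne k _ _ _ _ h, h]
  have h2 : ∀ a b, L.u k a b * (Z * L.u k p r) * L.u k b a =
      if r = b then L.u k a r * Z * L.u k p a else 0 := fun a b => by
    by_cases h : r = b
    · subst h; simp [mul_assoc, L.u_mul_u]
    · simp [mul_assoc, L.u_mul_u_ne k _ _ _ _ h, h]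
  simp [h1, h2]

theorem tr_tr_leg2_mul (k : ℕ) (X : Op2 N) (Z : E) :
    L.tr k (L.tr (k + 1) (L.leg2 k X * Z)) = L.tr k (L.tr (k + 1) (Z * L.leg2 k X)) := by
  simp only [leg2_apply, Finset.sum_mul, Finset.mul_sum, map_sum, smul_mul_assoc, mul_smul_comm,
    map_smul]
  refine Finset.sum_congr rfl fun x _ => Finset.sum_congr rfl fun y _ => ?_
  congr 1
  have hk : L.u k x.1 y.1 ∈ L.away (k + 1) := L.u_mem_away (by omega) _ _
  rw [mul_assoc, L.tr_mul_left hk, L.tr_u_mul, L.tr_u_mul,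
    L.u_comm k (k + 1) _ _ _ _ (by omega), ← mul_assoc, L.tr_mul_right hk]

theorem sh_tr (k : ℕ) (Z : E) : L.sh (L.tr k Z) = L.tr (k + 1) (L.sh Z) := by
  simp [tr_apply, L.sh_u]

/-- Decomposition of an element according to its matrix elements in the leg `k`. -/
theorem eq_sum_u_mul (k : ℕ) (Z : E) :
    Z = ∑ a, ∑ b, L.u k a b * ∑ c, L.u k c a * Z * L.u k b c := by
  have h1 : ∀ a b, L.u k a b * ∑ c, L.u k c a * Z * L.u k b c = L.u k a a * Z * L.u k b b := by
    intro a b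
    rw [Finset.mul_sum, Finset.sum_eq_single b]
    · rw [← mul_assoc, ← mul_assoc, L.u_mul_u]
    · intro c _ hc; rw [← mul_assoc, ← mul_assoc, L.u_mul_u_ne k _ _ _ _ hc.symm]; simp
    · simp
  simp only [h1, ← Finset.mul_sum, L.sum_u, mul_one]
  rw [← Finset.sum_mul, L.sum_u, one_mul]

theorem sum_u_mem_away (k : ℕ) (Z : E) (a b : Fin N) :
    ∑ c, L.u k c a * Z * L.u k b c ∈ L.away k := by
  rw [mem_away]
  intro p r
  rw [Finset.mul_sum, Finset.sum_mul, Finset.sum_eq_single r, Finset.sum_eq_single p]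
  · rw [mul_assoc, mul_assoc, mul_assoc, L.u_mul_u, ← mul_assoc, L.u_mul_u]
  · intro c _ hc; rw [mul_assoc, L.u_mul_u_ne k _ _ _ _ hc, mul_zero]
  · simp
  · intro c _ hc
    rw [mul_assoc, ← mul_assoc, L.u_mul_u_ne k _ _ _ _ hc.symm, zero_mul]
  · simp

theorem leg1_injective_of_eq_zero {k : ℕ} {W : Matrix (Fin N) (Fin N) ℂ}
    (h : L.leg1 k W = 0) (h1 : (1 : A) ≠ 0) : W = 0 := by
  ext a b
  have h2 : L.u k a a * L.leg1 k W * L.u k b b = W a b • L.u k a b := by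
    rw [leg1_apply, Finset.mul_sum, Finset.sum_mul, Finset.sum_eq_single a]
    · rw [Finset.mul_sum, Finset.sum_mul, Finset.sum_eq_single b]
      · simp [L.u_mul_u]
      · intro c _ hc; simp [L.u_mul_u, L.u_mul_u_ne k _ _ _ _ hc]
      · simp
    · intro c _ hc
      simp [Finset.mul_sum, L.u_mul_u_ne k _ _ _ _ hc.symm]
    · simp
  rw [h] at h2
  by_contra hW
  apply h1
  refine L.faithful 1 k a b ?_
  rw [map_one, one_mul]
  have h3 : W a b • L.u k a b = 0 := by rw [← h2]; simp
  rw [← inv_smul_smul₀ hW (L.u k a b), h3, smul_zero]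

theorem mat_injective : Function.Injective L.mat := by
  refine (injective_iff_map_eq_zero L.mat).2 fun Y h => ?_
  ext a b
  have h2 : L.u 0 a a * L.mat Y * L.u 0 b b = L.scal (Y a b) * L.u 0 a b := by
    rw [mat_apply, Finset.mul_sum, Finset.sum_mul, Finset.sum_eq_single a]
    · rw [Finset.mul_sum, Finset.sum_mul, Finset.sum_eq_single b]
      · rw [← mul_assoc, ← L.scal_comm, mul_assoc, mul_assoc, L.u_mul_u, L.u_mul_u]
      · intro c _ hc; simp [mul_assoc, L.u_mul_u_ne 0 _ _ _ _ hc]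
      · simp
    · intro c _ hc
      rw [Finset.mul_sum, Finset.sum_mul]
      refine Finset.sum_eq_zero fun d _ => ?_
      rw [← mul_assoc, ← L.scal_comm, mul_assoc (L.scal _), L.u_mul_u_ne 0 _ _ _ _ hc.symm]; simp
    · simp
  rw [h] at h2
  exact L.faithful _ 0 a b (by rw [← h2]; simp)

end LegSystem

/-- `D_X = Tr_{(2)} Ψ` for a skew inverse `Ψ` of `X`. -/
def trSnd {N : ℕ} (Ψ : Op2 N) : Matrix (Fin N) (Fin N) ℂ := fun a c => ∑ b, Ψ (a, b) (c, b)

/-- `Ψ_{21}`. -/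
def flip2 {N : ℕ} (Ψ : Op2 N) : Op2 N := fun x y => Ψ (x.2, x.1) (y.2, y.1)

/-- `X ⊗ Y` as an operator on `V ⊗ V`. -/
def kron {N : ℕ} (X Y : Matrix (Fin N) (Fin N) ℂ) : Op2 N := fun x y => X x.1 y.1 * Y x.2 y.2

theorem kron_mul_kron {N : ℕ} (X Y Z W : Matrix (Fin N) (Fin N) ℂ) :
    kron X Y * kron Z W = kron (X * Z) (Y * W) :=
  (Matrix.mul_kronecker_mul X Z Y W).symm

/-- The partial trace over the second factor weighted by `D`. -/
def ptrSnd {N : ℕ} (D : Matrix (Fin N) (Fin N) ℂ) (Z : Op2 N) : Matrix (Fin N) (Fin N) ℂ :=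
  fun a c => ∑ b, ∑ m, D m b * Z (a, b) (c, m)

theorem matD_eq {N : ℕ} (X : Op2 N) : matD X = trSnd (skewInverse X) := rfl

theorem isSkewInverse_skewInverse {N : ℕ} {X : Op2 N} (h : SkewInvertible X) :
    IsSkewInverse X (skewInverse X) := by
  rw [skewInverse, dif_pos h]; exact h.choose_spec

theorem ptrSnd_self {N : ℕ} {X Ψ : Op2 N} (h : IsSkewInverse X Ψ) : ptrSnd (trSnd Ψ) X = 1 := by
  ext a c
  have h2 : ∑ e, ∑ b, ∑ m, X (a, b) (c, m) * Ψ (m, e) (b, e) = if a = c then 1 else 0 := by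
    simp only [h.1]
    by_cases hac : a = c
    · subst hac
      rw [Finset.sum_eq_single a]
      · simp
      · intro e _ he; exact if_neg fun hh => he hh.2
      · simp
    · rw [if_neg hac]
      refine Finset.sum_eq_zero fun e _ => if_neg ?_
      rintro ⟨rfl, rfl⟩; exact hac rfl
  rw [Matrix.one_apply, ← h2, Finset.sum_comm]
  refine Finset.sum_congr rfl fun b _ => ?_
  rw [Finset.sum_comm]
  refine Finset.sum_congr rfl fun m _ => ?_
  rw [← Finset.mul_sum, mul_comm]; rfl

namespace LegSystem

variable {N : ℕ} {A E : Type} [Ring A] [Algebra ℂ A] [Ring E] [Algebra ℂ E]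
variable (L : LegSystem N A E)

theorem leg1_eq_leg2 (k : ℕ) (W : Matrix (Fin N) (Fin N) ℂ) :
    L.leg1 k W = L.leg2 k (kron W 1) := by
  rw [leg1_apply, leg2_apply]
  simp only [Fintype.sum_prod_type, kron, Matrix.one_apply, mul_ite, mul_one,
    mul_zero, ite_smul, zero_smul, Finset.sum_ite_eq, Finset.mem_univ, if_true]
  refine Finset.sum_congr rfl fun a _ => ?_
  rw [Finset.sum_comm]
  refine Finset.sum_congr rfl fun b _ => ?_
  rw [← Finset.smul_sum, ← Finset.mul_sum, L.sum_u, mul_one]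

theorem leg1_succ_eq_leg2 (k : ℕ) (W : Matrix (Fin N) (Fin N) ℂ) :
    L.leg1 (k + 1) W = L.leg2 k (kron 1 W) := by
  rw [leg1_apply, leg2_apply]
  simp only [Fintype.sum_prod_type, kron, Matrix.one_apply, ite_mul, one_mul,
    zero_mul, ite_smul, zero_smul]
  symm
  rw [Finset.sum_comm]
  refine Finset.sum_congr rfl fun a _ => ?_
  have : ∀ x : Fin N, (∑ y, ∑ b, if x = y then W a b • (L.u k x y * L.u (k + 1) a b) else 0) =
      ∑ b, W a b • (L.u k x x * L.u (k + 1) a b) := fun x => by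
    rw [Finset.sum_eq_single x]
    · simp
    · intro y _ hy; simp [hy.symm]
    · simp
  simp only [this]
  rw [Finset.sum_comm]
  refine Finset.sum_congr rfl fun b _ => ?_
  rw [← Finset.smul_sum, ← Finset.sum_mul, L.sum_u, one_mul]

/-- The partial trace over the leg `k`, weighted by `D`. -/
def wtr (D : Matrix (Fin N) (Fin N) ℂ) (k : ℕ) : E →ₗ[ℂ] E :=
  L.tr k ∘ₗ LinearMap.mulLeft ℂ (L.leg1 k D)

theorem wtr_apply (D : Matrix (Fin N) (Fin N) ℂ) (k : ℕ) (Z : E) :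
    L.wtr D k Z = L.tr k (L.leg1 k D * Z) := rfl

variable {D : Matrix (Fin N) (Fin N) ℂ}

theorem wtr_mul_left {k : ℕ} {X : E} (hX : X ∈ L.away k) (Z : E) :
    L.wtr D k (X * Z) = X * L.wtr D k Z := by
  rw [wtr_apply, wtr_apply, ← L.tr_mul_left hX, ← mul_assoc, L.leg1_comm_of_away hX, mul_assoc]

theorem wtr_mul_right {k : ℕ} {X : E} (hX : X ∈ L.away k) (Z : E) :
    L.wtr D k (Z * X) = L.wtr D k Z * X := by
  rw [wtr_apply, wtr_apply, ← L.tr_mul_right hX, mul_assoc]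

theorem wtr_mem_away_self (k : ℕ) (Z : E) : L.wtr D k Z ∈ L.away k := L.tr_mem_away_self _ _

theorem wtr_mem_away {k l : ℕ} {Z : E} (hZ : Z ∈ L.away l) : L.wtr D k Z ∈ L.away l := by
  by_cases h : k = l
  · subst h; exact L.wtr_mem_away_self k Z
  · exact L.tr_mem_away (mul_mem (L.leg1_mem_away h _) hZ)

theorem wtr_wtr_comm (D' : Matrix (Fin N) (Fin N) ℂ) {k l : ℕ} (h : k ≠ l) (Z : E) :
    L.wtr D k (L.wtr D' l Z) = L.wtr D' l (L.wtr D k Z) := by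
  simp only [wtr_apply]
  rw [← L.tr_mul_left (L.leg1_mem_away h D), ← L.tr_mul_left (L.leg1_mem_away h.symm D'),
    L.tr_comm, ← mul_assoc, ← mul_assoc, L.leg1_comm_of_away (L.leg1_mem_away h.symm D')]

theorem sh_wtr (k : ℕ) (Z : E) : L.sh (L.wtr D k Z) = L.wtr D (k + 1) (L.sh Z) := by
  simp [wtr_apply, L.sh_tr, L.sh_leg1]

theorem wtr_u (k : ℕ) (p r : Fin N) : L.wtr D k (L.u k p r) = D r p • 1 := by
  rw [wtr_apply, leg1_apply, Finset.sum_mul, map_sum, Finset.sum_eq_single r]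
  · rw [Finset.sum_mul, map_sum, Finset.sum_eq_single p]
    · simp [L.u_mul_u, L.tr_u]
    · intro c _ hc; simp [L.u_mul_u_ne k _ _ _ _ hc]
    · simp
  · intro c _ hc
    rw [Finset.sum_mul, map_sum]
    refine Finset.sum_eq_zero fun d _ => ?_
    by_cases h : d = p
    · subst h; simp [L.u_mul_u, L.tr_u, hc]
    · simp [L.u_mul_u_ne k _ _ _ _ h]
  · simp

theorem wtr_one (k : ℕ) : L.wtr D k 1 = D.trace • 1 := by
  rw [← L.sum_u k, map_sum]
  simp only [wtr_u, L.sum_u, ← Finset.sum_smul]; rfl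

theorem wtr_succ_leg2 (k : ℕ) (Z : Op2 N) :
    L.wtr D (k + 1) (L.leg2 k Z) = L.leg1 k (ptrSnd D Z) := by
  rw [leg2_apply, leg1_apply]
  simp only [map_sum, map_smul, L.wtr_mul_left (L.u_mem_away (show k ≠ k + 1 by omega) _ _), wtr_u,
    mul_smul_comm, mul_one, Fintype.sum_prod_type, smul_smul, ptrSnd, Finset.sum_smul]
  refine Finset.sum_congr rfl fun a _ => ?_
  rw [Finset.sum_comm]
  refine Finset.sum_congr rfl fun c _ => Finset.sum_congr rfl fun b _ =>
    Finset.sum_congr rfl fun m _ => ?_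
  rw [mul_comm]

theorem wtr_succ_self {X Ψ : Op2 N} (h : IsSkewInverse X Ψ) (k : ℕ) :
    L.wtr (trSnd Ψ) (k + 1) (L.leg2 k X) = 1 := by
  rw [wtr_succ_leg2, ptrSnd_self h, map_one]

/-- For a compatible pair `{X, F}`, conjugation with `F` transports the `X`-trace. -/
theorem wtr_conj_u {X Ψ F G : Op2 N} (h : IsSkewInverse X Ψ) (hFG : F * G = 1)
    (hrel : L.leg2 1 G * L.leg2 0 X * L.leg2 1 F = L.leg2 0 F * L.leg2 1 X * L.leg2 0 G)
    (p r : Fin N) :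
    L.wtr (trSnd Ψ) 1 (L.leg2 0 G * L.u 0 p r * L.leg2 0 F) = trSnd Ψ r p • 1 := by
  set D := trSnd Ψ
  let W : Matrix (Fin N) (Fin N) ℂ := fun b d => Ψ (r, b) (p, d)
  have hX : L.wtr W 0 (L.leg2 0 X) = L.u 1 p r := by
    rw [leg2_apply]
    have hc : ∀ x y : Fin N × Fin N, L.wtr W 0 (X x y • (L.u 0 x.1 y.1 * L.u (0 + 1) x.2 y.2)) =
        (W y.1 x.1 * X x y) • L.u 1 x.2 y.2 := fun x y => by
      rw [map_smul, L.wtr_mul_right (L.u_mem_away (by omega) _ _), wtr_u, smul_mul_assoc, one_mul,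
        smul_smul, mul_comm]
    simp only [map_sum, hc, Fintype.sum_prod_type]
    have hs : ∀ e f : Fin N, ∑ d, ∑ b, W b d * X (d, e) (b, f) = if r = f ∧ e = p then 1 else 0 :=
      fun e f => by rw [← h.2 r p e f, Finset.sum_comm]
    calc ∑ d, ∑ e, ∑ b, ∑ f, (W b d * X (d, e) (b, f)) • L.u 1 e f
        = ∑ e, ∑ f, (∑ d, ∑ b, W b d * X (d, e) (b, f)) • L.u 1 e f := by
          rw [Finset.sum_comm]
          refine Finset.sum_congr rfl fun e _ => ?_
          have : ∀ d, ∑ b, ∑ f, (W b d * X (d, e) (b, f)) • L.u 1 e f =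
            ∑ f, ∑ b, (W b d * X (d, e) (b, f)) • L.u 1 e f := fun d => Finset.sum_comm
          simp only [this]
          rw [Finset.sum_comm]
          simp only [Finset.sum_smul]
      _ = L.u 1 p r := by
          simp only [hs]
          rw [Finset.sum_eq_single p, Finset.sum_eq_single r]
          · simp
          · intro f _ hf; rw [if_neg (fun hh => hf hh.1.symm), zero_smul]
          · simp
          · intro e _ he
            refine Finset.sum_eq_zero fun f _ => ?_
            rw [if_neg (fun hh => he hh.2), zero_smul]
          · simp
  have h1 : L.wtr D 2 (L.wtr W 0 (L.leg2 1 G * L.leg2 0 X * L.leg2 1 F)) =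
      L.wtr D 2 (L.leg2 1 G * L.u 1 p r * L.leg2 1 F) := by
    rw [L.wtr_mul_right (L.leg2_mem_away (by omega) (by omega) _),
      L.wtr_mul_left (L.leg2_mem_away (by omega) (by omega) _), hX]
  have h2 : L.wtr W 0 (L.wtr D 2 (L.leg2 0 F * L.leg2 1 X * L.leg2 0 G)) = D r p • 1 := by
    rw [L.wtr_mul_right (L.leg2_mem_away (by omega) (by omega) _),
      L.wtr_mul_left (L.leg2_mem_away (by omega) (by omega) _), L.wtr_succ_self h, mul_one,
      ← map_mul, hFG, map_one, wtr_one]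
    rfl
  apply L.sh_injective
  rw [sh_wtr, map_mul L.sh, map_mul L.sh, sh_leg2, sh_leg2, L.sh_u, ← h1, L.wtr_wtr_comm W (by omega), hrel,
    h2]
  simp

theorem u_zero_eq_leg2 (p r : Fin N) :
    L.u 0 p r = L.leg2 0 (kron (Matrix.single p r 1) 1) := by
  rw [← leg1_eq_leg2, leg1_apply, Finset.sum_eq_single p, Finset.sum_eq_single r]
  · simp
  · intro b _ hb; simp [hb.symm]
  · simp
  · intro b _ hb; simp [hb.symm]
  · simp

end LegSystem

/-- The transport property of the trace weighted by `D`, in coordinates. -/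
def Transports {N : ℕ} (D : Matrix (Fin N) (Fin N) ℂ) (G F : Op2 N) : Prop :=
  ∀ p r a c, ∑ m, ∑ y, (∑ b, D m b * G (a, b) (p, y)) * F (r, y) (c, m) =
    if a = c then D r p else 0

theorem ptrSnd_conj {N : ℕ} (D : Matrix (Fin N) (Fin N) ℂ) (G F : Op2 N) (p r a c : Fin N) :
    ptrSnd D (G * kron (Matrix.single p r 1) 1 * F) a c =
      ∑ m, ∑ y, (∑ b, D m b * G (a, b) (p, y)) * F (r, y) (c, m) := by
  have h1 : ∀ x y : Fin N × Fin N,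
      (G * kron (Matrix.single p r 1) 1) x y =
        if r = y.1 then G x (p, y.2) else 0 := fun x y => by
    rw [Matrix.mul_apply, Finset.sum_eq_single (p, y.2)]
    · simp [kron, Matrix.single_apply]
    · rintro ⟨z1, z2⟩ _ hz
      simp only [kron, Matrix.single_apply, Matrix.one_apply]
      by_cases hp : p = z1
      · by_cases h2 : z2 = y.2
        · exact (hz (by rw [hp, h2])).elim
        · simp [h2]
      · simp [hp]
    · simp
  have h2 : ∀ x y : Fin N × Fin N,
      (G * kron (Matrix.single p r 1) 1 * F) x y =
        ∑ z, G x (p, z) * F (r, z) y := fun x y => by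
    rw [Matrix.mul_apply, Fintype.sum_prod_type, Finset.sum_eq_single r]
    · simp [h1]
    · intro z _ hz; simp [h1, hz.symm]
    · simp
  simp only [ptrSnd, h2]
  rw [Finset.sum_comm]
  refine Finset.sum_congr rfl fun m _ => ?_
  simp only [Finset.mul_sum, Finset.sum_mul]
  rw [Finset.sum_comm]
  simp only [mul_assoc]

theorem transports_of_rel {N : ℕ} {E : Type} [Ring E] [Algebra ℂ E] (L : LegSystem N ℂ E)
    {X Ψ F G : Op2 N} (h : IsSkewInverse X Ψ) (hFG : F * G = 1)
    (hrel : L.leg2 1 G * L.leg2 0 X * L.leg2 1 F = L.leg2 0 F * L.leg2 1 X * L.leg2 0 G) :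
    Transports (trSnd Ψ) G F := by
  intro p r a c
  have h1 := L.wtr_conj_u h hFG hrel p r
  rw [L.u_zero_eq_leg2, ← map_mul, ← map_mul, L.wtr_succ_leg2] at h1
  have h2 : ptrSnd (trSnd Ψ) (G * kron (Matrix.single p r 1) 1 * F) -
      trSnd Ψ r p • 1 = 0 :=
    L.leg1_injective_of_eq_zero (k := 0) (by rw [map_sub, h1, map_smul, map_one, sub_self])
      one_ne_zero
  have h3 := congrFun (congrFun (sub_eq_zero.1 h2) a) c
  rw [ptrSnd_conj] at h3
  rw [h3, Matrix.smul_apply, Matrix.one_apply]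
  by_cases hac : a = c <;> simp [hac]

section Strip

variable {N : ℕ} {D : Matrix (Fin N) (Fin N) ℂ} {F G Ψ : Op2 N}

theorem snd_mul_eq (hΨ : IsSkewInverse F Ψ) (h : Transports D G F) :
    kron 1 D * G = flip2 Ψ * kron D 1 := by
  let H : Matrix (Fin N × Fin N) (Fin N × Fin N) ℂ := fun x y =>
    ∑ b, D y.1 b * G (x.1, b) (x.2, y.2)
  let F' : Matrix (Fin N × Fin N) (Fin N × Fin N) ℂ := fun y z => F (z.1, y.2) (z.2, y.1)
  let Ψ' : Matrix (Fin N × Fin N) (Fin N × Fin N) ℂ := fun z w => Ψ (w.1, z.2) (w.2, z.1)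
  let V : Matrix (Fin N × Fin N) (Fin N × Fin N) ℂ := fun x z =>
    if x.1 = z.2 then D z.1 x.2 else 0
  have h1 : H * F' = V := by
    ext ⟨a, p⟩ ⟨r, c⟩
    rw [Matrix.mul_apply, Fintype.sum_prod_type]
    exact h p r a c
  have h2 : F' * Ψ' = 1 := by
    ext ⟨m, y⟩ ⟨s, t⟩
    rw [Matrix.mul_apply, Fintype.sum_prod_type, Matrix.one_apply]
    have := hΨ.2 s t y m
    rw [Finset.sum_comm] at this
    simp only [F', Ψ', mul_comm (F _ _), this, Prod.mk.injEq]
    exact if_congr ⟨fun hh => ⟨hh.1.symm, hh.2⟩, fun hh => ⟨hh.1.symm, hh.2⟩⟩ rfl rfl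
  have h3 : H = V * Ψ' := by rw [← h1, mul_assoc, h2, mul_one]
  ext ⟨a, s⟩ ⟨p, t⟩
  have h4 := congrFun (congrFun h3 (a, p)) (s, t)
  rw [Matrix.mul_apply, Fintype.sum_prod_type] at h4 ⊢
  rw [Matrix.mul_apply, Fintype.sum_prod_type]
  rw [Finset.sum_eq_single a]
  · simp only [kron, Matrix.one_apply_eq, one_mul]
    refine h4.trans (Finset.sum_congr rfl fun r _ => ?_)
    rw [Finset.sum_eq_single a, Finset.sum_eq_single t]
    · simp [V, Ψ', flip2, mul_comm]
    · intro x _ hx; simp [hx]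
    · simp
    · intro x _ hx; simp [V, hx.symm]
    · simp
  · intro x _ hx; simp [kron, hx.symm]
  · simp

theorem mul_snd_eq (hΨ : IsSkewInverse F Ψ) (h : Transports D F G) :
    G * kron 1 D = kron D 1 * flip2 Ψ := by
  let H : Matrix (Fin N × Fin N) (Fin N × Fin N) ℂ := fun x z =>
    ∑ m, D m x.1 * G (z.1, x.2) (z.2, m)
  let F' : Matrix (Fin N × Fin N) (Fin N × Fin N) ℂ := fun x y => F (x.1, y.1) (x.2, y.2)
  let Ψ' : Matrix (Fin N × Fin N) (Fin N × Fin N) ℂ := fun w x => Ψ (w.2, x.2) (w.1, x.1)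
  let V : Matrix (Fin N × Fin N) (Fin N × Fin N) ℂ := fun x z =>
    if x.1 = z.2 then D z.1 x.2 else 0
  have h1 : F' * H = V := by
    ext ⟨a, p⟩ ⟨r, c⟩
    rw [Matrix.mul_apply, Fintype.sum_prod_type]
    refine Eq.trans ?_ (h p r a c)
    simp only [F', H, Finset.mul_sum, Finset.sum_mul]
    have e1 : ∀ b : Fin N, ∑ y, ∑ m, F (a, b) (p, y) * (D m b * G (r, y) (c, m)) =
        ∑ m, ∑ y, D m b * F (a, b) (p, y) * G (r, y) (c, m) := fun b => by
      rw [Finset.sum_comm]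
      exact Finset.sum_congr rfl fun m _ => Finset.sum_congr rfl fun y _ => by ring
    simp only [e1]
    rw [Finset.sum_comm]
    exact Finset.sum_congr rfl fun m _ => Finset.sum_comm
  have h2 : Ψ' * F' = 1 := by
    ext ⟨t, s⟩ ⟨b, y⟩
    rw [Matrix.mul_apply, Fintype.sum_prod_type, Matrix.one_apply]
    have := hΨ.2 s t b y
    rw [Finset.sum_comm] at this
    simp only [F', Ψ', this, Prod.mk.injEq]
    exact if_congr ⟨fun hh => ⟨hh.2.symm, hh.1⟩, fun hh => ⟨hh.2, hh.1.symm⟩⟩ rfl rfl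
  have h3 : H = Ψ' * V := by rw [← h1, ← mul_assoc, h2, one_mul]
  ext ⟨r, y⟩ ⟨c, b⟩
  have h4 := congrFun (congrFun h3 (b, y)) (r, c)
  rw [Matrix.mul_apply, Fintype.sum_prod_type] at h4 ⊢
  rw [Matrix.mul_apply, Fintype.sum_prod_type]
  rw [Finset.sum_eq_single c]
  · simp only [kron, Matrix.one_apply_eq, one_mul]
    refine Eq.trans (Finset.sum_congr rfl fun m _ => mul_comm _ _) (h4.trans ?_)
    rw [Finset.sum_eq_single c]
    · refine Finset.sum_congr rfl fun p _ => ?_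
      rw [Finset.sum_eq_single y]
      · simp [V, Ψ', flip2, mul_comm]
      · intro x _ hx; simp [hx.symm]
      · simp
    · intro x _ hx; simp [V, hx]
    · simp
  · intro x _ hx; simp [kron, hx]
  · simp

theorem kron_comm_of_transports (hΨ : IsSkewInverse F Ψ) (hFG : F * G = 1) (hGF : G * F = 1)
    {D' : Matrix (Fin N) (Fin N) ℂ} (h' : Transports D F G) (k : Transports D' G F) :
    kron D' D * F = F * kron D D' := by
  have e1 : kron D' D = kron 1 D * kron D' 1 := by rw [kron_mul_kron]; simp
  have e1' : kron D' D = kron D' 1 * kron 1 D := by rw [kron_mul_kron]; simp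
  have e2 : kron D D' = kron D 1 * kron 1 D' := by rw [kron_mul_kron]; simp
  have h1 : G * kron D' D = kron D D' * G := by
    rw [e1, ← mul_assoc, mul_snd_eq hΨ h', mul_assoc, ← snd_mul_eq hΨ k, ← mul_assoc, ← e2]
  calc kron D' D * F = F * (G * kron D' D) * F := by rw [← mul_assoc, hFG, one_mul]
    _ = F * kron D D' := by rw [h1, mul_assoc, mul_assoc, hGF, mul_one]

end Strip

namespace LegSystem

variable {N : ℕ} {A E : Type} [Ring A] [Algebra ℂ A] [Ring E] [Algebra ℂ E]
variable (L : LegSystem N A E) {D : Matrix (Fin N) (Fin N) ℂ} {F G : Op2 N}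

theorem wtr_conj_u_of_transports (h : Transports D G F) (k : ℕ) (p r : Fin N) :
    L.wtr D (k + 1) (L.leg2 k G * L.u k p r * L.leg2 k F) = L.wtr D k (L.u k p r) := by
  induction k with
  | zero =>
    rw [L.u_zero_eq_leg2, ← map_mul, ← map_mul, L.wtr_succ_leg2, ← L.u_zero_eq_leg2, L.wtr_u,
      ← map_one (L.leg1 0), ← map_smul]
    congr 1
    ext a c
    rw [ptrSnd_conj, h p r a c, Matrix.smul_apply, Matrix.one_apply]
    by_cases hac : a = c <;> simp [hac]
  | succ k ih =>
    have := congrArg L.sh ih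
    rwa [sh_wtr, sh_wtr, map_mul L.sh, map_mul L.sh, sh_leg2, sh_leg2, L.sh_u] at this

/-- Transport of the trace by conjugation. -/
theorem wtr_conj (h : Transports D G F) {k : ℕ} {Z : E} (hZ : Z ∈ L.away (k + 1)) :
    L.wtr D (k + 1) (L.leg2 k G * Z * L.leg2 k F) = L.wtr D k Z := by
  have hs : ∀ a b, ∑ c, L.u k c a * Z * L.u k b c ∈ L.away (k + 1) := fun a b =>
    sum_mem fun c _ => mul_mem (mul_mem (L.u_mem_away (by omega) _ _) hZ)
      (L.u_mem_away (by omega) _ _)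
  conv_lhs => rw [L.eq_sum_u_mul k Z]
  conv_rhs => rw [L.eq_sum_u_mul k Z]
  simp only [Finset.mul_sum, Finset.sum_mul, map_sum]
  refine Finset.sum_congr rfl fun a _ => Finset.sum_congr rfl fun b _ => ?_
  simp only [← map_sum, ← Finset.mul_sum, ← Finset.sum_mul]
  set y := ∑ c, L.u k c a * Z * L.u k b c with hy
  have hy1 : y ∈ L.away k := L.sum_u_mem_away k Z a b
  rw [L.wtr_mul_right hy1, ← L.wtr_conj_u_of_transports h, ← L.wtr_mul_right (hs a b),
    mul_assoc, mul_assoc, mul_assoc, L.leg2_comm_of_away hy1 (hs a b), mul_assoc]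

theorem leg1_mul_leg1_succ (k : ℕ) (W W' : Matrix (Fin N) (Fin N) ℂ) :
    L.leg1 k W * L.leg1 (k + 1) W' = L.leg2 k (kron W W') := by
  rw [leg1_eq_leg2, leg1_succ_eq_leg2, ← map_mul, kron_mul_kron, mul_one, one_mul]

/-- Cyclicity of the double trace. -/
theorem wtr_wtr_leg2_mul (k : ℕ) {X : Op2 N} (h : kron D D * X = X * kron D D) (Z : E) :
    L.wtr D k (L.wtr D (k + 1) (L.leg2 k X * Z)) = L.wtr D k (L.wtr D (k + 1) (Z * L.leg2 k X)) := by
  have hD : L.leg1 k D ∈ L.away (k + 1) := L.leg1_mem_away (by omega) _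
  simp only [wtr_apply]
  rw [← L.tr_mul_left hD, ← L.tr_mul_left hD, ← mul_assoc, ← mul_assoc, leg1_mul_leg1_succ,
    ← mul_assoc, ← map_mul (L.leg2 k), h, map_mul (L.leg2 k), mul_assoc, L.tr_tr_leg2_mul,
    mul_assoc, leg1_mul_leg1_succ]

end LegSystem

section Bridge

variable {N : ℕ} {A : Type} [Ring A] [Algebra ℂ A]

/-- Replace the first `n` letters of a sequence. -/
def overwrite {n : ℕ} (r : ℕ → Fin N) (t : Fin n → Fin N) : ℕ → Fin N :=
  fun k => if h : k < n then t ⟨k, h⟩ else r k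

/-- The first `n` letters of a sequence. -/
def firstN (n : ℕ) (r : ℕ → Fin N) : Fin n → Fin N := fun k => r k

@[simp] theorem firstN_overwrite {n : ℕ} (r : ℕ → Fin N) (t : Fin n → Fin N) :
    firstN n (overwrite r t) = t := by
  ext k; simp [firstN, overwrite]

@[simp] theorem overwrite_overwrite {n : ℕ} (r : ℕ → Fin N) (t s : Fin n → Fin N) :
    overwrite (overwrite r t) s = overwrite r s := by
  ext k; by_cases h : k < n <;> simp [overwrite, h]

@[simp] theorem overwrite_firstN {n : ℕ} (r : ℕ → Fin N) : overwrite r (firstN n r) = r := by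
  ext k; by_cases h : k < n <;> simp [overwrite, firstN, h]

/-- The action of an operator on the first `n` tensor factors. -/
def opHom (n : ℕ) : Op N n A →ₐ[ℂ] FunOp N A where
  toFun Y :=
    { toFun f r := ∑ t, Y (firstN n r) t * f (overwrite r t)
      map_add' f g := by ext r; simp [mul_add, Finset.sum_add_distrib]
      map_smul' c f := by ext r; simp [Finset.smul_sum] }
  map_one' := by
    ext f r
    simp [Matrix.one_apply]
  map_mul' Y Z := by
    ext f r
    simp only [LinearMap.coe_mk, AddHom.coe_mk, Module.End.mul_apply, Matrix.mul_apply,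
      Finset.sum_mul, firstN_overwrite, overwrite_overwrite, Finset.mul_sum]
    rw [Finset.sum_comm]
    simp only [mul_assoc]
  map_zero' := by ext; simp
  map_add' Y Z := by ext f r; simp [add_mul, Finset.sum_add_distrib]
  commutes' c := by
    ext f r
    simp [Matrix.algebraMap_matrix_apply, Algebra.algebraMap_eq_smul_one]

theorem opHom_apply {n : ℕ} (Y : Op N n A) (f : (ℕ → Fin N) → A) (r : ℕ → Fin N) :
    opHom n Y f r = ∑ t, Y (firstN n r) t * f (overwrite r t) := rfl

theorem toA_mul {ι : Type} [Fintype ι] (X Y : Matrix ι ι ℂ) : toA A (X * Y) = toA A X * toA A Y :=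
  Matrix.map_mul

theorem toA_one {ι : Type} [DecidableEq ι] : toA A (1 : Matrix ι ι ℂ) = 1 :=
  Matrix.map_one _ (map_zero _) (map_one _)

theorem toA_add {ι : Type} (X Y : Matrix ι ι ℂ) : toA A (X + Y) = toA A X + toA A Y :=
  Matrix.map_add _ (map_add _) X Y

theorem toA_smul {ι : Type} (c : ℂ) (X : Matrix ι ι ℂ) : toA A (c • X) = c • toA A X := by
  ext i j; simp [toA, Algebra.smul_def]

/-- The action of a complex operator on the first `n` tensor factors. -/
def cHom (n : ℕ) : Op N n ℂ →ₐ[ℂ] FunOp N A :=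
  (opHom n).comp
    { toFun := toA A
      map_one' := toA_one
      map_mul' := toA_mul
      map_zero' := Matrix.map_zero _ (map_zero _)
      map_add' := toA_add
      commutes' c := by
        rw [Algebra.algebraMap_eq_smul_one, toA_smul, toA_one, Algebra.algebraMap_eq_smul_one] }

theorem opHom_toA {n : ℕ} (X : Op N n ℂ) : opHom n (toA A X) = cHom n X := rfl

theorem cHom_apply {n : ℕ} (Y : Op N n ℂ) (f : (ℕ → Fin N) → A) (r : ℕ → Fin N) :
    cHom n Y f r = ∑ t, Y (firstN n r) t • f (overwrite r t) := by
  rw [← opHom_toA, opHom_apply]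
  simp [toA, Algebra.smul_def]

theorem leg2_apply_apply (i : ℕ) (X : Op2 N) (f : (ℕ → Fin N) → A) (r : ℕ → Fin N) :
    (funLegs N A).leg2 i X f r = ∑ y : Fin N × Fin N, X (r i, r (i + 1)) y •
      f (Function.update (Function.update r i y.1) (i + 1) y.2) := by
  rw [LegSystem.leg2_apply]
  simp only [LinearMap.sum_apply, Finset.sum_apply, LinearMap.smul_apply, Pi.smul_apply]
  rw [Finset.sum_eq_single (r i, r (i + 1))]
  · refine Finset.sum_congr rfl fun y _ => ?_
    simp [funLegs, unitOp_apply]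
  · rintro ⟨x1, x2⟩ _ hx
    refine Finset.sum_eq_zero fun y _ => ?_
    by_cases h1 : r i = x1
    · by_cases h2 : r (i + 1) = x2
      · exact (hx (by rw [h1, h2])).elim
      · simp [funLegs, unitOp_apply, h2]
    · simp [funLegs, unitOp_apply, h1]
  · simp

theorem cHom_legs {n i : ℕ} (h : i + 1 < n) (X : Op2 N) :
    cHom n (legs n X i) = (funLegs N A).leg2 i X := by
  ext f r
  rw [cHom_apply, leg2_apply_apply]
  symm
  have hi : (⟨i, by omega⟩ : Fin n) ≠ ⟨i + 1, h⟩ := by simp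
  refine Finset.sum_of_injOn (fun y : Fin N × Fin N => Function.update (Function.update (firstN n r)
    ⟨i, by omega⟩ y.1) ⟨i + 1, h⟩ y.2) ?_ (fun _ _ => by simp) ?_ ?_
  · rintro ⟨a, b⟩ _ ⟨c, d⟩ _ hh
    have h1 := congrFun hh ⟨i, by omega⟩
    have h2 := congrFun hh ⟨i + 1, h⟩
    simp at h1 h2
    rw [h1, h2]
  · intro t _ ht
    have : legs n X i (firstN n r) t = 0 := by
      rw [legs, dif_pos h, if_neg]
      intro hh
      apply ht
      refine ⟨(t ⟨i, by omega⟩, t ⟨i + 1, h⟩), by simp, ?_⟩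
      ext k
      by_cases hk : k = ⟨i + 1, h⟩
      · subst hk; simp
      · by_cases hk' : k = ⟨i, by omega⟩
        · subst hk'; simp
        · simp only [Function.update_of_ne hk, Function.update_of_ne hk']
          rw [hh k (fun e => hk' (Fin.ext e)) (fun e => hk (Fin.ext e))]
    rw [this, zero_smul]
  · rintro ⟨a, b⟩ _
    congr 1
    · rw [legs, dif_pos h, if_pos]
      · simp [firstN]
      · intro k hk hk'
        rw [Function.update_of_ne (fun e => hk' (by rw [e])),
          Function.update_of_ne (fun e => hk (by rw [e]))]
    · congr 1
      ext k
      by_cases hk : k = i + 1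
      · subst hk; simp [overwrite, h]
      · by_cases hk' : k = i
        · subst hk'; simp [overwrite, show k < n by omega]
        · by_cases hn : k < n
          · simp [overwrite, hn, Function.update, hk, hk', firstN]
          · simp [overwrite, hn, Function.update, hk, hk']

theorem mat_apply_apply (M : Matrix (Fin N) (Fin N) A) (f : (ℕ → Fin N) → A) (r : ℕ → Fin N) :
    (funLegs N A).mat M f r = ∑ b, M (r 0) b * f (Function.update r 0 b) := by
  rw [LegSystem.mat_apply]
  simp only [LinearMap.sum_apply, Finset.sum_apply]
  rw [Finset.sum_eq_single (r 0)]
  · simp [funLegs, unitOp_apply, scalOp_apply]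
  · intro x _ hx
    simp [funLegs, unitOp_apply, scalOp_apply, hx.symm]
  · simp

theorem opHom_firstLeg (n : ℕ) (M : Matrix (Fin N) (Fin N) A) :
    opHom (n + 1) (firstLeg n M) = (funLegs N A).mat M := by
  ext f r
  rw [opHom_apply, mat_apply_apply]
  symm
  refine Finset.sum_of_injOn (fun b => Function.update (firstN (n + 1) r) 0 b) ?_
    (fun _ _ => by simp) ?_ ?_
  · intro a _ b _ hh
    simpa using congrFun hh 0
  · intro t _ ht
    have : firstLeg n M (firstN (n + 1) r) t = 0 := by
      rw [firstLeg, if_neg]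
      intro hh
      apply ht
      refine ⟨t 0, by simp, ?_⟩
      ext k
      refine Fin.cases ?_ (fun j => ?_) k
      · simp
      · simp [hh j]
    rw [this, zero_mul]
  · intro b _
    congr 1
    · rw [firstLeg, if_pos]
      · simp [firstN]
      · intro k; simp
    · congr 1
      ext k
      cases k with
      | zero => simp [overwrite]
      | succ k =>
        by_cases hn : k + 1 < n + 1
        · have : (⟨k + 1, hn⟩ : Fin (n + 1)) ≠ 0 := by simp [Fin.ext_iff]
          simp [overwrite, hn, Function.update, firstN, this]
        · simp [overwrite, hn, Function.update]

/-- The partial trace of an operator over the last tensor factor. -/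
def ptr {n : ℕ} (D : Matrix (Fin N) (Fin N) ℂ) (Y : Op N (n + 1) A) : Op N n A := fun s t =>
  ∑ b, ∑ c, D b c • Y (Fin.snoc s c) (Fin.snoc t b)

theorem leg1_apply_apply (i : ℕ) (X : Matrix (Fin N) (Fin N) ℂ) (f : (ℕ → Fin N) → A)
    (r : ℕ → Fin N) :
    (funLegs N A).leg1 i X f r = ∑ y, X (r i) y • f (Function.update r i y) := by
  rw [LegSystem.leg1_apply]
  simp only [LinearMap.sum_apply, Finset.sum_apply, LinearMap.smul_apply, Pi.smul_apply]
  rw [Finset.sum_eq_single (r i)]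
  · simp [funLegs, unitOp_apply]
  · intro x _ hx
    simp [funLegs, unitOp_apply, hx.symm]
  · simp

theorem wtr_apply_apply (D : Matrix (Fin N) (Fin N) ℂ) (n : ℕ) (Z : FunOp N A)
    (f : (ℕ → Fin N) → A) (r : ℕ → Fin N) :
    (funLegs N A).wtr D n Z f r =
      ∑ b, ∑ c, D b c • Z (unitOp n b (r n) f) (Function.update r n c) := by
  rw [LegSystem.wtr_apply, LegSystem.tr_apply]
  simp only [LinearMap.sum_apply, Finset.sum_apply]
  rw [Finset.sum_eq_single (r n)]
  · refine Finset.sum_congr rfl fun b _ => ?_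
    have : (funLegs N A).u = unitOp := rfl
    rw [this, Module.End.mul_apply, Module.End.mul_apply, Module.End.mul_apply, unitOp_apply,
      if_pos rfl, leg1_apply_apply]
    simp
  · intro a _ ha
    refine Finset.sum_eq_zero fun b _ => ?_
    have : (funLegs N A).u = unitOp := rfl
    rw [this, Module.End.mul_apply, Module.End.mul_apply, unitOp_apply, if_neg ha.symm]
  · simp

theorem wtr_opHom {n : ℕ} (D : Matrix (Fin N) (Fin N) ℂ) (Y : Op N (n + 1) A) :
    (funLegs N A).wtr D n (opHom (n + 1) Y) = opHom n (ptr D Y) := by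
  ext f r
  rw [wtr_apply_apply, opHom_apply]
  simp only [opHom_apply, ptr, Finset.sum_mul, smul_mul_assoc]
  symm
  rw [Finset.sum_comm]
  refine Finset.sum_congr rfl fun b _ => ?_
  rw [Finset.sum_comm]
  refine Finset.sum_congr rfl fun c _ => ?_
  rw [← Finset.smul_sum]
  congr 1
  have h1 : firstN (n + 1) (Function.update r n c) = Fin.snoc (firstN n r) c := by
    ext k
    refine Fin.lastCases ?_ (fun j => ?_) k
    · simp [firstN]
    · simp [firstN, Function.update, j.2.ne]
  rw [h1]
  refine Finset.sum_of_injOn (fun t => Fin.snoc t b) ?_ (fun _ _ => by simp) ?_ ?_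
  · intro t _ t' _ hh
    exact (Fin.snoc_injective2 hh).1
  · intro t _ ht
    rw [unitOp_apply, if_neg, mul_zero]
    intro hb
    apply ht
    refine ⟨Fin.init t, by simp, ?_⟩
    rw [← hb]
    ext k
    refine Fin.lastCases ?_ (fun j => ?_) k
    · simp only [Fin.snoc_last, overwrite, Nat.lt_succ_self, dite_true]; rfl
    · simp only [Fin.snoc_castSucc]; rfl
  · intro t _
    have h2 : overwrite (Function.update r n c) (Fin.snoc t b : Fin (n + 1) → Fin N) n = b := by
      have : (⟨n, Nat.lt_succ_self n⟩ : Fin (n + 1)) = Fin.last n := rfl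
      simp [overwrite, this]
    rw [unitOp_apply, if_pos h2]
    congr 2
    ext k
    by_cases hk : k = n
    · subst hk; simp [overwrite]
    · by_cases hk' : k < n
      · have : (Fin.snoc t b : Fin (n + 1) → Fin N) ⟨k, by omega⟩ = t ⟨k, hk'⟩ :=
          Fin.snoc_castSucc (α := fun _ => Fin N) b t ⟨k, hk'⟩
        simp [overwrite, Function.update, hk, hk', show k < n + 1 by omega, this]
      · simp [overwrite, Function.update, hk, hk', show ¬ k < n + 1 by omega]

theorem sum_snoc {B : Type} [AddCommMonoid B] {n : ℕ} (f : (Fin (n + 1) → Fin N) → B) :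
    ∑ u, f u = ∑ u : Fin n → Fin N, ∑ x, f (Fin.snoc u x) := by
  rw [← (Fin.snocEquiv fun _ : Fin (n + 1) => Fin N).sum_comp, Fintype.sum_prod_type,
    Finset.sum_comm]
  rfl

theorem tailTrace_succ {n : ℕ} (D : Matrix (Fin N) (Fin N) ℂ) (Y : Op N (n + 2) A) :
    tailTrace D Y = tailTrace D (ptr D Y) := by
  ext a b
  have hc : ∀ (a : Fin N) (v : Fin n → Fin N) (y : Fin N),
      (Matrix.vecCons a (Fin.snoc v y : Fin (n + 1) → Fin N) : Fin (n + 2) → Fin N) =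
        Fin.snoc (Matrix.vecCons a v : Fin (n + 1) → Fin N) y := fun a v y =>
      Fin.cons_snoc_eq_snoc_cons (β := Fin N) a v y
  simp only [tailTrace, ptr, Finset.smul_sum, sum_snoc, Fin.prod_univ_castSucc, Fin.snoc_castSucc,
    Fin.snoc_last, hc, smul_smul]
  refine Finset.sum_congr rfl fun u _ => ?_
  rw [Finset.sum_comm]

theorem fullTrace_succ {n : ℕ} (D : Matrix (Fin N) (Fin N) ℂ) (Y : Op N (n + 1) A) :
    fullTrace D Y = fullTrace D (ptr D Y) := by
  simp only [fullTrace, ptr, Finset.smul_sum, sum_snoc, Fin.prod_univ_castSucc, Fin.snoc_castSucc,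
    Fin.snoc_last, smul_smul]
  refine Finset.sum_congr rfl fun u _ => ?_
  rw [Finset.sum_comm]

end Bridge

namespace LegSystem

variable {N : ℕ} {A E : Type} [Ring A] [Algebra ℂ A] [Ring E] [Algebra ℂ E]

/-- The iterated trace `T_k T_{k+1} ⋯ T_{k+n-1}`. -/
def trs (L : LegSystem N A E) (D : Matrix (Fin N) (Fin N) ℂ) (k : ℕ) : ℕ → E →ₗ[ℂ] E
  | 0 => LinearMap.id
  | n + 1 => trs L D k n ∘ₗ L.wtr D (k + n)

theorem trs_zero (L : LegSystem N A E) (D) (k : ℕ) (Z : E) : L.trs D k 0 Z = Z := rfl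

theorem trs_succ (L : LegSystem N A E) (D) (k n : ℕ) (Z : E) :
    L.trs D k (n + 1) Z = L.trs D k n (L.wtr D (k + n) Z) := rfl

end LegSystem

section Bridge

variable {N : ℕ} {A : Type} [Ring A] [Algebra ℂ A]

theorem opHom_one_eq (Y : Op N 1 A) (D : Matrix (Fin N) (Fin N) ℂ) :
    opHom 1 Y = (funLegs N A).mat (tailTrace D Y) := by
  rw [← opHom_firstLeg 0]
  congr 1
  ext s t
  simp only [firstLeg, IsEmpty.forall_iff, if_true, tailTrace, Finset.univ_unique,
    Finset.sum_singleton, Finset.univ_eq_empty, Finset.prod_empty, one_smul]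
  congr 1
  · ext k; fin_cases k; rfl
  · ext k; fin_cases k; rfl

theorem mat_tailTrace {n : ℕ} (D : Matrix (Fin N) (Fin N) ℂ) (Y : Op N (n + 1) A) :
    (funLegs N A).mat (tailTrace D Y) = (funLegs N A).trs D 1 n (opHom (n + 1) Y) := by
  induction n with
  | zero => rw [LegSystem.trs_zero, ← opHom_one_eq]
  | succ n ih => rw [tailTrace_succ, ih, LegSystem.trs_succ, add_comm 1 n, wtr_opHom]

theorem scal_fullTrace {n : ℕ} (D : Matrix (Fin N) (Fin N) ℂ) (Y : Op N n A) :
    (funLegs N A).scal (fullTrace D Y) = (funLegs N A).trs D 0 n (opHom n Y) := by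
  induction n with
  | zero =>
    rw [LegSystem.trs_zero]
    ext f r
    rw [opHom_apply]
    simp only [funLegs, scalOp_apply, fullTrace, Finset.univ_unique, Finset.sum_singleton,
      Finset.univ_eq_empty, Finset.prod_empty, one_smul]
    have h1 : ∀ t : Fin 0 → Fin N, overwrite r t = r := fun t => by ext k; simp [overwrite]
    rw [h1]
    congr 2
    exact Subsingleton.elim _ _
  | succ n ih => rw [fullTrace_succ, ih, LegSystem.trs_succ, zero_add, wtr_opHom]

/-- Join the first `m` letters of `r` with the sequence `t`. -/
def joinSeq (m : ℕ) (r t : ℕ → Fin N) : ℕ → Fin N := fun k => if k < m then r k else t (k - m)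

theorem shiftOp_iterate_apply (m : ℕ) (Z : FunOp N A) (f : (ℕ → Fin N) → A) (r : ℕ → Fin N) :
    ((funLegs N A).sh^[m] Z) f r = Z (fun t => f (joinSeq m r t)) (fun k => r (m + k)) := by
  have hs : (funLegs N A).sh = shiftOp := rfl
  induction m generalizing f r with
  | zero =>
    have : ∀ t : ℕ → Fin N, joinSeq 0 r t = t := fun t => by ext k; simp [joinSeq]
    simp [this]
  | succ m ih =>
    rw [Function.iterate_succ_apply', hs, shiftOp_apply, ← hs, ih]
    have e1 : ∀ t, consSeq (r 0) (joinSeq m (tailSeq r) t) = joinSeq (m + 1) r t := fun t => by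
      ext k
      cases k with
      | zero => simp [joinSeq]
      | succ k => by_cases hk : k < m <;> simp [joinSeq, hk]
    simp only [e1, tailSeq_apply]
    have e2 : (fun k => r (m + k + 1)) = fun k => r (m + 1 + k) := by
      ext k; rw [add_right_comm]
    rw [e2]

theorem cHom_opTensor {m n : ℕ} (X : Op N m ℂ) (Y : Op N n ℂ) :
    cHom (A := A) (m + n) (opTensor X Y) =
      cHom m X * (funLegs N A).sh^[m] (cHom n Y) := by
  ext f r
  rw [Module.End.mul_apply, cHom_apply, cHom_apply]
  simp only [shiftOp_iterate_apply, cHom_apply, Finset.smul_sum, smul_smul]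
  rw [← Fintype.sum_prod_type', ← (Fin.appendEquiv m n).sum_comp]
  refine Finset.sum_congr rfl fun x _ => ?_
  obtain ⟨t, s⟩ := x
  have h1 : (Fin.appendEquiv m n) (t, s) ∘ Fin.castAdd n = t := by ext k; simp [Fin.appendEquiv]
  have h2 : (Fin.appendEquiv m n) (t, s) ∘ Fin.natAdd m = s := by ext k; simp [Fin.appendEquiv]
  rw [opTensor, h1, h2]
  congr 1
  · congr 2
    ext k
    simp [firstN, overwrite]
  · congr 1
    ext k
    by_cases hk : k < m
    · have : Fin.append t s ⟨k, by omega⟩ = t ⟨k, hk⟩ := Fin.append_left t s ⟨k, hk⟩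
      simp [overwrite, joinSeq, hk, show k < m + n by omega, Fin.appendEquiv, this]
    · by_cases hk' : k - m < n
      · have h3 := Fin.append_right t s ⟨k - m, hk'⟩
        have this : Fin.append t s ⟨k, by omega⟩ = s ⟨k - m, hk'⟩ := by
          rw [← h3]; congr 1; ext; simp; omega
        simp [overwrite, joinSeq, hk, hk', show k < m + n by omega, Fin.appendEquiv, this]
      · simp [overwrite, joinSeq, hk, hk', show ¬ k < m + n by omega, show m + (k - m) = k by omega]

end Bridge

section Relations

variable {N : ℕ} {A : Type} [Ring A] [Algebra ℂ A]

/-- Transfer of a relation between operators on `V^{⊗3}` to all triples of consecutive legs. -/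
theorem legs3_rel {X Y Z X' Y' Z' : Op2 N} {a b c a' b' c' : ℕ}
    (h : legs 3 X a * legs 3 Y b * legs 3 Z c = legs 3 X' a' * legs 3 Y' b' * legs 3 Z' c')
    (ha : a < 2) (hb : b < 2) (hc : c < 2) (ha' : a' < 2) (hb' : b' < 2) (hc' : c' < 2) (k : ℕ) :
    (funLegs N A).leg2 (k + a) X * (funLegs N A).leg2 (k + b) Y * (funLegs N A).leg2 (k + c) Z =
      (funLegs N A).leg2 (k + a') X' * (funLegs N A).leg2 (k + b') Y' *
        (funLegs N A).leg2 (k + c') Z' := by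
  induction k with
  | zero =>
    have := congrArg (cHom (A := A) 3) h
    simp only [map_mul] at this
    rw [cHom_legs (by omega), cHom_legs (by omega), cHom_legs (by omega), cHom_legs (by omega),
      cHom_legs (by omega), cHom_legs (by omega)] at this
    simpa only [zero_add] using this
  | succ k ih =>
    have := congrArg (funLegs N A).sh ih
    simp only [map_mul (funLegs N A).sh, LegSystem.sh_leg2] at this
    simpa only [add_right_comm] using this

theorem Compatible.leg2_fst {X F : Op2 N} (h : Compatible X F) (k : ℕ) :
    (funLegs N A).leg2 k X * (funLegs N A).leg2 (k + 1) F * (funLegs N A).leg2 k F =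
      (funLegs N A).leg2 (k + 1) F * (funLegs N A).leg2 k F * (funLegs N A).leg2 (k + 1) X :=
  legs3_rel h.1 (by omega) (by omega) (by omega) (by omega) (by omega) (by omega) k

theorem Compatible.leg2_snd {X F : Op2 N} (h : Compatible X F) (k : ℕ) :
    (funLegs N A).leg2 (k + 1) X * (funLegs N A).leg2 k F * (funLegs N A).leg2 (k + 1) F =
      (funLegs N A).leg2 k F * (funLegs N A).leg2 (k + 1) F * (funLegs N A).leg2 k X :=
  legs3_rel h.2 (by omega) (by omega) (by omega) (by omega) (by omega) (by omega) k

theorem IsRMatrix.compatible {X : Op2 N} (h : IsRMatrix X) : Compatible X X := ⟨h.2, h.2.symm⟩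

theorem conj_swap {E : Type} [Ring E] {x y f f' g g' : E} (hf : f * g = 1) (hg : g' * f' = 1)
    (h : x * f' * f = f' * f * y) : g' * x * f' = f * y * g := by
  calc g' * x * f' = g' * x * f' * (f * g) := by rw [hf, mul_one]
    _ = g' * (x * f' * f) * g := by simp only [mul_assoc]
    _ = g' * f' * (f * y * g) := by rw [h]; simp only [mul_assoc]
    _ = f * y * g := by rw [hg, one_mul]

theorem Compatible.transports {X F G Ψ : Op2 N} (h : Compatible X F) (hΨ : IsSkewInverse X Ψ)
    (hFG : F * G = 1) : Transports (trSnd Ψ) G F := by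
  have hGF : G * F = 1 := mul_eq_one_comm.1 hFG
  refine transports_of_rel (funLegs N ℂ) hΨ hFG ?_
  refine conj_swap ?_ ?_ (h.leg2_fst 0)
  · rw [← map_mul, hFG, map_one]
  · rw [← map_mul, hGF, map_one]

theorem Compatible.transports_symm {X F G Ψ : Op2 N} (h : Compatible X F)
    (hΨ : IsSkewInverse X Ψ) (hFG : F * G = 1) : Transports (trSnd Ψ) F G := by
  have hGF : G * F = 1 := mul_eq_one_comm.1 hFG
  refine transports_of_rel (funLegs N ℂ) hΨ hGF ?_
  have h1 := h.leg2_snd (A := ℂ) 0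
  have e : ∀ k, (funLegs N ℂ).leg2 k F * (funLegs N ℂ).leg2 k G = 1 := fun k => by
    rw [← map_mul, hFG, map_one]
  have e' : ∀ k, (funLegs N ℂ).leg2 k G * (funLegs N ℂ).leg2 k F = 1 := fun k => by
    rw [← map_mul, hGF, map_one]
  have := conj_swap (e (0 + 1)) (e' 0) h1
  exact this.symm

theorem cyclic_of_compatible {R Ψ Ri : Op2 N} (h : Compatible R R) (hΨ : IsSkewInverse R Ψ)
    (hR : R * Ri = 1) : kron (trSnd Ψ) (trSnd Ψ) * R = R * kron (trSnd Ψ) (trSnd Ψ) :=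
  kron_comm_of_transports hΨ hR (mul_eq_one_comm.1 hR) (h.transports_symm hΨ hR)
    (h.transports hΨ hR)

end Relations

namespace QMData

variable {N : ℕ} (𝒟 : QMData N)

/-- The operator `K` on `V ⊗ V`. -/
def K2 : Op2 N := (𝒟.μ * 𝒟.lam)⁻¹ • ((𝒟.q • 1 - 𝒟.R) * (𝒟.q⁻¹ • 1 + 𝒟.R))

/-- The hypotheses on a compatible pair which are used below. -/
structure Admissible : Prop where
  q_ne : 𝒟.q ≠ 0
  μ_ne : 𝒟.μ ≠ 0
  lam_ne : 𝒟.lam ≠ 0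
  eta_ne : 𝒟.eta ≠ 0
  R_mul : 𝒟.R * 𝒟.R⁻¹ = 1
  F_mul : 𝒟.F * 𝒟.F⁻¹ = 1
  skewR : SkewInvertible 𝒟.R
  skewF : SkewInvertible 𝒟.F
  compR : Compatible 𝒟.R 𝒟.R
  compF : Compatible 𝒟.F 𝒟.F
  comp : Compatible 𝒟.R 𝒟.F
  K2_ne : 𝒟.K2 ≠ 0
  R_mul_K2 : 𝒟.R * 𝒟.K2 = 𝒟.μ • 𝒟.K2
  K_mul_K : 𝒟.Kop 3 1 * 𝒟.Kop 3 0 = 𝒟.Rop 3 0 * 𝒟.Rop 3 1 * 𝒟.Kop 3 0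
  K_mul_K' : 𝒟.Kop 3 1 * 𝒟.Kop 3 0 = 𝒟.RopInv 3 0 * 𝒟.RopInv 3 1 * 𝒟.Kop 3 0
  K_mul_K_mul_K : 𝒟.Kop 3 0 * 𝒟.Kop 3 1 * 𝒟.Kop 3 0 = 𝒟.Kop 3 0

theorem admissible {k : ℕ} (hR : 𝒟.IsOrthogonal k) (hF : IsRMatrix 𝒟.F)
    (hFskew : StrictSkewInvertible 𝒟.F) (hRF : Compatible 𝒟.R 𝒟.F) : 𝒟.Admissible := by
  obtain ⟨hs, ⟨hq0, hq1, hq2, hμ0, hμ1, hμ2, hRm, hmin, k1, k2, k3⟩, -⟩ := hR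
  have hlam : 𝒟.lam ≠ 0 := by
    intro h
    have h1 : 𝒟.q * 𝒟.q = 1 := by
      have : 𝒟.q = 𝒟.q⁻¹ := sub_eq_zero.1 h
      calc 𝒟.q * 𝒟.q = 𝒟.q * 𝒟.q⁻¹ := by rw [← this]
        _ = 1 := mul_inv_cancel₀ hq0
    rcases mul_self_eq_one_iff.1 h1 with h | h
    · exact hq1 h
    · exact hq2 h
  have hc : (𝒟.μ * 𝒟.lam)⁻¹ ≠ 0 := inv_ne_zero (mul_ne_zero hμ0 hlam)
  have key : Polynomial.aeval 𝒟.R ((Polynomial.X - Polynomial.C 𝒟.q) *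
      (Polynomial.X + Polynomial.C 𝒟.q⁻¹)) = -((𝒟.q • 1 - 𝒟.R) * (𝒟.q⁻¹ • 1 + 𝒟.R)) := by
    rw [map_mul, map_sub, map_add, Polynomial.aeval_X, Polynomial.aeval_C, Polynomial.aeval_C,
      Algebra.algebraMap_eq_smul_one, Algebra.algebraMap_eq_smul_one, ← neg_mul, neg_sub,
      add_comm 𝒟.R]
  refine ⟨hq0, hμ0, hlam, ?_, Matrix.mul_nonsing_inv _ ((Matrix.isUnit_iff_isUnit_det _).1 hRm.1),
    Matrix.mul_nonsing_inv _ ((Matrix.isUnit_iff_isUnit_det _).1 hF.1), hs, hFskew.1,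
    hRm.compatible, hF.compatible, hRF, ?_, ?_, k1, k2, k3⟩
  · refine div_ne_zero (mul_ne_zero (sub_ne_zero.2 hμ1.symm) ?_) (mul_ne_zero hμ0 hlam)
    intro h
    exact hμ2 (eq_neg_of_add_eq_zero_right h)
  · intro h
    have h0 : (𝒟.q • 1 - 𝒟.R) * (𝒟.q⁻¹ • 1 + 𝒟.R) = 0 := (smul_eq_zero.1 h).resolve_left hc
    have hdvd := minpoly.dvd ℂ 𝒟.R (by rw [key, h0, neg_zero])
    rw [hmin] at hdvd
    have hne : (Polynomial.X - Polynomial.C 𝒟.q) * (Polynomial.X + Polynomial.C 𝒟.q⁻¹) ≠ 0 :=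
      mul_ne_zero (Polynomial.X_sub_C_ne_zero _) (Polynomial.X_add_C_ne_zero _)
    have hdeg := Polynomial.natDegree_le_of_dvd hdvd hne
    rw [Polynomial.natDegree_mul hne (Polynomial.X_sub_C_ne_zero _)] at hdeg
    simp at hdeg
  · have h1 := minpoly.aeval ℂ 𝒟.R
    rw [hmin, map_mul, key, map_sub, Polynomial.aeval_X, Polynomial.aeval_C,
      Algebra.algebraMap_eq_smul_one, neg_mul, neg_eq_zero] at h1
    set Q := (𝒟.q • 1 - 𝒟.R) * (𝒟.q⁻¹ • 1 + 𝒟.R) with hQ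
    have hcomm : 𝒟.R * Q = Q * 𝒟.R := by
      rw [hQ]
      simp only [mul_sub, sub_mul, mul_add, add_mul, smul_mul_assoc, mul_smul_comm, one_mul,
        mul_one, mul_assoc]
    rw [K2, ← hQ, mul_smul_comm, hcomm, smul_comm]
    congr 1
    rw [mul_sub, mul_smul_comm, mul_one, sub_eq_zero] at h1
    exact h1

variable {𝒟} {A : Type} [Ring A] [Algebra ℂ A]

theorem cHom_Rop {n i : ℕ} (h : i + 1 < n) :
    cHom (A := A) n (𝒟.Rop n i) = (funLegs N A).leg2 i 𝒟.R := cHom_legs h _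

theorem cHom_RopInv {n i : ℕ} (h : i + 1 < n) :
    cHom (A := A) n (𝒟.RopInv n i) = (funLegs N A).leg2 i 𝒟.R⁻¹ := cHom_legs h _

theorem cHom_Kop {n i : ℕ} (h : i + 1 < n) :
    cHom (A := A) n (𝒟.Kop n i) = (funLegs N A).leg2 i 𝒟.K2 := by
  rw [Kop, K2]
  simp only [map_smul, map_mul, map_add, map_sub, map_one, cHom_Rop h]

theorem rel_transfer {x y : Op N 3 ℂ} {f g : ℕ → FunOp N A} (h : x = y)
    (hx : cHom 3 x = f 0) (hy : cHom 3 y = g 0)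
    (hf : ∀ k, (funLegs N A).sh (f k) = f (k + 1)) (hg : ∀ k, (funLegs N A).sh (g k) = g (k + 1))
    (k : ℕ) : f k = g k := by
  induction k with
  | zero => rw [← hx, ← hy, h]
  | succ k ih => rw [← hf, ← hg, ih]

end QMData

theorem inv_conj {E : Type} [Ring E] {x y x' y' z w : E} (hx : x' * x = 1) (hy : y' * y = 1) (hx' : x * x' = 1)
    (hy' : y * y' = 1) (h : x * y * z = w * x * y) : y' * x' * w = z * y' * x' := by
  calc y' * x' * w = y' * x' * (w * x * y) * y' * x' := by
        simp only [mul_assoc]; rw [← mul_assoc y y', hy', one_mul, hx', mul_one]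
    _ = y' * (x' * x) * y * z * y' * x' := by rw [← h]; simp only [mul_assoc]
    _ = _ := by rw [hx, mul_one, hy, one_mul]

/-- The relations of the Birman–Murakami–Wenzl algebra between three sequences of elements (the
commutation of distant elements is not included). -/
structure BMWSeq {N : ℕ} (𝒟 : QMData N) {E : Type} [Ring E] [Algebra ℂ E] (R Ri K : ℕ → E) :
    Prop where
  μ_ne : 𝒟.μ ≠ 0
  lam_ne : 𝒟.lam ≠ 0
  eta_ne : 𝒟.eta ≠ 0
  q_ne : 𝒟.q ≠ 0
  R_Ri : ∀ k, R k * Ri k = 1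
  Ri_R : ∀ k, Ri k * R k = 1
  K_def : ∀ k, K k = (𝒟.μ * 𝒟.lam)⁻¹ • ((𝒟.q • 1 - R k) * (𝒟.q⁻¹ • 1 + R k))
  R_K : ∀ k, R k * K k = 𝒟.μ • K k
  braid : ∀ k, R k * R (k + 1) * R k = R (k + 1) * R k * R (k + 1)
  K1K0 : ∀ k, K (k + 1) * K k = R k * R (k + 1) * K k
  K1K0' : ∀ k, K (k + 1) * K k = Ri k * Ri (k + 1) * K k
  K0K1K0 : ∀ k, K k * K (k + 1) * K k = K k

namespace BMWSeq

variable {N : ℕ} {𝒟 : QMData N} {E : Type} [Ring E] [Algebra ℂ E] {R Ri K : ℕ → E}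
variable (b : BMWSeq 𝒟 R Ri K) (k : ℕ)
include b

theorem R_sq : R k * R k = 1 + 𝒟.lam • R k - (𝒟.lam * 𝒟.μ) • K k := by
  have h := b.K_def k
  have hc : 𝒟.μ * 𝒟.lam ≠ 0 := mul_ne_zero b.μ_ne b.lam_ne
  have h1 : (𝒟.μ * 𝒟.lam) • K k = (𝒟.q • 1 - R k) * (𝒟.q⁻¹ • 1 + R k) := by
    rw [h, smul_inv_smul₀ hc]
  rw [mul_comm 𝒟.lam, h1]
  simp only [sub_mul, mul_add, smul_mul_assoc, mul_smul_comm, one_mul, mul_one, QMData.lam,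
    sub_smul, smul_sub, smul_smul, inv_mul_cancel₀ b.q_ne, one_smul]
  abel

theorem K_R : K k * R k = 𝒟.μ • K k := by
  rw [← b.R_K, b.K_def, smul_mul_assoc, mul_smul_comm]
  congr 1
  simp only [mul_sub, sub_mul, mul_add, add_mul, smul_mul_assoc, mul_smul_comm, one_mul,
    mul_one, mul_assoc]

theorem Ri_K : Ri k * K k = 𝒟.μ⁻¹ • K k := by
  have h := congrArg (Ri k * ·) (b.R_K k)
  simp only [← mul_assoc, b.Ri_R, one_mul, mul_smul_comm] at h
  conv_rhs => rw [h, inv_smul_smul₀ b.μ_ne]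

theorem K_Ri : K k * Ri k = 𝒟.μ⁻¹ • K k := by
  have h := congrArg (· * Ri k) (b.K_R k)
  simp only [mul_assoc, b.R_Ri, mul_one, smul_mul_assoc] at h
  conv_rhs => rw [h, inv_smul_smul₀ b.μ_ne]

theorem Ri_eq : Ri k = R k - 𝒟.lam • 1 + 𝒟.lam • K k := by
  have h : R k * (R k - 𝒟.lam • 1 + 𝒟.lam • K k) = 1 := by
    rw [mul_add, mul_sub, b.R_sq, mul_smul_comm, mul_smul_comm, b.R_K, mul_one, smul_smul]
    abel
  calc Ri k = Ri k * (R k * (R k - 𝒟.lam • 1 + 𝒟.lam • K k)) := by rw [h, mul_one]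
    _ = _ := by rw [← mul_assoc, b.Ri_R, one_mul]

theorem R_sub_Ri : R k - Ri k = 𝒟.lam • (1 - K k) := by
  rw [b.Ri_eq, smul_sub]; abel

theorem Ri_sq : Ri k * Ri k = 1 - 𝒟.lam • Ri k + (𝒟.lam * 𝒟.μ⁻¹) • K k := by
  conv_lhs => enter [1]; rw [b.Ri_eq]
  rw [add_mul, sub_mul, b.R_Ri, smul_mul_assoc, smul_mul_assoc, one_mul, b.K_Ri, smul_smul]

theorem lam_mul_eta : 𝒟.μ * 𝒟.lam * 𝒟.eta = 1 + 𝒟.lam * 𝒟.μ - 𝒟.μ * 𝒟.μ := by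
  have hq := b.q_ne
  rw [QMData.eta, mul_div_cancel₀ _ (mul_ne_zero b.μ_ne b.lam_ne), QMData.lam]
  field_simp
  ring

theorem K_K : K k * K k = 𝒟.eta • K k := by
  have hc : 𝒟.μ * 𝒟.lam ≠ 0 := mul_ne_zero b.μ_ne b.lam_ne
  have h := congrArg (· * K k) (b.R_sq k)
  simp only [mul_assoc, b.R_K, mul_smul_comm, sub_mul, add_mul, one_mul, smul_mul_assoc] at h
  have h2 : (𝒟.μ * 𝒟.lam) • (K k * K k) = (𝒟.μ * 𝒟.lam) • 𝒟.eta • K k := by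
    rw [smul_smul, b.lam_mul_eta, mul_comm 𝒟.μ 𝒟.lam, sub_smul, add_smul, one_smul, mul_smul,
      mul_smul 𝒟.μ 𝒟.μ, h, mul_smul 𝒟.lam]
    module
  exact smul_right_injective E hc h2

theorem R0R1K0 : R k * R (k + 1) * K k = K (k + 1) * R k * R (k + 1) := by
  rw [b.K_def, b.K_def, mul_smul_comm, smul_mul_assoc, smul_mul_assoc]
  congr 1
  have h : R k * R (k + 1) * R k = R (k + 1) * (R k * R (k + 1)) := by rw [b.braid, mul_assoc]
  have h1 : R k * R (k + 1) * (𝒟.q • 1 - R k) = (𝒟.q • 1 - R (k + 1)) * (R k * R (k + 1)) := by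
    rw [mul_sub, sub_mul, h]; simp
  have h2 : R k * R (k + 1) * (𝒟.q⁻¹ • 1 + R k) = (𝒟.q⁻¹ • 1 + R (k + 1)) * (R k * R (k + 1)) := by
    rw [mul_add, add_mul, h]; simp
  rw [← mul_assoc, h1, mul_assoc, h2]
  simp only [mul_assoc]

theorem R1R0K1 : R (k + 1) * R k * K (k + 1) = K k * R (k + 1) * R k := by
  rw [b.K_def, b.K_def, mul_smul_comm, smul_mul_assoc, smul_mul_assoc]
  congr 1
  have h : R (k + 1) * R k * R (k + 1) = R k * (R (k + 1) * R k) := by rw [← b.braid, mul_assoc]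
  have h1 : R (k + 1) * R k * (𝒟.q • 1 - R (k + 1)) = (𝒟.q • 1 - R k) * (R (k + 1) * R k) := by
    rw [mul_sub, sub_mul, h]; simp
  have h2 : R (k + 1) * R k * (𝒟.q⁻¹ • 1 + R (k + 1)) = (𝒟.q⁻¹ • 1 + R k) * (R (k + 1) * R k) := by
    rw [mul_add, add_mul, h]; simp
  rw [← mul_assoc, h1, mul_assoc, h2]
  simp only [mul_assoc]

theorem K1K0_right : K (k + 1) * K k = K (k + 1) * R k * R (k + 1) := by
  rw [b.K1K0, b.R0R1K0]

theorem Ri1Ri0K1 : Ri (k + 1) * Ri k * K (k + 1) = K k * Ri (k + 1) * Ri k :=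
  inv_conj (b.Ri_R _) (b.Ri_R _) (b.R_Ri _) (b.R_Ri _) (b.R0R1K0 k)

theorem Ri0Ri1K0 : Ri k * Ri (k + 1) * K k = K (k + 1) * Ri k * Ri (k + 1) :=
  inv_conj (b.Ri_R _) (b.Ri_R _) (b.R_Ri _) (b.R_Ri _) (b.R1R0K1 k)

theorem Delta_R : R k * R (k + 1) * R k * R k = R (k + 1) * (R k * R (k + 1) * R k) := by
  rw [b.braid]; simp only [mul_assoc]; rw [← mul_assoc (R k), b.braid]; simp only [mul_assoc]

theorem K0K1 : K k * K (k + 1) = R (k + 1) * R k * K (k + 1) := by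
  -- conjugate by the half twist
  set Δ := R k * R (k + 1) * R k with hΔ
  have hi : (Ri k * Ri (k + 1) * Ri k) * Δ = 1 := by
    rw [hΔ]; simp only [mul_assoc]
    rw [← mul_assoc (Ri k) (R k), b.Ri_R, one_mul, ← mul_assoc (Ri (k + 1)) (R (k + 1)), b.Ri_R,
      one_mul, b.Ri_R]
  have h0 : Δ * R k = R (k + 1) * Δ := b.Delta_R k
  have h1 : Δ * R (k + 1) = R k * Δ := by
    rw [hΔ, mul_assoc, mul_assoc]; rw [← mul_assoc (R (k + 1)), ← b.braid]
  have hK : ∀ i j, Δ * R i = R j * Δ → Δ * K i = K j * Δ := fun i j hij => by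
    rw [b.K_def, b.K_def, mul_smul_comm, smul_mul_assoc]
    congr 1
    have h1 : Δ * (𝒟.q • 1 - R i) = (𝒟.q • 1 - R j) * Δ := by rw [mul_sub, sub_mul, hij]; simp
    have h2 : Δ * (𝒟.q⁻¹ • 1 + R i) = (𝒟.q⁻¹ • 1 + R j) * Δ := by rw [mul_add, add_mul, hij]; simp
    rw [← mul_assoc, h1, mul_assoc, h2, mul_assoc]
  have hK0 := hK _ _ h0
  have hK1 := hK _ _ h1
  have e : Δ * (K (k + 1) * K k) = Δ * (R k * R (k + 1) * K k) := by rw [b.K1K0]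
  have e1 : Δ * (K (k + 1) * K k) = K k * K (k + 1) * Δ := by
    rw [← mul_assoc, hK1, mul_assoc, hK0, mul_assoc]
  have e2 : Δ * (R k * R (k + 1) * K k) = R (k + 1) * R k * K (k + 1) * Δ := by
    rw [← mul_assoc, ← mul_assoc, h0, mul_assoc (R (k + 1)), h1, mul_assoc, mul_assoc, hK0]
    simp only [mul_assoc]
  have hΔi : Δ * (Ri k * Ri (k + 1) * Ri k) = 1 := by
    rw [hΔ]; simp only [mul_assoc]
    rw [← mul_assoc (R k) (Ri k), b.R_Ri, one_mul, ← mul_assoc (R (k + 1)) (Ri (k + 1)), b.R_Ri,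
      one_mul, b.R_Ri]
  calc K k * K (k + 1) = K k * K (k + 1) * Δ * (Ri k * Ri (k + 1) * Ri k) := by
        rw [mul_assoc _ Δ, hΔi, mul_one]
    _ = R (k + 1) * R k * K (k + 1) * Δ * (Ri k * Ri (k + 1) * Ri k) := by rw [← e1, e, e2]
    _ = _ := by rw [mul_assoc _ Δ, hΔi, mul_one]

theorem K0K1_right : K k * K (k + 1) = K k * R (k + 1) * R k := by rw [b.K0K1, b.R1R0K1]

theorem K0R1K0 : K k * R (k + 1) * K k = 𝒟.μ⁻¹ • K k := by
  have h := b.K0K1K0 k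
  rw [mul_assoc, b.K1K0, ← mul_assoc, ← mul_assoc, b.K_R, smul_mul_assoc, smul_mul_assoc] at h
  conv_rhs => rw [← h, inv_smul_smul₀ b.μ_ne]

theorem K1K0K1 : K (k + 1) * K k * K (k + 1) = K (k + 1) := by
  have h1 := b.K0K1K0 k
  have h2 : K (k + 1) * K k = Ri k * Ri (k + 1) * K k := b.K1K0' k
  have h3 : Ri k * Ri (k + 1) * K k = K (k + 1) * Ri k * Ri (k + 1) := b.Ri0Ri1K0 k
  have e : K (k + 1) * (Ri k * Ri (k + 1)) = Ri k * Ri (k + 1) * K k := by rw [h3, mul_assoc]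
  have h4 : K k * K (k + 1) * (Ri k * Ri (k + 1)) = K k * (K (k + 1) * K k) := by
    rw [mul_assoc, e, ← h2]
  -- conjugation by `Ri k * Ri (k + 1)` sends `K k` to `K (k + 1)`
  have h5 : K k * K (k + 1) = K k * (R (k + 1) * R k) := by rw [b.K0K1_right, mul_assoc]
  have h6 : Ri k * Ri (k + 1) * (R (k + 1) * R k) = 1 := by
    rw [mul_assoc, ← mul_assoc (Ri (k + 1)), b.Ri_R, one_mul, b.Ri_R]
  calc K (k + 1) * K k * K (k + 1) = Ri k * Ri (k + 1) * K k * (R (k + 1) * R k) := by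
        rw [mul_assoc, h5, ← mul_assoc, h2]
    _ = K (k + 1) * (Ri k * Ri (k + 1) * (R (k + 1) * R k)) := by rw [h3]; simp only [mul_assoc]
    _ = K (k + 1) := by rw [h6, mul_one]

theorem K0K1_right' : K k * K (k + 1) = K k * Ri (k + 1) * Ri k := by
  have h1 : K k * K (k + 1) = Ri (k + 1) * Ri k * K (k + 1) := by
    have h := b.K1K0_right k
    have h2 : K k * Ri (k + 1) * Ri k = Ri (k + 1) * Ri k * K (k + 1) := (b.Ri1Ri0K1 k).symm
    calc K k * K (k + 1) = K k * Ri (k + 1) * (Ri k * (R k * R (k + 1))) * K (k + 1) := by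
          rw [← mul_assoc (Ri k), b.Ri_R, one_mul, mul_assoc (K k), b.Ri_R, mul_one]
      _ = Ri (k + 1) * Ri k * (K (k + 1) * R k * R (k + 1)) * K (k + 1) := by
          simp only [← mul_assoc]; rw [h2]
      _ = Ri (k + 1) * Ri k * (K (k + 1) * K k * K (k + 1)) := by rw [← h]; simp only [mul_assoc]
      _ = _ := by rw [b.K1K0K1]
  rw [h1, b.Ri1Ri0K1]

end BMWSeq

namespace LegSystem

variable {N : ℕ} {A E : Type} [Ring A] [Algebra ℂ A] [Ring E] [Algebra ℂ E]
variable (L : LegSystem N A E)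

theorem leg2_eq_zero {k : ℕ} {X : Op2 N} (h : L.leg2 k X = 0) (h1 : (1 : A) ≠ 0) : X = 0 := by
  ext x y
  have hu : ∀ x y z w : Fin N × Fin N, (L.u k x.1 y.1 * L.u (k + 1) x.2 y.2) *
      (L.u k z.1 w.1 * L.u (k + 1) z.2 w.2) = if y = z then
        L.u k x.1 w.1 * L.u (k + 1) x.2 w.2 else 0 := fun x y z w => by
    rw [mul_assoc, ← mul_assoc (L.u (k + 1) _ _), ← L.u_comm k (k + 1) _ _ _ _ (by omega),
        mul_assoc, ← mul_assoc]
    by_cases h1 : y.1 = z.1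
    · by_cases h2 : y.2 = z.2
      · rw [if_pos (Prod.ext h1 h2), h1, h2, L.u_mul_u, L.u_mul_u]
      · rw [L.u_mul_u_ne (k + 1) _ _ _ _ h2, mul_zero, if_neg fun e => h2 (by rw [e])]
    · rw [L.u_mul_u_ne k _ _ _ _ h1, zero_mul, if_neg fun e => h1 (by rw [e])]
  have h2 : (L.u k x.1 x.1 * L.u (k + 1) x.2 x.2) * L.leg2 k X *
      (L.u k y.1 y.1 * L.u (k + 1) y.2 y.2) = X x y • (L.u k x.1 y.1 * L.u (k + 1) x.2 y.2) := by
    rw [leg2_apply]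
    simp only [Finset.mul_sum, Finset.sum_mul, mul_smul_comm, smul_mul_assoc, hu, ite_mul,
      zero_mul]
    simp
  rw [h, mul_zero, zero_mul] at h2
  by_contra hX
  have h3 : L.u k x.1 y.1 * L.u (k + 1) x.2 y.2 = 0 :=
    (smul_eq_zero.1 h2.symm).resolve_left hX
  have h4 := congrArg (L.wtr (Matrix.single y.2 x.2 1) (k + 1)) h3
  rw [L.wtr_mul_left (L.u_mem_away (by omega) _ _), L.wtr_u, map_zero] at h4
  apply h1
  refine L.faithful 1 k x.1 y.1 ?_
  simpa using h4

theorem wtr_single_leg1 (k : ℕ) (z : Matrix (Fin N) (Fin N) ℂ) (a c : Fin N) :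
    L.wtr (Matrix.single c a 1) k (L.leg1 k z) = z a c • 1 := by
  rw [leg1_apply]
  simp only [map_sum, map_smul, wtr_u]
  rw [Finset.sum_eq_single a, Finset.sum_eq_single c]
  · simp
  · intro x _ hx; simp [hx.symm]
  · simp
  · intro x _ hx; simp [hx.symm]
  · simp

end LegSystem

namespace QMData

variable {N : ℕ} {𝒟 : QMData N}

namespace Admissible

variable (H : 𝒟.Admissible)
include H

theorem bmw (A : Type) [Ring A] [Algebra ℂ A] : BMWSeq 𝒟 (fun k => (funLegs N A).leg2 k 𝒟.R)
    (fun k => (funLegs N A).leg2 k 𝒟.R⁻¹) (fun k => (funLegs N A).leg2 k 𝒟.K2) where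
  μ_ne := H.μ_ne
  lam_ne := H.lam_ne
  eta_ne := H.eta_ne
  q_ne := H.q_ne
  R_Ri k := by rw [← map_mul, H.R_mul, map_one]
  Ri_R k := by rw [← map_mul, mul_eq_one_comm.1 H.R_mul, map_one]
  K_def k := by simp only [K2, map_smul, map_mul, map_add, map_sub, map_one]
  R_K k := by rw [← map_mul, H.R_mul_K2, map_smul]
  braid k := H.compR.leg2_fst k
  K1K0 k := rel_transfer (f := fun k => (funLegs N A).leg2 (k + 1) 𝒟.K2 * (funLegs N A).leg2 k 𝒟.K2)
    (g := fun k => (funLegs N A).leg2 k 𝒟.R * (funLegs N A).leg2 (k + 1) 𝒟.R *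
      (funLegs N A).leg2 k 𝒟.K2) H.K_mul_K
    (by rw [map_mul, cHom_Kop (by omega), cHom_Kop (by omega)])
    (by rw [map_mul, map_mul, cHom_Kop (by omega), cHom_Rop (by omega), cHom_Rop (by omega)])
    (fun k => by rw [map_mul, LegSystem.sh_leg2, LegSystem.sh_leg2])
    (fun k => by rw [map_mul, map_mul, LegSystem.sh_leg2, LegSystem.sh_leg2, LegSystem.sh_leg2]) k
  K1K0' k := rel_transfer (f := fun k => (funLegs N A).leg2 (k + 1) 𝒟.K2 * (funLegs N A).leg2 k 𝒟.K2)
    (g := fun k => (funLegs N A).leg2 k 𝒟.R⁻¹ * (funLegs N A).leg2 (k + 1) 𝒟.R⁻¹ *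
      (funLegs N A).leg2 k 𝒟.K2) H.K_mul_K'
    (by rw [map_mul, cHom_Kop (by omega), cHom_Kop (by omega)])
    (by rw [map_mul, map_mul, cHom_Kop (by omega), cHom_RopInv (by omega), cHom_RopInv (by omega)])
    (fun k => by rw [map_mul, LegSystem.sh_leg2, LegSystem.sh_leg2])
    (fun k => by rw [map_mul, map_mul, LegSystem.sh_leg2, LegSystem.sh_leg2, LegSystem.sh_leg2]) k
  K0K1K0 k := rel_transfer (f := fun k => (funLegs N A).leg2 k 𝒟.K2 *
      (funLegs N A).leg2 (k + 1) 𝒟.K2 * (funLegs N A).leg2 k 𝒟.K2)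
    (g := fun k => (funLegs N A).leg2 k 𝒟.K2) H.K_mul_K_mul_K
    (by rw [map_mul, map_mul, cHom_Kop (by omega), cHom_Kop (by omega)])
    (by rw [cHom_Kop (by omega)])
    (fun k => by rw [map_mul, map_mul, LegSystem.sh_leg2, LegSystem.sh_leg2])
    (fun k => by rw [LegSystem.sh_leg2]) k

theorem skew : IsSkewInverse 𝒟.R (skewInverse 𝒟.R) := isSkewInverse_skewInverse H.skewR

theorem ptrSnd_R : ptrSnd (matD 𝒟.R) 𝒟.R = 1 := ptrSnd_self H.skew

theorem ptrSnd_K : ptrSnd (matD 𝒟.R) 𝒟.K2 = 𝒟.μ • 1 := by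
  set L := funLegs N ℂ
  have b := H.bmw ℂ
  set D := matD 𝒟.R
  have hT : ∀ X : Op2 N, ∀ k, L.wtr D (k + 1) (L.leg2 k X) = L.leg1 k (ptrSnd D X) :=
    fun X k => L.wtr_succ_leg2 k X
  set z : Matrix (Fin N) (Fin N) ℂ := ptrSnd D 𝒟.K2 - 𝒟.μ • 1 with hz
  have h0 : ∀ {k}, L.leg2 0 𝒟.K2 ∈ L.away (k + 2) := L.leg2_mem_away (by omega) (by omega) _
  have h1 : L.leg1 1 z * L.leg2 0 𝒟.K2 = 0 := by
    have h := congrArg (L.wtr D 2) (b.K1K0 0)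
    rw [L.wtr_mul_right h0, L.wtr_mul_right h0, L.wtr_mul_left
      (L.leg2_mem_away (by omega) (by omega) _), hT, hT, H.ptrSnd_R, map_one, mul_one, b.R_K 0] at h
    rw [hz, map_sub, sub_mul, map_smul, map_one, smul_mul_assoc, one_mul, sub_eq_zero]
    exact h
  have h2 : L.leg1 2 z * L.leg2 1 𝒟.K2 = 0 := by
    have := congrArg L.sh h1
    rwa [map_mul L.sh, LegSystem.sh_leg1, LegSystem.sh_leg2, map_zero] at this
  have hc : ∀ X : Op2 N, L.leg1 2 z * L.leg2 0 X = L.leg2 0 X * L.leg1 2 z := fun X =>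
    L.leg1_comm_of_away (L.leg2_mem_away (by omega) (by omega) _) z
  have h3 : L.leg1 2 z * (L.leg2 1 𝒟.R * L.leg2 0 𝒟.K2) = 0 := by
    have e : L.leg1 2 z * (L.leg2 1 𝒟.K2 * L.leg2 0 𝒟.K2) = 0 := by
      rw [← mul_assoc, h2, zero_mul]
    rw [b.K1K0 0, mul_assoc (L.leg2 0 𝒟.R), ← mul_assoc, hc, mul_assoc] at e
    have e' := congrArg (L.leg2 0 𝒟.R⁻¹ * ·) e
    simp only [mul_zero] at e'
    rw [← mul_assoc, b.Ri_R 0, one_mul] at e'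
    exact e'
  have h3' : L.leg1 2 z * (L.leg2 1 𝒟.R⁻¹ * L.leg2 0 𝒟.K2) = 0 := by
    have e : L.leg1 2 z * (L.leg2 1 𝒟.K2 * L.leg2 0 𝒟.K2) = 0 := by
      rw [← mul_assoc, h2, zero_mul]
    rw [b.K1K0' 0, mul_assoc (L.leg2 0 𝒟.R⁻¹), ← mul_assoc, hc, mul_assoc] at e
    have e' := congrArg (L.leg2 0 𝒟.R * ·) e
    simp only [mul_zero] at e'
    rw [← mul_assoc, b.R_Ri 0, one_mul] at e'
    exact e'
  have h4 : L.leg1 2 z * L.leg2 0 𝒟.K2 = 0 := by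
    have e : L.leg1 2 z * ((L.leg2 1 𝒟.R - L.leg2 1 𝒟.R⁻¹) * L.leg2 0 𝒟.K2) = 0 := by
      rw [sub_mul, mul_sub, h3, h3', sub_zero]
    rw [b.R_sub_Ri 1, smul_mul_assoc, mul_smul_comm, sub_mul, mul_sub, one_mul,
      ← mul_assoc (L.leg1 2 z), h2, zero_mul, sub_zero] at e
    exact (smul_eq_zero.1 e).resolve_left H.lam_ne
  have h5 : z = 0 := by
    ext a c
    have e := congrArg (L.wtr (Matrix.single c a 1) 2) h4
    rw [L.wtr_mul_right h0, L.wtr_single_leg1, map_zero, smul_mul_assoc, one_mul] at e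
    by_contra hne
    exact H.K2_ne (L.leg2_eq_zero ((smul_eq_zero.1 e).resolve_left hne) one_ne_zero)
  exact sub_eq_zero.1 h5

theorem ptrSnd_Ri : ptrSnd (matD 𝒟.R) 𝒟.R⁻¹ = (𝒟.μ * 𝒟.μ) • 1 := by
  set L := funLegs N ℂ
  have b := H.bmw ℂ
  set D := matD 𝒟.R
  have hT : ∀ X : Op2 N, ∀ k, L.wtr D (k + 1) (L.leg2 k X) = L.leg1 k (ptrSnd D X) :=
    fun X k => L.wtr_succ_leg2 k X
  have h0 : ∀ {k}, L.leg2 0 𝒟.K2 ∈ L.away (k + 2) := L.leg2_mem_away (by omega) (by omega) _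
  -- the partial trace of the inverse is a scalar
  have hs : ptrSnd D 𝒟.R⁻¹ = (1 - 𝒟.lam * D.trace + 𝒟.lam * 𝒟.μ) • 1 := by
    refine sub_eq_zero.1 (L.leg1_injective_of_eq_zero (k := 0) ?_ one_ne_zero)
    rw [map_sub, ← hT, b.Ri_eq 0, map_add, map_sub, map_smul, map_smul, LegSystem.wtr_one, hT, hT,
      H.ptrSnd_R, H.ptrSnd_K, map_smul, map_smul, map_one]
    module
  have h := congrArg (L.wtr D 2) (b.K1K0' 0)
  rw [L.wtr_mul_right h0, L.wtr_mul_right h0, L.wtr_mul_left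
    (L.leg2_mem_away (by omega) (by omega) _), hT, hT, H.ptrSnd_K, hs, map_smul, map_smul, map_one,
    mul_smul_comm, mul_one, smul_mul_assoc, smul_mul_assoc, one_mul, b.Ri_K 0, smul_smul] at h
  have hK : L.leg2 0 𝒟.K2 ≠ 0 := fun e => H.K2_ne (L.leg2_eq_zero e one_ne_zero)
  have h2 := smul_left_injective ℂ hK h
  rw [hs]
  congr 1
  have hμ := H.μ_ne
  field_simp at h2
  linear_combination -h2

theorem N_pos : 0 < N := by
  rcases Nat.eq_zero_or_pos N with rfl | hN
  · exact (H.K2_ne (by ext x; exact x.1.elim0)).elim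
  · exact hN

theorem trace_D : (matD 𝒟.R).trace = 𝒟.μ * 𝒟.eta := by
  have hN := H.N_pos
  set L := funLegs N ℂ
  have b := H.bmw ℂ
  set D := matD 𝒟.R
  have hT : ∀ X : Op2 N, ∀ k, L.wtr D (k + 1) (L.leg2 k X) = L.leg1 k (ptrSnd D X) :=
    fun X k => L.wtr_succ_leg2 k X
  have h := congrArg (L.wtr D 1) (b.Ri_eq 0)
  rw [map_add, map_sub, map_smul, map_smul, LegSystem.wtr_one, hT, hT, hT, H.ptrSnd_R, H.ptrSnd_K,
    H.ptrSnd_Ri, map_smul, map_smul, map_one] at h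
  have hne : (1 : FunOp N ℂ) ≠ 0 := by
    intro e
    exact one_ne_zero (L.faithful (1 : ℂ) 0 ⟨0, hN⟩ ⟨0, hN⟩ (by rw [map_one, e, zero_mul]))
  have h1 : (𝒟.μ * 𝒟.μ) • (1 : FunOp N ℂ) = (1 - 𝒟.lam * D.trace + 𝒟.lam * 𝒟.μ) • 1 := by
    rw [h]; module
  have h2 := smul_left_injective ℂ hne h1
  have h3 := b.lam_mul_eta
  refine mul_left_cancel₀ H.lam_ne ?_
  linear_combination h2 - h3

theorem isUnit_D : IsUnit (matD 𝒟.R) := by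
  have h1 := snd_mul_eq H.skew (H.compR.transports H.skew H.R_mul)
  have h2 : matC 𝒟.R * matD 𝒟.R = (𝒟.μ * 𝒟.μ) • 1 := by
    rw [← H.ptrSnd_Ri]
    ext a c
    have h3 : ∀ m, (flip2 (skewInverse 𝒟.R) * kron (matD 𝒟.R) 1) (a, m) (c, m) =
        ∑ b, matD 𝒟.R m b * 𝒟.R⁻¹ (a, b) (c, m) := fun m => by
      rw [matD_eq, ← h1, Matrix.mul_apply, Fintype.sum_prod_type, Finset.sum_eq_single a]
      · simp [kron]
      · intro x _ hx; simp [kron, hx.symm]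
      · simp
    rw [ptrSnd, Finset.sum_comm]
    simp only [← h3]
    simp only [Matrix.mul_apply, Fintype.sum_prod_type, kron, flip2, Matrix.one_apply, mul_ite,
      mul_one, mul_zero, Finset.sum_ite_eq', Finset.mem_univ, if_true, matC, Finset.sum_mul]
    exact Finset.sum_comm
  have hμ : 𝒟.μ * 𝒟.μ ≠ 0 := mul_ne_zero H.μ_ne H.μ_ne
  refine (Matrix.isUnit_iff_isUnit_det _).2 (Matrix.isUnit_det_of_left_inverse
    (B := (𝒟.μ * 𝒟.μ)⁻¹ • matC 𝒟.R) ?_)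
  rw [smul_mul_assoc, h2, inv_smul_smul₀ hμ]

end Admissible

end QMData

/-- An algebra with the operators `R_k^{±1}, K_k, F_k^{±1}` of infinitely many tensor factors, the
partial `R`-traces `T_k`, the scalars `A` and the matrices over `A` in the first factor. -/
structure Tower {N : ℕ} (𝒟 : QMData N) (A E : Type) [Ring A] [Algebra ℂ A] [Ring E]
    [Algebra ℂ E] where
  (R Ri K F G : ℕ → E)
  away : ℕ → Subalgebra ℂ E
  T : ℕ → E →ₗ[ℂ] E
  sh : E →ₐ[ℂ] E
  scal : A →ₐ[ℂ] E
  mat : Matrix (Fin N) (Fin N) A →ₐ[ℂ] E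
  rtr : Matrix (Fin N) (Fin N) A → A
  bmw : BMWSeq 𝒟 R Ri K
  F_G : ∀ k, F k * G k = 1
  G_F : ∀ k, G k * F k = 1
  R_mem : ∀ {k l}, k ≠ l → k + 1 ≠ l → R k ∈ away l
  Ri_mem : ∀ {k l}, k ≠ l → k + 1 ≠ l → Ri k ∈ away l
  K_mem : ∀ {k l}, k ≠ l → k + 1 ≠ l → K k ∈ away l
  F_mem : ∀ {k l}, k ≠ l → k + 1 ≠ l → F k ∈ away l
  G_mem : ∀ {k l}, k ≠ l → k + 1 ≠ l → G k ∈ away l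
  R_comm : ∀ {k Z}, Z ∈ away k → Z ∈ away (k + 1) → R k * Z = Z * R k
  Ri_comm : ∀ {k Z}, Z ∈ away k → Z ∈ away (k + 1) → Ri k * Z = Z * Ri k
  K_comm : ∀ {k Z}, Z ∈ away k → Z ∈ away (k + 1) → K k * Z = Z * K k
  F_comm : ∀ {k Z}, Z ∈ away k → Z ∈ away (k + 1) → F k * Z = Z * F k
  G_comm : ∀ {k Z}, Z ∈ away k → Z ∈ away (k + 1) → G k * Z = Z * G k
  FFF : ∀ k, F k * F (k + 1) * F k = F (k + 1) * F k * F (k + 1)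
  RFF : ∀ k, R k * F (k + 1) * F k = F (k + 1) * F k * R (k + 1)
  RFF' : ∀ k, R (k + 1) * F k * F (k + 1) = F k * F (k + 1) * R k
  T_mul_left : ∀ {k X}, X ∈ away k → ∀ Z, T k (X * Z) = X * T k Z
  T_mul_right : ∀ {k X}, X ∈ away k → ∀ Z, T k (Z * X) = T k Z * X
  T_mem_self : ∀ k Z, T k Z ∈ away k
  T_mem : ∀ {k l Z}, Z ∈ away l → T k Z ∈ away l
  T_comm : ∀ k l Z, T k (T l Z) = T l (T k Z)
  T_one : ∀ k, T k 1 = (𝒟.μ * 𝒟.eta) • 1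
  T_R : ∀ k, T (k + 1) (R k) = 1
  T_K : ∀ k, T (k + 1) (K k) = 𝒟.μ • 1
  T_conj_F : ∀ {k Z}, Z ∈ away (k + 1) → T (k + 1) (F k * Z * G k) = T k Z
  T_conj_R : ∀ {k Z}, Z ∈ away (k + 1) → T (k + 1) (R k * Z * Ri k) = T k Z
  T_cyc : ∀ k Z, T k (T (k + 1) (R k * Z)) = T k (T (k + 1) (Z * R k))
  sh_R : ∀ k, sh (R k) = R (k + 1)
  sh_Ri : ∀ k, sh (Ri k) = Ri (k + 1)
  sh_K : ∀ k, sh (K k) = K (k + 1)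
  scal_injective : Function.Injective scal
  scal_mem : ∀ x k, scal x ∈ away k
  mat_injective : Function.Injective mat
  mat_mem : ∀ Y {k}, k ≠ 0 → mat Y ∈ away k
  mat_map : ∀ Y c, mat (Y.map (· * c)) = mat Y * scal c
  T_mat : ∀ Y, T 0 (mat Y) = scal (rtr Y)
  J : ℕ → Subalgebra ℂ E
  R_mem_J : ∀ {i n}, i + 1 < n → R i ∈ J n
  Ri_mem_J : ∀ {i n}, i + 1 < n → Ri i ∈ J n
  F_mem_J : ∀ {i n}, i + 1 < n → F i ∈ J n
  G_mem_J : ∀ {i n}, i + 1 < n → G i ∈ J n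
  mat_mem_J : ∀ Y {n}, 0 < n → mat Y ∈ J n
  T_mem_J : ∀ {n Z}, Z ∈ J (n + 1) → T n Z ∈ J n
  exists_mat : ∀ {Z}, Z ∈ J 1 → ∃ Y, mat Y = Z
  exists_scal : ∀ {Z}, Z ∈ J 0 → ∃ x, scal x = Z
  mat_phi : ∀ Y, mat (𝒟.phi Y) = T 1 (F 0 * mat Y * G 0 * R 0)
  mat_xi : ∀ Y, mat (𝒟.xi Y) = T 1 (F 0 * mat Y * G 0 * K 0)

section Standard

variable {N : ℕ} {𝒟 : QMData N} {A : Type} [Ring A] [Algebra ℂ A]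

theorem opHom_copy {n i : ℕ} (h : i < n + 1) (M : Matrix (Fin N) (Fin N) A) :
    opHom (n + 1) (𝒟.copy n M i) = i.rec ((funLegs N A).mat M) fun i y =>
      (funLegs N A).leg2 i 𝒟.F * y * (funLegs N A).leg2 i 𝒟.F⁻¹ := by
  induction i with
  | zero => exact opHom_firstLeg n M
  | succ i ih =>
    rw [QMData.copy, map_mul, map_mul, opHom_toA, opHom_toA, cHom_legs h, cHom_legs h,
      ih (by omega)]

theorem mat_map_mul (L : LegSystem N A (FunOp N A)) (Y : Matrix (Fin N) (Fin N) A) (c : A) :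
    L.mat (Y.map (· * c)) = L.mat Y * L.scal c := by
  simp only [LegSystem.mat_apply, Finset.sum_mul, Matrix.map_apply, map_mul, mul_assoc,
    ← L.scal_comm]

theorem wtr_zero_mat (L : LegSystem N A (FunOp N A)) (D : Matrix (Fin N) (Fin N) ℂ)
    (Y : Matrix (Fin N) (Fin N) A) :
    L.wtr D 0 (L.mat Y) = L.scal (∑ a, ∑ b, D b a • Y a b) := by
  rw [LegSystem.mat_apply]
  have h : ∀ x, L.scal x ∈ L.away 0 := fun x => L.scal_mem_away x 0
  simp only [map_sum, map_smul, L.wtr_mul_left (h _), LegSystem.wtr_u, mul_smul_comm, mul_one]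

/-- The standard example. -/
def QMData.Admissible.tower (H : 𝒟.Admissible) (A : Type) [Ring A] [Algebra ℂ A] :
    Tower 𝒟 A (FunOp N A) where
  R k := (funLegs N A).leg2 k 𝒟.R
  Ri k := (funLegs N A).leg2 k 𝒟.R⁻¹
  K k := (funLegs N A).leg2 k 𝒟.K2
  F k := (funLegs N A).leg2 k 𝒟.F
  G k := (funLegs N A).leg2 k 𝒟.F⁻¹
  away := (funLegs N A).away
  T := (funLegs N A).wtr (matD 𝒟.R)
  sh := (funLegs N A).sh
  scal := (funLegs N A).scal
  mat := (funLegs N A).mat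
  rtr Y := ∑ a, ∑ b, matD 𝒟.R b a • Y a b
  bmw := H.bmw A
  F_G k := by rw [← map_mul, H.F_mul, map_one]
  G_F k := by rw [← map_mul, mul_eq_one_comm.1 H.F_mul, map_one]
  R_mem h h' := (funLegs N A).leg2_mem_away h h' _
  Ri_mem h h' := (funLegs N A).leg2_mem_away h h' _
  K_mem h h' := (funLegs N A).leg2_mem_away h h' _
  F_mem h h' := (funLegs N A).leg2_mem_away h h' _
  G_mem h h' := (funLegs N A).leg2_mem_away h h' _
  R_comm h h' := (funLegs N A).leg2_comm_of_away h h' _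
  Ri_comm h h' := (funLegs N A).leg2_comm_of_away h h' _
  K_comm h h' := (funLegs N A).leg2_comm_of_away h h' _
  F_comm h h' := (funLegs N A).leg2_comm_of_away h h' _
  G_comm h h' := (funLegs N A).leg2_comm_of_away h h' _
  FFF k := H.compF.leg2_fst k
  RFF k := H.comp.leg2_fst k
  RFF' k := H.comp.leg2_snd k
  T_mul_left h Z := (funLegs N A).wtr_mul_left h Z
  T_mul_right h Z := (funLegs N A).wtr_mul_right h Z
  T_mem_self k Z := (funLegs N A).wtr_mem_away_self k Z
  T_mem h := (funLegs N A).wtr_mem_away h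
  T_comm k l Z := by
    by_cases h : k = l
    · rw [h]
    · exact (funLegs N A).wtr_wtr_comm _ h Z
  T_one k := by rw [LegSystem.wtr_one, H.trace_D]
  T_R k := by rw [LegSystem.wtr_succ_leg2, H.ptrSnd_R, map_one]
  T_K k := by rw [LegSystem.wtr_succ_leg2, H.ptrSnd_K, map_smul, map_one]
  T_conj_F h := (funLegs N A).wtr_conj (H.comp.transports_symm H.skew H.F_mul) h
  T_conj_R h := (funLegs N A).wtr_conj (H.compR.transports_symm H.skew H.R_mul) h
  T_cyc k Z := (funLegs N A).wtr_wtr_leg2_mul k (cyclic_of_compatible H.compR H.skew H.R_mul) Z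
  sh_R k := (funLegs N A).sh_leg2 k _
  sh_Ri k := (funLegs N A).sh_leg2 k _
  sh_K k := (funLegs N A).sh_leg2 k _
  scal_injective := (funLegs N A).scal_injective H.N_pos
  scal_mem x k := (funLegs N A).scal_mem_away x k
  mat_injective := (funLegs N A).mat_injective
  mat_mem Y _ h := (funLegs N A).mat_mem_away Y h.symm
  mat_map Y c := mat_map_mul _ Y c
  T_mat Y := wtr_zero_mat _ _ Y
  J n := (opHom n).range
  R_mem_J h := ⟨_, by rw [← cHom_legs h]; rfl⟩
  Ri_mem_J h := ⟨_, by rw [← cHom_legs h]; rfl⟩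
  F_mem_J h := ⟨_, by rw [← cHom_legs h]; rfl⟩
  G_mem_J h := ⟨_, by rw [← cHom_legs h]; rfl⟩
  mat_mem_J Y n h := by
    obtain ⟨n, rfl⟩ := Nat.exists_eq_succ_of_ne_zero h.ne'
    exact ⟨_, opHom_firstLeg n Y⟩
  T_mem_J := by
    rintro n _ ⟨Y, rfl⟩
    exact ⟨ptr (matD 𝒟.R) Y, (wtr_opHom _ Y).symm⟩
  exists_mat := by
    rintro _ ⟨Y, rfl⟩
    exact ⟨_, (opHom_one_eq Y 1).symm⟩
  exists_scal := by
    rintro _ ⟨Y, rfl⟩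
    exact ⟨_, scal_fullTrace 1 Y⟩
  mat_phi Y := by
    rw [QMData.phi, mat_tailTrace, map_mul, opHom_copy (by omega), opHom_toA,
      QMData.cHom_Rop (by omega), LegSystem.trs_succ, LegSystem.trs_zero]
    rfl
  mat_xi Y := by
    rw [QMData.xi, mat_tailTrace, map_mul, opHom_copy (by omega), opHom_toA,
      QMData.cHom_Kop (by omega), LegSystem.trs_succ, LegSystem.trs_zero]
    rfl

end Standard

section PhiBijective

variable {N : ℕ} {𝒟 : QMData N}

theorem QMData.Admissible.phi_injective_complex (H : 𝒟.Admissible) {Y : Matrix (Fin N) (Fin N) ℂ}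
    (h : 𝒟.phi Y = 0) : Y = 0 := by
  set L := funLegs N ℂ with hL
  set t := H.tower ℂ
  set D := matD 𝒟.R with hD
  set D' := matD 𝒟.F with hD'
  have hF := isSkewInverse_skewInverse H.skewF
  have b := t.bmw
  -- the shifted equation
  have h1 : L.wtr D 2 (t.F 1 * L.leg1 1 Y * t.G 1 * t.R 1) = 0 := by
    have e : L.mat Y = L.leg1 0 Y := rfl
    have := congrArg L.sh (t.mat_phi Y)
    rw [h, map_zero, map_zero] at this
    have e2 : t.T 1 (t.F 0 * t.mat Y * t.G 0 * t.R 0) =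
      L.wtr D 1 (L.leg2 0 𝒟.F * L.leg1 0 Y * L.leg2 0 𝒟.F⁻¹ * L.leg2 0 𝒟.R) := rfl
    rw [e2, LegSystem.sh_wtr, map_mul L.sh, map_mul L.sh, map_mul L.sh, LegSystem.sh_leg1,
      LegSystem.sh_leg2, LegSystem.sh_leg2, LegSystem.sh_leg2] at this
    exact this.symm
  have hcomm : L.leg1 1 D' * L.leg1 2 D * t.F 1 = t.F 1 * (L.leg1 1 D * L.leg1 2 D') := by
    rw [LegSystem.leg1_mul_leg1_succ, LegSystem.leg1_mul_leg1_succ]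
    change L.leg2 1 _ * L.leg2 1 _ = L.leg2 1 _ * L.leg2 1 _
    rw [← map_mul, ← map_mul]
    congr 1
    exact kron_comm_of_transports hF H.F_mul (mul_eq_one_comm.1 H.F_mul)
      (H.comp.transports_symm H.skew H.F_mul) (H.compF.transports hF H.F_mul)
  have hbr : t.G 1 * t.R 1 * t.F 0 = t.F 0 * t.F 1 * t.G 0 * t.R 0 * t.G 1 := by
    have e1 : t.R 1 * t.F 0 = t.F 0 * t.F 1 * t.R 0 * t.G 1 := by
      rw [← t.RFF' 0, mul_assoc, t.F_G, mul_one]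
    have e2 : t.G 1 * t.F 0 * t.F 1 = t.F 0 * t.F 1 * t.G 0 := by
      have e := t.FFF 0
      calc t.G 1 * t.F 0 * t.F 1 = t.G 1 * (t.F 0 * t.F 1 * t.F 0) * t.G 0 := by
            simp only [mul_assoc, t.F_G, mul_one]
        _ = (t.G 1 * t.F 1) * t.F 0 * t.F 1 * t.G 0 := by rw [e]; simp only [mul_assoc]
        _ = _ := by rw [t.G_F, one_mul]
    rw [mul_assoc, e1]
    simp only [← mul_assoc]
    rw [e2]
  have h2 : L.tr 1 (L.leg1 1 D * L.leg1 1 Y * t.R 0) = 0 := by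
    have e : L.tr 1 (L.leg1 1 D' * L.wtr D 2 (t.F 1 * L.leg1 1 Y * t.G 1 * t.R 1) * t.F 0) = 0 := by
      rw [h1]; simp
    have a1 : L.leg1 1 D' ∈ L.away 2 := L.leg1_mem_away (by omega) _
    have a2 : L.leg1 1 Y ∈ L.away 2 := L.leg1_mem_away (by omega) _
    have a3 : L.leg1 1 D ∈ L.away 2 := L.leg1_mem_away (by omega) _
    have a4 : t.F 0 ∈ L.away 2 := t.F_mem (by omega) (by omega)
    have a5 : t.G 0 ∈ L.away 2 := t.G_mem (by omega) (by omega)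
    have a6 : t.R 0 ∈ L.away 2 := t.R_mem (by omega) (by omega)
    rw [LegSystem.wtr_apply, ← L.tr_mul_left a1, ← L.tr_mul_right a4] at e
    have e1 : L.leg1 1 D' * (L.leg1 2 D * (t.F 1 * L.leg1 1 Y * t.G 1 * t.R 1)) * t.F 0 =
        t.F 1 * (L.leg1 1 D * L.leg1 2 D' * L.leg1 1 Y * (t.F 0 * t.F 1 * t.G 0 * t.R 0 * t.G 1)) := by
      calc _ = L.leg1 1 D' * L.leg1 2 D * t.F 1 * L.leg1 1 Y * (t.G 1 * t.R 1 * t.F 0) := by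
            simp only [mul_assoc]
        _ = _ := by rw [hcomm, hbr]; simp only [mul_assoc]
    rw [e1] at e
    have e2 := L.tr_tr_leg2_mul 1 𝒟.F (L.leg1 1 D * L.leg1 2 D' * L.leg1 1 Y *
      (t.F 0 * t.F 1 * t.G 0 * t.R 0 * t.G 1))
    have e3 : L.leg1 1 D * L.leg1 2 D' * L.leg1 1 Y * (t.F 0 * t.F 1 * t.G 0 * t.R 0 * t.G 1) *
        t.F 1 = L.leg1 1 D * L.leg1 1 Y * t.F 0 * (L.leg1 2 D' * t.F 1) * (t.G 0 * t.R 0) := by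
      have c1 : L.leg1 2 D' * L.leg1 1 Y = L.leg1 1 Y * L.leg1 2 D' := L.leg1_comm_of_away a2 _
      have c2 : L.leg1 2 D' * t.F 0 = t.F 0 * L.leg1 2 D' := L.leg1_comm_of_away a4 _
      calc _ = L.leg1 1 D * (L.leg1 2 D' * L.leg1 1 Y) * t.F 0 * t.F 1 * t.G 0 * t.R 0 *
              (t.G 1 * t.F 1) := by simp only [mul_assoc]
        _ = L.leg1 1 D * L.leg1 1 Y * (L.leg1 2 D' * t.F 0) * t.F 1 * t.G 0 * t.R 0 := by
            rw [c1, t.G_F, mul_one]; simp only [mul_assoc]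
        _ = _ := by rw [c2]; simp only [mul_assoc]
    have e4 : L.tr 2 (L.leg1 2 D' * t.F 1) = 1 := L.wtr_succ_self hF 1
    have e5 := e2.symm.trans e
    change L.tr 1 (L.tr 2 (L.leg1 1 D * L.leg1 2 D' * L.leg1 1 Y *
      (t.F 0 * t.F 1 * t.G 0 * t.R 0 * t.G 1) * t.F 1)) = 0 at e5
    rw [e3, L.tr_mul_right (mul_mem a5 a6), L.tr_mul_left (mul_mem (mul_mem a3 a2) a4), e4,
      mul_one] at e5
    rw [← e5]
    congr 1
    rw [mul_assoc _ (t.F 0), ← mul_assoc (t.F 0), t.F_G, one_mul]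
  -- strip the operator `R`
  have h3 : ptrSnd (D * Y) 𝒟.R = 0 := by
    refine L.leg1_injective_of_eq_zero (k := 0) ?_ one_ne_zero
    rw [← LegSystem.wtr_succ_leg2, LegSystem.wtr_apply,
      map_mul (L.leg1 _)]
    exact h2
  have h4 : D * Y = 0 := by
    ext m c
    have hΨ := H.skew
    set Ψ := skewInverse 𝒟.R
    have e : ∑ x, ∑ y, Ψ (m, y) (c, x) * ptrSnd (D * Y) 𝒟.R x y = 0 := by simp [h3]
    simp only [ptrSnd, Finset.mul_sum] at e
    rw [Finset.sum_comm] at e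
    have e1 : ∀ y x, ∑ i, ∑ j, Ψ (m, y) (c, x) * ((D * Y) j i * 𝒟.R (x, i) (y, j)) =
        ∑ i, ∑ j, (D * Y) j i * (Ψ (m, y) (c, x) * 𝒟.R (x, i) (y, j)) := fun y x =>
      Finset.sum_congr rfl fun i _ => Finset.sum_congr rfl fun j _ => by ring
    simp only [e1] at e
    have e2 : ∑ i, ∑ j, (D * Y) j i * ∑ y, ∑ x, Ψ (m, y) (c, x) * 𝒟.R (x, i) (y, j) = 0 := by
      rw [← e]
      simp only [Finset.mul_sum]
      calc _ = ∑ i, ∑ y, ∑ j, ∑ x, (D * Y) j i * (Ψ (m, y) (c, x) * 𝒟.R (x, i) (y, j)) :=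
            Finset.sum_congr rfl fun i _ => Finset.sum_comm
        _ = ∑ y, ∑ i, ∑ j, ∑ x, (D * Y) j i * (Ψ (m, y) (c, x) * 𝒟.R (x, i) (y, j)) :=
            Finset.sum_comm
        _ = ∑ y, ∑ i, ∑ x, ∑ j, (D * Y) j i * (Ψ (m, y) (c, x) * 𝒟.R (x, i) (y, j)) :=
            Finset.sum_congr rfl fun y _ => Finset.sum_congr rfl fun i _ => Finset.sum_comm
        _ = _ := Finset.sum_congr rfl fun y _ => Finset.sum_comm
    simp only [hΨ.2] at e2
    rw [Finset.sum_eq_single c, Finset.sum_eq_single m] at e2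
    · simpa using e2
    · intro j _ hj; simp [hj.symm]
    · simp
    · intro i _ hi
      refine Finset.sum_eq_zero fun j _ => ?_
      rw [if_neg (fun hh => hi hh.2), mul_zero]
    · simp
  obtain ⟨u, hu⟩ := H.isUnit_D
  rw [hD, ← hu] at h4
  simpa using congrArg (((u⁻¹ : (Matrix (Fin N) (Fin N) ℂ)ˣ) : Matrix (Fin N) (Fin N) ℂ) * ·) h4

variable {A : Type} [Ring A] [Algebra ℂ A]

theorem Tower.phi_add {E : Type} [Ring E] [Algebra ℂ E] (t : Tower 𝒟 A E)
    (Y Z : Matrix (Fin N) (Fin N) A) : 𝒟.phi (Y + Z) = 𝒟.phi Y + 𝒟.phi Z :=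
  t.mat_injective (by simp only [map_add, t.mat_phi, mul_add, add_mul])

theorem Tower.phi_smul {E : Type} [Ring E] [Algebra ℂ E] (t : Tower 𝒟 A E) (c : ℂ)
    (Y : Matrix (Fin N) (Fin N) A) : 𝒟.phi (c • Y) = c • 𝒟.phi Y :=
  t.mat_injective (by simp only [map_smul, t.mat_phi, mul_smul_comm, smul_mul_assoc])

/-- A complex matrix times an element of the coefficient algebra. -/
def scaled {ι : Type} (Z : Matrix ι ι ℂ) (x : A) : Matrix ι ι A := Z.map (· • x)

theorem phi_scaled (Z : Matrix (Fin N) (Fin N) ℂ) (x : A) :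
    𝒟.phi (scaled Z x) = scaled (𝒟.phi Z) x := by
  have hl : ∀ {ι : Type} [Fintype ι] (X Y : Matrix ι ι ℂ),
      toA A X * scaled Y x = scaled (X * Y) x := fun X Y => by
    ext i j
    simp only [toA, scaled, Matrix.mul_apply, Finset.sum_smul, Matrix.map_apply, mul_smul,
      Algebra.algebraMap_eq_smul_one, smul_mul_assoc, one_mul]
  have hr : ∀ {ι : Type} [Fintype ι] (X Y : Matrix ι ι ℂ),
      scaled Y x * toA A X = scaled (Y * X) x := fun X Y => by
    ext i j
    simp only [toA, scaled, Matrix.mul_apply, Finset.sum_smul, Matrix.map_apply, mul_smul,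
      Algebra.algebraMap_eq_smul_one, mul_smul_comm, mul_one]
    exact Finset.sum_congr rfl fun k _ => smul_comm _ _ _
  have hf : firstLeg 1 (scaled Z x) = scaled (firstLeg 1 Z) x := by
    ext i j
    simp only [firstLeg, scaled, Matrix.map_apply]
    split_ifs <;> simp
  have hc : ∀ {ι : Type} (X : Matrix ι ι ℂ), toA ℂ X = X := fun X => by ext i j; simp [toA]
  rw [QMData.phi, QMData.phi, QMData.copy, QMData.copy, QMData.copy, QMData.copy, hf, hl, hr, hr,
    hc, hc, hc]
  ext a b
  simp [tailTrace, scaled, Finset.sum_smul, mul_smul]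

theorem sum_scaled_single (Y : Matrix (Fin N) (Fin N) A) :
    ∑ c, ∑ d, scaled (Matrix.single c d 1) (Y c d) = Y := by
  ext a b
  simp only [Matrix.sum_apply, scaled, Matrix.map_apply, Matrix.single_apply]
  rw [Finset.sum_eq_single a, Finset.sum_eq_single b]
  · simp
  · intro d _ hd; simp [hd]
  · simp
  · intro c _ hc; simp [hc]
  · simp

theorem QMData.Admissible.phi_bijective (H : 𝒟.Admissible) :
    Function.Bijective (𝒟.phi : Matrix (Fin N) (Fin N) A → Matrix (Fin N) (Fin N) A) := by
  let p : Matrix (Fin N) (Fin N) ℂ →ₗ[ℂ] Matrix (Fin N) (Fin N) ℂ :=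
    { toFun := 𝒟.phi
      map_add' := (H.tower ℂ).phi_add
      map_smul' := (H.tower ℂ).phi_smul }
  have hp : Function.Injective p := (injective_iff_map_eq_zero p).2 fun Y =>
    H.phi_injective_complex
  let e := LinearEquiv.ofInjectiveEndo p hp
  have he : ∀ Z, 𝒟.phi (e.symm Z) = Z := fun Z => e.apply_symm_apply Z
  let pA : Matrix (Fin N) (Fin N) A →+ Matrix (Fin N) (Fin N) A :=
    { toFun := 𝒟.phi
      map_add' := (H.tower A).phi_add
      map_zero' := by
        have := (H.tower A).phi_smul 0 0
        simpa using this }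
  let ψ : Matrix (Fin N) (Fin N) A →+ Matrix (Fin N) (Fin N) A :=
    { toFun Z := ∑ c, ∑ d, scaled (e.symm (Matrix.single c d 1)) (Z c d)
      map_add' Y Z := by
        simp only [← Finset.sum_add_distrib]
        refine Finset.sum_congr rfl fun c _ => Finset.sum_congr rfl fun d _ => ?_
        ext a b; simp [scaled]
      map_zero' := by
        refine Finset.sum_eq_zero fun c _ => Finset.sum_eq_zero fun d _ => ?_
        ext a b; simp [scaled] }
  have hψ : ∀ (Z : Matrix (Fin N) (Fin N) ℂ) (x : A), ψ (scaled Z x) = scaled (e.symm Z) x := by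
    intro Z x
    have h : e.symm Z = ∑ c, ∑ d, Z c d • e.symm (Matrix.single c d 1) := by
      conv_lhs => rw [Matrix.matrix_eq_sum_single Z]
      simp only [map_sum, ← map_smul, Matrix.smul_single, smul_eq_mul, mul_one]
    rw [h]
    ext a b
    simp only [ψ, AddMonoidHom.coe_mk, ZeroHom.coe_mk, scaled, Matrix.sum_apply, Matrix.map_apply,
      Matrix.smul_apply, smul_eq_mul, Finset.sum_smul]
    refine Finset.sum_congr rfl fun c _ => Finset.sum_congr rfl fun d _ => ?_
    rw [smul_smul, mul_comm]
  refine Function.bijective_iff_has_inverse.2 ⟨ψ, fun Y => ?_, fun Z => ?_⟩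
  · change ψ (pA Y) = Y
    conv_lhs => rw [← sum_scaled_single Y]
    simp only [map_sum]
    conv_rhs => rw [← sum_scaled_single Y]
    refine Finset.sum_congr rfl fun c _ => Finset.sum_congr rfl fun d _ => ?_
    change ψ (𝒟.phi _) = _
    rw [phi_scaled, hψ]
    congr 1
    exact e.symm_apply_apply _
  · change pA (∑ c, ∑ d, scaled (e.symm (Matrix.single c d 1)) (Z c d)) = Z
    simp only [map_sum]
    conv_rhs => rw [← sum_scaled_single Z]
    refine Finset.sum_congr rfl fun c _ => Finset.sum_congr rfl fun d _ => ?_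
    change 𝒟.phi _ = _
    rw [phi_scaled, he]

end PhiBijective

namespace Tower

variable {N : ℕ} {𝒟 : QMData N} {A E : Type} [Ring A] [Algebra ℂ A] [Ring E] [Algebra ℂ E]
variable (t : Tower 𝒟 A E)

/-- A sequence of operators in consecutive pairs of legs, compatible with `F`. -/
structure Local (X : ℕ → E) : Prop where
  mem : ∀ {k l}, k ≠ l → k + 1 ≠ l → X k ∈ t.away l
  comm : ∀ {k Z}, Z ∈ t.away k → Z ∈ t.away (k + 1) → X k * Z = Z * X k
  XFF : ∀ k, X k * t.F (k + 1) * t.F k = t.F (k + 1) * t.F k * X (k + 1)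
  XFF' : ∀ k, X (k + 1) * t.F k * t.F (k + 1) = t.F k * t.F (k + 1) * X k

theorem local_R : t.Local t.R := ⟨t.R_mem, t.R_comm, t.RFF, t.RFF'⟩

theorem local_F : t.Local t.F := ⟨t.F_mem, t.F_comm, t.FFF, fun k => (t.FFF k).symm⟩

theorem inv_intertwine {E : Type} [Ring E] {x x' y y' v : E} (hx' : x' * x = 1) (hy : y * y' = 1)
    (h : x * v = v * y) : x' * v = v * y' := by
  calc x' * v = x' * (v * y) * y' := by rw [mul_assoc, mul_assoc, hy, mul_one]
    _ = v * y' := by rw [← h, ← mul_assoc, hx', one_mul]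

theorem poly_intertwine {x y v : E} {a c d : ℂ} (h : x * v = v * y) :
    (d • ((a • 1 - x) * (c • 1 + x))) * v = v * (d • ((a • 1 - y) * (c • 1 + y))) := by
  have h1 : (c • 1 + x) * v = v * (c • 1 + y) := by rw [add_mul, mul_add, h]; simp
  have h2 : (a • 1 - x) * v = v * (a • 1 - y) := by rw [sub_mul, mul_sub, h]; simp
  rw [smul_mul_assoc, mul_smul_comm, mul_assoc, h1, ← mul_assoc, h2, mul_assoc]

theorem local_Ri : t.Local t.Ri := by
  refine ⟨t.Ri_mem, t.Ri_comm, fun k => ?_, fun k => ?_⟩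
  · rw [mul_assoc]
    exact inv_intertwine (t.bmw.Ri_R k) (t.bmw.R_Ri _)
      (by rw [← mul_assoc, t.RFF])
  · rw [mul_assoc]
    exact inv_intertwine (t.bmw.Ri_R _) (t.bmw.R_Ri _)
      (by rw [← mul_assoc, t.RFF'])

theorem local_K : t.Local t.K := by
  refine ⟨t.K_mem, t.K_comm, fun k => ?_, fun k => ?_⟩
  · rw [mul_assoc, t.bmw.K_def, t.bmw.K_def]
    exact poly_intertwine (by rw [← mul_assoc, t.RFF])
  · rw [mul_assoc, t.bmw.K_def, t.bmw.K_def]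
    exact poly_intertwine (by rw [← mul_assoc, t.RFF'])

/-- The copy `Y_{\overline{k+1}}` of a matrix. -/
def bar (Y : Matrix (Fin N) (Fin N) A) : ℕ → E
  | 0 => t.mat Y
  | k + 1 => t.F k * bar Y k * t.G k

variable {t}

theorem bar_zero (Y : Matrix (Fin N) (Fin N) A) : t.bar Y 0 = t.mat Y := rfl

theorem bar_succ (Y : Matrix (Fin N) (Fin N) A) (k : ℕ) :
    t.bar Y (k + 1) = t.F k * t.bar Y k * t.G k := rfl

theorem bar_mem (Y : Matrix (Fin N) (Fin N) A) {k l : ℕ} (h : k < l) : t.bar Y k ∈ t.away l := by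
  induction k with
  | zero => exact t.mat_mem Y (by omega)
  | succ k ih =>
    exact mul_mem (mul_mem (t.F_mem (by omega) (by omega)) (ih (by omega)))
      (t.G_mem (by omega) (by omega))

theorem bar_one (k : ℕ) : t.bar 1 k = 1 := by
  induction k with
  | zero => rw [bar_zero, map_one]
  | succ k ih => rw [bar_succ, ih, mul_one, t.F_G]

theorem bar_mul (Y Z : Matrix (Fin N) (Fin N) A) (k : ℕ) :
    t.bar (Y * Z) k = t.bar Y k * t.bar Z k := by
  induction k with
  | zero => rw [bar_zero, bar_zero, bar_zero, map_mul]
  | succ k ih =>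
    rw [bar_succ, bar_succ, bar_succ, ih]
    calc _ = t.F k * t.bar Y k * (t.G k * t.F k) * t.bar Z k * t.G k := by
          rw [t.G_F, mul_one]; simp only [mul_assoc]
      _ = _ := by simp only [mul_assoc]

theorem bar_add (Y Z : Matrix (Fin N) (Fin N) A) (k : ℕ) :
    t.bar (Y + Z) k = t.bar Y k + t.bar Z k := by
  induction k with
  | zero => rw [bar_zero, bar_zero, bar_zero, map_add]
  | succ k ih => rw [bar_succ, bar_succ, bar_succ, ih, mul_add, add_mul]

theorem bar_smul (c : ℂ) (Y : Matrix (Fin N) (Fin N) A) (k : ℕ) :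
    t.bar (c • Y) k = c • t.bar Y k := by
  induction k with
  | zero => rw [bar_zero, bar_zero, map_smul]
  | succ k ih => rw [bar_succ, bar_succ, ih, mul_smul_comm, smul_mul_assoc]

theorem bar_map (Y : Matrix (Fin N) (Fin N) A) (c : A) (k : ℕ) :
    t.bar (Y.map (· * c)) k = t.bar Y k * t.scal c := by
  induction k with
  | zero => exact t.mat_map Y c
  | succ k ih =>
    rw [bar_succ, bar_succ, ih, mul_assoc, mul_assoc, ← t.G_comm (t.scal_mem _ _) (t.scal_mem _ _)]
    simp only [mul_assoc]

theorem bar_eq_zero {Y : Matrix (Fin N) (Fin N) A} {k : ℕ} (h : t.bar Y k = 0) : Y = 0 := by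
  induction k with
  | zero => exact t.mat_injective (by rw [map_zero]; exact h)
  | succ k ih =>
    refine ih ?_
    rw [bar_succ] at h
    calc t.bar Y k = (t.G k * t.F k) * t.bar Y k * (t.G k * t.F k) := by rw [t.G_F]; simp
      _ = t.G k * (t.F k * t.bar Y k * t.G k) * t.F k := by simp only [mul_assoc]
      _ = 0 := by rw [h]; simp

namespace Local

variable {X : ℕ → E} (hX : t.Local X)
include hX

theorem far {k l : ℕ} (h : k + 2 ≤ l) {Y : ℕ → E} (hY : t.Local Y) : X k * Y l = Y l * X k :=
  hX.comm (hY.mem (by omega) (by omega)) (hY.mem (by omega) (by omega))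

theorem bar_comm (Y : Matrix (Fin N) (Fin N) A) {k j : ℕ} (h : k + 2 ≤ j) :
    X k * t.bar Y j = t.bar Y j * X k := by
  induction j, h using Nat.le_induction with
  | base =>
    have h1 : X (k + 1) * t.bar Y k = t.bar Y k * X (k + 1) :=
      hX.comm (bar_mem Y (by omega)) (bar_mem Y (by omega))
    have h2 : X (k + 1) * (t.G k * t.G (k + 1)) = t.G k * t.G (k + 1) * X k := by
      have e : t.G k * t.G (k + 1) * (t.F (k + 1) * t.F k) = 1 := by
        rw [mul_assoc, ← mul_assoc (t.G (k + 1)), t.G_F, one_mul, t.G_F]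
      have e' : t.F (k + 1) * t.F k * (t.G k * t.G (k + 1)) = 1 := by
        rw [mul_assoc, ← mul_assoc (t.F k), t.F_G, one_mul, t.F_G]
      calc X (k + 1) * (t.G k * t.G (k + 1)) = t.G k * t.G (k + 1) * (t.F (k + 1) * t.F k) *
            X (k + 1) * (t.G k * t.G (k + 1)) := by rw [e, one_mul]
        _ = t.G k * t.G (k + 1) * (X k * t.F (k + 1) * t.F k) * (t.G k * t.G (k + 1)) := by
            rw [hX.XFF]; simp only [mul_assoc]
        _ = t.G k * t.G (k + 1) * X k * (t.F (k + 1) * t.F k * (t.G k * t.G (k + 1))) := by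
            simp only [mul_assoc]
        _ = _ := by rw [e', mul_one]
    rw [bar_succ, bar_succ]
    calc X k * (t.F (k + 1) * (t.F k * t.bar Y k * t.G k) * t.G (k + 1)) =
          X k * t.F (k + 1) * t.F k * t.bar Y k * (t.G k * t.G (k + 1)) := by simp only [mul_assoc]
      _ = t.F (k + 1) * t.F k * (X (k + 1) * t.bar Y k) * (t.G k * t.G (k + 1)) := by
          rw [hX.XFF]; simp only [mul_assoc]
      _ = t.F (k + 1) * t.F k * t.bar Y k * (X (k + 1) * (t.G k * t.G (k + 1))) := by
          rw [h1]; simp only [mul_assoc]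
      _ = _ := by rw [h2]; simp only [mul_assoc]
  | succ j hj ih =>
    rw [bar_succ]
    have h1 := hX.far hj t.local_F
    have h2 : X k * t.G j = t.G j * X k :=
      hX.comm (t.G_mem (by omega) (by omega)) (t.G_mem (by omega) (by omega))
    calc X k * (t.F j * t.bar Y j * t.G j) = (X k * t.F j) * t.bar Y j * t.G j := by
          simp only [mul_assoc]
      _ = t.F j * (X k * t.bar Y j) * t.G j := by rw [h1]; simp only [mul_assoc]
      _ = t.F j * t.bar Y j * (X k * t.G j) := by rw [ih]; simp only [mul_assoc]
      _ = _ := by rw [h2]; simp only [mul_assoc]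

theorem bar_comm_lt (Y : Matrix (Fin N) (Fin N) A) {k j : ℕ} (h : j < k) :
    X k * t.bar Y j = t.bar Y j * X k :=
  hX.comm (bar_mem Y h) (bar_mem Y (by omega))

theorem bar_of_mat {Y Z : Matrix (Fin N) (Fin N) A} (h : t.mat Z = t.T 1 (t.bar Y 1 * X 0))
    (k : ℕ) : t.bar Z k = t.T (k + 1) (t.bar Y (k + 1) * X k) := by
  induction k with
  | zero => exact h
  | succ k ih =>
    have hZ : t.bar Y (k + 1) * X k ∈ t.away (k + 2) :=
      mul_mem (bar_mem Y (by omega)) (hX.mem (by omega) (by omega))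
    rw [bar_succ, ih, ← t.T_conj_F hZ, ← t.T_mul_left (t.F_mem (by omega) (by omega)),
      ← t.T_mul_right (t.G_mem (by omega) (by omega))]
    congr 1
    have h1 : t.F k * t.F (k + 1) * X k = X (k + 1) * (t.F k * t.F (k + 1)) := by
      rw [← hX.XFF', mul_assoc]
    have h2 : t.F k * t.bar Y (k + 2) = t.bar Y (k + 2) * t.F k := t.local_F.bar_comm Y (by omega)
    have h3 : t.F (k + 1) * t.bar Y (k + 1) = t.bar Y (k + 2) * t.F (k + 1) := by
      rw [bar_succ Y (k + 1), mul_assoc _ (t.G (k + 1)), t.G_F, mul_one]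
    have h4 : t.F k * t.F (k + 1) * t.G (k + 1) * t.G k = 1 := by
      rw [mul_assoc (t.F k), t.F_G, mul_one, t.F_G]
    calc t.F k * (t.F (k + 1) * (t.bar Y (k + 1) * X k) * t.G (k + 1)) * t.G k =
          t.F k * (t.F (k + 1) * t.bar Y (k + 1)) * X k * t.G (k + 1) * t.G k := by
          simp only [mul_assoc]
      _ = (t.F k * t.bar Y (k + 2)) * t.F (k + 1) * X k * t.G (k + 1) * t.G k := by
          rw [h3]; simp only [mul_assoc]
      _ = t.bar Y (k + 2) * (t.F k * t.F (k + 1) * X k) * t.G (k + 1) * t.G k := by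
          rw [h2]; simp only [mul_assoc]
      _ = t.bar Y (k + 2) * X (k + 1) * (t.F k * t.F (k + 1) * t.G (k + 1) * t.G k) := by
          rw [h1]; simp only [mul_assoc]
      _ = _ := by rw [h4, mul_one]

end Local

theorem bar_phi (Y : Matrix (Fin N) (Fin N) A) (k : ℕ) :
    t.bar (𝒟.phi Y) k = t.T (k + 1) (t.bar Y (k + 1) * t.R k) :=
  t.local_R.bar_of_mat (t.mat_phi Y) k

theorem bar_xi (Y : Matrix (Fin N) (Fin N) A) (k : ℕ) :
    t.bar (𝒟.xi Y) k = t.T (k + 1) (t.bar Y (k + 1) * t.K k) :=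
  t.local_K.bar_of_mat (t.mat_xi Y) k

theorem T_bar (Y : Matrix (Fin N) (Fin N) A) (k : ℕ) :
    t.T k (t.bar Y k) = t.scal (t.rtr Y) := by
  induction k with
  | zero => exact t.T_mat Y
  | succ k ih => rw [bar_succ, t.T_conj_F (bar_mem Y (by omega)), ih]

theorem T_cyc_Ri (k : ℕ) (Z : E) :
    t.T k (t.T (k + 1) (t.Ri k * Z)) = t.T k (t.T (k + 1) (Z * t.Ri k)) := by
  have h := t.T_cyc k (t.Ri k * Z * t.Ri k)
  rw [← mul_assoc, ← mul_assoc, t.bmw.R_Ri, one_mul, mul_assoc _ (t.Ri k), t.bmw.Ri_R,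
    mul_one] at h
  exact h.symm

theorem T_cyc_K (k : ℕ) (Z : E) :
    t.T k (t.T (k + 1) (t.K k * Z)) = t.T k (t.T (k + 1) (Z * t.K k)) := by
  have h : t.K k = 𝒟.lam⁻¹ • (t.Ri k - t.R k) + 1 := by
    rw [t.bmw.Ri_eq, eq_comm]
    have := t.bmw.lam_ne
    have e : t.R k - 𝒟.lam • 1 + 𝒟.lam • t.K k - t.R k = 𝒟.lam • (t.K k - 1) := by
      rw [smul_sub]; abel
    rw [e, inv_smul_smul₀ this, sub_add_cancel]
  rw [h]
  simp only [add_mul, mul_add, sub_mul, mul_sub, smul_mul_assoc, mul_smul_comm, map_add, map_sub,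
    map_smul, t.T_cyc, T_cyc_Ri, one_mul, mul_one]

theorem scal_comm {X : ℕ → E} (hX : t.Local X) (x : A) (k : ℕ) :
    X k * t.scal x = t.scal x * X k := hX.comm (t.scal_mem _ _) (t.scal_mem _ _)

/-- The double braiding identities with `B = R₂R₁R₃R₂`. -/
theorem rank_one {Y : E} (h2 : ∀ l, 2 ≤ l → Y ∈ t.away l) (hl : t.K 0 * Y = 𝒟.eta • Y)
    (hr : Y * t.K 0 = 𝒟.eta • Y) : (𝒟.μ * 𝒟.μ * 𝒟.eta) • Y = t.K 0 * t.T 0 (t.T 1 Y) := by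
  have b := t.bmw
  have c02 : t.K 0 * t.K 2 = t.K 2 * t.K 0 := t.local_K.far (by omega) t.local_K
  have cR02 : t.R 0 * t.R 2 = t.R 2 * t.R 0 := t.local_R.far (by omega) t.local_R
  have cRK : t.R 0 * t.K 2 = t.K 2 * t.R 0 := t.local_R.far (by omega) t.local_K
  have a1 : t.R 2 * t.R 1 * t.K 2 = t.K 1 * t.K 2 := (b.K0K1 1).symm
  have a2 : t.R 1 * t.R 0 * t.K 1 * t.K 0 = t.K 0 := by
    rw [mul_assoc, b.K1K0', ← mul_assoc, ← mul_assoc, mul_assoc (t.R 1), b.R_Ri, mul_one, b.R_Ri,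
      one_mul]
  have a3 : t.K 0 * t.K 1 * t.R 0 * t.R 1 = t.K 0 := by
    rw [b.K0K1_right', mul_assoc _ (t.Ri 0), b.Ri_R, mul_one, mul_assoc, b.Ri_R, mul_one]
  have hB1 : t.R 1 * t.R 0 * t.R 2 * t.R 1 * t.K 2 = t.K 0 * (t.R 1 * t.R 0 * t.R 2 * t.R 1) := by
    have e1 : t.R 2 * t.R 1 * t.K 2 = t.K 1 * t.R 2 * t.R 1 := b.R1R0K1 1
    have e2 : t.R 1 * t.R 0 * t.K 1 = t.K 0 * t.R 1 * t.R 0 := b.R1R0K1 0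
    calc _ = t.R 1 * t.R 0 * (t.R 2 * t.R 1 * t.K 2) := by simp only [mul_assoc]
      _ = (t.R 1 * t.R 0 * t.K 1) * t.R 2 * t.R 1 := by rw [e1]; simp only [mul_assoc]
      _ = _ := by rw [e2]; simp only [mul_assoc]
  have hB2 : t.R 1 * t.R 0 * t.R 2 * t.R 1 * (t.K 2 * t.K 0) = t.K 2 * t.K 0 := by
    calc _ = t.R 1 * t.R 0 * (t.R 2 * t.R 1 * t.K 2) * t.K 0 := by simp only [mul_assoc]
      _ = t.R 1 * t.R 0 * t.K 1 * (t.K 2 * t.K 0) := by rw [a1]; simp only [mul_assoc]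
      _ = _ := by rw [← c02, ← mul_assoc, a2]
  have hB3 : t.K 2 * t.K 0 * (t.R 1 * t.R 0 * t.R 2 * t.R 1) = t.K 2 * t.K 0 := by
    have e1 : t.K 2 * t.R 1 * t.R 2 = t.K 2 * t.K 1 := (b.K1K0_right 1).symm
    calc _ = t.K 0 * (t.K 2 * t.R 1 * t.R 2) * t.R 0 * t.R 1 := by
          rw [← c02, mul_assoc (t.R 1), cR02]; simp only [mul_assoc]
      _ = t.K 0 * t.K 2 * t.K 1 * t.R 0 * t.R 1 := by rw [e1]; simp only [mul_assoc]
      _ = t.K 2 * (t.K 0 * t.K 1 * t.R 0 * t.R 1) := by rw [c02]; simp only [mul_assoc]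
      _ = _ := by rw [a3]
  set B := t.R 1 * t.R 0 * t.R 2 * t.R 1 with hBdef
  set Bi := t.Ri 1 * t.Ri 2 * t.Ri 0 * t.Ri 1 with hBidef
  have hBBi : B * Bi = 1 := by
    rw [hBdef, hBidef]
    calc _ = t.R 1 * t.R 0 * t.R 2 * (t.R 1 * t.Ri 1) * t.Ri 2 * t.Ri 0 * t.Ri 1 := by
          simp only [mul_assoc]
      _ = t.R 1 * t.R 0 * (t.R 2 * t.Ri 2) * t.Ri 0 * t.Ri 1 := by
          rw [b.R_Ri, mul_one]; simp only [mul_assoc]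
      _ = t.R 1 * (t.R 0 * t.Ri 0) * t.Ri 1 := by rw [b.R_Ri, mul_one]; simp only [mul_assoc]
      _ = 1 := by rw [b.R_Ri, mul_one, b.R_Ri]
  have hB4 : t.K 2 * t.K 0 * Bi = t.K 2 * t.K 0 := by
    conv_lhs => rw [← hB3, mul_assoc, hBBi, mul_one]
  have hK2 : t.K 2 * Y = Y * t.K 2 := t.K_comm (h2 2 le_rfl) (h2 3 (by omega))
  have he := b.eta_ne
  have f1 : t.K 2 * Y = t.K 0 * B * Y := by
    refine smul_right_injective E he ?_
    change 𝒟.eta • (t.K 2 * Y) = 𝒟.eta • (t.K 0 * B * Y)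
    rw [← mul_smul_comm, ← hl, ← mul_assoc, ← hB2, mul_assoc B, mul_assoc (t.K 2), hl,
      mul_smul_comm, mul_smul_comm, ← mul_assoc, hB1]
  have f2 : t.K 2 * Y = t.K 2 * Y * Bi := by
    refine smul_right_injective E he ?_
    change 𝒟.eta • (t.K 2 * Y) = 𝒟.eta • (t.K 2 * Y * Bi)
    rw [← mul_smul_comm, ← smul_mul_assoc, ← mul_smul_comm, ← hr, ← mul_assoc, hK2,
      mul_assoc Y (t.K 2)]
    rw [mul_assoc Y, hB4]
  have f3 : t.K 2 * Y = t.K 0 * (B * Y * Bi) := by rw [f2, f1]; simp only [mul_assoc]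
  have f4 : t.T 2 (t.T 3 (t.K 2 * Y)) = t.T 2 (t.T 3 (t.K 0 * (B * Y * Bi))) := by rw [f3]
  have k0 : ∀ l, 2 ≤ l → t.K 0 ∈ t.away l := fun l h => t.K_mem (by omega) (by omega)
  rw [t.T_mul_right (h2 3 (by omega)), t.T_K, smul_mul_assoc, one_mul, map_smul,
    t.T_mul_left (k0 3 (by omega)), t.T_mul_left (k0 2 (by omega))] at f4
  have g1 : t.T 2 Y = (𝒟.μ * 𝒟.eta) • Y := by
    have := t.T_mul_right (h2 2 le_rfl) 1
    rw [one_mul, t.T_one, smul_mul_assoc, one_mul] at this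
    exact this
  rw [g1, smul_smul, ← mul_assoc] at f4
  rw [f4]
  congr 1
  have r01 : t.R 0 * t.R 1 * Y * t.Ri 1 * t.Ri 0 ∈ t.away 3 :=
    mul_mem (mul_mem (mul_mem (mul_mem (t.R_mem (by omega) (by omega))
      (t.R_mem (by omega) (by omega))) (h2 3 (by omega))) (t.Ri_mem (by omega) (by omega)))
      (t.Ri_mem (by omega) (by omega))
  have cRi02 : t.Ri 2 * t.Ri 0 = t.Ri 0 * t.Ri 2 := (t.local_Ri.far (by omega) t.local_Ri).symm
  have e1 : B * Y * Bi = t.R 1 * (t.R 2 * (t.R 0 * t.R 1 * Y * t.Ri 1 * t.Ri 0) * t.Ri 2) *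
      t.Ri 1 := by
    rw [hBdef, hBidef, mul_assoc (t.R 1) (t.R 0), cR02, mul_assoc (t.Ri 1) (t.Ri 2), cRi02]
    simp only [mul_assoc]
  have m1 : t.R 1 ∈ t.away 3 := t.R_mem (by omega) (by omega)
  have m1' : t.Ri 1 ∈ t.away 3 := t.Ri_mem (by omega) (by omega)
  have m0 : t.R 0 ∈ t.away 2 := t.R_mem (by omega) (by omega)
  have m0' : t.Ri 0 ∈ t.away 2 := t.Ri_mem (by omega) (by omega)
  rw [e1, t.T_mul_right m1', t.T_mul_left m1, t.T_conj_R r01, mul_assoc (t.R 0), mul_assoc (t.R 0),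
    t.T_mul_right m0', t.T_mul_left m0, t.T_conj_R (h2 2 le_rfl)]
  have m2 : t.R 0 * t.T 1 Y * t.Ri 0 ∈ t.away 2 :=
    mul_mem (mul_mem m0 (t.T_mem (h2 2 le_rfl))) m0'
  rw [t.T_conj_R m2, t.T_conj_R (t.T_mem_self 1 Y)]

/-- A matrix satisfying the relations of the quantum matrix algebra with an invertible
2-contraction `g`. -/
structure QM (t : Tower 𝒟 A E) (M : Matrix (Fin N) (Fin N) A) (g gi : A) : Prop where
  rel_zero : t.R 0 * (t.bar M 0 * t.bar M 1) = t.bar M 0 * t.bar M 1 * t.R 0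
  scal_g : t.scal g = 𝒟.eta⁻¹ • t.T 0 (t.T 1 (t.bar M 0 * t.bar M 1 * t.K 0))
  g_gi : g * gi = 1
  gi_g : gi * g = 1

namespace QM

variable {M : Matrix (Fin N) (Fin N) A} {g gi : A} (h : t.QM M g gi)
include h

theorem rel (k : ℕ) : t.R k * (t.bar M k * t.bar M (k + 1)) = t.bar M k * t.bar M (k + 1) * t.R k := by
  induction k with
  | zero => exact h.rel_zero
  | succ k ih =>
    set V := t.F k * t.F (k + 1) with hV
    set Vi := t.G (k + 1) * t.G k with hVi
    have e1 : V * Vi = 1 := by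
      rw [hV, hVi, mul_assoc, ← mul_assoc (t.F (k + 1)), t.F_G, one_mul, t.F_G]
    have c1 : t.R (k + 1) * V = V * t.R k := by rw [hV, ← mul_assoc, t.RFF']
    have c2 : t.bar M (k + 1) * V = V * t.bar M k := by
      have : t.F (k + 1) * t.bar M k = t.bar M k * t.F (k + 1) :=
        t.F_comm (bar_mem M (by omega)) (bar_mem M (by omega))
      rw [bar_succ, hV, mul_assoc (t.F k * _), ← mul_assoc (t.G k), t.G_F, one_mul, mul_assoc,
        ← this, mul_assoc]
    have c3 : t.bar M (k + 2) * V = V * t.bar M (k + 1) := by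
      rw [hV, ← mul_assoc, ← t.local_F.bar_comm M (by omega), bar_succ M (k + 1)]
      simp only [mul_assoc, t.G_F, mul_one]
    have e : t.R (k + 1) * (t.bar M (k + 1) * t.bar M (k + 2)) * V =
        t.bar M (k + 1) * t.bar M (k + 2) * t.R (k + 1) * V := by
      calc _ = t.R (k + 1) * (t.bar M (k + 1) * (t.bar M (k + 2) * V)) := by simp only [mul_assoc]
        _ = t.R (k + 1) * (t.bar M (k + 1) * V * t.bar M (k + 1)) := by
            rw [c3]; simp only [mul_assoc]
        _ = (t.R (k + 1) * V) * (t.bar M k * t.bar M (k + 1)) := by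
            rw [c2]; simp only [mul_assoc]
        _ = V * t.bar M k * t.bar M (k + 1) * t.R k := by
            rw [c1, mul_assoc, ih]; simp only [mul_assoc]
        _ = t.bar M (k + 1) * (V * t.bar M (k + 1)) * t.R k := by
            rw [← c2]; simp only [mul_assoc]
        _ = t.bar M (k + 1) * t.bar M (k + 2) * (V * t.R k) := by
            rw [← c3]; simp only [mul_assoc]
        _ = _ := by rw [← c1]; simp only [mul_assoc]
    calc _ = t.R (k + 1) * (t.bar M (k + 1) * t.bar M (k + 2)) * V * Vi := by
          rw [mul_assoc _ V, e1, mul_one]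
      _ = _ := by rw [e, mul_assoc _ V, e1, mul_one]

theorem rel_K (k : ℕ) :
    t.K k * (t.bar M k * t.bar M (k + 1)) = t.bar M k * t.bar M (k + 1) * t.K k := by
  rw [t.bmw.K_def]
  exact poly_intertwine (h.rel k)

theorem rel_Ri (k : ℕ) :
    t.Ri k * (t.bar M k * t.bar M (k + 1)) = t.bar M k * t.bar M (k + 1) * t.Ri k :=
  inv_intertwine (t.bmw.Ri_R k) (t.bmw.R_Ri k) (h.rel k)

theorem bar_bar_K : t.bar M 0 * t.bar M 1 * t.K 0 = (𝒟.μ * 𝒟.μ)⁻¹ • (t.K 0 * t.scal g) := by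
  have b := t.bmw
  have h1 := t.rank_one (Y := t.bar M 0 * t.bar M 1 * t.K 0)
    (fun l hl => mul_mem (mul_mem (bar_mem M (by omega)) (bar_mem M (by omega)))
      (t.K_mem (by omega) (by omega)))
    (by rw [← mul_assoc, h.rel_K, mul_assoc, b.K_K, mul_smul_comm])
    (by rw [mul_assoc, b.K_K, mul_smul_comm])
  have h2 : t.T 0 (t.T 1 (t.bar M 0 * t.bar M 1 * t.K 0)) = 𝒟.eta • t.scal g := by
    rw [h.scal_g, smul_inv_smul₀ b.eta_ne]
  rw [h2, mul_smul_comm, mul_comm, mul_smul] at h1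
  have h3 := smul_right_injective E b.eta_ne h1
  rw [← h3, inv_smul_smul₀ (mul_ne_zero b.μ_ne b.μ_ne)]

omit h in
theorem eq_zero_of_K_bar {Y : Matrix (Fin N) (Fin N) A} (h : t.K 0 * t.bar Y 1 = 0) : Y = 0 := by
  have b := t.bmw
  have h1 : t.K 1 * t.bar Y 2 = 0 := by
    have e : t.K 1 * t.bar Y 2 * (t.F 0 * t.F 1) = t.F 0 * t.F 1 * (t.K 0 * t.bar Y 1) := by
      have c3 : t.bar Y 2 * (t.F 0 * t.F 1) = t.F 0 * t.F 1 * t.bar Y 1 := by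
        rw [← mul_assoc, ← t.local_F.bar_comm Y (by omega), bar_succ Y 1]
        simp only [mul_assoc, t.G_F, mul_one]
      rw [mul_assoc, c3, ← mul_assoc, ← mul_assoc, t.local_K.XFF' 0]
      simp only [mul_assoc]
    rw [h, mul_zero] at e
    have e1 : t.F 0 * t.F 1 * (t.G 1 * t.G 0) = 1 := by
      rw [mul_assoc, ← mul_assoc (t.F 1), t.F_G, one_mul, t.F_G]
    rw [← mul_one (t.K 1 * _), ← e1, ← mul_assoc _ (t.F 0 * t.F 1), e, zero_mul]
  have h2 : t.K 0 * t.R 1 * t.bar Y 2 = 0 := by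
    have e : t.K 0 * t.K 1 * t.bar Y 2 = 0 := by rw [mul_assoc, h1, mul_zero]
    rw [b.K0K1_right, mul_assoc _ (t.R 0), t.local_R.bar_comm Y (by omega), ← mul_assoc] at e
    rw [← mul_one (t.K 0 * _ * _), ← b.R_Ri 0, ← mul_assoc, e, zero_mul]
  have h2' : t.K 0 * t.Ri 1 * t.bar Y 2 = 0 := by
    have e : t.K 0 * t.K 1 * t.bar Y 2 = 0 := by rw [mul_assoc, h1, mul_zero]
    rw [b.K0K1_right', mul_assoc _ (t.Ri 0), t.local_Ri.bar_comm Y (by omega), ← mul_assoc] at e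
    rw [← mul_one (t.K 0 * _ * _), ← b.Ri_R 0, ← mul_assoc, e, zero_mul]
  have h3 : t.bar Y 2 * t.K 0 = 0 := by
    have e : t.K 0 * (t.R 1 - t.Ri 1) * t.bar Y 2 = 0 := by rw [mul_sub, sub_mul, h2, h2', sub_zero]
    rw [b.R_sub_Ri, mul_smul_comm, smul_mul_assoc, mul_sub, sub_mul, mul_one,
      mul_assoc _ (t.K 1), h1, mul_zero, sub_zero] at e
    rw [← t.local_K.bar_comm Y (by omega)]
    exact (smul_eq_zero.1 e).resolve_left b.lam_ne
  have h4 : t.K 1 * t.bar Y 0 = 0 := by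
    have e1 : t.bar Y 2 * (t.F 1 * t.F 0) = t.F 1 * t.F 0 * t.bar Y 0 := by
      rw [bar_succ Y 1, bar_succ Y 0]
      simp only [mul_assoc]
      rw [← mul_assoc (t.G 1), t.G_F, one_mul, t.G_F, mul_one]
    have e : t.F 1 * t.F 0 * (t.K 1 * t.bar Y 0) = 0 := by
      rw [← mul_assoc, ← t.local_K.XFF 0, mul_assoc, mul_assoc, ← mul_assoc (t.F 1), ← e1,
        ← mul_assoc, t.local_K.bar_comm Y (by omega), h3, zero_mul]
    have e2 : t.G 0 * t.G 1 * (t.F 1 * t.F 0) = 1 := by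
      rw [mul_assoc, ← mul_assoc (t.G 1), t.G_F, one_mul, t.G_F]
    rw [← one_mul (t.K 1 * _), ← e2, mul_assoc, e, mul_zero]
  have h5 := congrArg (t.T 2) h4
  rw [t.T_mul_right (bar_mem Y (by omega)), t.T_K, smul_mul_assoc, one_mul, map_zero] at h5
  exact bar_eq_zero ((smul_eq_zero.1 h5).resolve_left b.μ_ne)

theorem eq_zero_of_mul {Y : Matrix (Fin N) (Fin N) A} (hY : M * Y = 0) : Y = 0 := by
  refine eq_zero_of_K_bar (t := t) ?_
  have b := t.bmw
  have e : t.bar M 0 * t.bar M 1 * t.K 0 * t.bar Y 1 = 0 := by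
    rw [← h.rel_K, mul_assoc, mul_assoc, ← bar_mul, hY]
    have : t.bar (0 : Matrix (Fin N) (Fin N) A) 1 = 0 := by
      rw [bar_succ, bar_zero, map_zero, mul_zero, zero_mul]
    rw [this]; simp
  rw [h.bar_bar_K, smul_mul_assoc] at e
  have e1 := (smul_eq_zero.1 e).resolve_left (inv_ne_zero (mul_ne_zero b.μ_ne b.μ_ne))
  rw [scal_comm t.local_K, mul_assoc] at e1
  rw [← one_mul (t.K 0 * _), ← map_one t.scal, ← h.gi_g, map_mul, mul_assoc, e1, mul_zero]

end QM

end Tower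

namespace Tower

variable {N : ℕ} {𝒟 : QMData N} {A E : Type} [Ring A] [Algebra ℂ A] [Ring E] [Algebra ℂ E]
variable (t : Tower 𝒟 A E)

/-- The iterated trace `T_k ⋯ T_{k+n-1}`. -/
def trs (k : ℕ) : ℕ → E →ₗ[ℂ] E
  | 0 => LinearMap.id
  | n + 1 => trs k n ∘ₗ t.T (k + n)

/-- The image of the group algebra of the braid group on the legs `k, …, k + n - 1`. -/
def B (k n : ℕ) : Subalgebra ℂ E :=
  Algebra.adjoin ℂ {x | ∃ i, k ≤ i ∧ i + 1 < k + n ∧ (x = t.R i ∨ x = t.Ri i)}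

/-- The product `M_{\bar k} ⋯ M_{\overline{k+n-1}}` of copies of a matrix. -/
def prod (M : Matrix (Fin N) (Fin N) A) (k : ℕ) : ℕ → E
  | 0 => 1
  | n + 1 => prod M k n * t.bar M (k + n)

/-- `R_{n-1} ⋯ R_1 R_0`. -/
def u : ℕ → E
  | 0 => 1
  | n + 1 => t.R n * u n

/-- `R_0^{-1} ⋯ R_{n-1}^{-1}`. -/
def ui : ℕ → E
  | 0 => 1
  | n + 1 => ui n * t.Ri n

/-- `F_k ⋯ F_{k+n-1}`. -/
def U (k : ℕ) : ℕ → E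
  | 0 => 1
  | n + 1 => U k n * t.F (k + n)

/-- The inverse of `U`. -/
def Ui (k : ℕ) : ℕ → E
  | 0 => 1
  | n + 1 => t.G (k + n) * Ui k n

variable {t}

theorem trs_zero (k : ℕ) (Z : E) : t.trs k 0 Z = Z := rfl

theorem trs_succ (k n : ℕ) (Z : E) : t.trs k (n + 1) Z = t.trs k n (t.T (k + n) Z) := rfl

theorem trs_one (k : ℕ) (Z : E) : t.trs k 1 Z = t.T k Z := rfl

theorem trs_add (k m n : ℕ) (Z : E) : t.trs k (m + n) Z = t.trs k m (t.trs (k + m) n Z) := by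
  induction n generalizing Z with
  | zero => rfl
  | succ n ih => rw [← add_assoc, trs_succ, ih, trs_succ, add_assoc]

theorem trs_succ' (k n : ℕ) (Z : E) : t.trs k (n + 1) Z = t.T k (t.trs (k + 1) n Z) := by
  rw [add_comm, trs_add, trs_one]

theorem trs_mul_left {k n : ℕ} {X : E} (hX : ∀ l, k ≤ l → l < k + n → X ∈ t.away l) (Z : E) :
    t.trs k n (X * Z) = X * t.trs k n Z := by
  induction n generalizing Z with
  | zero => rfl
  | succ n ih =>
    rw [trs_succ, t.T_mul_left (hX _ (by omega) (by omega)),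
      ih fun l h h' => hX l h (by omega), trs_succ]

theorem trs_mul_right {k n : ℕ} {X : E} (hX : ∀ l, k ≤ l → l < k + n → X ∈ t.away l) (Z : E) :
    t.trs k n (Z * X) = t.trs k n Z * X := by
  induction n generalizing Z with
  | zero => rfl
  | succ n ih =>
    rw [trs_succ, t.T_mul_right (hX _ (by omega) (by omega)),
      ih fun l h h' => hX l h (by omega), trs_succ]

theorem trs_mem {k n l : ℕ} {Z : E} (h : Z ∈ t.away l ∨ (k ≤ l ∧ l < k + n)) :
    t.trs k n Z ∈ t.away l := by
  induction n generalizing Z with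
  | zero =>
    rcases h with h | h
    · exact h
    · omega
  | succ n ih =>
    rw [trs_succ]
    refine ih ?_
    rcases h with h | h
    · exact Or.inl (t.T_mem h)
    · by_cases hl : l = k + n
      · left; rw [hl]; exact t.T_mem_self _ _
      · right; omega

theorem trs_factor {k n i : ℕ} (h : k ≤ i) (h' : i + 1 < k + n) :
    ∃ Φ : E →ₗ[ℂ] E, ∀ Z, t.trs k n Z = Φ (t.T i (t.T (i + 1) Z)) := by
  induction n with
  | zero => omega
  | succ n ih =>
    by_cases hn : i + 1 < k + n
    · obtain ⟨Φ, hΦ⟩ := ih hn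
      refine ⟨Φ ∘ₗ t.T (k + n), fun Z => ?_⟩
      rw [trs_succ, hΦ, LinearMap.comp_apply, t.T_comm (i + 1), t.T_comm i]
    · obtain ⟨m, rfl⟩ : ∃ m, n = m + 1 := ⟨n - 1, by omega⟩
      obtain rfl : i = k + m := by omega
      exact ⟨t.trs k m, fun Z => by rw [trs_succ, trs_succ, add_assoc]⟩

theorem R_mem_B {k n i : ℕ} (h : k ≤ i) (h' : i + 1 < k + n) : t.R i ∈ t.B k n :=
  Algebra.subset_adjoin ⟨i, h, h', Or.inl rfl⟩

theorem Ri_mem_B {k n i : ℕ} (h : k ≤ i) (h' : i + 1 < k + n) : t.Ri i ∈ t.B k n :=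
  Algebra.subset_adjoin ⟨i, h, h', Or.inr rfl⟩

theorem K_mem_B {k n i : ℕ} (h : k ≤ i) (h' : i + 1 < k + n) : t.K i ∈ t.B k n := by
  rw [t.bmw.K_def]
  exact Subalgebra.smul_mem _ (mul_mem (sub_mem (Subalgebra.smul_mem _ (one_mem _) _)
    (R_mem_B h h')) (add_mem (Subalgebra.smul_mem _ (one_mem _) _) (R_mem_B h h'))) _

theorem B_mono {k n k' n' : ℕ} (h : k' ≤ k) (h' : k + n ≤ k' + n') : t.B k n ≤ t.B k' n' := by
  refine Algebra.adjoin_mono ?_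
  rintro x ⟨i, hi, hi', hx⟩
  exact ⟨i, by omega, by omega, hx⟩

theorem B_le {k n : ℕ} {S : Subalgebra ℂ E} (h : ∀ i, k ≤ i → i + 1 < k + n → t.R i ∈ S)
    (h' : ∀ i, k ≤ i → i + 1 < k + n → t.Ri i ∈ S) : t.B k n ≤ S := by
  refine Algebra.adjoin_le ?_
  rintro x ⟨i, hi, hi', rfl | rfl⟩
  · exact h i hi hi'
  · exact h' i hi hi'

theorem B_le_away {k n l : ℕ} (h : l < k ∨ k + n ≤ l) : t.B k n ≤ t.away l :=
  B_le (fun _ _ _ => t.R_mem (by omega) (by omega)) fun _ _ _ => t.Ri_mem (by omega) (by omega)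

theorem B_le_J {k n m : ℕ} (h : k + n ≤ m) : t.B k n ≤ t.J m :=
  B_le (fun _ _ _ => t.R_mem_J (by omega)) fun _ _ _ => t.Ri_mem_J (by omega)

theorem B_comm {k n : ℕ} {Z : E} (h : ∀ i, k ≤ i → i + 1 < k + n → t.R i * Z = Z * t.R i) {b : E}
    (hb : b ∈ t.B k n) : b * Z = Z * b := by
  have : t.B k n ≤ Subalgebra.centralizer ℂ {Z} := by
    refine B_le (fun i hi hi' => ?_) fun i hi hi' => ?_
    · rw [Subalgebra.mem_centralizer_iff]
      rintro _ rfl; exact (h i hi hi').symm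
    · rw [Subalgebra.mem_centralizer_iff]
      rintro _ rfl
      exact (inv_intertwine (t.bmw.Ri_R i) (t.bmw.R_Ri i) (h i hi hi')).symm
  exact ((Subalgebra.mem_centralizer_iff ℂ).1 (this hb) Z rfl).symm

theorem B_comm_away {k n : ℕ} {Z : E} (h : ∀ l, k ≤ l → l < k + n → Z ∈ t.away l) {b : E}
    (hb : b ∈ t.B k n) : b * Z = Z * b :=
  B_comm (fun i hi hi' => t.R_comm (h i hi (by omega)) (h (i + 1) (by omega) hi')) hb

theorem B_comm_bar (Y : Matrix (Fin N) (Fin N) A) {k n j : ℕ} (h : k + n ≤ j ∨ j < k) {b : E}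
    (hb : b ∈ t.B k n) : b * t.bar Y j = t.bar Y j * b := by
  refine B_comm (fun i hi hi' => ?_) hb
  rcases h with h | h
  · exact t.local_R.bar_comm Y (by omega)
  · exact t.local_R.bar_comm_lt Y (by omega)

theorem sh_mem_B {k n : ℕ} {b : E} (hb : b ∈ t.B k n) : t.sh b ∈ t.B (k + 1) n := by
  have : t.B k n ≤ (t.B (k + 1) n).comap t.sh := by
    refine B_le (fun i hi hi' => ?_) fun i hi hi' => ?_
    · rw [Subalgebra.mem_comap, t.sh_R]; exact R_mem_B (by omega) (by omega)
    · rw [Subalgebra.mem_comap, t.sh_Ri]; exact Ri_mem_B (by omega) (by omega)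
  exact this hb

theorem sh_iterate_mem_B {k n : ℕ} (m : ℕ) {b : E} (hb : b ∈ t.B k n) :
    t.sh^[m] b ∈ t.B (k + m) n := by
  induction m with
  | zero => exact hb
  | succ m ih => rw [Function.iterate_succ_apply']; exact sh_mem_B ih

theorem exists_sh {k n : ℕ} {b : E} (hb : b ∈ t.B (k + 1) n) : ∃ c ∈ t.B k n, t.sh c = b := by
  have : t.B (k + 1) n ≤ (t.B k n).map t.sh := by
    refine B_le (fun i hi hi' => ?_) fun i hi hi' => ?_
    · obtain ⟨i, rfl⟩ : ∃ j, i = j + 1 := ⟨i - 1, by omega⟩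
      exact ⟨t.R i, R_mem_B (by omega) (by omega), t.sh_R i⟩
    · obtain ⟨i, rfl⟩ : ∃ j, i = j + 1 := ⟨i - 1, by omega⟩
      exact ⟨t.Ri i, Ri_mem_B (by omega) (by omega), t.sh_Ri i⟩
  exact this hb

/-- Cyclicity of the iterated traces. -/
theorem trs_cyc {k n k' n' : ℕ} (h : k ≤ k') (h' : k' + n' ≤ k + n) {b : E} (hb : b ∈ t.B k' n')
    (Z : E) : t.trs k n (b * Z) = t.trs k n (Z * b) := by
  let S : Subalgebra ℂ E :=
    { carrier := {b | ∀ Z, t.trs k n (b * Z) = t.trs k n (Z * b)}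
      mul_mem' := fun {a b} ha hb Z => by rw [mul_assoc, ha, mul_assoc, hb, mul_assoc]
      add_mem' := fun {a b} ha hb Z => by rw [add_mul, mul_add, map_add, map_add, ha, hb]
      algebraMap_mem' := fun c Z => by rw [Algebra.commutes] }
  have : t.B k' n' ≤ S := by
    refine B_le (fun i hi hi' Z => ?_) fun i hi hi' Z => ?_
    · obtain ⟨Φ, hΦ⟩ := t.trs_factor (k := k) (n := n) (i := i) (by omega) (by omega)
      rw [hΦ, hΦ, t.T_cyc]
    · obtain ⟨Φ, hΦ⟩ := t.trs_factor (k := k) (n := n) (i := i) (by omega) (by omega)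
      rw [hΦ, hΦ, T_cyc_Ri]
  exact this hb Z

theorem u_mem (n : ℕ) : t.u n ∈ t.B 0 (n + 1) := by
  induction n with
  | zero => exact one_mem _
  | succ n ih => exact mul_mem (R_mem_B (by omega) (by omega)) (B_mono le_rfl (by omega) ih)

theorem ui_mem (n : ℕ) : t.ui n ∈ t.B 0 (n + 1) := by
  induction n with
  | zero => exact one_mem _
  | succ n ih => exact mul_mem (B_mono le_rfl (by omega) ih) (Ri_mem_B (by omega) (by omega))

theorem ui_mul_u (n : ℕ) : t.ui n * t.u n = 1 := by
  induction n with
  | zero => exact one_mul 1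
  | succ n ih => rw [ui, u, mul_assoc, ← mul_assoc (t.Ri n), t.bmw.Ri_R, one_mul, ih]

theorem u_mul_ui (n : ℕ) : t.u n * t.ui n = 1 := by
  induction n with
  | zero => exact one_mul 1
  | succ n ih => rw [ui, u, mul_assoc, ← mul_assoc (t.u n), ih, one_mul, t.bmw.R_Ri]

theorem R_mul_u {i n : ℕ} (h : i + 1 < n) : t.R i * t.u n = t.u n * t.R (i + 1) := by
  induction n with
  | zero => omega
  | succ n ih =>
    by_cases hn : i + 1 < n
    · rw [u, ← mul_assoc, t.local_R.far (by omega) t.local_R, mul_assoc, ih hn, mul_assoc]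
    · obtain rfl : n = i + 1 := by omega
      have hc : t.u i * t.R (i + 1) = t.R (i + 1) * t.u i :=
        B_comm_away (fun l h h' => t.R_mem (by omega) (by omega)) (u_mem i)
      calc t.R i * t.u (i + 1 + 1) = t.R i * t.R (i + 1) * t.R i * t.u i := by
            simp only [u, mul_assoc]
        _ = t.R (i + 1) * t.R i * (t.R (i + 1) * t.u i) := by
            rw [t.bmw.braid]; simp only [mul_assoc]
        _ = _ := by rw [← hc]; simp only [u, mul_assoc]

theorem B_intertwine {k n : ℕ} {v : E} (σ : E →ₐ[ℂ] E)
    (h : ∀ i, k ≤ i → i + 1 < k + n → t.R i * v = v * σ (t.R i))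
    {b : E} (hb : b ∈ t.B k n) : b * v = v * σ b := by
  let S : Subalgebra ℂ E :=
    { carrier := {b | b * v = v * σ b}
      mul_mem' := fun {a b} ha hb => by
        change a * b * v = v * σ (a * b)
        rw [map_mul, mul_assoc, hb, ← mul_assoc, ha, mul_assoc]
      add_mem' := fun {a b} ha hb => by
        change (a + b) * v = v * σ (a + b)
        rw [add_mul, ha, hb, map_add, mul_add]
      algebraMap_mem' := fun c => by
        change _ * v = v * σ _
        rw [AlgHom.commutes, Algebra.commutes] }
  have : t.B k n ≤ S := by
    refine B_le h fun i hi hi' => inv_intertwine (t.bmw.Ri_R i) ?_ (h i hi hi')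
    rw [← map_mul, t.bmw.R_Ri, map_one]
  exact this hb

theorem mul_u {n : ℕ} {b : E} (hb : b ∈ t.B 0 n) : b * t.u n = t.u n * t.sh b :=
  B_intertwine t.sh (fun i _ hi => by rw [t.sh_R, R_mul_u (by omega)]) hb

theorem u_succ' (n : ℕ) : t.u (n + 1) = t.sh (t.u n) * t.R 0 := by
  induction n with
  | zero => simp [u]
  | succ n ih =>
    calc t.u (n + 1 + 1) = t.R (n + 1) * (t.sh (t.u n) * t.R 0) := by rw [← ih]; rfl
      _ = t.sh (t.R n * t.u n) * t.R 0 := by rw [map_mul, t.sh_R, mul_assoc]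

theorem U_mul_Ui (k n : ℕ) : t.U k n * t.Ui k n = 1 := by
  induction n with
  | zero => exact one_mul 1
  | succ n ih => rw [Ui, U, mul_assoc, ← mul_assoc (t.F _), t.F_G, one_mul, ih]

theorem U_mem {k n l : ℕ} (h : l < k ∨ k + n < l) : t.U k n ∈ t.away l := by
  induction n with
  | zero => exact one_mem _
  | succ n ih => exact mul_mem (ih (by omega)) (t.F_mem (by omega) (by omega))

theorem Ui_mem {k n l : ℕ} (h : l < k ∨ k + n < l) : t.Ui k n ∈ t.away l := by
  induction n with
  | zero => exact one_mem _
  | succ n ih => exact mul_mem (t.G_mem (by omega) (by omega)) (ih (by omega))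

theorem U_bar (Y : Matrix (Fin N) (Fin N) A) {k m j : ℕ} (h : k ≤ j) (h' : j < k + m) :
    t.U k m * t.bar Y j = t.bar Y (j + 1) * t.U k m := by
  induction m with
  | zero => omega
  | succ m ih =>
    by_cases hj : j < k + m
    · have : t.F (k + m) * t.bar Y j = t.bar Y j * t.F (k + m) :=
        t.local_F.bar_comm_lt Y hj
      rw [U, mul_assoc, this, ← mul_assoc, ih hj, mul_assoc]
    · obtain rfl : j = k + m := by omega
      have h3 : t.F (k + m) * t.bar Y (k + m) = t.bar Y (k + m + 1) * t.F (k + m) := by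
        rw [bar_succ Y (k + m), mul_assoc _ (t.G _), t.G_F, mul_one]
      have h4 : ∀ p, p ≤ m → t.U k p * t.bar Y (k + m + 1) = t.bar Y (k + m + 1) * t.U k p := by
        intro p hp
        induction p with
        | zero => rw [U, one_mul, mul_one]
        | succ p ihp =>
          rw [U, mul_assoc, t.local_F.bar_comm Y (by omega), ← mul_assoc, ihp (by omega), mul_assoc]
      rw [U, mul_assoc, h3, ← mul_assoc, h4 m le_rfl, mul_assoc]

theorem U_R {k m i : ℕ} (h : k ≤ i) (h' : i + 1 < k + m) :
    t.U k m * t.R i = t.R (i + 1) * t.U k m := by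
  induction m with
  | zero => omega
  | succ m ih =>
    by_cases hi : i + 1 < k + m
    · rw [U, mul_assoc, ← t.local_R.far (by omega) t.local_F, ← mul_assoc, ih hi, mul_assoc]
    · obtain ⟨m, rfl⟩ : ∃ p, m = p + 1 := ⟨m - 1, by omega⟩
      obtain rfl : i = k + m := by omega
      have hc : t.R (k + m + 1) * t.U k m = t.U k m * t.R (k + m + 1) :=
        t.R_comm (U_mem (by omega)) (U_mem (by omega))
      calc t.U k (m + 1 + 1) * t.R (k + m) = t.U k m * (t.F (k + m) * t.F (k + m + 1) *
            t.R (k + m)) := by simp only [U, mul_assoc, add_assoc]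
        _ = (t.U k m * t.R (k + m + 1)) * t.F (k + m) * t.F (k + m + 1) := by
            rw [← t.RFF']; simp only [mul_assoc]
        _ = _ := by rw [← hc]; simp only [U, mul_assoc, add_assoc]

theorem U_B {k m n : ℕ} (hn : n ≤ m) {b : E} (hb : b ∈ t.B k n) :
    t.U k m * b = t.sh b * t.U k m := by
  let S : Subalgebra ℂ E :=
    { carrier := {b | t.U k m * b = t.sh b * t.U k m}
      mul_mem' := fun {a b} ha hb => by
        change t.U k m * (a * b) = t.sh (a * b) * t.U k m
        rw [map_mul, ← mul_assoc, ha, mul_assoc, hb, mul_assoc]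
      add_mem' := fun {a b} ha hb => by
        change t.U k m * (a + b) = t.sh (a + b) * t.U k m
        rw [mul_add, ha, hb, map_add, add_mul]
      algebraMap_mem' := fun c => by
        change t.U k m * _ = t.sh _ * _
        rw [AlgHom.commutes, Algebra.commutes] }
  have : t.B k n ≤ S := by
    refine B_le (fun i hi hi' => ?_) fun i hi hi' => ?_
    · change t.U k m * t.R i = _
      rw [t.sh_R, U_R hi (by omega)]
    · change t.U k m * t.Ri i = _
      rw [t.sh_Ri]
      exact (inv_intertwine (t.bmw.Ri_R _) (t.bmw.R_Ri _) (U_R hi (by omega)).symm).symm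
  exact this hb

theorem prod_succ (M : Matrix (Fin N) (Fin N) A) (k n : ℕ) :
    t.prod M k (n + 1) = t.prod M k n * t.bar M (k + n) := rfl

theorem prod_add (M : Matrix (Fin N) (Fin N) A) (k m n : ℕ) :
    t.prod M k (m + n) = t.prod M k m * t.prod M (k + m) n := by
  induction n with
  | zero => exact (mul_one _).symm
  | succ n ih => rw [← add_assoc, prod_succ, ih, prod_succ, mul_assoc, add_assoc]

theorem prod_succ' (M : Matrix (Fin N) (Fin N) A) (k n : ℕ) :
    t.prod M k (n + 1) = t.bar M k * t.prod M (k + 1) n := by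
  rw [add_comm, prod_add]
  congr 1
  exact one_mul _

theorem prod_mem (M : Matrix (Fin N) (Fin N) A) {k n l : ℕ} (h : k + n ≤ l) :
    t.prod M k n ∈ t.away l := by
  induction n with
  | zero => exact one_mem _
  | succ n ih => exact mul_mem (ih (by omega)) (bar_mem M (by omega))

theorem U_prod (M : Matrix (Fin N) (Fin N) A) {k m n : ℕ} (h : n ≤ m) :
    t.U k m * t.prod M k n = t.prod M (k + 1) n * t.U k m := by
  induction n with
  | zero => rw [prod, prod, one_mul, mul_one]
  | succ n ih =>
    rw [prod_succ, prod_succ, ← mul_assoc, ih (by omega), mul_assoc, U_bar M (by omega) (by omega),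
      ← mul_assoc, add_right_comm k 1 n]

theorem bar_mem_J (Y : Matrix (Fin N) (Fin N) A) {k n : ℕ} (h : k < n) : t.bar Y k ∈ t.J n := by
  induction k with
  | zero => exact t.mat_mem_J Y (by omega)
  | succ k ih =>
    exact mul_mem (mul_mem (t.F_mem_J (by omega)) (ih (by omega))) (t.G_mem_J (by omega))

theorem prod_mem_J (M : Matrix (Fin N) (Fin N) A) {k n m : ℕ} (h : k + n ≤ m) :
    t.prod M k n ∈ t.J m := by
  induction n with
  | zero => exact one_mem _
  | succ n ih => exact mul_mem (ih (by omega)) (bar_mem_J M (by omega))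

theorem trs_mem_J {k n : ℕ} {Z : E} (h : Z ∈ t.J (k + n)) : t.trs k n Z ∈ t.J k := by
  induction n generalizing Z with
  | zero => exact h
  | succ n ih => exact ih (t.T_mem_J h)

theorem F_trs_G {k n : ℕ} {Z : E} (hZ : ∀ l, k + n < l → Z ∈ t.away l) :
    t.F k * t.trs (k + 1) n Z * t.G k = t.trs (k + 2) n (t.U k (n + 1) * Z * t.Ui k (n + 1)) := by
  induction n generalizing Z with
  | zero => simp [U, Ui, trs_zero]
  | succ n ih =>
    have h1 : t.U k (n + 1) ∈ t.away (k + n + 2) := U_mem (by omega)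
    have h2 : t.Ui k (n + 1) ∈ t.away (k + n + 2) := Ui_mem (by omega)
    rw [trs_succ, ih, show k + 1 + n = k + n + 1 by omega, ← t.T_conj_F (hZ _ (by omega)),
      ← t.T_mul_left h1, ← t.T_mul_right h2, trs_succ, show k + 2 + n = k + n + 2 by omega,
      show t.U k (n + 1 + 1) = t.U k (n + 1) * t.F (k + n + 1) from rfl,
      show t.Ui k (n + 1 + 1) = t.G (k + n + 1) * t.Ui k (n + 1) from rfl]
    · simp only [mul_assoc]
    · intro l hl
      by_cases hl' : l = k + 1 + n
      · rw [hl']; exact t.T_mem_self _ _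
      · exact t.T_mem (hZ l (by omega))

theorem trs_shift {k n : ℕ} {Z : E} (hZ : ∀ l, k + n ≤ l → Z ∈ t.away l) :
    t.trs (k + 1) n (t.U k n * Z * t.Ui k n) = t.trs k n Z := by
  cases n with
  | zero => simp [U, Ui, trs_zero]
  | succ n =>
    rw [trs_succ', ← F_trs_G fun l hl => hZ l (by omega), trs_succ', t.T_conj_F]
    by_cases hn : n = 0
    · subst hn; exact hZ _ le_rfl
    · exact trs_mem (Or.inr ⟨le_rfl, by omega⟩)

theorem U_conj (M : Matrix (Fin N) (Fin N) A) {k m n : ℕ} (h : n ≤ m) {b : E} (hb : b ∈ t.B k n) :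
    t.U k m * (t.prod M k n * b) * t.Ui k m = t.prod M (k + 1) n * t.sh b := by
  rw [← mul_assoc, U_prod M h, mul_assoc (t.prod M (k + 1) n), U_B h hb, mul_assoc, mul_assoc,
    U_mul_Ui, mul_one]

/-- The copies of `M^b`. -/
theorem bar_pow {M Y : Matrix (Fin N) (Fin N) A} {n : ℕ} {b : E} (hb : b ∈ t.B 0 (n + 1))
    (hY : t.mat Y = t.trs 1 n (t.prod M 0 (n + 1) * b)) (k : ℕ) :
    t.bar Y k = t.trs (k + 1) n (t.prod M k (n + 1) * t.sh^[k] b) := by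
  induction k with
  | zero => exact hY
  | succ k ih =>
    have hb' : t.sh^[k] b ∈ t.B k (n + 1) := by
      have := sh_iterate_mem_B k hb
      rwa [zero_add] at this
    rw [bar_succ, ih, F_trs_G, U_conj M le_rfl hb', Function.iterate_succ_apply']
    intro l hl
    exact mul_mem (prod_mem M (by omega)) (B_le_away (by omega) hb')

theorem trs_prod_shift (M : Matrix (Fin N) (Fin N) A) {n : ℕ} {b : E} (hb : b ∈ t.B 0 n) (k : ℕ) :
    t.trs k n (t.prod M k n * t.sh^[k] b) = t.trs 0 n (t.prod M 0 n * b) := by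
  induction k with
  | zero => rfl
  | succ k ih =>
    have hb' : t.sh^[k] b ∈ t.B k n := by
      have := sh_iterate_mem_B k hb
      rwa [zero_add] at this
    rw [← ih, Function.iterate_succ_apply', ← U_conj M le_rfl hb', trs_shift]
    intro l hl
    exact mul_mem (prod_mem M (by omega)) (B_le_away (by omega) hb')

end Tower

/-- `Y ↦ M · φ(Y)`. -/
def QMData.mulS {N : ℕ} (𝒟 : QMData N) {A : Type} [Ring A] [Algebra ℂ A]
    (M Y : Matrix (Fin N) (Fin N) A) : Matrix (Fin N) (Fin N) A := M * 𝒟.phi Y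

/-- `Y ↦ M · ξ(Y)`. -/
def QMData.mulTop {N : ℕ} (𝒟 : QMData N) {A : Type} [Ring A] [Algebra ℂ A]
    (M Y : Matrix (Fin N) (Fin N) A) : Matrix (Fin N) (Fin N) A := M * 𝒟.xi Y

namespace Tower

variable {N : ℕ} {𝒟 : QMData N} {A E : Type} [Ring A] [Algebra ℂ A] [Ring E] [Algebra ℂ E]
variable {t : Tower 𝒟 A E}

section Generic

variable (M : Matrix (Fin N) (Fin N) A)

theorem bar_S (Y : Matrix (Fin N) (Fin N) A) (k : ℕ) :
    t.bar (𝒟.mulS M Y) k = t.T (k + 1) (t.bar M k * t.bar Y (k + 1) * t.R k) := by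
  rw [QMData.mulS, bar_mul, bar_phi, ← t.T_mul_left (bar_mem M (by omega)), mul_assoc]

theorem bar_top (Y : Matrix (Fin N) (Fin N) A) (k : ℕ) :
    t.bar (𝒟.mulTop M Y) k = t.T (k + 1) (t.bar M k * t.bar Y (k + 1) * t.K k) := by
  rw [QMData.mulTop, bar_mul, bar_xi, ← t.T_mul_left (bar_mem M (by omega)), mul_assoc]

variable {M}

theorem bar_comp {f g : Matrix (Fin N) (Fin N) A → Matrix (Fin N) (Fin N) A} {X X' : ℕ → E}
    (hX : t.Local X)
    (hf : ∀ Y k, t.bar (f Y) k = t.T (k + 1) (t.bar M k * t.bar Y (k + 1) * X k))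
    (hg : ∀ Y k, t.bar (g Y) k = t.T (k + 1) (t.bar M k * t.bar Y (k + 1) * X' k))
    (Y : Matrix (Fin N) (Fin N) A) (k : ℕ) :
    t.bar (f (g Y)) k = t.T (k + 1) (t.T (k + 2)
      (t.bar M k * t.bar M (k + 1) * t.bar Y (k + 2) * (X' (k + 1) * X k))) := by
  rw [hf, hg, ← t.T_mul_left (bar_mem M (by omega)),
    ← t.T_mul_right (hX.mem (by omega) (by omega))]
  simp only [mul_assoc]

theorem bar_comp₃ {f g h : Matrix (Fin N) (Fin N) A → Matrix (Fin N) (Fin N) A} {X X' X'' : ℕ → E}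
    (hX : t.Local X) (hX' : t.Local X')
    (hf : ∀ Y k, t.bar (f Y) k = t.T (k + 1) (t.bar M k * t.bar Y (k + 1) * X k))
    (hg : ∀ Y k, t.bar (g Y) k = t.T (k + 1) (t.bar M k * t.bar Y (k + 1) * X' k))
    (hh : ∀ Y k, t.bar (h Y) k = t.T (k + 1) (t.bar M k * t.bar Y (k + 1) * X'' k))
    (Y : Matrix (Fin N) (Fin N) A) :
    t.mat (f (g (h Y))) = t.T 1 (t.T 2 (t.T 3
      (t.bar M 0 * t.bar M 1 * t.bar M 2 * t.bar Y 3 * (X'' 2 * X' 1 * X 0)))) := by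
  have := bar_comp hX hf hg (h Y) 0
  rw [bar_zero] at this
  rw [this, hh, ← t.T_mul_left (mul_mem (bar_mem M (by omega)) (bar_mem M (by omega))),
    ← t.T_mul_right (mul_mem (hX'.mem (by omega) (by omega)) (hX.mem (by omega) (by omega)))]
  simp only [mul_assoc]

theorem mulS_one (t : Tower 𝒟 A E) : 𝒟.mulS M 1 = M := by
  refine t.mat_injective ?_
  rw [← bar_zero, bar_S, bar_one, mul_one, t.T_mul_left (bar_mem M (by omega)), t.T_R, mul_one]
  rfl

theorem mulTop_one (t : Tower 𝒟 A E) : 𝒟.mulTop M 1 = 𝒟.μ • M := by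
  refine t.mat_injective ?_
  rw [← bar_zero, bar_top, bar_one, mul_one, t.T_mul_left (bar_mem M (by omega)), t.T_K,
    mul_smul_comm, mul_one, map_smul]
  rfl

theorem mulS_map (t : Tower 𝒟 A E) (Y : Matrix (Fin N) (Fin N) A) (c : A) :
    𝒟.mulS M (Y.map (· * c)) = (𝒟.mulS M Y).map (· * c) := by
  refine t.mat_injective ?_
  rw [t.mat_map, ← bar_zero, ← bar_zero, bar_S, bar_S, bar_map,
    ← t.T_mul_right (t.scal_mem _ _), mul_assoc _ _ (t.scal c), scal_comm t.local_R]
  simp only [mul_assoc]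

theorem mulTop_map (t : Tower 𝒟 A E) (Y : Matrix (Fin N) (Fin N) A) (c : A) :
    𝒟.mulTop M (Y.map (· * c)) = (𝒟.mulTop M Y).map (· * c) := by
  refine t.mat_injective ?_
  rw [t.mat_map, ← bar_zero, ← bar_zero, bar_top, bar_top, bar_map,
    ← t.T_mul_right (t.scal_mem _ _), mul_assoc _ _ (t.scal c), scal_comm t.local_K]
  simp only [mul_assoc]

theorem mulS_add (t : Tower 𝒟 A E) (Y Z : Matrix (Fin N) (Fin N) A) :
    𝒟.mulS M (Y + Z) = 𝒟.mulS M Y + 𝒟.mulS M Z := by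
  rw [QMData.mulS, t.phi_add, mul_add]; rfl

theorem mulS_smul (t : Tower 𝒟 A E) (c : ℂ) (Y : Matrix (Fin N) (Fin N) A) :
    𝒟.mulS M (c • Y) = c • 𝒟.mulS M Y := by
  rw [QMData.mulS, t.phi_smul, mul_smul_comm]; rfl

theorem mulTop_add (t : Tower 𝒟 A E) (Y Z : Matrix (Fin N) (Fin N) A) :
    𝒟.mulTop M (Y + Z) = 𝒟.mulTop M Y + 𝒟.mulTop M Z := by
  rw [QMData.mulTop, QMData.mulTop, QMData.mulTop, ← mul_add]
  congr 1
  exact t.mat_injective (by simp only [map_add, t.mat_xi, mul_add, add_mul])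

theorem mulTop_smul (t : Tower 𝒟 A E) (c : ℂ) (Y : Matrix (Fin N) (Fin N) A) :
    𝒟.mulTop M (c • Y) = c • 𝒟.mulTop M Y := by
  rw [QMData.mulTop, QMData.mulTop, ← mul_smul_comm]
  congr 1
  exact t.mat_injective (by simp only [map_smul, t.mat_xi, mul_smul_comm, smul_mul_assoc])

theorem rtr_add (Y Z : Matrix (Fin N) (Fin N) A) : t.rtr (Y + Z) = t.rtr Y + t.rtr Z :=
  t.scal_injective (by rw [map_add, ← t.T_mat, ← t.T_mat, ← t.T_mat, map_add, map_add])

theorem rtr_smul (c : ℂ) (Y : Matrix (Fin N) (Fin N) A) : t.rtr (c • Y) = c • t.rtr Y :=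
  t.scal_injective (by rw [map_smul, ← t.T_mat, ← t.T_mat, map_smul, map_smul])

theorem rtr_map (Y : Matrix (Fin N) (Fin N) A) (c : A) : t.rtr (Y.map (· * c)) = t.rtr Y * c :=
  t.scal_injective (by
    rw [map_mul, ← t.T_mat, ← t.T_mat, t.mat_map, t.T_mul_right (t.scal_mem _ _)])

theorem rtr_one : t.rtr 1 = (𝒟.μ * 𝒟.eta) • 1 :=
  t.scal_injective (by rw [← t.T_mat, map_one, t.T_one, map_smul, map_one])

end Generic

namespace QM

variable {M : Matrix (Fin N) (Fin N) A} {g gi : A} (h : t.QM M g gi)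
include h

/-- Moving `R_1^{-1}` around the triple trace. -/
theorem trace_Ri (Y : Matrix (Fin N) (Fin N) A) (W : E) :
    t.T 1 (t.T 2 (t.T 3 (t.bar M 0 * t.bar M 1 * t.bar M 2 * t.bar Y 3 * (t.Ri 1 * W)))) =
      t.T 1 (t.T 2 (t.T 3 (t.bar M 0 * t.bar M 1 * t.bar M 2 * t.bar Y 3 * (W * t.Ri 1)))) := by
  have c0 : t.Ri 1 * t.bar M 0 = t.bar M 0 * t.Ri 1 := t.local_Ri.bar_comm_lt M (by omega)
  have c1 := h.rel_Ri 1
  have c3 : t.Ri 1 * t.bar Y 3 = t.bar Y 3 * t.Ri 1 := t.local_Ri.bar_comm Y (by omega)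
  have hm : t.Ri 1 ∈ t.away 3 := t.Ri_mem (by omega) (by omega)
  have e : t.bar M 0 * t.bar M 1 * t.bar M 2 * t.bar Y 3 * (t.Ri 1 * W) =
      t.Ri 1 * (t.bar M 0 * t.bar M 1 * t.bar M 2 * t.bar Y 3 * W) := by
    calc _ = t.bar M 0 * (t.bar M 1 * t.bar M 2) * (t.bar Y 3 * t.Ri 1) * W := by
          simp only [mul_assoc]
      _ = t.bar M 0 * (t.bar M 1 * t.bar M 2 * t.Ri 1) * t.bar Y 3 * W := by
          rw [← c3]; simp only [mul_assoc]
      _ = (t.bar M 0 * t.Ri 1) * t.bar M 1 * t.bar M 2 * t.bar Y 3 * W := by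
          rw [← c1]; simp only [mul_assoc]
      _ = _ := by rw [← c0]; simp only [mul_assoc]
  rw [e, t.T_mul_left hm, T_cyc_Ri, ← t.T_mul_right hm]
  simp only [mul_assoc]

theorem top_top_S (Y : Matrix (Fin N) (Fin N) A) :
    𝒟.mulTop M (𝒟.mulTop M (𝒟.mulS M Y)) = 𝒟.mulS M (𝒟.mulTop M (𝒟.mulTop M Y)) := by
  have b := t.bmw
  refine t.mat_injective ?_
  rw [bar_comp₃ t.local_K t.local_K (bar_top M) (bar_top M) (bar_S M),
    bar_comp₃ t.local_R t.local_K (bar_S M) (bar_top M) (bar_top M)]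
  have e1 : t.R 2 * t.K 1 * t.K 0 = t.Ri 1 * (t.K 2 * t.K 1 * t.K 0) := by
    rw [b.K1K0 1, ← mul_assoc, ← mul_assoc, ← mul_assoc, b.Ri_R, one_mul]
  have e2 : t.K 2 * t.K 1 * t.R 0 = t.K 2 * t.K 1 * t.K 0 * t.Ri 1 := by
    rw [mul_assoc (t.K 2), mul_assoc (t.K 2), mul_assoc (t.K 2), b.K1K0_right,
      mul_assoc _ (t.R (0 + 1)), b.R_Ri, mul_one]
  rw [e1, e2, h.trace_Ri]

theorem S_top_S (Y : Matrix (Fin N) (Fin N) A) :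
    𝒟.mulS M (𝒟.mulTop M (𝒟.mulS M Y)) = 𝒟.mulTop M (𝒟.mulTop M (𝒟.mulTop M Y)) -
      𝒟.lam • 𝒟.mulTop M (𝒟.mulTop M (𝒟.mulS M Y)) +
      (𝒟.lam * 𝒟.μ⁻¹) • (𝒟.mulTop M (𝒟.mulTop M M)).map (· * t.rtr Y) := by
  have b := t.bmw
  refine t.mat_injective ?_
  rw [map_add, map_sub, map_smul, map_smul, t.mat_map,
    bar_comp₃ t.local_R t.local_K (bar_S M) (bar_top M) (bar_S M),
    bar_comp₃ t.local_K t.local_K (bar_top M) (bar_top M) (bar_top M),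
    bar_comp₃ t.local_K t.local_K (bar_top M) (bar_top M) (bar_S M)]
  have e1 : t.R 2 * t.K 1 * t.R 0 = t.Ri 1 * (t.K 2 * t.K 1 * t.K 0 * t.Ri 1) := by
    rw [b.K1K0 1, mul_assoc (t.R 1 * t.R 2), b.K1K0_right]
    simp only [mul_assoc]
    rw [b.R_Ri, mul_one, ← mul_assoc (t.Ri 1), b.Ri_R, one_mul]
  have e2 : t.R 2 * t.K 1 * t.K 0 = t.Ri 1 * (t.K 2 * t.K 1 * t.K 0) := by
    rw [b.K1K0 1, ← mul_assoc, ← mul_assoc, ← mul_assoc, b.Ri_R, one_mul]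
  have e3 : t.K 1 * (t.K 2 * t.K 1 * t.K 0) = t.K 1 * t.K 0 := by
    rw [← mul_assoc, ← mul_assoc, b.K0K1K0 1]
  have e4 : t.mat (𝒟.mulTop M (𝒟.mulTop M M)) * t.scal (t.rtr Y) =
      t.T 1 (t.T 2 (t.T 3 (t.bar M 0 * t.bar M 1 * t.bar M 2 * t.bar Y 3 *
        (t.K 1 * (t.K 2 * t.K 1 * t.K 0))))) := by
    have c : t.bar Y 3 * (t.K 1 * t.K 0) = t.K 1 * t.K 0 * t.bar Y 3 := by
      rw [← mul_assoc, ← t.local_K.bar_comm Y (by omega), mul_assoc,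
        ← t.local_K.bar_comm Y (by omega), mul_assoc]
    rw [e3, mul_assoc _ (t.bar Y 3), c, ← mul_assoc, t.T_mul_left (mul_mem (mul_mem (mul_mem
      (bar_mem M (by omega)) (bar_mem M (by omega))) (bar_mem M (by omega)))
      (mul_mem (t.K_mem (by omega) (by omega)) (t.K_mem (by omega) (by omega)))), T_bar,
      t.T_mul_right (t.scal_mem _ _), t.T_mul_right (t.scal_mem _ _)]
    congr 1
    exact bar_comp t.local_K (bar_top M) (bar_top M) M 0
  rw [e1, ← mul_assoc (t.Ri 1), ← h.trace_Ri, e4, e2, ← mul_assoc (t.Ri 1), b.Ri_sq]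
  simp only [add_mul, sub_mul, mul_add, mul_sub, smul_mul_assoc, mul_smul_comm, one_mul, map_add,
    map_sub, map_smul]

theorem mulTop_self : 𝒟.mulTop M M = 𝒟.μ⁻¹ • (1 : Matrix (Fin N) (Fin N) A).map (· * g) := by
  have b := t.bmw
  refine t.mat_injective ?_
  rw [← bar_zero, bar_top, h.bar_bar_K, map_smul, map_smul, t.mat_map, map_one, one_mul,
    t.T_mul_right (t.scal_mem _ _), t.T_K, smul_mul_assoc, one_mul, smul_smul, mul_inv, mul_assoc,
    inv_mul_cancel₀ b.μ_ne, mul_one]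

theorem rtr_mulTop_mulS (Y : Matrix (Fin N) (Fin N) A) :
    t.rtr (𝒟.mulTop M (𝒟.mulS M Y)) = 𝒟.μ⁻¹ • (g * t.rtr Y) := by
  have b := t.bmw
  refine t.scal_injective ?_
  have e := bar_comp t.local_K (bar_top M) (bar_S M) Y 0
  have e0 : t.scal (t.rtr (𝒟.mulTop M (𝒟.mulS M Y))) = t.T 0 (t.T 1 (t.T 2
      (t.bar M 0 * t.bar M 1 * t.bar Y 2 * (t.R 1 * t.K 0)))) := by
    rw [← T_bar _ 0, e]
  have m : t.K 0 ∈ t.away 2 := t.K_mem (by omega) (by omega)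
  have hK : t.K 0 = 𝒟.eta⁻¹ • (t.K 0 * t.K 0) := by rw [b.K_K, inv_smul_smul₀ b.eta_ne]
  have e1 : t.T 0 (t.T 1 (t.T 2 (t.bar M 0 * t.bar M 1 * t.bar Y 2 * (t.R 1 * (t.K 0 * t.K 0))))) =
      𝒟.μ⁻¹ • t.T 0 (t.T 1 (t.T 2 (t.bar M 0 * t.bar M 1 * t.bar Y 2 * t.K 0))) := by
    have c : t.K 0 * t.bar Y 2 = t.bar Y 2 * t.K 0 := t.local_K.bar_comm Y (by omega)
    have f : t.K 0 * (t.bar M 0 * t.bar M 1 * t.bar Y 2 * (t.R 1 * t.K 0)) =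
        𝒟.μ⁻¹ • (t.bar M 0 * t.bar M 1 * t.bar Y 2 * t.K 0) := by
      calc _ = t.K 0 * (t.bar M 0 * t.bar M 1) * t.bar Y 2 * (t.R 1 * t.K 0) := by
            simp only [mul_assoc]
        _ = t.bar M 0 * t.bar M 1 * (t.K 0 * t.bar Y 2) * (t.R 1 * t.K 0) := by
            rw [h.rel_K]; simp only [mul_assoc]
        _ = t.bar M 0 * t.bar M 1 * t.bar Y 2 * (t.K 0 * t.R 1 * t.K 0) := by
            rw [c]; simp only [mul_assoc]
        _ = _ := by rw [b.K0R1K0, mul_smul_comm]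
    rw [← mul_assoc (t.R 1), ← mul_assoc _ _ (t.K 0), t.T_mul_right m, ← T_cyc_K, ← t.T_mul_left m,
      f, map_smul, map_smul, map_smul]
  have e2 : t.T 0 (t.T 1 (t.T 2 (t.bar M 0 * t.bar M 1 * t.bar Y 2 * t.K 0))) =
      𝒟.eta • (t.scal g * t.scal (t.rtr Y)) := by
    rw [t.T_mul_right m, t.T_mul_left (mul_mem (bar_mem M (by omega)) (bar_mem M (by omega))),
      T_bar, mul_assoc _ _ (t.K 0), ← scal_comm t.local_K, ← mul_assoc,
      t.T_mul_right (t.scal_mem _ _), t.T_mul_right (t.scal_mem _ _), h.scal_g, smul_mul_assoc,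
      smul_inv_smul₀ b.eta_ne]
  rw [e0, hK, mul_smul_comm, mul_smul_comm, map_smul, map_smul, map_smul, e1, e2, map_smul, map_mul,
    smul_smul, smul_smul, mul_comm, mul_inv_cancel_left₀ b.eta_ne]

theorem mulTop_mulTop_one :
    𝒟.mulTop M (𝒟.mulTop M 1) = (1 : Matrix (Fin N) (Fin N) A).map (· * g) := by
  rw [mulTop_one t, mulTop_smul t, h.mulTop_self, smul_inv_smul₀ t.bmw.μ_ne]

end QM

end Tower

namespace Tower

variable {N : ℕ} {𝒟 : QMData N} {A E : Type} [Ring A] [Algebra ℂ A] [Ring E] [Algebra ℂ E]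

/-- `x = ch(b)`. -/
def IsCh (t : Tower 𝒟 A E) (M : Matrix (Fin N) (Fin N) A) (n : ℕ) (b : E) (x : A) : Prop :=
  t.scal x = t.trs 0 n (t.prod M 0 n * b)

/-- `Y = M^b`. -/
def IsPow (t : Tower 𝒟 A E) (M : Matrix (Fin N) (Fin N) A) (n : ℕ) (b : E)
    (Y : Matrix (Fin N) (Fin N) A) : Prop :=
  t.mat Y = t.trs 1 n (t.prod M 0 (n + 1) * b)

variable {t : Tower 𝒟 A E} {M : Matrix (Fin N) (Fin N) A}

theorem exists_isCh (M : Matrix (Fin N) (Fin N) A) {n : ℕ} {b : E} (hb : b ∈ t.B 0 n) :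
    ∃ x, t.IsCh M n b x :=
  t.exists_scal (trs_mem_J (by
    rw [zero_add]; exact mul_mem (prod_mem_J M (by omega)) (B_le_J (by omega) hb)))

theorem IsPow.rtr {n : ℕ} {b : E} {Y : Matrix (Fin N) (Fin N) A} (hY : t.IsPow M n b Y) :
    t.IsCh M (n + 1) b (t.rtr Y) := by
  rw [IsCh, ← t.T_mat, hY, trs_succ']

theorem IsPow.mulS {n : ℕ} {b : E} (hb : b ∈ t.B 0 (n + 1)) {Y : Matrix (Fin N) (Fin N) A}
    (hY : t.IsPow M n b Y) : t.IsPow M (n + 1) (t.sh b * t.R 0) (𝒟.mulS M Y) := by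
  have h := bar_pow hb hY 1
  rw [IsPow, ← bar_zero, bar_S, h, trs_succ', prod_succ' M 0, zero_add,
    ← trs_mul_left (fun l _ _ => bar_mem M (by omega)), ← trs_mul_right
    (fun l _ _ => t.R_mem (by omega) (by omega))]
  simp only [mul_assoc, Function.iterate_one]

theorem IsPow.mulTop {n : ℕ} {b : E} (hb : b ∈ t.B 0 (n + 1)) {Y : Matrix (Fin N) (Fin N) A}
    (hY : t.IsPow M n b Y) : t.IsPow M (n + 1) (t.sh b * t.K 0) (𝒟.mulTop M Y) := by
  have h := bar_pow hb hY 1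
  rw [IsPow, ← bar_zero, bar_top, h, trs_succ', prod_succ' M 0, zero_add,
    ← trs_mul_left (fun l _ _ => bar_mem M (by omega)), ← trs_mul_right
    (fun l _ _ => t.K_mem (by omega) (by omega))]
  simp only [mul_assoc, Function.iterate_one]

theorem IsCh.map {n : ℕ} {b : E} (hb : b ∈ t.B 0 n) {x : A} (hx : t.IsCh M n b x) :
    t.IsPow M n (t.sh b) (M.map (· * x)) := by
  rw [IsPow, t.mat_map, hx, ← trs_prod_shift M hb 1, prod_succ', mul_assoc,
    trs_mul_left (fun l _ _ => bar_mem M (by omega))]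
  rfl

/-- The copies of `M` with a matrix in the last place. -/
theorem bar_prod_bar {M Y Z : Matrix (Fin N) (Fin N) A} {n : ℕ} {b : E} (hb : b ∈ t.B 0 (n + 1))
    (hZ : t.mat Z = t.trs 1 n (t.prod M 0 n * t.bar Y n * b)) (k : ℕ) :
    t.bar Z k = t.trs (k + 1) n (t.prod M k n * t.bar Y (k + n) * t.sh^[k] b) := by
  induction k with
  | zero => rw [bar_zero, hZ, zero_add, zero_add]; rfl
  | succ k ih =>
    have hb' : t.sh^[k] b ∈ t.B k (n + 1) := by
      have := sh_iterate_mem_B k hb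
      rwa [zero_add] at this
    rw [bar_succ, ih, F_trs_G, Function.iterate_succ_apply']
    · congr 1
      rw [← mul_assoc, ← mul_assoc, U_prod M (by omega), mul_assoc (t.prod M (k + 1) n), U_bar Y
        (by omega) (by omega), ← mul_assoc, mul_assoc _ (t.U k (n + 1)), U_B le_rfl hb', mul_assoc,
        mul_assoc (t.sh _), U_mul_Ui, mul_one, show k + n + 1 = k + 1 + n by omega]
    intro l hl
    exact mul_mem (mul_mem (prod_mem M (by omega)) (bar_mem Y (by omega)))
      (B_le_away (by omega) hb')

namespace QM

variable {g gi : A} (h : t.QM M g gi)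
include h

theorem R_prod {k n i : ℕ} (hk : k ≤ i) (hi : i + 1 < k + n) :
    t.R i * t.prod M k n = t.prod M k n * t.R i := by
  induction n with
  | zero => omega
  | succ n ih =>
    rw [prod_succ]
    by_cases hn : i + 1 < k + n
    · rw [← mul_assoc, ih hn, mul_assoc, t.local_R.bar_comm M (by omega), mul_assoc]
    · obtain ⟨n, rfl⟩ : ∃ m, n = m + 1 := ⟨n - 1, by omega⟩
      obtain rfl : i = k + n := by omega
      have hp : t.R (k + n) * t.prod M k n = t.prod M k n * t.R (k + n) :=
        t.R_comm (prod_mem M le_rfl) (prod_mem M (by omega))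
      rw [prod_succ, mul_assoc (t.prod M k n), ← mul_assoc, hp, mul_assoc, ← add_assoc, h.rel]
      simp only [mul_assoc]

theorem B_prod {k n k' n' : ℕ} (hk : k ≤ k') (hn : k' + n' ≤ k + n) {b : E} (hb : b ∈ t.B k' n') :
    b * t.prod M k n = t.prod M k n * b :=
  B_comm (fun _ hi hi' => h.R_prod (by omega) (by omega)) hb

omit h in
theorem IsCh_mul {m n : ℕ} {a b : E} (ha : a ∈ t.B 0 m) (hb : b ∈ t.B 0 n) {x y : A}
    (hx : t.IsCh M m a x) (hy : t.IsCh M n b y) : t.IsCh M (m + n) (a * t.sh^[m] b) (x * y) := by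
  have hb' : t.sh^[m] b ∈ t.B m n := by simpa using sh_iterate_mem_B m hb
  have c : t.prod M m n * t.sh^[m] b * a = a * (t.prod M m n * t.sh^[m] b) := by
    refine (B_comm (k := 0) (n := m) (fun i hi hi' => ?_) ha).symm
    have h1 : t.R i * t.prod M m n = t.prod M m n * t.R i := by
      clear hb' hy hb
      induction n with
      | zero => simp [prod]
      | succ n ih =>
        rw [prod_succ, ← mul_assoc, ih, mul_assoc, t.local_R.bar_comm M (by omega), mul_assoc]
    have h2 : t.R i * t.sh^[m] b = t.sh^[m] b * t.R i :=
      t.R_comm (B_le_away (by omega) hb') (B_le_away (by omega) hb')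
    rw [← mul_assoc, h1, mul_assoc, h2, mul_assoc]
  rw [IsCh, map_mul, hx, hy, ← trs_prod_shift M hb m, trs_add, prod_add]
  simp only [zero_add]
  have e : t.prod M 0 m * t.prod M m n * (a * t.sh^[m] b) =
      t.prod M 0 m * a * (t.prod M m n * t.sh^[m] b) := by
    rw [mul_assoc (t.prod M 0 m) a, ← c]
    have c2 : a * t.sh^[m] b = t.sh^[m] b * a :=
      B_comm (fun i hi hi' => t.R_comm (B_le_away (by omega) hb') (B_le_away (by omega) hb')) ha
    rw [c2]; simp only [mul_assoc]
  have hs : ∃ z, t.scal z = t.trs m n (t.prod M m n * t.sh^[m] b) :=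
    ⟨y, by rw [hy, ← trs_prod_shift M hb m]⟩
  obtain ⟨z, hz⟩ := hs
  rw [e, trs_mul_left (fun l hl hl' => mul_mem (prod_mem M (by omega)) (B_le_away (by omega) ha)),
    ← hz, trs_mul_right (fun l _ _ => t.scal_mem _ _)]

end QM

/-- The braid moving a strand of `n` legs past `m` legs. -/
def blk (t : Tower 𝒟 A E) (n : ℕ) : ℕ → E
  | 0 => 1
  | m + 1 => blk t n m * t.sh^[m] (t.u n)

/-- The inverse of `blk`. -/
def blkInv (t : Tower 𝒟 A E) (n : ℕ) : ℕ → E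
  | 0 => 1
  | m + 1 => t.sh^[m] (t.ui n) * blkInv t n m

theorem blkInv_mul_blk (n m : ℕ) : t.blkInv n m * t.blk n m = 1 := by
  induction m with
  | zero => exact one_mul 1
  | succ m ih =>
    rw [blk, blkInv, mul_assoc, ← mul_assoc (t.blkInv n m), ih, one_mul]
    have := congrArg (t.sh^[m]) (ui_mul_u (t := t) n)
    rwa [iterate_map_mul, iterate_map_one] at this

theorem blk_mul_blkInv (n m : ℕ) : t.blk n m * t.blkInv n m = 1 := by
  induction m with
  | zero => exact one_mul 1
  | succ m ih =>
    have := congrArg (t.sh^[m]) (u_mul_ui (t := t) n)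
    rw [iterate_map_mul, iterate_map_one] at this
    rw [blk, blkInv, mul_assoc, ← mul_assoc (t.sh^[m] _), this, one_mul, ih]

theorem blk_mem (n m : ℕ) : t.blk n m ∈ t.B 0 (m + n) := by
  induction m with
  | zero => exact one_mem _
  | succ m ih =>
    exact mul_mem (B_mono le_rfl (by omega) ih)
      (B_mono (by omega) (by omega) (sh_iterate_mem_B m (u_mem n)))

theorem blkInv_mem (n m : ℕ) : t.blkInv n m ∈ t.B 0 (m + n) := by
  induction m with
  | zero => exact one_mem _
  | succ m ih =>
    exact mul_mem (B_mono (by omega) (by omega) (sh_iterate_mem_B m (ui_mem n)))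
      (B_mono le_rfl (by omega) ih)

theorem mul_blk {n : ℕ} {b : E} (hb : b ∈ t.B 0 n) (m : ℕ) :
    b * t.blk n m = t.blk n m * t.sh^[m] b := by
  induction m with
  | zero => simp [blk]
  | succ m ih =>
    have := congrArg (t.sh^[m]) (mul_u hb)
    rw [iterate_map_mul, iterate_map_mul] at this
    rw [blk, ← mul_assoc, ih, mul_assoc, this, mul_assoc, ← Function.iterate_succ_apply]

theorem sh_iterate_R (i k : ℕ) : t.sh^[k] (t.R i) = t.R (i + k) := by
  induction k with
  | zero => rfl
  | succ k ih => rw [Function.iterate_succ_apply', ih, t.sh_R, add_assoc]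

theorem R_mul_blk {i m : ℕ} (n : ℕ) (hi : i + 1 < m) :
    t.R (i + n) * t.blk n m = t.blk n m * t.R i := by
  induction m with
  | zero => omega
  | succ m ih =>
    rw [blk]
    by_cases hm : i + 1 < m
    · rw [← mul_assoc, ih hm, mul_assoc, mul_assoc]
      congr 1
      have : t.sh^[m] (t.u n) ∈ t.B m (n + 1) := by simpa using sh_iterate_mem_B m (u_mem (t := t) n)
      exact t.R_comm (B_le_away (by omega) this) (B_le_away (by omega) this)
    · obtain ⟨m, rfl⟩ : ∃ k, m = k + 1 := ⟨m - 1, by omega⟩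
      obtain rfl : i = m := by omega
      have e0 : t.R n * (t.u n * t.sh (t.u n)) = t.u n * t.sh (t.u n) * t.R 0 := by
        have e := mul_u (u_mem (t := t) n)
        rw [u_succ', ← mul_assoc] at e
        rw [e, ← mul_assoc, ← u_succ', u]
      have e1 := congrArg (t.sh^[i]) e0
      simp only [iterate_map_mul, sh_iterate_R, zero_add] at e1
      rw [← Function.iterate_succ_apply] at e1
      have c : t.R (i + n) * t.blk n i = t.blk n i * t.R (i + n) :=
        t.R_comm (B_le_away (by omega) (blk_mem n i)) (B_le_away (by omega) (blk_mem n i))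
      rw [blk, mul_assoc (t.blk n i), ← mul_assoc, c, mul_assoc, add_comm i n, e1]
      simp only [mul_assoc]

theorem sh_mul_blk {m : ℕ} (n : ℕ) {a : E} (ha : a ∈ t.B 0 m) :
    t.sh^[n] a * t.blk n m = t.blk n m * a := by
  let S : Subalgebra ℂ E :=
    { carrier := {a | t.sh^[n] a * t.blk n m = t.blk n m * a}
      mul_mem' := fun {a b} ha hb => by
        change t.sh^[n] (a * b) * _ = _ * (a * b)
        rw [iterate_map_mul, mul_assoc, hb, ← mul_assoc, ha, mul_assoc]
      add_mem' := fun {a b} ha hb => by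
        change t.sh^[n] (a + b) * _ = _ * (a + b)
        rw [iterate_map_add, add_mul, mul_add, ha, hb]
      algebraMap_mem' := fun r => by
        change t.sh^[n] (algebraMap ℂ E r) * _ = _
        have : t.sh^[n] (algebraMap ℂ E r) = algebraMap ℂ E r := by
          induction n with
          | zero => rfl
          | succ n ih => rw [Function.iterate_succ_apply, AlgHom.commutes, ih]
        rw [this, Algebra.commutes] }
  have hR : ∀ i, 0 ≤ i → i + 1 < 0 + m → t.R i ∈ S := fun i _ hi => by
    change t.sh^[n] (t.R i) * _ = _
    rw [sh_iterate_R, R_mul_blk n (by omega)]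
  have : t.B 0 m ≤ S := by
    refine B_le hR fun i hi hi' => ?_
    have e1 : t.sh^[n] (t.Ri i) * t.sh^[n] (t.R i) = 1 := by
      rw [← iterate_map_mul, t.bmw.Ri_R, iterate_map_one]
    exact inv_intertwine e1 (t.bmw.R_Ri i) (hR i hi hi')
  exact this ha

theorem QM.IsCh_comm {g gi : A} (h : t.QM M g gi) {m n : ℕ} {a b : E} (ha : a ∈ t.B 0 m)
    (hb : b ∈ t.B 0 n) {x y : A} (hx : t.IsCh M m a x) (hy : t.IsCh M n b y) : x * y = y * x := by
  refine t.scal_injective ?_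
  rw [QM.IsCh_mul ha hb hx hy, QM.IsCh_mul hb ha hy hx, add_comm n m]
  have e1 : t.sh^[m] b = t.blkInv n m * b * t.blk n m := by
    rw [mul_assoc, mul_blk hb, ← mul_assoc, blkInv_mul_blk, one_mul]
  have e2 : a * t.blkInv n m = t.blkInv n m * t.sh^[n] a := by
    calc _ = t.blkInv n m * (t.blk n m * a) * t.blkInv n m := by
          rw [← mul_assoc, blkInv_mul_blk, one_mul]
      _ = _ := by rw [← sh_mul_blk n ha, mul_assoc, mul_assoc, blk_mul_blkInv, mul_one]
  have e3 : a * t.sh^[m] b = t.blkInv n m * (t.sh^[n] a * b * t.blk n m) := by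
    rw [e1, ← mul_assoc, ← mul_assoc, e2]; simp only [mul_assoc]
  have ha' : t.sh^[n] a ∈ t.B n m := by simpa using sh_iterate_mem_B n ha
  have c2 : b * t.sh^[n] a = t.sh^[n] a * b :=
    B_comm (fun i hi hi' => t.R_comm (B_le_away (by omega) ha') (B_le_away (by omega) ha')) hb
  have hW := blk_mem (t := t) n m
  rw [e3, c2, ← mul_assoc, ← h.B_prod (le_refl 0) (by omega) (blkInv_mem n m), mul_assoc,
    trs_cyc (le_refl 0) (by omega) (blkInv_mem n m)]
  simp only [mul_assoc]
  rw [blk_mul_blkInv, mul_one]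

/-- Left `⋆`-multiplication by `M^α`, written on arbitrary matrices (`β = α R_0⁻¹ ⋯ R_{n-2}⁻¹`). -/
theorem QM.exists_leftStar {g gi : A} (h : t.QM M g gi) {n : ℕ} {β : E} (hβ : β ∈ t.B 0 n) :
    ∃ L : Matrix (Fin N) (Fin N) A → Matrix (Fin N) (Fin N) A,
      (∀ Y, t.mat (L Y) = t.trs 1 n (t.prod M 0 n * t.bar Y n * (β * t.u n))) ∧
      (∀ Y, L (𝒟.mulS M Y) = 𝒟.mulS M (L Y)) ∧
      (∀ Y c, L (Y.map (· * c)) = (L Y).map (· * c)) := by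
  have hB : β * t.u n ∈ t.B 0 (n + 1) := mul_mem (B_mono le_rfl (by omega) hβ) (u_mem n)
  have ex : ∀ Y, ∃ Z, t.mat Z = t.trs 1 n (t.prod M 0 n * t.bar Y n * (β * t.u n)) := fun Y =>
    t.exists_mat (trs_mem_J (mul_mem (mul_mem (prod_mem_J M (by omega)) (bar_mem_J Y (by omega)))
      (B_le_J (by omega) hB)))
  choose L hL using ex
  refine ⟨L, hL, fun Y => t.mat_injective ?_, fun Y c => t.mat_injective ?_⟩
  · have e1 := bar_prod_bar hB (hL Y) 1
    have hsβ : t.sh β ∈ t.B 1 n := by simpa using sh_mem_B hβ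
    have cR : t.R n * β = β * t.R n :=
      t.R_comm (B_le_away (by omega) hβ) (B_le_away (by omega) hβ)
    have m1 : ∀ l, 2 ≤ l → t.R 0 ∈ t.away l := fun l hl => t.R_mem (by omega) (by omega)
    rw [← bar_zero (𝒟.mulS M (L Y)), bar_S, e1, hL, bar_S, Function.iterate_one, map_mul t.sh]
    have l1 : t.trs 1 n (t.prod M 0 n * t.T (n + 1) (t.bar M n * t.bar Y (n + 1) * t.R n) *
        (β * t.u n)) = t.trs 1 (n + 1) (t.prod M 0 (n + 1) * t.bar Y (n + 1) * (β * t.u (n + 1))) := by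
      rw [← t.T_mul_left (prod_mem M (by omega)), ← t.T_mul_right (B_le_away (by omega) hB),
        trs_succ, add_comm 1 n]
      congr 2
      calc _ = t.prod M 0 n * t.bar M n * t.bar Y (n + 1) * (t.R n * β) * t.u n := by
            simp only [mul_assoc]
        _ = _ := by
            rw [cR, prod_succ, zero_add, show t.u (n + 1) = t.R n * t.u n from rfl]
            simp only [mul_assoc]
    have l2 : t.T (0 + 1) (t.bar M 0 * t.trs (1 + 1) n (t.prod M 1 n * t.bar Y (1 + n) *
        (t.sh β * t.sh (t.u n))) * t.R 0) =
        t.trs 1 (n + 1) (t.prod M 0 (n + 1) * t.bar Y (n + 1) * (t.sh β * t.u (n + 1))) := by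
      rw [← trs_mul_left (fun l _ _ => bar_mem M (by omega)),
        ← trs_mul_right (fun l hl _ => m1 l hl), trs_succ', prod_succ', u_succ', add_comm 1 n]
      simp only [mul_assoc, zero_add]
    rw [l1, l2, mul_u (B_mono le_rfl (by omega) hβ), ← mul_assoc,
      ← trs_cyc (b := t.sh β) (k' := 1) (n' := n) le_rfl (by omega) hsβ]
    congr 1
    have c1 : t.sh β * t.prod M 0 (n + 1) = t.prod M 0 (n + 1) * t.sh β :=
      h.B_prod (by omega) (by omega) hsβ
    have c2 : t.sh β * t.bar Y (n + 1) = t.bar Y (n + 1) * t.sh β :=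
      B_comm_bar Y (by omega) hsβ
    rw [← mul_assoc, ← mul_assoc, c1, mul_assoc (t.prod _ _ _), c2]
    simp only [mul_assoc]
  · have cb : t.scal c * (β * t.u n) = β * t.u n * t.scal c :=
      (B_comm (fun i _ _ => scal_comm t.local_R c i) hB).symm
    rw [t.mat_map, hL, hL, bar_map, ← trs_mul_right (fun l _ _ => t.scal_mem _ _), mul_assoc,
      mul_assoc, cb]
    simp only [mul_assoc]

/-- The value at the unit matrix. -/
theorem leftStar_one {n : ℕ} {α : E} (hα : α ∈ t.B 0 (n + 1)) {L Y : Matrix (Fin N) (Fin N) A}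
    (hL : t.mat L = t.trs 1 (n + 1) (t.prod M 0 (n + 1) * t.bar 1 (n + 1) *
      (α * t.ui n * t.u (n + 1)))) (hY : t.IsPow M n α Y) : L = Y := by
  refine t.mat_injective ?_
  have cR : t.R n * (t.ui n) = t.R n * t.ui n := rfl
  have e : t.prod M 0 (n + 1) * t.bar 1 (n + 1) * (α * t.ui n * t.u (n + 1)) =
      t.prod M 0 (n + 1) * (α * t.ui n) * t.R n * t.u n := by
    rw [bar_one, mul_one, show t.u (n + 1) = t.R n * t.u n from rfl]
    simp only [mul_assoc]
  rw [hL, hY, e, trs_succ, add_comm 1 n, t.T_mul_right (B_le_away (by omega) (u_mem n)),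
    t.T_mul_left (mul_mem (prod_mem M (by omega)) (mul_mem (B_le_away (by omega) hα)
      (B_le_away (by omega) (ui_mem n)))), t.T_R, mul_one, mul_assoc, mul_assoc, ui_mul_u, mul_one]

theorem leftStar_pow {n p : ℕ} {α b : E} (hα : α ∈ t.B 0 (n + 1)) (hb : b ∈ t.B 0 (p + 1))
    {L Y : Matrix (Fin N) (Fin N) A}
    (hL : t.mat L = t.trs 1 (n + 1) (t.prod M 0 (n + 1) * t.bar Y (n + 1) *
      (α * t.ui n * t.u (n + 1)))) (hY : t.IsPow M p b Y) :
    t.IsPow M (n + 1 + p) (α * t.sh^[n + 1] b * (t.u (n + 1) * t.sh (t.ui n))) L := by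
  have hu : t.u (n + 1) * t.sh (t.ui n) = t.ui n * t.u (n + 1) := (mul_u (ui_mem n)).symm
  have hb' : t.sh^[n + 1] b ∈ t.B (n + 1) (p + 1) := by simpa using sh_iterate_mem_B (n + 1) hb
  have c : t.sh^[n + 1] b * (α * t.ui n) = α * t.ui n * t.sh^[n + 1] b :=
    B_comm (fun i hi hi' => t.R_comm (mul_mem (B_le_away (by omega) hα)
      (B_le_away (by omega) (ui_mem n))) (mul_mem (B_le_away (by omega) hα)
      (B_le_away (by omega) (ui_mem n)))) hb'
  have c' : t.sh^[n + 1] b * t.ui n = t.ui n * t.sh^[n + 1] b :=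
    B_comm (fun i hi hi' => t.R_comm (B_le_away (by omega) (ui_mem n))
      (B_le_away (by omega) (ui_mem n))) hb'
  rw [IsPow, hL, hu, bar_pow hb hY, trs_add 1 (n + 1) p, add_comm 1 (n + 1), add_assoc (n + 1) p 1,
    prod_add M 0 (n + 1) (p + 1), zero_add]
  congr 1
  rw [← trs_mul_left (fun l _ _ => prod_mem M (by omega)), ← trs_mul_right (fun l _ _ => mul_mem
    (mul_mem (B_le_away (by omega) hα) (B_le_away (by omega) (ui_mem n)))
    (B_le_away (by omega) (u_mem _)))]
  congr 1
  calc _ = t.prod M 0 (n + 1) * t.prod M (n + 1) (p + 1) * (t.sh^[n + 1] b * (α * t.ui n)) *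
        t.u (n + 1) := by simp only [mul_assoc]
    _ = t.prod M 0 (n + 1) * t.prod M (n + 1) (p + 1) * (α * (t.ui n * t.sh^[n + 1] b)) *
        t.u (n + 1) := by rw [c]; simp only [mul_assoc]
    _ = _ := by rw [← c']; simp only [mul_assoc]

end Tower

namespace Tower

variable {N : ℕ} {𝒟 : QMData N} {A E : Type} [Ring A] [Algebra ℂ A] [Ring E] [Algebra ℂ E]
variable {t : Tower 𝒟 A E} {M : Matrix (Fin N) (Fin N) A}

section Span

variable (t)

/-- The elements `x`, `x R_k y`, `x K_k y`, with `x`, `y` not involving the leg `k`. -/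
def spanSet (k n : ℕ) : Submodule ℂ E :=
  Submodule.span ℂ ((t.B (k + 1) n : Set E) ∪
    {z | ∃ x ∈ t.B (k + 1) n, ∃ y ∈ t.B (k + 1) n, z = x * t.R k * y ∨ z = x * t.K k * y})

variable {t} {k n : ℕ}

theorem mem_spanSet {x : E} (hx : x ∈ t.B (k + 1) n) : x ∈ t.spanSet k n :=
  Submodule.subset_span (Or.inl hx)

theorem R_mem_spanSet {x y : E} (hx : x ∈ t.B (k + 1) n) (hy : y ∈ t.B (k + 1) n) :
    x * t.R k * y ∈ t.spanSet k n :=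
  Submodule.subset_span (Or.inr ⟨x, hx, y, hy, Or.inl rfl⟩)

theorem K_mem_spanSet {x y : E} (hx : x ∈ t.B (k + 1) n) (hy : y ∈ t.B (k + 1) n) :
    x * t.K k * y ∈ t.spanSet k n :=
  Submodule.subset_span (Or.inr ⟨x, hx, y, hy, Or.inr rfl⟩)

theorem mul_mem_spanSet {x y z : E} (hx : x ∈ t.B (k + 1) n) (hy : y ∈ t.B (k + 1) n)
    (hz : z ∈ t.spanSet k n) : x * z * y ∈ t.spanSet k n := by
  induction hz using Submodule.span_induction with
  | mem z hz =>
    rcases hz with hz | ⟨a, ha, b, hb, rfl | rfl⟩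
    · exact mem_spanSet (mul_mem (mul_mem hx hz) hy)
    · rw [show x * (a * t.R k * b) * y = x * a * t.R k * (b * y) by simp only [mul_assoc]]
      exact R_mem_spanSet (mul_mem hx ha) (mul_mem hb hy)
    · rw [show x * (a * t.K k * b) * y = x * a * t.K k * (b * y) by simp only [mul_assoc]]
      exact K_mem_spanSet (mul_mem hx ha) (mul_mem hb hy)
  | zero => simp
  | add a b _ _ ha hb => rw [mul_add, add_mul]; exact add_mem ha hb
  | smul c a _ ha => rw [mul_smul_comm, smul_mul_assoc]; exact Submodule.smul_mem _ _ ha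

theorem sandwich_one_mem {X Z : E} (hX : X = t.R k ∨ X = t.K k) (hZ : Z = t.R k ∨ Z = t.K k) :
    X * Z ∈ t.spanSet k n := by
  have b := t.bmw
  have h1 : (1 : E) ∈ t.B (k + 1) n := one_mem _
  have m1 : (1 : E) ∈ t.spanSet k n := mem_spanSet h1
  have mR : t.R k ∈ t.spanSet k n := by simpa using R_mem_spanSet h1 h1
  have mK : t.K k ∈ t.spanSet k n := by simpa using K_mem_spanSet h1 h1
  rcases hX with rfl | rfl <;> rcases hZ with rfl | rfl
  · rw [b.R_sq]
    exact sub_mem (add_mem m1 (Submodule.smul_mem _ _ mR)) (Submodule.smul_mem _ _ mK)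
  · rw [b.R_K]; exact Submodule.smul_mem _ _ mK
  · rw [b.K_R]; exact Submodule.smul_mem _ _ mK
  · rw [b.K_K]; exact Submodule.smul_mem _ _ mK

theorem sandwich_mem {X Y Z : E} (hX : X = t.R k ∨ X = t.K k)
    (hY : Y = t.R (k + 1) ∨ Y = t.K (k + 1)) (hZ : Z = t.R k ∨ Z = t.K k) (hn : 2 ≤ n) :
    X * Y * Z ∈ t.spanSet k n := by
  have b := t.bmw
  have h1 : (1 : E) ∈ t.B (k + 1) n := one_mem _
  have hR : t.R (k + 1) ∈ t.B (k + 1) n := R_mem_B le_rfl (by omega)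
  have hRi : t.Ri (k + 1) ∈ t.B (k + 1) n := Ri_mem_B le_rfl (by omega)
  have hK : t.K (k + 1) ∈ t.B (k + 1) n := K_mem_B le_rfl (by omega)
  have mK : t.K k ∈ t.spanSet k n := by simpa using K_mem_spanSet h1 h1
  have e1 : t.R k * t.K (k + 1) * t.K k = t.Ri (k + 1) * t.K k := by
    rw [mul_assoc, b.K1K0', ← mul_assoc, ← mul_assoc, b.R_Ri, one_mul]
  have e2 : t.K k * t.K (k + 1) * t.R k = t.K k * t.Ri (k + 1) := by
    rw [b.K0K1_right', mul_assoc, b.Ri_R, mul_one]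
  rcases hX with rfl | rfl <;> rcases hY with rfl | rfl <;> rcases hZ with rfl | rfl
  · rw [b.braid]; exact R_mem_spanSet hR hR
  · rw [← b.K1K0]; simpa using K_mem_spanSet hK h1
  · have e : t.R k * t.K (k + 1) * t.R k = t.Ri (k + 1) * t.K k * t.Ri (k + 1) := by
      have := congrArg (· * t.Ri (k + 1)) e1
      beta_reduce at this
      rw [← this, mul_assoc (t.R k) _ (t.K k), b.K1K0_right, mul_assoc (t.R k) _ (t.Ri (k + 1)),
        mul_assoc (t.K (k + 1) * t.R k), b.R_Ri, mul_one, mul_assoc]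
    rw [e]; exact K_mem_spanSet hRi hRi
  · rw [e1]; simpa using K_mem_spanSet hRi h1
  · rw [← b.K0K1_right]; simpa using K_mem_spanSet h1 hK
  · rw [b.K0R1K0]; exact Submodule.smul_mem _ _ mK
  · rw [e2]; simpa using K_mem_spanSet h1 hRi
  · rw [b.K0K1K0]; exact mK

theorem B_one (k : ℕ) : t.B k 1 = ⊥ := by
  rw [eq_bot_iff]
  exact B_le (fun i _ _ => by omega) fun i _ _ => by omega

theorem B_le_spanSet (k n : ℕ) : (t.B k (n + 1)).toSubmodule ≤ t.spanSet k n := by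
  induction n generalizing k with
  | zero =>
    rw [zero_add, B_one]
    intro x hx
    obtain ⟨r, rfl⟩ := Algebra.mem_bot.1 hx
    exact mem_spanSet (Subalgebra.algebraMap_mem _ r)
  | succ n ih =>
    have h1 : (1 : E) ∈ t.B (k + 1) (n + 1) := one_mem _
    have up : ∀ {a}, a ∈ t.B (k + 2) n → a ∈ t.B (k + 1) (n + 1) := fun ha =>
      B_mono (by omega) (by omega) ha
    have hw : ∀ X, X = t.R k ∨ X = t.K k → ∀ Z, Z = t.R k ∨ Z = t.K k → ∀ w ∈ t.B (k + 1) (n + 1),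
        X * w * Z ∈ t.spanSet k (n + 1) := by
      intro X hX Z hZ w hw
      rcases Nat.eq_zero_or_pos n with hn | hn
      · subst hn
        rw [zero_add, B_one] at hw
        obtain ⟨r, rfl⟩ := Algebra.mem_bot.1 hw
        rw [Algebra.algebraMap_eq_smul_one, mul_smul_comm, smul_mul_assoc, mul_one]
        exact Submodule.smul_mem _ _ (sandwich_one_mem hX hZ)
      have comm : ∀ X, X = t.R k ∨ X = t.K k → ∀ a ∈ t.B (k + 2) n, a * X = X * a := by
        rintro X (rfl | rfl) a ha
        · exact (t.R_comm (B_le_away (by omega) ha) (B_le_away (by omega) ha)).symm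
        · exact (t.K_comm (B_le_away (by omega) ha) (B_le_away (by omega) ha)).symm
      have hw' := ih (k + 1) hw
      clear hw
      induction hw' using Submodule.span_induction with
      | mem z hz =>
        rcases hz with hz | ⟨a, ha, c, hc, hz⟩
        · rw [mul_assoc, comm Z hZ z hz, ← mul_assoc, ← one_mul (X * Z)]
          exact mul_mem_spanSet h1 (up hz) (sandwich_one_mem hX hZ)
        · obtain ⟨Y, hY, rfl⟩ : ∃ Y, (Y = t.R (k + 1) ∨ Y = t.K (k + 1)) ∧ z = a * Y * c := by
            rcases hz with rfl | rfl
            exacts [⟨_, Or.inl rfl, rfl⟩, ⟨_, Or.inr rfl, rfl⟩]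
          have e : X * (a * Y * c) * Z = a * (X * Y * Z) * c := by
            rw [← mul_assoc, ← mul_assoc, ← comm X hX a ha, mul_assoc, comm Z hZ c hc]
            simp only [mul_assoc]
          rw [e]
          exact mul_mem_spanSet (up ha) (up hc) (sandwich_mem hX hY hZ (by omega))
      | zero => simp
      | add a b _ _ ha hb => rw [mul_add, add_mul]; exact add_mem ha hb
      | smul c a _ ha => rw [mul_smul_comm, smul_mul_assoc]; exact Submodule.smul_mem _ _ ha
    have hX : ∀ X, X = t.R k ∨ X = t.K k → ∀ z ∈ t.spanSet k (n + 1),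
        X * z ∈ t.spanSet k (n + 1) := by
      intro X hX z hz
      induction hz using Submodule.span_induction with
      | mem z hz =>
        rcases hz with hz | ⟨a, ha, c, hc, rfl | rfl⟩
        · rcases hX with rfl | rfl
          · simpa using R_mem_spanSet h1 hz
          · simpa using K_mem_spanSet h1 hz
        · have := mul_mem_spanSet h1 hc (hw X hX _ (Or.inl rfl) a ha)
          simpa only [one_mul, mul_assoc] using this
        · have := mul_mem_spanSet h1 hc (hw X hX _ (Or.inr rfl) a ha)
          simpa only [one_mul, mul_assoc] using this
      | zero => simp
      | add a b _ _ ha hb => rw [mul_add]; exact add_mem ha hb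
      | smul c a _ ha => rw [mul_smul_comm]; exact Submodule.smul_mem _ _ ha
    let S : Subalgebra ℂ E :=
      { carrier := {b | ∀ z ∈ t.spanSet k (n + 1), b * z ∈ t.spanSet k (n + 1)}
        mul_mem' := fun ha hb z hz => by rw [mul_assoc]; exact ha _ (hb z hz)
        add_mem' := fun ha hb z hz => by rw [add_mul]; exact add_mem (ha z hz) (hb z hz)
        algebraMap_mem' := fun r z hz => by
          rw [← Algebra.smul_def]; exact Submodule.smul_mem _ r hz }
    have hR : ∀ i, k ≤ i → i + 1 < k + (n + 1 + 1) → t.R i ∈ S := fun i hi hi' z hz => by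
      rcases hi.eq_or_lt with rfl | hi
      · exact hX _ (Or.inl rfl) z hz
      · have := mul_mem_spanSet (R_mem_B (i := i) (by omega) (by omega)) h1 hz
        rwa [mul_one] at this
    have hK : t.K k ∈ S := fun z hz => hX _ (Or.inr rfl) z hz
    have : t.B k (n + 1 + 1) ≤ S := by
      refine B_le hR fun i hi hi' => ?_
      rcases hi.eq_or_lt with rfl | hi
      · rw [t.bmw.Ri_eq]
        exact add_mem (sub_mem (hR k le_rfl hi') (Subalgebra.smul_mem _ (one_mem _) _))
          (Subalgebra.smul_mem _ hK _)
      · intro z hz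
        have := mul_mem_spanSet (Ri_mem_B (i := i) (by omega) (by omega)) h1 hz
        rwa [mul_one] at this
    intro b hb
    have := this hb 1 (mem_spanSet h1)
    rwa [mul_one] at this

end Span

theorem exists_isPow_iterate (M : Matrix (Fin N) (Fin N) A) (n : ℕ) :
    ∃ b ∈ t.B 0 (n + 1), t.IsPow M n b ((𝒟.mulS M)^[n + 1] 1) := by
  induction n with
  | zero =>
    refine ⟨1, one_mem _, ?_⟩
    rw [zero_add, Function.iterate_one, mulS_one t, IsPow, trs_zero, mul_one]
    exact (one_mul _).symm
  | succ n ih =>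
    obtain ⟨b, hb, hx⟩ := ih
    refine ⟨t.sh b * t.R 0, mul_mem (B_mono (k := 0 + 1) (n := n + 1) (by omega) (by omega)
      (sh_mem_B hb)) (R_mem_B (by omega) (by omega)), ?_⟩
    rw [Function.iterate_succ_apply']
    exact hx.mulS hb

/-- A quantum matrix algebra with invertible 2-contraction and a characteristic subalgebra `C`. -/
structure Star (t : Tower 𝒟 A E) (M : Matrix (Fin N) (Fin N) A) (g gi : A)
    (C : Subalgebra ℂ A) : Prop extends t.QM M g gi where
  phi_bijective : Function.Bijective (𝒟.phi : Matrix (Fin N) (Fin N) A → Matrix (Fin N) (Fin N) A)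
  rtr_iterate_mem : ∀ n, t.rtr ((𝒟.mulS M)^[n] 1) ∈ C
  g_mem : g ∈ C
  gi_mem : gi ∈ C
  comm : ∀ x ∈ C, ∀ y ∈ C, x * y = y * x

/-- Right multiplication of a matrix by a scalar. -/
def rm (N : ℕ) (c : A) : Module.End ℂ (Matrix (Fin N) (Fin N) A) where
  toFun Y := Y.map (· * c)
  map_add' Y Z := by ext; simp [add_mul]
  map_smul' r Y := by ext; simp

theorem rm_apply (c : A) (Y : Matrix (Fin N) (Fin N) A) : rm N c Y = Y.map (· * c) := rfl

theorem rm_rm (c d : A) (Y : Matrix (Fin N) (Fin N) A) : rm N c (rm N d Y) = rm N (d * c) Y := by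
  ext; simp [rm_apply, mul_assoc]

theorem rm_one (Y : Matrix (Fin N) (Fin N) A) : rm N 1 Y = Y := by
  ext; simp [rm_apply]

theorem map_mem_of_span {f : Module.End ℂ (Matrix (Fin N) (Fin N) A)}
    {s : Set (Matrix (Fin N) (Fin N) A)} {W : Submodule ℂ (Matrix (Fin N) (Fin N) A)}
    (hf : ∀ Y ∈ s, f Y ∈ W) {Y : Matrix (Fin N) (Fin N) A} (hY : Y ∈ Submodule.span ℂ s) :
    f Y ∈ W :=
  (Submodule.span_le.2 (fun Z hZ => hf Z hZ) : Submodule.span ℂ s ≤ W.comap f) hY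

namespace Star

variable {g gi : A} {C : Subalgebra ℂ A} (h : t.Star M g gi C)
include h

theorem mul_inv_right : M * (𝒟.μ • (𝒟.xi M).map (· * gi)) = 1 := by
  have e : M * (𝒟.xi M).map (· * gi) = (𝒟.mulTop M M).map (· * gi) := by
    ext a b
    simp [QMData.mulTop, Matrix.mul_apply, Finset.sum_mul, mul_assoc]
  rw [mul_smul_comm, e, h.mulTop_self]
  change 𝒟.μ • rm N gi (𝒟.μ⁻¹ • rm N g 1) = 1
  rw [map_smul, smul_smul, mul_inv_cancel₀ t.bmw.μ_ne, one_smul, rm_rm, h.g_gi, rm_one]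

theorem mulS_bijective :
    Function.Bijective (𝒟.mulS M : Matrix (Fin N) (Fin N) A → Matrix (Fin N) (Fin N) A) := by
  constructor
  · intro Y Z hYZ
    refine h.phi_bijective.1 (sub_eq_zero.1 (h.eq_zero_of_mul ?_))
    rw [mul_sub, sub_eq_zero]
    exact hYZ
  · intro Z
    obtain ⟨Y, hY⟩ := h.phi_bijective.2 (𝒟.μ • (𝒟.xi M).map (· * gi) * Z)
    exact ⟨Y, by rw [QMData.mulS, hY, ← mul_assoc, h.mul_inv_right, one_mul]⟩

/-- `Y ↦ M ⋆ Y` as an automorphism. -/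
def S : Matrix (Fin N) (Fin N) A ≃ₗ[ℂ] Matrix (Fin N) (Fin N) A :=
  LinearEquiv.ofBijective
    { toFun := 𝒟.mulS M
      map_add' := mulS_add t
      map_smul' := mulS_smul t } h.mulS_bijective

theorem S_apply (Y : Matrix (Fin N) (Fin N) A) : h.S Y = 𝒟.mulS M Y := rfl

/-- `Y ↦ M ξ(Y)` as a linear map. -/
def top (_ : t.Star M g gi C) : Module.End ℂ (Matrix (Fin N) (Fin N) A) where
  toFun := 𝒟.mulTop M
  map_add' := mulTop_add t
  map_smul' := mulTop_smul t

/-- The `⋆`-powers of `M`. -/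
def x (n : ℤ) : Matrix (Fin N) (Fin N) A := (h.S ^ n) 1

theorem x_zero : h.x 0 = 1 := rfl

theorem S_x (n : ℤ) : h.S (h.x n) = h.x (n + 1) := by
  rw [x, x, add_comm, zpow_one_add]; rfl

theorem S_symm_x (n : ℤ) : h.S.symm (h.x n) = h.x (n - 1) := by
  rw [LinearEquiv.symm_apply_eq, S_x, sub_add_cancel]

theorem x_one : h.x 1 = M := by
  have := h.S_x 0
  rw [zero_add] at this
  rw [← this, x_zero]
  exact mulS_one t

theorem S_rm (c : A) (Y : Matrix (Fin N) (Fin N) A) : h.S (rm N c Y) = rm N c (h.S Y) :=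
  mulS_map t Y c

theorem S_symm_rm (c : A) (Y : Matrix (Fin N) (Fin N) A) :
    h.S.symm (rm N c Y) = rm N c (h.S.symm Y) := by
  rw [LinearEquiv.symm_apply_eq, S_rm, LinearEquiv.apply_symm_apply]

theorem top_rm (c : A) (Y : Matrix (Fin N) (Fin N) A) : h.top (rm N c Y) = rm N c (h.top Y) :=
  mulTop_map t Y c

theorem top_one : h.top 1 = 𝒟.μ • M := mulTop_one t

theorem top_top_S (Y : Matrix (Fin N) (Fin N) A) :
    h.top (h.top (h.S Y)) = h.S (h.top (h.top Y)) := h.toQM.top_top_S Y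

theorem top_top_S_symm (Y : Matrix (Fin N) (Fin N) A) :
    h.top (h.top (h.S.symm Y)) = h.S.symm (h.top (h.top Y)) := by
  rw [LinearEquiv.eq_symm_apply, ← h.top_top_S, LinearEquiv.apply_symm_apply]

theorem top_top_x (n : ℤ) : h.top (h.top (h.x n)) = rm N g (h.x n) := by
  induction n using Int.induction_on with
  | zero => exact h.mulTop_mulTop_one
  | succ n ih => rw [← S_x, top_top_S, ih, S_rm]
  | pred n ih => rw [← S_symm_x, top_top_S_symm, ih, S_symm_rm]

theorem top_M : h.top M = 𝒟.μ⁻¹ • rm N g 1 := h.mulTop_self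

theorem top_top_M : h.top (h.top M) = rm N g M := by
  have := h.top_top_x 1
  rwa [x_one] at this

theorem S_top_x (n : ℤ) : h.S (h.top (h.x (n + 1))) = rm N g (h.top (h.x n)) -
    𝒟.lam • rm N g (h.x (n + 1)) + (𝒟.lam * 𝒟.μ⁻¹) • rm N (g * t.rtr (h.x n)) M := by
  have e : h.S (h.top (h.S (h.x n))) = h.top (h.top (h.top (h.x n))) -
      𝒟.lam • h.top (h.top (h.S (h.x n))) +
      (𝒟.lam * 𝒟.μ⁻¹) • rm N (t.rtr (h.x n)) (h.top (h.top M)) := h.toQM.S_top_S (h.x n)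
  rw [S_x, top_top_x, top_top_x, top_rm, top_top_M, rm_rm] at e
  exact e

theorem rtr_top_x (n : ℤ) : t.rtr (h.top (h.x (n + 1))) = 𝒟.μ⁻¹ • (g * t.rtr (h.x n)) := by
  rw [← S_x]; exact h.toQM.rtr_mulTop_mulS (h.x n)

theorem x_nat (n : ℕ) : h.x n = (𝒟.mulS M)^[n] 1 := by
  induction n with
  | zero => rfl
  | succ n ih => rw [Nat.cast_succ, ← S_x, ih, Function.iterate_succ_apply', S_apply]

theorem rtr_x_nat_mem (n : ℕ) : t.rtr (h.x n) ∈ C := by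
  rw [x_nat]; exact h.rtr_iterate_mem n

/-- The right `C`-module spanned by the powers `x^n`, `n ≥ k`. -/
def Pge (k : ℤ) : Submodule ℂ (Matrix (Fin N) (Fin N) A) :=
  Submodule.span ℂ {Y | ∃ n : ℤ, k ≤ n ∧ ∃ c ∈ C, Y = rm N c (h.x n)}

/-- The right `C`-module spanned by all powers `x^n`. -/
def P : Submodule ℂ (Matrix (Fin N) (Fin N) A) :=
  Submodule.span ℂ {Y | ∃ n : ℤ, ∃ c ∈ C, Y = rm N c (h.x n)}

theorem Pge_le_P (k : ℤ) : h.Pge k ≤ h.P :=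
  Submodule.span_mono fun _ ⟨n, _, hY⟩ => ⟨n, hY⟩

theorem Pge_anti {k l : ℤ} (hkl : k ≤ l) : h.Pge l ≤ h.Pge k :=
  Submodule.span_mono fun _ ⟨n, hn, hY⟩ => ⟨n, hkl.trans hn, hY⟩

theorem x_mem_Pge {k n : ℤ} (hk : k ≤ n) : h.x n ∈ h.Pge k :=
  Submodule.subset_span ⟨n, hk, 1, one_mem _, (rm_one _).symm⟩

theorem x_mem (n : ℤ) : h.x n ∈ h.P := h.Pge_le_P n (h.x_mem_Pge le_rfl)

theorem one_mem_P : (1 : Matrix (Fin N) (Fin N) A) ∈ h.P := h.x_mem 0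

theorem M_mem_P : M ∈ h.P := by
  have := h.x_mem 1
  rwa [x_one] at this

theorem rm_mem_Pge {k : ℤ} {c : A} (hc : c ∈ C) {Y : Matrix (Fin N) (Fin N) A}
    (hY : Y ∈ h.Pge k) : rm N c Y ∈ h.Pge k := by
  refine map_mem_of_span ?_ hY
  rintro _ ⟨n, hn, d, hd, rfl⟩
  exact Submodule.subset_span ⟨n, hn, _, mul_mem hd hc, rm_rm _ _ _⟩

theorem rm_mem {c : A} (hc : c ∈ C) {Y : Matrix (Fin N) (Fin N) A} (hY : Y ∈ h.P) :
    rm N c Y ∈ h.P := by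
  refine map_mem_of_span ?_ hY
  rintro _ ⟨n, d, hd, rfl⟩
  exact Submodule.subset_span ⟨n, _, mul_mem hd hc, rm_rm _ _ _⟩

theorem S_mem_Pge {k : ℤ} {Y : Matrix (Fin N) (Fin N) A} (hY : Y ∈ h.Pge k) :
    h.S Y ∈ h.Pge (k + 1) := by
  refine map_mem_of_span (f := h.S.toLinearMap) ?_ hY
  rintro _ ⟨n, hn, d, hd, rfl⟩
  exact Submodule.subset_span ⟨n + 1, by omega, d, hd, by
    rw [LinearEquiv.coe_coe, S_rm, S_x]⟩

theorem S_mem {Y : Matrix (Fin N) (Fin N) A} (hY : Y ∈ h.P) : h.S Y ∈ h.P := by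
  refine map_mem_of_span (f := h.S.toLinearMap) ?_ hY
  rintro _ ⟨n, d, hd, rfl⟩
  exact Submodule.subset_span ⟨n + 1, d, hd, by rw [LinearEquiv.coe_coe, S_rm, S_x]⟩

theorem S_symm_mem {Y : Matrix (Fin N) (Fin N) A} (hY : Y ∈ h.P) : h.S.symm Y ∈ h.P := by
  refine map_mem_of_span (f := h.S.symm.toLinearMap) ?_ hY
  rintro _ ⟨n, d, hd, rfl⟩
  exact Submodule.subset_span ⟨n - 1, d, hd, by rw [LinearEquiv.coe_coe, S_symm_rm, S_symm_x]⟩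

theorem top_x_neg_mem (m : ℕ) : (∀ n : ℤ, -m ≤ n → t.rtr (h.x n) ∈ C) ∧
    h.top (h.x (-m)) ∈ h.Pge (1 - m) := by
  induction m with
  | zero =>
    constructor
    · intro n hn
      obtain ⟨n, rfl⟩ := Int.eq_ofNat_of_zero_le (by simpa using hn)
      exact h.rtr_x_nat_mem n
    · rw [Nat.cast_zero, neg_zero, x_zero, top_one]
      refine Submodule.smul_mem _ _ ?_
      have := h.x_mem_Pge (le_refl 1)
      rwa [x_one] at this
  | succ m ih =>
    obtain ⟨ih1, ih2⟩ := ih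
    have e0 : (-(m + 1 : ℕ) : ℤ) + 1 = -m := by push_cast; ring
    have r1 : t.rtr (h.x (-(m + 1 : ℕ))) ∈ C := by
      have e := h.rtr_top_x (-(m + 1 : ℕ))
      rw [e0] at e
      have e' : t.rtr (h.x (-(m + 1 : ℕ))) = 𝒟.μ • (gi * t.rtr (h.top (h.x (-m)))) := by
        rw [e, mul_smul_comm, smul_smul, mul_inv_cancel₀ t.bmw.μ_ne, one_smul, ← mul_assoc, h.gi_g,
          one_mul]
      rw [e']
      refine C.smul_mem (mul_mem h.gi_mem ?_) _
      refine Submodule.span_induction (p := fun Y _ => t.rtr Y ∈ C) ?_ ?_ ?_ ?_ ih2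
      · rintro _ ⟨n, hn, d, hd, rfl⟩
        rw [rm_apply, rtr_map]
        exact mul_mem (ih1 n (by omega)) hd
      · have : t.rtr (0 : Matrix (Fin N) (Fin N) A) = 0 := by
          have := rtr_smul (t := t) 0 (0 : Matrix (Fin N) (Fin N) A)
          simpa using this
        rw [this]; exact zero_mem _
      · intro Y Z _ _ hY hZ
        rw [rtr_add]; exact add_mem hY hZ
      · intro c Y _ hY
        rw [rtr_smul]; exact C.smul_mem hY c
    refine ⟨fun n hn => ?_, ?_⟩
    · by_cases hn' : -(m : ℤ) ≤ n
      · exact ih1 n hn'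
      · obtain rfl : n = -(m + 1 : ℕ) := by push_cast at hn ⊢; omega
        exact r1
    · have e := h.S_top_x (-(m + 1 : ℕ))
      rw [e0] at e
      have e' : h.top (h.x (-(m + 1 : ℕ))) = rm N gi (h.S (h.top (h.x (-m))) +
          𝒟.lam • rm N g (h.x (-m)) -
          (𝒟.lam * 𝒟.μ⁻¹) • rm N (g * t.rtr (h.x (-(m + 1 : ℕ)))) M) := by
        have e2 : ∀ a b c : Matrix (Fin N) (Fin N) A, a - b + c + b - c = a := fun a b c => by abel
        rw [e, e2, rm_rm, h.g_gi, rm_one]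
      rw [e']
      have hM := h.x_mem_Pge (k := -m) (n := 1) (by omega)
      rw [x_one] at hM
      have := h.Pge_anti (show (-m : ℤ) ≤ 1 - m + 1 by omega) (h.S_mem_Pge ih2)
      rw [show (1 - (m + 1 : ℕ) : ℤ) = -m by push_cast; ring]
      exact h.rm_mem_Pge h.gi_mem (sub_mem (add_mem this (Submodule.smul_mem _ _
        (h.rm_mem_Pge h.g_mem (h.x_mem_Pge le_rfl)))) (Submodule.smul_mem _ _
        (h.rm_mem_Pge (mul_mem h.g_mem r1) hM)))

theorem rtr_x_mem (n : ℤ) : t.rtr (h.x n) ∈ C := (h.top_x_neg_mem n.natAbs).1 n (by omega)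

theorem top_x_mem (n : ℤ) : h.top (h.x n) ∈ h.P := by
  obtain ⟨n, rfl | rfl⟩ := n.eq_nat_or_neg
  · induction n with
    | zero =>
      rw [Nat.cast_zero, x_zero, top_one]
      exact Submodule.smul_mem _ _ h.M_mem_P
    | succ n ih =>
      have e := h.S_top_x n
      rw [Nat.cast_succ, ← LinearEquiv.symm_apply_apply h.S (h.top _), e]
      exact h.S_symm_mem (add_mem (sub_mem (h.rm_mem h.g_mem ih) (Submodule.smul_mem _ _
        (h.rm_mem h.g_mem (h.x_mem _)))) (Submodule.smul_mem _ _
        (h.rm_mem (mul_mem h.g_mem (h.rtr_x_mem n)) h.M_mem_P)))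
  · exact h.Pge_le_P _ (h.top_x_neg_mem n).2

theorem top_mem {Y : Matrix (Fin N) (Fin N) A} (hY : Y ∈ h.P) : h.top Y ∈ h.P := by
  refine map_mem_of_span ?_ hY
  rintro _ ⟨n, d, hd, rfl⟩
  rw [top_rm]
  exact h.rm_mem hd (h.top_x_mem n)

theorem rtr_mem {Y : Matrix (Fin N) (Fin N) A} (hY : Y ∈ h.P) : t.rtr Y ∈ C := by
  refine Submodule.span_induction (p := fun Y _ => t.rtr Y ∈ C) ?_ ?_ ?_ ?_ hY
  · rintro _ ⟨n, d, hd, rfl⟩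
    rw [rm_apply, rtr_map]
    exact mul_mem (h.rtr_x_mem n) hd
  · have : t.rtr (0 : Matrix (Fin N) (Fin N) A) = 0 := by
      have := rtr_smul (t := t) 0 (0 : Matrix (Fin N) (Fin N) A)
      simpa using this
    rw [this]; exact zero_mem _
  · intro Y Z _ _ hY hZ
    rw [rtr_add]; exact add_mem hY hZ
  · intro c Y _ hY
    rw [rtr_smul]; exact C.smul_mem hY c

theorem exists_pow_mem (n : ℕ) : (∀ b ∈ t.B 0 n, ∀ x, t.IsCh M n b x → x ∈ C) ∧
    ∀ b ∈ t.B 0 (n + 1), ∃ Z ∈ h.P, t.IsPow M n b Z := by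
  induction n with
  | zero =>
    refine ⟨fun b hb x hx => ?_, fun b hb => ?_⟩
    · have hb' : b ∈ t.B 0 1 := B_mono (by omega) (by omega) hb
      rw [B_one] at hb'
      obtain ⟨r, rfl⟩ := Algebra.mem_bot.1 hb'
      have : x = r • 1 := t.scal_injective (by
        rw [hx, trs_zero, prod, one_mul, map_smul, map_one, Algebra.algebraMap_eq_smul_one])
      rw [this]
      exact C.smul_mem C.one_mem r
    · rw [zero_add, B_one] at hb
      obtain ⟨r, rfl⟩ := Algebra.mem_bot.1 hb
      refine ⟨r • M, Submodule.smul_mem _ _ h.M_mem_P, ?_⟩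
      rw [IsPow, trs_zero, Algebra.algebraMap_eq_smul_one, mul_smul_comm, mul_one, map_smul]
      congr 1
      exact (one_mul _).symm
  | succ n ih =>
    obtain ⟨-, ih⟩ := ih
    have hch : ∀ b ∈ t.B 0 (n + 1), ∀ x, t.IsCh M (n + 1) b x → x ∈ C := by
      intro b hb x hx
      obtain ⟨Z, hZ, hZ'⟩ := ih b hb
      rw [t.scal_injective (hx.trans hZ'.rtr.symm)]
      exact h.rtr_mem hZ
    refine ⟨hch, fun b hb => ?_⟩
    have hb' := B_le_spanSet 0 (n + 1) hb
    clear hb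
    have cyc : ∀ {X y z}, y ∈ t.B 1 (n + 1) → t.IsPow M (n + 1) (y * X) z →
        t.IsPow M (n + 1) (X * y) z := fun {X y z} hy hz => by
      rw [IsPow, ← mul_assoc, ← trs_cyc (le_refl 1) (by omega) hy, ← mul_assoc,
        h.B_prod (by omega) (by omega) hy, mul_assoc]
      exact hz
    induction hb' using Submodule.span_induction with
    | mem z hz =>
      rcases hz with hz | ⟨u, hu, y, hy, hz⟩
      · obtain ⟨c, hc, rfl⟩ := exists_sh hz
        obtain ⟨x, hx⟩ := exists_isCh (t := t) M hc
        exact ⟨_, h.rm_mem (hch _ hc _ hx) h.M_mem_P, IsCh.map hc hx⟩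
      · obtain ⟨d, hd, hdy⟩ := exists_sh (mul_mem hy hu)
        obtain ⟨Z, hZ, hZ'⟩ := ih _ hd
        rcases hz with rfl | rfl
        · refine ⟨_, h.S_mem hZ, cyc hy ?_⟩
          rw [← mul_assoc, ← hdy]
          exact hZ'.mulS hd
        · refine ⟨_, h.top_mem hZ, cyc hy ?_⟩
          rw [← mul_assoc, ← hdy]
          exact hZ'.mulTop hd
    | zero => exact ⟨0, zero_mem _, by simp [IsPow]⟩
    | add a c _ _ ha hc =>
      obtain ⟨Y, hY, hY'⟩ := ha
      obtain ⟨Z, hZ, hZ'⟩ := hc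
      exact ⟨Y + Z, add_mem hY hZ, by rw [IsPow, map_add, hY', hZ', mul_add, map_add]⟩
    | smul r a _ ha =>
      obtain ⟨Y, hY, hY'⟩ := ha
      exact ⟨r • Y, Submodule.smul_mem _ _ hY, by
        rw [IsPow, map_smul, hY', mul_smul_comm, map_smul]⟩

theorem pow_mem {n : ℕ} {b : E} (hb : b ∈ t.B 0 (n + 1)) {Y : Matrix (Fin N) (Fin N) A}
    (hY : t.IsPow M n b Y) : Y ∈ h.P := by
  obtain ⟨Z, hZ, hZ'⟩ := (h.exists_pow_mem n).2 b hb
  rwa [t.mat_injective (hY.trans hZ'.symm)]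

theorem ch_mem {n : ℕ} {b : E} (hb : b ∈ t.B 0 n) {x : A} (hx : t.IsCh M n b x) : x ∈ C :=
  (h.exists_pow_mem n).1 b hb x hx

end Star

end Tower

namespace Tower

variable {N : ℕ} {𝒟 : QMData N} {A E : Type} [Ring A] [Algebra ℂ A] [Ring E] [Algebra ℂ E]
variable {t : Tower 𝒟 A E} {M : Matrix (Fin N) (Fin N) A}

namespace Star

variable {g gi : A} {C : Subalgebra ℂ A} (h : t.Star M g gi C)

/-- The algebra of operators generated by `M ⋆`, its inverse and the multiplications by
elements of `C`. -/
def ops : Subalgebra ℂ (Module.End ℂ (Matrix (Fin N) (Fin N) A)) :=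
  Algebra.adjoin ℂ ({h.S.toLinearMap, h.S.symm.toLinearMap} ∪ {f | ∃ c ∈ C, f = rm N c})

theorem S_mem_ops : h.S.toLinearMap ∈ h.ops := Algebra.subset_adjoin (Or.inl (Or.inl rfl))

theorem S_symm_mem_ops : h.S.symm.toLinearMap ∈ h.ops :=
  Algebra.subset_adjoin (Or.inl (Or.inr rfl))

theorem rm_mem_ops {c : A} (hc : c ∈ C) : rm N c ∈ h.ops :=
  Algebra.subset_adjoin (Or.inr ⟨c, hc, rfl⟩)

theorem commute_ops {f : Module.End ℂ (Matrix (Fin N) (Fin N) A)}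
    (hS : ∀ Y, f (h.S Y) = h.S (f Y)) (hc : ∀ c ∈ C, ∀ Y, f (rm N c Y) = rm N c (f Y))
    {k : Module.End ℂ (Matrix (Fin N) (Fin N) A)} (hk : k ∈ h.ops) : Commute f k := by
  refine Algebra.commute_of_mem_adjoin_of_forall_mem_commute hk ?_
  rintro _ ((rfl | rfl) | ⟨c, hC, rfl⟩)
  · exact LinearMap.ext hS
  · refine LinearMap.ext fun Y => ?_
    change f (h.S.symm Y) = h.S.symm (f Y)
    rw [LinearEquiv.eq_symm_apply, ← hS, LinearEquiv.apply_symm_apply]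
  · exact LinearMap.ext (hc c hC)

theorem ops_comm {f k : Module.End ℂ (Matrix (Fin N) (Fin N) A)} (hf : f ∈ h.ops)
    (hk : k ∈ h.ops) : Commute f k := by
  have hS : Commute f h.S.toLinearMap :=
    (h.commute_ops (fun Y => rfl) (fun c _ Y => h.S_rm c Y) hf).symm
  refine h.commute_ops (fun Y => congrArg (· Y) hS.eq) (fun c hc Y => ?_) hk
  have := (h.commute_ops (f := rm N c) (fun Y => (h.S_rm c Y).symm) (fun d hd Y => by
    rw [rm_rm, rm_rm, h.comm c hc d hd]) hf).symm
  exact congrArg (· Y) this.eq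

theorem ops_mem {f : Module.End ℂ (Matrix (Fin N) (Fin N) A)} (hf : f ∈ h.ops) :
    ∀ {Y}, Y ∈ h.P → f Y ∈ h.P := by
  induction hf using Algebra.adjoin_induction with
  | mem f hf =>
    intro Y hY
    rcases hf with (rfl | rfl) | ⟨c, hc, rfl⟩
    exacts [h.S_mem hY, h.S_symm_mem hY, h.rm_mem hc hY]
  | algebraMap r =>
    intro Y hY
    rw [Algebra.algebraMap_eq_smul_one]
    exact Submodule.smul_mem _ r hY
  | add f k _ _ hf hk => exact fun hY => add_mem (hf hY) (hk hY)
  | mul f k _ _ hf hk => exact fun hY => hf (hk hY)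

theorem exists_ops {Y : Matrix (Fin N) (Fin N) A} (hY : Y ∈ h.P) : ∃ f ∈ h.ops, f 1 = Y := by
  have hx : ∀ n : ℤ, ∃ f ∈ h.ops, f 1 = h.x n := by
    intro n
    induction n using Int.induction_on with
    | zero => exact ⟨1, one_mem _, rfl⟩
    | succ n ih =>
      obtain ⟨f, hf, hf'⟩ := ih
      exact ⟨_, mul_mem h.S_mem_ops hf, by rw [← S_x, ← hf']; rfl⟩
    | pred n ih =>
      obtain ⟨f, hf, hf'⟩ := ih
      exact ⟨_, mul_mem h.S_symm_mem_ops hf, by rw [← S_symm_x, ← hf']; rfl⟩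
  induction hY using Submodule.span_induction with
  | mem Y hY =>
    obtain ⟨n, c, hc, rfl⟩ := hY
    obtain ⟨f, hf, hf'⟩ := hx n
    exact ⟨_, mul_mem (h.rm_mem_ops hc) hf, by rw [← hf']; rfl⟩
  | zero => exact ⟨0, zero_mem _, rfl⟩
  | add Y Z _ _ hY hZ =>
    obtain ⟨f, hf, rfl⟩ := hY
    obtain ⟨k, hk, rfl⟩ := hZ
    exact ⟨f + k, add_mem hf hk, rfl⟩
  | smul c Y _ hY =>
    obtain ⟨f, hf, rfl⟩ := hY
    exact ⟨c • f, Subalgebra.smul_mem _ hf c, rfl⟩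

theorem ops_ext {f k : Module.End ℂ (Matrix (Fin N) (Fin N) A)}
    (hf : ∀ {p}, p ∈ h.ops → Commute f p) (hk : ∀ {p}, p ∈ h.ops → Commute k p) (e : f 1 = k 1)
    {Y : Matrix (Fin N) (Fin N) A} (hY : Y ∈ h.P) : f Y = k Y := by
  obtain ⟨p, hp, rfl⟩ := h.exists_ops hY
  have e1 : f (p 1) = p (f 1) := congrArg (· 1) (hf hp).eq
  have e2 : k (p 1) = p (k 1) := congrArg (· 1) (hk hp).eq
  rw [e1, e2, e]

/-- `s` is the product `f(1) ⋆ Z = f(Z)`. -/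
def IsStar {W : Submodule ℂ (Matrix (Fin N) (Fin N) A)} (s : W →ₗ[ℂ] W →ₗ[ℂ] W) : Prop :=
  ∀ Y Z : W, ∀ f ∈ h.ops, f 1 = Y → (s Y Z : Matrix (Fin N) (Fin N) A) = f Z

theorem exists_isStar {W : Submodule ℂ (Matrix (Fin N) (Fin N) A)} (hW : W = h.P) :
    ∃ s : W →ₗ[ℂ] W →ₗ[ℂ] W, h.IsStar s := by
  subst hW
  have ex : ∀ Y : h.P, ∃ f ∈ h.ops, f 1 = Y := fun Y => h.exists_ops Y.2
  choose F hF hF1 using ex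
  have key : ∀ (Y Z : h.P), ∀ f ∈ h.ops, f 1 = Y → F Y Z = f Z := fun Y Z f hf e =>
    h.ops_ext (h.ops_comm (hF Y)) (h.ops_comm hf) ((hF1 Y).trans e.symm) Z.2
  refine ⟨LinearMap.mk₂ ℂ (fun Y Z => ⟨F Y Z, h.ops_mem (hF Y) Z.2⟩) ?_ ?_ ?_ ?_, fun Y Z f hf e =>
    key Y Z f hf e⟩
  · intro Y Y' Z
    refine Subtype.ext (key _ _ _ (add_mem (hF Y) (hF Y')) ?_)
    rw [LinearMap.add_apply, hF1, hF1]; rfl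
  · intro c Y Z
    refine Subtype.ext (key _ _ _ (Subalgebra.smul_mem _ (hF Y) c) ?_)
    rw [LinearMap.smul_apply, hF1]; rfl
  · intro Y Z Z'
    exact Subtype.ext (map_add (F Y) _ _)
  · intro c Y Z
    exact Subtype.ext (map_smul (F Y) _ _)

theorem isStar_of_assoc {W : Submodule ℂ (Matrix (Fin N) (Fin N) A)} (hW : W = h.P)
    {s : W →ₗ[ℂ] W →ₗ[ℂ] W} (assoc : ∀ X Y Z, s (s X Y) Z = s X (s Y Z))
    (scalar : ∀ c ∈ C, ∀ I Y : W, (I : Matrix (Fin N) (Fin N) A) = rm N c 1 →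
      (s I Y : Matrix (Fin N) (Fin N) A) = rm N c Y)
    (inv_left : ∀ X Y : W, (X : Matrix (Fin N) (Fin N) A) = h.x (-1) →
      (s X Y : Matrix (Fin N) (Fin N) A) = h.S.symm Y)
    (inv_right : ∀ X Y : W, (X : Matrix (Fin N) (Fin N) A) = h.x (-1) →
      (s Y X : Matrix (Fin N) (Fin N) A) = h.S.symm Y) : h.IsStar s := by
  subst hW
  let m : h.P := ⟨M, h.M_mem_P⟩
  let mi : h.P := ⟨h.x (-1), h.x_mem _⟩
  have one : ∀ Z : h.P, s ⟨1, h.one_mem_P⟩ Z = Z := fun Z =>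
    Subtype.ext (by rw [scalar 1 (one_mem _) _ _ (rm_one _).symm, rm_one])
  have hm : ∀ Y : h.P, (s m Y : Matrix (Fin N) (Fin N) A) = h.S Y := by
    intro Y
    have e1 : s m mi = ⟨1, h.one_mem_P⟩ := by
      refine Subtype.ext ?_
      rw [inv_right _ _ rfl]
      change h.S.symm M = 1
      rw [LinearEquiv.symm_apply_eq]
      exact (mulS_one t).symm
    have e2 : s mi ⟨h.S Y, h.S_mem Y.2⟩ = Y := by
      refine Subtype.ext ?_
      rw [inv_left _ _ rfl, LinearEquiv.symm_apply_apply]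
    have := assoc m mi ⟨h.S Y, h.S_mem Y.2⟩
    rw [e1, e2, one] at this
    rw [← this]
  have key : ∀ f (hf : f ∈ h.ops), ∀ Y Z : h.P,
      (s ⟨f Y, h.ops_mem hf Y.2⟩ Z : Matrix (Fin N) (Fin N) A) = f (s Y Z) := by
    intro f hf
    induction hf using Algebra.adjoin_induction with
    | mem f hf =>
      intro Y Z
      rcases hf with (rfl | rfl) | ⟨c, hc, rfl⟩
      · have : (⟨h.S Y, h.S_mem Y.2⟩ : h.P) = s m Y := Subtype.ext (hm Y).symm
        exact (congrArg (fun X => (s X Z : Matrix (Fin N) (Fin N) A)) this).trans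
          (by rw [assoc, hm]; rfl)
      · have : (⟨h.S.symm Y, h.S_symm_mem Y.2⟩ : h.P) = s mi Y :=
          Subtype.ext (inv_left _ _ rfl).symm
        exact (congrArg (fun X => (s X Z : Matrix (Fin N) (Fin N) A)) this).trans
          (by rw [assoc, inv_left _ _ rfl]; rfl)
      · have : (⟨rm N c Y, h.rm_mem hc Y.2⟩ : h.P) =
            s ⟨rm N c 1, h.rm_mem hc h.one_mem_P⟩ Y := Subtype.ext (scalar c hc _ _ rfl).symm
        exact (congrArg (fun X => (s X Z : Matrix (Fin N) (Fin N) A)) this).trans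
          (by rw [assoc, scalar c hc _ _ rfl])
    | algebraMap r =>
      intro Y Z
      have : (⟨algebraMap ℂ (Module.End ℂ (Matrix (Fin N) (Fin N) A)) r Y,
        h.ops_mem (Subalgebra.algebraMap_mem _ r) Y.2⟩ : h.P) = r • Y := Subtype.ext rfl
      rw [this, map_smul]; rfl
    | add f k hf' hk' hf hk =>
      intro Y Z
      have : (⟨(f + k) Y, h.ops_mem (add_mem hf' hk') Y.2⟩ : h.P) =
        ⟨f Y, h.ops_mem hf' Y.2⟩ + ⟨k Y, h.ops_mem hk' Y.2⟩ := Subtype.ext rfl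
      rw [this, map_add, LinearMap.add_apply, Submodule.coe_add, hf, hk]; rfl
    | mul f k hf' hk' hf hk =>
      intro Y Z
      have := hf ⟨k Y, h.ops_mem hk' Y.2⟩ Z
      rw [hk] at this
      exact this
  intro Y Z f hf e
  have := key f hf ⟨1, h.one_mem_P⟩ Z
  rw [one] at this
  have e' : Y = ⟨f 1, h.ops_mem hf h.one_mem_P⟩ := Subtype.ext e.symm
  rw [e']
  exact this

namespace IsStar

variable {h} {W : Submodule ℂ (Matrix (Fin N) (Fin N) A)} {s : W →ₗ[ℂ] W →ₗ[ℂ] W}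
  (hs : h.IsStar s) (hW : W = h.P)
include hs hW

theorem ext {s' : W →ₗ[ℂ] W →ₗ[ℂ] W} (hs' : h.IsStar s') : s = s' := by
  refine LinearMap.ext₂ fun Y Z => Subtype.ext ?_
  obtain ⟨f, hf, e⟩ := h.exists_ops (hW.le Y.2)
  rw [hs Y Z f hf e, hs' Y Z f hf e]

theorem assoc (X Y Z : W) : s (s X Y) Z = s X (s Y Z) := by
  refine Subtype.ext ?_
  obtain ⟨f, hf, e⟩ := h.exists_ops (hW.le X.2)
  obtain ⟨k, hk, e'⟩ := h.exists_ops (hW.le Y.2)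
  rw [hs X _ f hf e, hs Y _ k hk e', hs _ Z (f * k) (mul_mem hf hk)]
  · rfl
  · rw [hs X Y f hf e, ← e']; rfl

theorem comm (Y Z : W) : s Y Z = s Z Y := by
  refine Subtype.ext ?_
  obtain ⟨f, hf, e⟩ := h.exists_ops (hW.le Y.2)
  obtain ⟨k, hk, e'⟩ := h.exists_ops (hW.le Z.2)
  rw [hs Y Z f hf e, hs Z Y k hk e', ← e, ← e']
  exact congrArg (· 1) (h.ops_comm hf hk).eq

/-- `M^α ⋆ M^β`. -/
theorem pow_pow {n p : ℕ} {α b : E} (hα : α ∈ t.B 0 (n + 1)) (hb : b ∈ t.B 0 (p + 1))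
    {Y Z : W} (hY : t.IsPow M n α Y) (hZ : t.IsPow M p b Z) :
    t.IsPow M (n + 1 + p) (α * t.sh^[n + 1] b * (t.u (n + 1) * t.sh (t.ui n))) (s Y Z) := by
  obtain ⟨L, hL, hLS, hLc⟩ := h.exists_leftStar (n := n + 1) (mul_mem hα (ui_mem n))
  obtain ⟨f, hf, e⟩ := h.exists_ops (hW.le Y.2)
  let L' : Module.End ℂ (Matrix (Fin N) (Fin N) A) :=
    { toFun := L
      map_add' := fun Y Z => t.mat_injective (by
        rw [hL, map_add, hL, hL, bar_add, mul_add, add_mul, map_add])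
      map_smul' := fun c Y => t.mat_injective (by
        rw [hL, map_smul, hL, bar_smul, mul_smul_comm, smul_mul_assoc, map_smul, RingHom.id_apply]) }
  have e1 : f 1 = L' 1 := e.trans (leftStar_one hα (hL 1) hY).symm
  have e2 : f Z = L Z := h.ops_ext (h.ops_comm hf)
    (h.commute_ops (f := L') hLS fun c _ Y => hLc Y c) e1 (hW.le Z.2)
  rw [hs Y Z f hf e, e2]
  exact leftStar_pow hα hb (hL Z) hZ

end IsStar

end Star

end Tower

section Standard

variable {N : ℕ} {𝒟 : QMData N} {A : Type} [Ring A] [Algebra ℂ A]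

namespace QMData.Admissible

variable (H : 𝒟.Admissible)

theorem trs_eq (k n : ℕ) (Z : FunOp N A) :
    (funLegs N A).trs (matD 𝒟.R) k n Z = (H.tower A).trs k n Z := by
  induction n generalizing Z with
  | zero => rfl
  | succ n ih => rw [LegSystem.trs_succ, ih, Tower.trs_succ]; rfl

theorem opHom_copy_eq_bar {n i : ℕ} (h : i < n + 1) (M : Matrix (Fin N) (Fin N) A) :
    opHom (n + 1) (𝒟.copy n M i) = (H.tower A).bar M i := by
  induction i with
  | zero => exact opHom_firstLeg n M
  | succ i ih =>
    rw [QMData.copy, map_mul, map_mul, opHom_toA, opHom_toA, cHom_legs h, cHom_legs h,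
      ih (by omega)]
    rfl

theorem opHom_copyProd {n j : ℕ} (h : j ≤ n + 1) (M : Matrix (Fin N) (Fin N) A) :
    opHom (n + 1) (𝒟.copyProd n M j) = (H.tower A).prod M 0 j := by
  induction j with
  | zero => exact map_one _
  | succ j ih =>
    rw [QMData.copyProd, map_mul, ih (by omega), H.opHom_copy_eq_bar (by omega), Tower.prod_succ,
      zero_add]

theorem isCh (M : Matrix (Fin N) (Fin N) A) (n : ℕ) (X : Op N n ℂ) :
    (H.tower A).IsCh M n (cHom n X) (𝒟.ch M n X) := by
  cases n with
  | zero =>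
    rw [Tower.IsCh, ← H.trs_eq, QMData.ch]
    change (funLegs N A).scal _ = _
    rw [scal_fullTrace, opHom_toA]
    exact congrArg _ (one_mul _).symm
  | succ n =>
    rw [Tower.IsCh, ← H.trs_eq, QMData.ch]
    change (funLegs N A).scal _ = _
    rw [scal_fullTrace, map_mul, opHom_toA, H.opHom_copyProd le_rfl]

theorem isPow (M : Matrix (Fin N) (Fin N) A) (n : ℕ) (X : Op N (n + 1) ℂ) :
    (H.tower A).IsPow M n (cHom (n + 1) X) (𝒟.matPow M n X) := by
  rw [Tower.IsPow, ← H.trs_eq, QMData.matPow]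
  change (funLegs N A).mat _ = _
  rw [mat_tailTrace, map_mul, opHom_toA, H.opHom_copyProd le_rfl]

theorem map_braidAlg (n : ℕ) : (𝒟.braidAlg n).map (cHom n) = (H.tower A).B 0 n := by
  rw [QMData.braidAlg, AlgHom.map_adjoin, Tower.B]
  congr 1
  ext x
  constructor
  · rintro ⟨_, ⟨i, hi, rfl⟩ | ⟨i, hi, rfl⟩, rfl⟩
    · exact ⟨i, by omega, by omega, Or.inl (QMData.cHom_Rop hi)⟩
    · exact ⟨i, by omega, by omega, Or.inr (QMData.cHom_RopInv hi)⟩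
  · rintro ⟨i, -, hi, rfl | rfl⟩
    · exact ⟨_, Or.inl ⟨i, by omega, rfl⟩, QMData.cHom_Rop (by omega)⟩
    · exact ⟨_, Or.inr ⟨i, by omega, rfl⟩, QMData.cHom_RopInv (by omega)⟩

theorem cHom_mem {n : ℕ} {X : Op N n ℂ} (hX : X ∈ 𝒟.braidAlg n) :
    cHom n X ∈ (H.tower A).B 0 n := H.map_braidAlg (A := A) n ▸ ⟨X, hX, rfl⟩

theorem exists_cHom {n : ℕ} {b : FunOp N A} (hb : b ∈ (H.tower A).B 0 n) :
    ∃ X ∈ 𝒟.braidAlg n, cHom n X = b := by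
  rw [← H.map_braidAlg] at hb
  exact hb

theorem cHom_twistWord (m p : ℕ) : cHom (m + 1 + (p + 1)) (𝒟.twistWord m p) =
    (H.tower A).u (m + 1) * (H.tower A).sh ((H.tower A).ui m) := by
  have h1 : ∀ n j, j + 1 ≤ n →
      cHom n ((List.range j).reverse.map (𝒟.Rop n)).prod = (H.tower A).u j := by
    intro n j hj
    induction j with
    | zero => exact map_one _
    | succ j ih =>
      rw [List.range_succ, List.reverse_append, List.map_append, List.prod_append, map_mul,
        ih (by omega)]
      simp only [List.reverse_cons, List.reverse_nil, List.nil_append, List.map_cons, List.map_nil,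
        List.prod_cons, List.prod_nil, mul_one]
      rw [QMData.cHom_Rop (by omega)]
      rfl
  have h2 : ∀ n j, j + 2 ≤ n →
      cHom n ((List.range j).map fun i => 𝒟.RopInv n (i + 1)).prod =
        (H.tower A).sh ((H.tower A).ui j) := by
    intro n j hj
    induction j with
    | zero =>
      rw [List.range_zero, List.map_nil, List.prod_nil, map_one]
      exact (map_one _).symm
    | succ j ih =>
      rw [List.range_succ, List.map_append, List.prod_append, map_mul, ih (by omega)]
      simp only [List.map_cons, List.map_nil, List.prod_cons, List.prod_nil, mul_one]
      rw [QMData.cHom_RopInv (by omega)]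
      have : (H.tower A).ui (j + 1) = (H.tower A).ui j * (H.tower A).Ri j := rfl
      rw [this, map_mul (H.tower A).sh, Tower.sh_Ri]
      rfl
  rw [QMData.twistWord, map_mul, h1 _ _ (by omega), h2 _ _ (by omega)]

theorem cHom_expStar {m p : ℕ} (X : Op N (m + 1) ℂ) (Y : Op N (p + 1) ℂ) :
    cHom (m + 1 + p + 1) (𝒟.expStar X Y) = cHom (m + 1) X *
      (H.tower A).sh^[m + 1] (cHom (p + 1) Y) *
      ((H.tower A).u (m + 1) * (H.tower A).sh ((H.tower A).ui m)) := by
  rw [QMData.expStar, ← H.cHom_twistWord m p]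
  change cHom (m + 1 + (p + 1)) _ = _
  rw [map_mul, cHom_opTensor]
  rfl

end QMData.Admissible

section Map

variable {A' : Type} [Ring A'] [Algebra ℂ A'] (f : A →ₐ[ℂ] A')

theorem map_toA {ι : Type} (X : Matrix ι ι ℂ) : (toA A X).map f = toA A' X := by
  ext i j; simp [toA]

theorem map_copy (n : ℕ) (M : Matrix (Fin N) (Fin N) A) (i : ℕ) :
    (𝒟.copy n M i).map f = 𝒟.copy n (M.map f) i := by
  induction i with
  | zero =>
    ext s u
    simp only [QMData.copy, firstLeg, Matrix.map_apply]
    split_ifs <;> simp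
  | succ i ih =>
    rw [QMData.copy, QMData.copy, ← ih, ← map_toA f, ← map_toA f, ← Matrix.map_mul, ← Matrix.map_mul]

theorem map_copyProd (n : ℕ) (M : Matrix (Fin N) (Fin N) A) (j : ℕ) :
    (𝒟.copyProd n M j).map f = 𝒟.copyProd n (M.map f) j := by
  induction j with
  | zero => exact Matrix.map_one _ (map_zero _) (map_one _)
  | succ j ih => rw [QMData.copyProd, QMData.copyProd, ← ih, ← map_copy f, ← Matrix.map_mul]

theorem map_fullTrace {n : ℕ} (D : Matrix (Fin N) (Fin N) ℂ) (Y : Op N n A) :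
    f (fullTrace D Y) = fullTrace D (Y.map f) := by
  simp [fullTrace, map_sum, map_smul]

theorem map_ch (M : Matrix (Fin N) (Fin N) A) (n : ℕ) (X : Op N n ℂ) :
    f (𝒟.ch M n X) = 𝒟.ch (M.map f) n X := by
  cases n with
  | zero => rw [QMData.ch, QMData.ch, map_fullTrace, map_toA]
  | succ n =>
    rw [QMData.ch, QMData.ch, map_fullTrace, Matrix.map_mul, map_toA, map_copyProd]

theorem map_gElt (M : Matrix (Fin N) (Fin N) A) : f (𝒟.gElt M) = 𝒟.gElt (M.map f) := by
  rw [QMData.gElt, QMData.gElt, map_smul, map_ch]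

end Map

end Standard

section Component

variable {N : ℕ} {𝒟 : QMData N} (ℓ : ℕ) (ε : ℂ)

namespace QMData.Admissible

variable (H : 𝒟.Admissible)

theorem freeM_map : 𝒟.freeM.map (RingQuot.mkAlgHom ℂ (𝒟.ComponentRel ℓ ε)) = 𝒟.genM ℓ ε := rfl

theorem g_mul_gInv : 𝒟.gElt (𝒟.genM ℓ ε) * 𝒟.gInv ℓ ε = 1 := by
  have := RingQuot.mkAlgHom_rel ℂ (ComponentRel.mul_inv (𝒟 := 𝒟) (ℓ := ℓ) (ε := ε))
  rw [map_mul, map_one, map_gElt] at this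
  exact this

theorem gInv_mul_g : 𝒟.gInv ℓ ε * 𝒟.gElt (𝒟.genM ℓ ε) = 1 := by
  have := RingQuot.mkAlgHom_rel ℂ (ComponentRel.inv_mul (𝒟 := 𝒟) (ℓ := ℓ) (ε := ε))
  rw [map_mul, map_one, map_gElt] at this
  exact this

include H in
theorem qm : (H.tower (𝒟.Component ℓ ε)).QM (𝒟.genM ℓ ε) (𝒟.gElt (𝒟.genM ℓ ε)) (𝒟.gInv ℓ ε) where
  rel_zero := by
    have e : toA (𝒟.Component ℓ ε) (𝒟.Rop 2 0) * 𝒟.copy 1 (𝒟.genM ℓ ε) 0 *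
        𝒟.copy 1 (𝒟.genM ℓ ε) 1 = 𝒟.copy 1 (𝒟.genM ℓ ε) 0 * 𝒟.copy 1 (𝒟.genM ℓ ε) 1 *
          toA (𝒟.Component ℓ ε) (𝒟.Rop 2 0) := by
      simp only [← freeM_map, ← map_copy, ← map_toA (RingQuot.mkAlgHom ℂ (𝒟.ComponentRel ℓ ε)),
        ← Matrix.map_mul]
      ext s u
      exact RingQuot.mkAlgHom_rel ℂ (ComponentRel.quad s u)
    have e' := congrArg (opHom 2) e
    simp only [map_mul, H.opHom_copy_eq_bar (show 0 < 1 + 1 by omega),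
      H.opHom_copy_eq_bar (show 1 < 1 + 1 by omega), opHom_toA,
      QMData.cHom_Rop (show 0 + 1 < 2 by omega), mul_assoc] at e'
    rw [mul_assoc]
    exact e'
  scal_g := by
    have h := H.isCh (𝒟.genM ℓ ε) 2 (𝒟.Kop 2 0)
    rw [Tower.IsCh, QMData.cHom_Kop (by omega)] at h
    rw [QMData.gElt, map_smul, h]
    simp only [Tower.trs_succ, Tower.trs_zero, Tower.prod, one_mul, zero_add]
    rfl
  g_gi := g_mul_gInv ℓ ε
  gi_g := gInv_mul_g ℓ ε

theorem gElt_mem : 𝒟.gElt (𝒟.genM ℓ ε) ∈ 𝒟.charAlg ℓ ε := (𝒟.gC ℓ ε).2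

include H in
theorem star : (H.tower (𝒟.Component ℓ ε)).Star (𝒟.genM ℓ ε) (𝒟.gElt (𝒟.genM ℓ ε)) (𝒟.gInv ℓ ε)
    (𝒟.charAlg ℓ ε) where
  toQM := H.qm ℓ ε
  phi_bijective := H.phi_bijective
  rtr_iterate_mem n := by
    cases n with
    | zero =>
      rw [Function.iterate_zero, id, Tower.rtr_one]
      exact Subalgebra.smul_mem _ (one_mem _) _
    | succ n =>
      obtain ⟨b, hb, hb'⟩ := Tower.exists_isPow_iterate (t := H.tower (𝒟.Component ℓ ε)) (𝒟.genM ℓ ε) n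
      obtain ⟨X, hX, rfl⟩ := H.exists_cHom hb
      rw [(H.tower _).scal_injective (hb'.rtr.trans (H.isCh (𝒟.genM ℓ ε) _ X).symm)]
      exact Algebra.subset_adjoin (Or.inl ⟨_, X, hX, rfl⟩)
  g_mem := gElt_mem ℓ ε
  gi_mem := Algebra.subset_adjoin (Or.inr rfl)
  comm := by
    have hch : ∀ m X, X ∈ 𝒟.braidAlg m → ∀ n Y, Y ∈ 𝒟.braidAlg n →
        Commute (𝒟.ch (𝒟.genM ℓ ε) m X) (𝒟.ch (𝒟.genM ℓ ε) n Y) := fun m X hX n Y hY =>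
      (H.qm ℓ ε).IsCh_comm (H.cHom_mem hX) (H.cHom_mem hY) (H.isCh _ m X) (H.isCh _ n Y)
    have hgi : ∀ n Y, Y ∈ 𝒟.braidAlg n →
        Commute (𝒟.gInv ℓ ε) (𝒟.ch (𝒟.genM ℓ ε) n Y) := by
      intro n Y hY
      have : Commute (𝒟.gElt (𝒟.genM ℓ ε)) (𝒟.ch (𝒟.genM ℓ ε) n Y) :=
        (hch 2 _ (𝒟.Kop_mem (by omega)) n Y hY).smul_left _
      have e := this.eq
      change _ * _ = _ * _
      calc _ = 𝒟.gInv ℓ ε * (𝒟.ch (𝒟.genM ℓ ε) n Y * 𝒟.gElt (𝒟.genM ℓ ε)) * 𝒟.gInv ℓ ε := by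
            rw [mul_assoc, mul_assoc (𝒟.ch _ _ _), g_mul_gInv, mul_one]
        _ = _ := by rw [← e, ← mul_assoc, gInv_mul_g, one_mul]
    intro x hx y hy
    refine Algebra.commute_of_mem_adjoin_of_forall_mem_commute hy fun b hb => ?_
    refine (Algebra.commute_of_mem_adjoin_of_forall_mem_commute hx fun a ha => ?_).symm
    rcases ha with ⟨m, X, hX, rfl⟩ | rfl <;> rcases hb with ⟨n, Y, hY, rfl⟩ | rfl
    · exact (hch m X hX n Y hY).symm
    · exact hgi m X hX
    · exact (hgi n Y hY).symm
    · exact Commute.refl _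

theorem S_symm_eq (Y : Matrix (Fin N) (Fin N) (𝒟.Component ℓ ε)) :
    (H.star ℓ ε).S.symm Y = 𝒟.starMInv ℓ ε Y := by
  rw [LinearEquiv.symm_apply_eq, Tower.Star.S_apply, QMData.mulS, QMData.starMInv,
    Function.rightInverse_invFun H.phi_bijective.2, ← mul_assoc]
  have := (H.star ℓ ε).mul_inv_right
  rw [QMData.genMInv, this, one_mul]

theorem x_eq (n : ℤ) : (H.star ℓ ε).x n = 𝒟.starPow ℓ ε n := by
  have h0 : ∀ n : ℕ, (H.star ℓ ε).x n = (𝒟.starM ℓ ε)^[n] 1 := by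
    intro n
    induction n with
    | zero => rfl
    | succ n ih =>
      rw [Function.iterate_succ_apply', ← ih, Nat.cast_succ, ← Tower.Star.S_x]; rfl
  have h1 : ∀ n : ℕ, (H.star ℓ ε).x (-n) = (𝒟.starMInv ℓ ε)^[n] 1 := by
    intro n
    induction n with
    | zero => rfl
    | succ n ih =>
      rw [Function.iterate_succ_apply', ← ih, Nat.cast_succ, ← H.S_symm_eq, Tower.Star.S_symm_x]
      congr 1
      ring
  cases n with
  | ofNat n => exact h0 n
  | negSucc n => exact h1 (n + 1)

theorem powMod_eq : 𝒟.powMod ℓ ε = (H.star ℓ ε).P := by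
  refine le_antisymm (Submodule.span_le.2 ?_) (Submodule.span_le.2 ?_)
  · rintro _ ⟨Y, hY, c, hc, rfl⟩
    refine (H.star ℓ ε).rm_mem hc ?_
    rcases hY with (⟨n, X, hX, rfl⟩ | ⟨n, rfl⟩) | ⟨n, rfl⟩
    · exact (H.star ℓ ε).pow_mem (H.cHom_mem hX) (H.isPow _ n X)
    · rw [← H.x_eq]
      exact (H.star ℓ ε).x_mem n
    · rw [← H.x_eq]
      exact (H.star ℓ ε).top_x_mem n
  · rintro _ ⟨n, c, hc, rfl⟩
    rw [H.x_eq]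
    exact Submodule.subset_span ⟨_, Or.inl (Or.inr ⟨n, rfl⟩), c, hc, rfl⟩

variable {ℓ ε}

theorem isStarProduct_iff {s : 𝒟.powMod ℓ ε →ₗ[ℂ] 𝒟.powMod ℓ ε →ₗ[ℂ] 𝒟.powMod ℓ ε} :
    𝒟.IsStarProduct ℓ ε s ↔ (H.star ℓ ε).IsStar s := by
  have hW := H.powMod_eq ℓ ε
  have h0 : (𝒟.starPow ℓ ε 0) = 1 := rfl
  constructor
  · intro hs
    refine (H.star ℓ ε).isStar_of_assoc hW hs.assoc ?_ ?_ ?_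
    · intro c hc I Y hI
      have : I = 𝒟.rmul ℓ ε (𝒟.oneP ℓ ε) ⟨c, hc⟩ := Subtype.ext hI
      rw [this, hs.scalar_left]
      rfl
    · intro X Y hX
      rw [H.x_eq] at hX
      have : X = 𝒟.powP ℓ ε (-1) := Subtype.ext hX
      rw [this, hs.inv_left, H.S_symm_eq]
    · intro X Y hX
      rw [H.x_eq] at hX
      have : X = 𝒟.powP ℓ ε (-1) := Subtype.ext hX
      rw [this, hs.inv_right, H.S_symm_eq]
  · intro hs
    have sl : ∀ c Y, s (𝒟.rmul ℓ ε (𝒟.oneP ℓ ε) c) Y = 𝒟.rmul ℓ ε Y c := fun c Y =>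
      Subtype.ext (hs _ Y _ ((H.star ℓ ε).rm_mem_ops c.2) rfl)
    have il : ∀ Y, (s (𝒟.powP ℓ ε (-1)) Y : Matrix (Fin N) (Fin N) (𝒟.Component ℓ ε)) =
        𝒟.starMInv ℓ ε Y := fun Y => by
      rw [hs _ Y _ ((H.star ℓ ε).S_symm_mem_ops)]
      · exact H.S_symm_eq ℓ ε Y
      · exact H.x_eq ℓ ε (-1)
    refine ⟨hs.assoc hW, ?_, sl, fun c Y => by rw [hs.comm hW, sl], il,
      fun Y => by rw [hs.comm hW, il]⟩
    intro m p X Y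
    have := hs.pow_pow hW (H.cHom_mem X.2) (H.cHom_mem Y.2) (Y := 𝒟.matPowP ℓ ε m X)
      (Z := 𝒟.matPowP ℓ ε p Y) (H.isPow _ m X.1) (H.isPow _ p Y.1)
    rw [← H.cHom_expStar] at this
    exact (H.tower _).mat_injective (this.trans (H.isPow _ _ _).symm)

include H in
theorem existsUnique_star : ∃! s, 𝒟.IsStarProduct ℓ ε s := by
  obtain ⟨s, hs⟩ := (H.star ℓ ε).exists_isStar (H.powMod_eq ℓ ε)
  exact ⟨s, H.isStarProduct_iff.2 hs, fun s' hs' =>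
    (H.isStarProduct_iff.1 hs').ext (H.powMod_eq ℓ ε) hs⟩

end QMData.Admissible

end Component

/-! ### Antisymmetrizers -/

section Antisymmetrizer

variable {N : ℕ} (𝒟 : QMData N) {E : Type} [Ring E] [Algebra ℂ E] (R K : ℕ → E)

/-- The baxterized element `1 + (x - 1)/(q - q⁻¹) R_i + (x - 1)/(q μ⁻¹ x + 1) K_i`. -/
def baxSeq (i : ℕ) (x : ℂ) : E :=
  1 + ((x - 1) / 𝒟.lam) • R i + ((x - 1) / (𝒟.q * 𝒟.μ⁻¹ * x + 1)) • K i

/-- The antisymmetrizer on the legs `s, …, s + n - 1`. -/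
def asymSeq (s : ℕ) : ℕ → E
  | 0 => 1
  | 1 => 1
  | i + 2 => (𝒟.q ^ (i + 1) / 𝒟.qnum (i + 2)) •
      (asymSeq s (i + 1) * baxSeq 𝒟 R K (s + i) ((𝒟.q ^ (2 * (i + 1)))⁻¹) * asymSeq s (i + 1))

/-- The relations between two neighbouring pairs of generators used in the fusion procedure. -/
structure FusionPair (s₁ k₁ s₂ k₂ : E) : Prop where
  sq : s₂ * s₂ = 1 + 𝒟.lam • s₂ - (𝒟.lam * 𝒟.μ) • k₂
  s₂k₂ : s₂ * k₂ = 𝒟.μ • k₂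
  braid : s₂ * s₁ * s₂ = s₁ * s₂ * s₁
  ssk : s₂ * s₁ * k₂ = k₁ * k₂
  kss : k₁ * s₂ * s₁ = k₁ * k₂
  skk : s₂ * k₁ * k₂ = s₁ * k₂ - 𝒟.lam • k₂ + 𝒟.lam • (k₁ * k₂)

variable {𝒟 R K}

theorem FusionPair.fusion {s₁ k₁ s₂ k₂ : E} (h : FusionPair 𝒟 s₁ k₁ s₂ k₂) (hq : 𝒟.q ≠ 0)
    (hμ : 𝒟.μ ≠ 0) (hl : 𝒟.lam ≠ 0) {x : ℂ} (hx : 𝒟.q * 𝒟.μ⁻¹ * x + 1 ≠ 0)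
    (hx' : 𝒟.q * 𝒟.μ⁻¹ * (𝒟.q ^ 2 * x) + 1 ≠ 0) {v : E} (hs : s₁ * v = -𝒟.q⁻¹ • v)
    (hk : k₁ * v = 0) :
    s₂ * ((1 + ((𝒟.q ^ 2 * x - 1) / 𝒟.lam) • s₁ +
        ((𝒟.q ^ 2 * x - 1) / (𝒟.q * 𝒟.μ⁻¹ * (𝒟.q ^ 2 * x) + 1)) • k₁) *
      (1 + ((x - 1) / 𝒟.lam) • s₂ + ((x - 1) / (𝒟.q * 𝒟.μ⁻¹ * x + 1)) • k₂) * v) =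
    -𝒟.q⁻¹ • ((1 + ((𝒟.q ^ 2 * x - 1) / 𝒟.lam) • s₁ +
        ((𝒟.q ^ 2 * x - 1) / (𝒟.q * 𝒟.μ⁻¹ * (𝒟.q ^ 2 * x) + 1)) • k₁) *
      (1 + ((x - 1) / 𝒟.lam) • s₂ + ((x - 1) / (𝒟.q * 𝒟.μ⁻¹ * x + 1)) • k₂) * v) := by
  set u := (x - 1) / 𝒟.lam with hu
  set w := (x - 1) / (𝒟.q * 𝒟.μ⁻¹ * x + 1) with hw
  set u' := (𝒟.q ^ 2 * x - 1) / 𝒟.lam with hu'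
  set w' := (𝒟.q ^ 2 * x - 1) / (𝒟.q * 𝒟.μ⁻¹ * (𝒟.q ^ 2 * x) + 1) with hw'
  have hlam : 𝒟.lam = 𝒟.q - 𝒟.q⁻¹ := rfl
  have d1 : 𝒟.q * x + 𝒟.μ ≠ 0 := by
    intro h0; apply hx; field_simp; linear_combination h0
  have d2 : 𝒟.q ^ 3 * x + 𝒟.μ ≠ 0 := by
    intro h0; apply hx'; field_simp; linear_combination h0
  have l2 : 𝒟.q ^ 2 - 1 ≠ 0 := by
    intro h0; apply hl; rw [hlam]; field_simp; linear_combination h0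
  have c1 : u' = 𝒟.q ^ 2 * u + 𝒟.q := by
    rw [hu, hu', hlam]; field_simp; ring
  have c2 : w' * (w - 𝒟.q * u) = -𝒟.q⁻¹ * u' * w := by
    rw [hu, hu', hw, hw', hlam]; field_simp; ring
  have c3 : (𝒟.μ + 𝒟.q⁻¹) * w - 𝒟.lam * 𝒟.μ * u = 𝒟.lam * (w' * (w - 𝒟.q * u)) := by
    rw [c2, hu, hu', hw, hlam]; field_simp; ring
  have e1 : s₂ * (s₂ * v) = v + 𝒟.lam • (s₂ * v) - (𝒟.lam * 𝒟.μ) • (k₂ * v) := by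
    rw [← mul_assoc, h.sq]; simp only [add_mul, sub_mul, one_mul, smul_mul_assoc]
  have e2 : s₂ * (k₂ * v) = 𝒟.μ • (k₂ * v) := by rw [← mul_assoc, h.s₂k₂, smul_mul_assoc]
  have e3 : s₂ * (s₁ * (s₂ * v)) = -𝒟.q⁻¹ • (s₁ * (s₂ * v)) := by
    rw [← mul_assoc s₁, ← mul_assoc s₂, ← mul_assoc s₂, h.braid, mul_assoc, hs, mul_smul_comm]
  have e4 : s₂ * (s₁ * (k₂ * v)) = k₁ * (k₂ * v) := by
    rw [← mul_assoc, ← mul_assoc, h.ssk, mul_assoc]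
  have e5 : k₁ * (s₂ * v) = -𝒟.q • (k₁ * (k₂ * v)) := by
    have := congrArg (· * v) h.kss
    simp only [mul_assoc, hs, mul_smul_comm] at this
    rw [← this, smul_smul]
    rw [neg_mul_neg, mul_inv_cancel₀ hq, one_smul]
  have e6 : s₂ * (k₁ * (k₂ * v)) =
      s₁ * (k₂ * v) - 𝒟.lam • (k₂ * v) + 𝒟.lam • (k₁ * (k₂ * v)) := by
    rw [← mul_assoc k₁, ← mul_assoc s₂, ← mul_assoc s₂, h.skk]
    simp only [add_mul, sub_mul, smul_mul_assoc, mul_assoc]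
  rw [mul_assoc]
  clear_value u w u' w'
  have expand : (1 + u' • s₁ + w' • k₁) * ((1 + u • s₂ + w • k₂) * v) =
      (1 - u' * 𝒟.q⁻¹) • v + u • (s₂ * v) + w • (k₂ * v) + (u' * u) • (s₁ * (s₂ * v)) +
        (u' * w) • (s₁ * (k₂ * v)) + (w' * (w - 𝒟.q * u)) • (k₁ * (k₂ * v)) := by
    simp only [add_mul, mul_add, one_mul, smul_mul_assoc, mul_smul_comm, hs, hk, e5]
    module
  have hp : 𝒟.q * 𝒟.q⁻¹ = 1 := mul_inv_cancel₀ hq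
  rw [expand, c2]
  rw [c2] at c3
  rw [hlam] at *
  generalize 𝒟.q⁻¹ = p at *
  simp only [mul_add, mul_smul_comm, e1, e2, e3, e4, e6]
  match_scalars
  · linear_combination (-p) * c1 - (1 + u * 𝒟.q) * hp
  · linear_combination (-p ^ 2) * c1 - (u * (1 + p * 𝒟.q) + p) * hp
  · linear_combination c3
  · ring
  · linear_combination (-u' * w) * hp
  · ring

theorem poly_comm {x v : E} {a c d : ℂ} (h : x * v = v * x) :
    (d • ((a • 1 - x) * (c • 1 + x))) * v = v * (d • ((a • 1 - x) * (c • 1 + x))) :=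
  Tower.poly_intertwine h

theorem mul_fused {w v b₁ b₂ r : E} {c p : ℂ} (hv : v = c • (w * b₁ * w)) (hw : w * v = v)
    (hb : b₂ * w = w * b₂) (hr : r * w = w * r) (hf : r * (b₁ * b₂ * v) = p • (b₁ * b₂ * v)) :
    r * (v * b₂ * v) = p • (v * b₂ * v) := by
  have e : v * b₂ * v = c • (w * (b₁ * b₂ * v)) := by
    calc v * b₂ * v = c • (w * b₁ * (w * b₂) * v) := by
          conv_lhs => enter [1, 1]; rw [hv]
          simp only [smul_mul_assoc, mul_assoc]
      _ = c • (w * (b₁ * b₂ * (w * v))) := by rw [← hb]; simp only [mul_assoc]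
      _ = _ := by rw [hw]
  rw [e, mul_smul_comm, ← mul_assoc, hr, mul_assoc, hf, mul_smul_comm, smul_comm]

namespace BMWSeq

variable {Ri : ℕ → E} (b : BMWSeq 𝒟 R Ri K)
include b

/-- The relations hold for the reversed multiplication. -/
theorem op : BMWSeq 𝒟 (fun k => MulOpposite.op (R k)) (fun k => MulOpposite.op (Ri k))
    (fun k => MulOpposite.op (K k)) where
  μ_ne := b.μ_ne
  lam_ne := b.lam_ne
  eta_ne := b.eta_ne
  q_ne := b.q_ne
  R_Ri k := by rw [← MulOpposite.op_mul, b.Ri_R]; rfl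
  Ri_R k := by rw [← MulOpposite.op_mul, b.R_Ri]; rfl
  K_def k := by
    refine MulOpposite.unop_injective ?_
    simp only [MulOpposite.unop_op, MulOpposite.unop_smul, MulOpposite.unop_mul,
      MulOpposite.unop_sub, MulOpposite.unop_add, MulOpposite.unop_one]
    rw [b.K_def]
    congr 1
    simp only [mul_sub, sub_mul, mul_add, add_mul, smul_mul_assoc, mul_smul_comm, one_mul, mul_one]
    module
  R_K k := by
    rw [← MulOpposite.op_mul, b.K_R, MulOpposite.op_smul]
  braid k := by
    simp only [← MulOpposite.op_mul]
    rw [← mul_assoc, b.braid, mul_assoc]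
  K1K0 k := by
    simp only [← MulOpposite.op_mul]
    rw [b.K0K1_right, mul_assoc]
  K1K0' k := by
    simp only [← MulOpposite.op_mul]
    rw [b.K0K1_right', mul_assoc]
  K0K1K0 k := by
    simp only [← MulOpposite.op_mul]
    rw [← mul_assoc, b.K0K1K0]

theorem fusionPair (k : ℕ) : FusionPair 𝒟 (R k) (K k) (R (k + 1)) (K (k + 1)) where
  sq := b.R_sq _
  s₂k₂ := b.R_K _
  braid := (b.braid k).symm
  ssk := (b.K0K1 k).symm
  kss := (b.K0K1_right k).symm
  skk := by
    have h : K k * K (k + 1) = Ri (k + 1) * Ri k * K (k + 1) := by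
      rw [b.K0K1_right', b.Ri1Ri0K1]
    rw [mul_assoc, h, ← mul_assoc, ← mul_assoc, b.R_Ri, one_mul, ← h, b.Ri_eq]
    simp only [sub_mul, add_mul, smul_mul_assoc, one_mul]

theorem fusionPair' (k : ℕ) : FusionPair 𝒟 (R (k + 1)) (K (k + 1)) (R k) (K k) where
  sq := b.R_sq _
  s₂k₂ := b.R_K _
  braid := b.braid k
  ssk := (b.K1K0 k).symm
  kss := (b.K1K0_right k).symm
  skk := by
    have h : R k * K (k + 1) * K k = Ri (k + 1) * K k := by
      rw [mul_assoc, b.K1K0', ← mul_assoc, ← mul_assoc, b.R_Ri, one_mul]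
    rw [h, b.Ri_eq]
    simp only [sub_mul, add_mul, smul_mul_assoc, one_mul]

theorem K_mul_of_R_mul {i : ℕ} {v : E} (hv : R i * v = -𝒟.q⁻¹ • v) : K i * v = 0 := by
  rw [b.K_def, smul_mul_assoc, mul_assoc, add_mul, hv]
  simp

theorem baxSeq_mul {i : ℕ} {v : E} (hv : R i * v = -𝒟.q⁻¹ • v) (x : ℂ) :
    baxSeq 𝒟 R K i x * v = (1 - 𝒟.q⁻¹ * ((x - 1) / 𝒟.lam)) • v := by
  rw [baxSeq, add_mul, add_mul, one_mul, smul_mul_assoc, smul_mul_assoc, hv, b.K_mul_of_R_mul hv]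
  module

omit b in
theorem qnum_succ (hl : 𝒟.lam ≠ 0) (hq : 𝒟.q ≠ 0) (n : ℕ) :
    𝒟.qnum (n + 1) = 𝒟.q ^ n + 𝒟.q⁻¹ * 𝒟.qnum n := by
  have hlam : 𝒟.lam = 𝒟.q - 𝒟.q⁻¹ := rfl
  have e : 𝒟.q ^ n = 𝒟.q ^ n * (𝒟.q - 𝒟.q⁻¹) / 𝒟.lam := by
    rw [← hlam, mul_div_cancel_right₀ _ hl]
  rw [e, QMData.qnum, QMData.qnum, mul_div, ← add_div]
  congr 1
  field_simp
  ring

theorem bax_eigenvalue (n : ℕ) (h : 𝒟.qnum (n + 1) ≠ 0) :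
    𝒟.q ^ n / 𝒟.qnum (n + 1) * (1 - 𝒟.q⁻¹ * (((𝒟.q ^ (2 * n))⁻¹ - 1) / 𝒟.lam)) = 1 := by
  have hq := b.q_ne
  have hl := b.lam_ne
  rw [div_mul_eq_mul_div, div_eq_one_iff_eq h, qnum_succ hl hq, QMData.qnum, mul_sub, mul_one,
    sub_eq_add_neg]
  congr 1
  rw [two_mul, pow_add]
  field_simp
  ring

/-- The antisymmetrizer acts as the identity on the joint eigenvectors. -/
theorem asymSeq_mul {s n : ℕ} (hqn : ∀ i, 2 ≤ i → i ≤ n → 𝒟.qnum i ≠ 0) {v : E}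
    (hv : ∀ i, i + 1 < n → R (s + i) * v = -𝒟.q⁻¹ • v) : asymSeq 𝒟 R K s n * v = v := by
  induction n with
  | zero => exact one_mul v
  | succ n ih =>
    cases n with
    | zero => exact one_mul v
    | succ n =>
      have e := ih (fun i h h' => hqn i h (by omega)) (fun i hi => hv i (by omega))
      rw [asymSeq, smul_mul_assoc, mul_assoc, e, mul_assoc, b.baxSeq_mul (hv n (by omega)),
        mul_smul_comm, e, smul_smul, b.bax_eigenvalue (n + 1) (hqn _ (by omega) (by omega)),
        one_smul]

theorem R_mul_bax_one (i : ℕ) (hx : 𝒟.q * 𝒟.μ⁻¹ * (𝒟.q ^ 2)⁻¹ + 1 ≠ 0) :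
    R i * baxSeq 𝒟 R K i (𝒟.q ^ 2)⁻¹ = -𝒟.q⁻¹ • baxSeq 𝒟 R K i (𝒟.q ^ 2)⁻¹ := by
  have hq := b.q_ne
  have hμ := b.μ_ne
  have hlam : 𝒟.lam = 𝒟.q - 𝒟.q⁻¹ := rfl
  have hl := b.lam_ne
  have l2 : 𝒟.q ^ 2 - 1 ≠ 0 := by
    intro h0; apply hl; rw [hlam]; field_simp; linear_combination h0
  have d1 : 𝒟.q * 𝒟.μ + 1 ≠ 0 := by
    intro h0; apply hx; field_simp; linear_combination h0
  have c1 : ((𝒟.q ^ 2)⁻¹ - 1) / 𝒟.lam = -𝒟.q⁻¹ := by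
    rw [hlam]; field_simp; ring
  have c2 : (𝒟.μ + 𝒟.q⁻¹) * (((𝒟.q ^ 2)⁻¹ - 1) / (𝒟.q * 𝒟.μ⁻¹ * (𝒟.q ^ 2)⁻¹ + 1)) =
      -𝒟.q⁻¹ * 𝒟.lam * 𝒟.μ := by
    have e : 𝒟.q * 𝒟.μ⁻¹ * (𝒟.q ^ 2)⁻¹ + 1 = (𝒟.q * 𝒟.μ + 1) / (𝒟.q * 𝒟.μ) := by
      field_simp
      ring
    rw [e, hlam, div_div_eq_mul_div, mul_div_assoc', div_eq_iff d1]
    field_simp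
    ring
  have hp : 𝒟.q * 𝒟.q⁻¹ = 1 := mul_inv_cancel₀ hq
  rw [baxSeq, c1]
  generalize ((𝒟.q ^ 2)⁻¹ - 1) / (𝒟.q * 𝒟.μ⁻¹ * (𝒟.q ^ 2)⁻¹ + 1) = w at *
  simp only [mul_add, mul_one, mul_smul_comm, b.R_sq, b.R_K]
  rw [hlam] at *
  generalize 𝒟.q⁻¹ = p at *
  match_scalars
  · linear_combination -hp
  · ring
  · linear_combination c2

variable (far : ∀ k l, k + 2 ≤ l → R k * R l = R l * R k)
include far

theorem R_K_far {k l : ℕ} (h : k + 2 ≤ l ∨ l + 2 ≤ k) : R k * K l = K l * R k := by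
  have hc : R k * R l = R l * R k := by
    rcases h with h | h
    exacts [far _ _ h, (far _ _ h).symm]
  rw [b.K_def]
  exact (poly_comm hc.symm).symm

theorem R_asymSeq_far {k s n : ℕ} (h : k + 1 < s ∨ s + n ≤ k) :
    R k * asymSeq 𝒟 R K s n = asymSeq 𝒟 R K s n * R k := by
  induction n with
  | zero => rw [asymSeq, mul_one, one_mul]
  | succ n ih =>
    cases n with
    | zero => rw [asymSeq, mul_one, one_mul]
    | succ n =>
      have e := ih (by omega)
      have hR : R k * R (s + n) = R (s + n) * R k := by
        rcases h with h | h
        · exact far _ _ (by omega)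
        · exact (far _ _ (by omega)).symm
      have hK : R k * K (s + n) = K (s + n) * R k := b.R_K_far far (by omega)
      have hb : ∀ x, R k * baxSeq 𝒟 R K (s + n) x = baxSeq 𝒟 R K (s + n) x * R k := fun x => by
        simp only [baxSeq, mul_add, add_mul, mul_smul_comm, smul_mul_assoc, hR, hK, mul_one,
          one_mul]
      rw [asymSeq, mul_smul_comm, smul_mul_assoc, ← mul_assoc, ← mul_assoc, e,
        mul_assoc _ (R k), hb, mul_assoc _ _ (R k), ← e]
      simp only [mul_assoc]

theorem bax_asymSeq_far {k s n : ℕ} (h : k + 1 < s ∨ s + n ≤ k) (x : ℂ) :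
    baxSeq 𝒟 R K k x * asymSeq 𝒟 R K s n = asymSeq 𝒟 R K s n * baxSeq 𝒟 R K k x := by
  have hR := b.R_asymSeq_far far h
  have hK : K k * asymSeq 𝒟 R K s n = asymSeq 𝒟 R K s n * K k := by
    rw [b.K_def]
    exact poly_comm hR
  simp only [baxSeq, mul_add, add_mul, mul_smul_comm, smul_mul_assoc, hR, hK, mul_one, one_mul]

/-- Absorption of the generators by the antisymmetrizer, on the left. -/
theorem R_mul_asymSeq {s n : ℕ} (hqn : ∀ i, 2 ≤ i → i < n → 𝒟.qnum i ≠ 0)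
    (hd : ∀ i, 1 ≤ i → i < n → 𝒟.q * 𝒟.μ⁻¹ * (𝒟.q ^ (2 * i))⁻¹ + 1 ≠ 0) :
    ∀ i, i + 1 < n → R (s + i) * asymSeq 𝒟 R K s n = -𝒟.q⁻¹ • asymSeq 𝒟 R K s n := by
  induction n with
  | zero => intro i hi; omega
  | succ n ih =>
    cases n with
    | zero => intro i hi; omega
    | succ n =>
      intro i hi
      have ih' := ih (fun i h h' => hqn i h (by omega)) (fun i h h' => hd i h (by omega))
      rw [asymSeq, mul_smul_comm, smul_comm (-𝒟.q⁻¹)]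
      congr 1
      rcases (show i < n ∨ i = n by omega) with h | rfl
      · rw [← mul_assoc, ← mul_assoc, ih' i (by omega)]
        simp only [smul_mul_assoc]
      cases i with
      | zero =>
        rw [asymSeq, one_mul, mul_one]
        exact b.R_mul_bax_one _ (hd 1 le_rfl (by omega))
      | succ i =>
        have ab : asymSeq 𝒟 R K s (i + 1) * asymSeq 𝒟 R K s (i + 2) = asymSeq 𝒟 R K s (i + 2) :=
          b.asymSeq_mul (fun j h h' => hqn j h (by omega)) (fun j hj => ih' j (by omega))
        have hx : (𝒟.q ^ (2 * (i + 1)))⁻¹ = 𝒟.q ^ 2 * (𝒟.q ^ (2 * (i + 1 + 1)))⁻¹ := by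
          have hq := b.q_ne
          field_simp
          ring
        have hf := (b.fusionPair (s + i)).fusion b.q_ne b.μ_ne b.lam_ne
          (v := asymSeq 𝒟 R K s (i + 2))
          (hd (i + 2) (by omega) (by omega)) (by rw [← hx]; exact hd (i + 1) (by omega) (by omega))
          (ih' i (by omega)) (b.K_mul_of_R_mul (ih' i (by omega)))
        rw [← hx] at hf
        exact mul_fused rfl ab (b.bax_asymSeq_far far (k := s + (i + 1)) (by omega) _)
          (b.R_asymSeq_far far (k := s + (i + 1)) (by omega)) hf

omit b far in
theorem asymSeq_op (s n : ℕ) : asymSeq 𝒟 (fun k => MulOpposite.op (R k))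
    (fun k => MulOpposite.op (K k)) s n = MulOpposite.op (asymSeq 𝒟 R K s n) := by
  induction n with
  | zero => rfl
  | succ n ih =>
    cases n with
    | zero => rfl
    | succ n =>
      rw [asymSeq, asymSeq, ih, MulOpposite.op_smul, MulOpposite.op_mul, MulOpposite.op_mul,
        ← mul_assoc]
      rfl

omit far in
theorem mul_asymSeq {s n : ℕ} (hqn : ∀ i, 2 ≤ i → i ≤ n → 𝒟.qnum i ≠ 0) {v : E}
    (hv : ∀ i, i + 1 < n → v * R (s + i) = -𝒟.q⁻¹ • v) : v * asymSeq 𝒟 R K s n = v := by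
  have := b.op.asymSeq_mul (s := s) hqn (v := MulOpposite.op v) (fun i hi => by
    rw [← MulOpposite.op_mul, hv i hi, MulOpposite.op_smul])
  rw [asymSeq_op, ← MulOpposite.op_mul] at this
  exact MulOpposite.op_injective this

omit far in
theorem mul_baxSeq {i : ℕ} {v : E} (hv : v * R i = -𝒟.q⁻¹ • v) (x : ℂ) :
    v * baxSeq 𝒟 R K i x = (1 - 𝒟.q⁻¹ * ((x - 1) / 𝒟.lam)) • v := by
  have := b.op.baxSeq_mul (i := i) (v := MulOpposite.op v) (by
    rw [← MulOpposite.op_mul, hv, MulOpposite.op_smul]) x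
  exact MulOpposite.op_injective this

theorem asymSeq_mul_R {s n : ℕ} (hqn : ∀ i, 2 ≤ i → i < n → 𝒟.qnum i ≠ 0)
    (hd : ∀ i, 1 ≤ i → i < n → 𝒟.q * 𝒟.μ⁻¹ * (𝒟.q ^ (2 * i))⁻¹ + 1 ≠ 0) (i : ℕ)
    (hi : i + 1 < n) : asymSeq 𝒟 R K s n * R (s + i) = -𝒟.q⁻¹ • asymSeq 𝒟 R K s n := by
  have := b.op.R_mul_asymSeq (fun k l h => by
    rw [← MulOpposite.op_mul, ← MulOpposite.op_mul, far _ _ h]) (s := s) hqn hd i hi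
  rw [asymSeq_op, ← MulOpposite.op_mul, ← MulOpposite.op_smul] at this
  exact MulOpposite.op_injective this

theorem asymSeq_sq {s n : ℕ} (hqn : ∀ i, 2 ≤ i → i ≤ n → 𝒟.qnum i ≠ 0)
    (hd : ∀ i, 1 ≤ i → i < n → 𝒟.q * 𝒟.μ⁻¹ * (𝒟.q ^ (2 * i))⁻¹ + 1 ≠ 0) :
    asymSeq 𝒟 R K s n * asymSeq 𝒟 R K s n = asymSeq 𝒟 R K s n :=
  b.asymSeq_mul hqn (b.R_mul_asymSeq far (fun i h h' => hqn i h h'.le) hd)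

/-- The mirror form of the recursion for the antisymmetrizers. -/
theorem asymSeq_succ_mirror {s n : ℕ} (hqn : ∀ i, 2 ≤ i → i ≤ n + 1 → 𝒟.qnum i ≠ 0)
    (hd : ∀ i, 1 ≤ i → i ≤ n → 𝒟.q * 𝒟.μ⁻¹ * (𝒟.q ^ (2 * i))⁻¹ + 1 ≠ 0) (hn : 1 ≤ n) :
    asymSeq 𝒟 R K s (n + 1) = (𝒟.q ^ n / 𝒟.qnum (n + 1)) • (asymSeq 𝒟 R K (s + 1) n *
      baxSeq 𝒟 R K s (𝒟.q ^ (2 * n))⁻¹ * asymSeq 𝒟 R K (s + 1) n) := by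
  induction n generalizing s with
  | zero => omega
  | succ n ih =>
    cases n with
    | zero => simp [asymSeq]
    | succ n =>
      have hL : ∀ i, i + 1 < n + 1 + 1 → R (s + 1 + i) * asymSeq 𝒟 R K (s + 1) (n + 1 + 1) =
          -𝒟.q⁻¹ • asymSeq 𝒟 R K (s + 1) (n + 1 + 1) :=
        b.R_mul_asymSeq far (fun i h h' => hqn i h (by omega)) (fun i h h' => hd i h (by omega))
      have hR : ∀ i, i + 1 < n + 1 + 1 + 1 → asymSeq 𝒟 R K s (n + 1 + 1 + 1) * R (s + i) =
          -𝒟.q⁻¹ • asymSeq 𝒟 R K s (n + 1 + 1 + 1) :=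
        b.asymSeq_mul_R far (fun i h h' => hqn i h (by omega)) (fun i h h' => hd i h (by omega))
      have ih' := ih (s := s + 1) (fun i h h' => hqn i h (by omega))
        (fun i h h' => hd i h (by omega)) (by omega)
      have ab : asymSeq 𝒟 R K (s + 1 + 1) (n + 1) * asymSeq 𝒟 R K (s + 1) (n + 1 + 1) =
          asymSeq 𝒟 R K (s + 1) (n + 1 + 1) :=
        b.asymSeq_mul (fun i h h' => hqn i h (by omega)) (fun i hi => by
          have := hL (i + 1) (by omega)
          rwa [show s + 1 + (i + 1) = s + 1 + 1 + i by omega] at this)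
      have hx : (𝒟.q ^ (2 * (n + 1)))⁻¹ = 𝒟.q ^ 2 * (𝒟.q ^ (2 * (n + 1 + 1)))⁻¹ := by
        have hq := b.q_ne
        field_simp
        ring
      have hf := (b.fusionPair' s).fusion b.q_ne b.μ_ne b.lam_ne
        (v := asymSeq 𝒟 R K (s + 1) (n + 1 + 1))
        (hd (n + 2) (by omega) (by omega)) (by rw [← hx]; exact hd (n + 1) (by omega) (by omega))
        (hL 0 (by omega)) (b.K_mul_of_R_mul (hL 0 (by omega)))
      rw [← hx] at hf
      have h0 := mul_fused ih' ab (b.bax_asymSeq_far far (k := s) (by omega) _)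
        (b.R_asymSeq_far far (k := s) (by omega)) hf
      have key : ∀ i, i + 1 < n + 1 + 1 + 1 → R (s + i) *
          (asymSeq 𝒟 R K (s + 1) (n + 1 + 1) * baxSeq 𝒟 R K s (𝒟.q ^ (2 * (n + 1 + 1)))⁻¹ *
            asymSeq 𝒟 R K (s + 1) (n + 1 + 1)) = -𝒟.q⁻¹ •
          (asymSeq 𝒟 R K (s + 1) (n + 1 + 1) * baxSeq 𝒟 R K s (𝒟.q ^ (2 * (n + 1 + 1)))⁻¹ *
            asymSeq 𝒟 R K (s + 1) (n + 1 + 1)) := by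
        intro i hi
        cases i with
        | zero => exact h0
        | succ i =>
          rw [show s + (i + 1) = s + 1 + i by omega, ← mul_assoc, ← mul_assoc, hL i (by omega)]
          simp only [smul_mul_assoc]
      have hA := b.mul_asymSeq (s := s + 1) (n := n + 1 + 1)
        (fun i h h' => hqn i h (by omega)) (fun i hi => by
          have := hR (i + 1) (by omega)
          rwa [show s + (i + 1) = s + 1 + i by omega] at this)
      have e1 := b.asymSeq_mul (fun i h h' => hqn i h (by omega)) key
      rw [← mul_assoc, ← mul_assoc, hA, b.mul_baxSeq (i := s) (hR 0 (by omega)), smul_mul_assoc, hA] at e1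
      rw [← e1, smul_smul, b.bax_eigenvalue _ (hqn _ (by omega) (by omega)), one_smul]

end BMWSeq

end Antisymmetrizer

variable {N : ℕ} {𝒟 : QMData N}

/-- The conditions under which the antisymmetrizers `a^{(i)}`, `i ≤ k + 1`, are defined. -/
structure QMData.Regular (𝒟 : QMData N) (k : ℕ) : Prop where
  qnum_ne : ∀ i, 2 ≤ i → i ≤ k → 𝒟.qnum i ≠ 0
  den_ne : ∀ i ≤ k, 𝒟.q * 𝒟.μ⁻¹ * (𝒟.q ^ (2 * i))⁻¹ + 1 ≠ 0

theorem QMData.regular {k : ℕ} (hq : 𝒟.q ≠ 0) (hl : 𝒟.lam ≠ 0)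
    (hqn : ∀ i, 2 ≤ i → i ≤ k → 𝒟.qnum i ≠ 0) (hμ : 𝒟.μ = 𝒟.q ^ (1 - (k : ℤ))) :
    𝒟.Regular k where
  qnum_ne := hqn
  den_ne i _ h0 := by
    have hz : 𝒟.q ^ ((k : ℤ) - 2 * i) = -1 := by
      have e : 𝒟.q * 𝒟.μ⁻¹ * (𝒟.q ^ (2 * i))⁻¹ = 𝒟.q ^ ((k : ℤ) - 2 * i) := by
        rw [hμ, ← zpow_neg, ← zpow_natCast, ← zpow_neg, ← zpow_one_add₀ hq, ← zpow_add₀ hq]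
        congr 1
        push_cast
        ring
      rw [← e]
      linear_combination h0
    obtain ⟨j, hj, hjk⟩ : ∃ j : ℕ, 𝒟.q ^ j = -1 ∧ j ≤ k := by
      rcases le_total (2 * i) k with hk | hk
      · refine ⟨k - 2 * i, ?_, by omega⟩
        rw [← zpow_natCast, ← hz]
        congr 1
        omega
      · refine ⟨2 * i - k, ?_, by omega⟩
        have : 𝒟.q ^ (2 * i - k) = (𝒟.q ^ ((k : ℤ) - 2 * i))⁻¹ := by
          rw [← zpow_natCast, ← zpow_neg]
          congr 1
          omega
        rw [this, hz]
        norm_num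
    rcases Nat.lt_or_ge j 2 with hj2 | hj2
    · interval_cases j
      · norm_num at hj
      · apply hl
        rw [pow_one] at hj
        rw [QMData.lam, hj]
        norm_num
    · apply hqn j hj2 hjk
      rw [QMData.qnum, hj]
      norm_num

theorem QMData.Regular.qnum_ne' {k : ℕ} (h : 𝒟.Regular k) (hl : 𝒟.lam ≠ 0) (i : ℕ) (hi : 1 ≤ i)
    (hk : i ≤ k) : 𝒟.qnum i ≠ 0 := by
  rcases hi.eq_or_lt with rfl | hi
  · rw [QMData.qnum, pow_one]
    exact div_ne_zero hl hl
  · exact h.qnum_ne i hi hk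

theorem QMData.pow_mul_sub_one (hl : 𝒟.lam ≠ 0) (hq : 𝒟.q ≠ 0) (n : ℕ) :
    𝒟.q ^ n * ((𝒟.q ^ (2 * n))⁻¹ - 1) = -(𝒟.lam * 𝒟.qnum n) := by
  rw [QMData.qnum, mul_div_cancel₀ _ hl, two_mul, pow_add]
  field_simp
  ring

namespace Tower

variable {A E : Type} [Ring A] [Algebra ℂ A] [Ring E] [Algebra ℂ E]

/-- The antisymmetrizer on the legs `s, …, s + n - 1`. -/
abbrev asym (t : Tower 𝒟 A E) (s n : ℕ) : E := asymSeq 𝒟 t.R t.K s n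

variable {t : Tower 𝒟 A E} {M : Matrix (Fin N) (Fin N) A}

theorem bax_mem {k n i : ℕ} (h : k ≤ i) (h' : i + 1 < k + n) (x : ℂ) :
    baxSeq 𝒟 t.R t.K i x ∈ t.B k n :=
  add_mem (add_mem (one_mem _) (Subalgebra.smul_mem _ (R_mem_B h h') _))
    (Subalgebra.smul_mem _ (K_mem_B h h') _)

theorem asym_mem (s n : ℕ) : t.asym s n ∈ t.B s n := by
  induction n with
  | zero => exact one_mem _
  | succ n ih =>
    cases n with
    | zero => exact one_mem _
    | succ n =>
      have ih' := B_mono (t := t) (k := s) (n := n + 1) (k' := s) (n' := n + 1 + 1) le_rfl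
        (by omega) ih
      exact Subalgebra.smul_mem _ (mul_mem (mul_mem ih' (bax_mem (by omega) (by omega) _)) ih') _

theorem sh_bax (i : ℕ) (x : ℂ) :
    t.sh (baxSeq 𝒟 t.R t.K i x) = baxSeq 𝒟 t.R t.K (i + 1) x := by
  simp only [baxSeq, map_add, map_smul, map_one, t.sh_R, t.sh_K]

theorem sh_asym (s n : ℕ) : t.sh (t.asym s n) = t.asym (s + 1) n := by
  induction n with
  | zero => exact map_one _
  | succ n ih =>
    cases n with
    | zero => exact map_one _
    | succ n =>
      rw [asym, asymSeq, map_smul, map_mul t.sh, map_mul t.sh, ih, sh_bax, asym, asym, asymSeq,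
        show s + n + 1 = s + 1 + n by omega]

theorem asym_sq {k : ℕ} (hk : 𝒟.Regular k) (s : ℕ) {n : ℕ} (hn : n ≤ k) :
    t.asym s n * t.asym s n = t.asym s n :=
  t.bmw.asymSeq_sq (fun _ _ h => t.local_R.far h t.local_R)
    (fun i h h' => hk.qnum_ne i h (by omega)) (fun i h h' => hk.den_ne i (by omega))

theorem asym_mirror {k : ℕ} (hk : 𝒟.Regular k) (s : ℕ) {n : ℕ} (hn : n + 1 ≤ k) (h1 : 1 ≤ n) :
    t.asym s (n + 1) = (𝒟.q ^ n / 𝒟.qnum (n + 1)) • (t.asym (s + 1) n *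
      baxSeq 𝒟 t.R t.K s (𝒟.q ^ (2 * n))⁻¹ * t.asym (s + 1) n) :=
  t.bmw.asymSeq_succ_mirror (fun _ _ h => t.local_R.far h t.local_R)
    (fun i h h' => hk.qnum_ne i h (by omega)) (fun i h h' => hk.den_ne i (by omega)) h1

namespace Star

variable {g gi : A} {C : Subalgebra ℂ A} (h : t.Star M g gi C)

/-- The recursion for `n_q M^{a^{(n)}}`. -/
def newton (a : ℕ → A) : ℕ → Matrix (Fin N) (Fin N) A
  | 0 => 0
  | n + 1 => 𝒟.q ^ n • rm N (a n) M - h.S (newton a n) -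
      (𝒟.lam / (𝒟.q * 𝒟.μ⁻¹ * (𝒟.q ^ (2 * n))⁻¹ + 1)) • h.top (newton a n)

include h

theorem isPow_step {k : ℕ} (hk : 𝒟.Regular k) {n : ℕ} (h1 : 1 ≤ n) (hn : n ≤ k) {a : A}
    (ha : t.IsCh M n (t.asym 0 n) a) {Y : Matrix (Fin N) (Fin N) A}
    (hY : t.IsPow M (n - 1) (𝒟.qnum n • t.asym 0 n) Y) :
    t.IsPow M n (𝒟.q ^ n • (t.asym 1 n * baxSeq 𝒟 t.R t.K 0 (𝒟.q ^ (2 * n))⁻¹ * t.asym 1 n))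
      (𝒟.q ^ n • rm N a M - h.S Y -
        (𝒟.lam / (𝒟.q * 𝒟.μ⁻¹ * (𝒟.q ^ (2 * n))⁻¹ + 1)) • h.top Y) := by
  obtain ⟨n, rfl⟩ : ∃ m, n = m + 1 := ⟨n - 1, by omega⟩
  rw [Nat.add_sub_cancel] at hY
  have hA := asym_mem (t := t) 0 (n + 1)
  have hA1 := asym_mem (t := t) 1 (n + 1)
  have hl := t.bmw.lam_ne
  have e1 := IsCh.map hA ha
  have e2 := hY.mulS (Subalgebra.smul_mem _ hA _)
  have e3 := hY.mulTop (Subalgebra.smul_mem _ hA _)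
  rw [IsPow] at e1 e2 e3 ⊢
  rw [map_smul, sh_asym] at e2 e3
  rw [sh_asym] at e1
  have cyc : ∀ X, t.trs 1 (n + 1) (t.prod M 0 (n + 1 + 1) * (t.asym 1 (n + 1) * X * t.asym 1 (n + 1))) =
      t.trs 1 (n + 1) (t.prod M 0 (n + 1 + 1) * (t.asym 1 (n + 1) * X)) := by
    intro X
    rw [← mul_assoc, ← trs_cyc (le_refl 1) (by omega) hA1, ← mul_assoc,
      h.B_prod (by omega) (by omega) hA1, mul_assoc, ← mul_assoc (t.asym 1 (n + 1)),
      asym_sq hk 1 hn]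
  rw [mul_smul_comm, map_smul, cyc, map_sub, map_sub, map_smul, map_smul, rm_apply, e1, S_apply, e2]
  change _ - _ - _ • t.mat (𝒟.mulTop M Y) = _
  rw [e3]
  have hq := QMData.pow_mul_sub_one hl t.bmw.q_ne (n + 1)
  generalize (𝒟.q ^ (2 * (n + 1)))⁻¹ = x at *
  simp only [baxSeq, smul_mul_assoc, mul_add, mul_one, mul_smul_comm, map_add, map_smul, smul_add,
    smul_smul]
  rw [mul_div_assoc', mul_div_assoc', hq]
  have : -(𝒟.lam * 𝒟.qnum (n + 1)) / 𝒟.lam = - 𝒟.qnum (n + 1) := by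
    rw [neg_div, mul_div_cancel_left₀ _ hl]
  rw [this]
  module

/-- The matrices `M^{a^{(n)}}` through the Newton recursion. -/
theorem isPow_newton {k : ℕ} (hk : 𝒟.Regular k) {a : ℕ → A}
    (ha : ∀ n ≤ k, t.IsCh M n (t.asym 0 n) (a n)) {n : ℕ} (hn : n + 1 ≤ k) :
    t.IsPow M n (𝒟.qnum (n + 1) • t.asym 0 (n + 1)) (h.newton a (n + 1)) := by
  have hl := t.bmw.lam_ne
  induction n with
  | zero =>
    have h0 : a 0 = 1 := t.scal_injective (by
      rw [ha 0 (by omega), trs_zero, prod, asym, asymSeq, mul_one, map_one])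
    have h1 : 𝒟.qnum (0 + 1) = 1 := by
      rw [QMData.qnum, zero_add, pow_one]
      exact div_self hl
    rw [newton, newton, h0, rm_one, map_zero, map_zero, h1, asym, asymSeq, IsPow, trs_zero]
    simp only [pow_zero, one_smul, smul_zero, sub_zero, mul_one]
    exact (one_mul _).symm
  | succ n ih =>
    have e := h.isPow_step hk (n := n + 1) (by omega) (by omega) (ha _ (by omega)) (ih (by omega))
    have hqn := hk.qnum_ne' hl (n + 1 + 1) (by omega) hn
    rw [newton, asym_mirror hk 0 hn (by omega), smul_smul, mul_div_cancel₀ _ hqn]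
    exact e

theorem newton_eq_zero {k : ℕ} (hk : 𝒟.Regular k) (h1 : 1 ≤ k) {a : ℕ → A}
    (ha : ∀ n ≤ k, t.IsCh M n (t.asym 0 n) (a n))
    (h0 : t.asym 1 k * baxSeq 𝒟 t.R t.K 0 (𝒟.q ^ (2 * k))⁻¹ * t.asym 1 k = 0) :
    h.newton a (k + 1) = 0 := by
  obtain ⟨k, rfl⟩ : ∃ m, k = m + 1 := ⟨k - 1, by omega⟩
  have e := h.isPow_step hk (by omega) le_rfl (ha _ le_rfl) (h.isPow_newton hk ha le_rfl)
  rw [h0, smul_zero, IsPow, mul_zero, map_zero] at e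
  exact t.mat_injective (e.trans (map_zero _).symm)

theorem rtr_newton {k : ℕ} (hk : 𝒟.Regular k) {a : ℕ → A}
    (ha : ∀ n ≤ k, t.IsCh M n (t.asym 0 n) (a n)) {n : ℕ} (hn : n ≤ k) :
    t.rtr (h.newton a n) = 𝒟.qnum n • a n := by
  cases n with
  | zero =>
    have e : t.rtr (0 : Matrix (Fin N) (Fin N) A) = 0 := by
      simpa using rtr_smul (t := t) 0 (0 : Matrix (Fin N) (Fin N) A)
    rw [newton, e, QMData.qnum]
    simp
  | succ n =>
    refine t.scal_injective ?_
    have e := (h.isPow_newton hk ha hn).rtr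
    rw [IsCh] at e
    rw [e, mul_smul_comm, map_smul, ← ha _ hn, map_smul]

theorem newton_mem {a : ℕ → A} (ha : ∀ n, a n ∈ C) (n : ℕ) : h.newton a n ∈ h.P := by
  induction n with
  | zero => exact zero_mem _
  | succ n ih =>
    exact sub_mem (sub_mem (Submodule.smul_mem _ _ (h.rm_mem (ha n) h.M_mem_P)) (h.S_mem ih))
      (Submodule.smul_mem _ _ (h.top_mem ih))

theorem top_top {Y : Matrix (Fin N) (Fin N) A} (hY : Y ∈ h.P) : h.top (h.top Y) = rm N g Y := by
  induction hY using Submodule.span_induction with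
  | mem Y hY =>
    obtain ⟨n, c, hc, rfl⟩ := hY
    rw [top_rm, top_rm, top_top_x, rm_rm, rm_rm, h.comm c hc g h.g_mem]
  | zero => simp
  | add Y Z _ _ hY hZ => simp only [map_add, hY, hZ]
  | smul c Y _ hY => simp only [map_smul, hY]

theorem S_top_S {Y : Matrix (Fin N) (Fin N) A} (hY : Y ∈ h.P) : h.S (h.top (h.S Y)) =
    rm N g (h.top Y) - 𝒟.lam • rm N g (h.S Y) +
      (𝒟.lam * 𝒟.μ⁻¹) • rm N (g * t.rtr Y) M := by
  have e : h.S (h.top (h.S Y)) = h.top (h.top (h.top Y)) -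
      𝒟.lam • h.top (h.top (h.S Y)) +
      (𝒟.lam * 𝒟.μ⁻¹) • rm N (t.rtr Y) (h.top (h.top M)) := h.toQM.S_top_S Y
  rw [h.top_top (h.top_mem hY), h.top_top (h.S_mem hY), top_top_M, rm_rm] at e
  exact e

/-- The recursion for the images of `newton` under `top`. -/
theorem top_newton {k : ℕ} (hk : 𝒟.Regular k) {a : ℕ → A}
    (ha : ∀ n ≤ k, t.IsCh M n (t.asym 0 n) (a n)) (ha' : ∀ n, a n ∈ C) {n : ℕ} (hn : n ≤ k) :
    h.S (h.top (h.newton a (n + 1))) = rm N g (((𝒟.q ^ n)⁻¹ * 𝒟.μ⁻¹) • rm N (a n) M -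
      h.top (h.newton a n) + (𝒟.lam * (𝒟.q * 𝒟.μ⁻¹ * (𝒟.q ^ (2 * n))⁻¹) /
        (𝒟.q * 𝒟.μ⁻¹ * (𝒟.q ^ (2 * n))⁻¹ + 1)) • h.S (h.newton a n)) := by
  have hY := h.newton_mem ha' n
  have hd := hk.den_ne n hn
  have e : 𝒟.q ^ n - 𝒟.lam * 𝒟.qnum n = (𝒟.q ^ n)⁻¹ := by
    rw [QMData.qnum, mul_div_cancel₀ _ t.bmw.lam_ne]; ring
  simp only [newton, map_add, map_sub, map_smul, h.top_top hY, top_rm, h.top_M, rm_rm,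
    h.S_top_S hY, h.rtr_newton hk ha hn, S_rm, show h.S 1 = M from mulS_one t, mul_smul_comm,
    h.comm _ (ha' n) g h.g_mem, ← e]
  have e2 : rm N (𝒟.qnum n • (g * a n)) M = 𝒟.qnum n • rm N (g * a n) M := by
    ext; simp [rm_apply]
  rw [e2]
  generalize 𝒟.q * 𝒟.μ⁻¹ * (𝒟.q ^ (2 * n))⁻¹ = c at *
  have e3 : 𝒟.lam / (c + 1) = 𝒟.lam - 𝒟.lam * c / (c + 1) := by
    field_simp; ring
  rw [e3]
  module

end Star

end Tower

namespace Tower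

variable {N : ℕ} {𝒟 : QMData N} {A E : Type} [Ring A] [Algebra ℂ A] [Ring E] [Algebra ℂ E]
variable {t : Tower 𝒟 A E} {M : Matrix (Fin N) (Fin N) A}

namespace Star

variable {g gi : A} {C : Subalgebra ℂ A} (h : t.Star M g gi C) (D : Subalgebra ℂ A)

/-- The right `D`-module spanned by the powers `x^n`, `k ≤ n ≤ l`. -/
def Picc (k l : ℤ) : Submodule ℂ (Matrix (Fin N) (Fin N) A) :=
  Submodule.span ℂ {Y | ∃ n : ℤ, (k ≤ n ∧ n ≤ l) ∧ ∃ c ∈ D, Y = rm N c (h.x n)}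

variable {D}

theorem Picc_mono {k l k' l' : ℤ} (hk : k' ≤ k) (hl : l ≤ l') : h.Picc D k l ≤ h.Picc D k' l' :=
  Submodule.span_mono fun _ ⟨n, hn, hY⟩ => ⟨n, ⟨hk.trans hn.1, hn.2.trans hl⟩, hY⟩

theorem x_mem_Picc {k l n : ℤ} (hk : k ≤ n) (hl : n ≤ l) : h.x n ∈ h.Picc D k l :=
  Submodule.subset_span ⟨n, ⟨hk, hl⟩, 1, one_mem _, (rm_one _).symm⟩

theorem M_mem_Picc {k l : ℤ} (hk : k ≤ 1) (hl : 1 ≤ l) : M ∈ h.Picc D k l := by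
  have := h.x_mem_Picc (D := D) hk hl
  rwa [x_one] at this

theorem rm_mem_Picc {k l : ℤ} {c : A} (hc : c ∈ D) {Y : Matrix (Fin N) (Fin N) A}
    (hY : Y ∈ h.Picc D k l) : rm N c Y ∈ h.Picc D k l := by
  refine map_mem_of_span ?_ hY
  rintro _ ⟨n, hn, d, hd, rfl⟩
  exact Submodule.subset_span ⟨n, hn, _, mul_mem hd hc, rm_rm _ _ _⟩

theorem S_mem_Picc {k l : ℤ} {Y : Matrix (Fin N) (Fin N) A} (hY : Y ∈ h.Picc D k l) :
    h.S Y ∈ h.Picc D (k + 1) (l + 1) := by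
  refine map_mem_of_span (f := h.S.toLinearMap) ?_ hY
  rintro _ ⟨n, hn, d, hd, rfl⟩
  exact Submodule.subset_span ⟨n + 1, ⟨by omega, by omega⟩, d, hd, by
    rw [LinearEquiv.coe_coe, S_rm, S_x]⟩

theorem S_symm_mem_Picc {k l : ℤ} {Y : Matrix (Fin N) (Fin N) A} (hY : Y ∈ h.Picc D k l) :
    h.S.symm Y ∈ h.Picc D (k - 1) (l - 1) := by
  refine map_mem_of_span (f := h.S.symm.toLinearMap) ?_ hY
  rintro _ ⟨n, hn, d, hd, rfl⟩
  exact Submodule.subset_span ⟨n - 1, ⟨by omega, by omega⟩, d, hd, by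
    rw [LinearEquiv.coe_coe, S_symm_rm, S_symm_x]⟩

theorem rtr_mem_of_Picc {k l : ℤ} (hp : ∀ j, k ≤ j → j ≤ l → t.rtr (h.x j) ∈ D)
    {Y : Matrix (Fin N) (Fin N) A} (hY : Y ∈ h.Picc D k l) : t.rtr Y ∈ D := by
  refine Submodule.span_induction (p := fun Y _ => t.rtr Y ∈ D) ?_ ?_ ?_ ?_ hY
  · rintro _ ⟨n, hn, d, hd, rfl⟩
    rw [rm_apply, rtr_map]
    exact mul_mem (hp n hn.1 hn.2) hd
  · have : t.rtr (0 : Matrix (Fin N) (Fin N) A) = 0 := by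
      simpa using rtr_smul (t := t) 0 (0 : Matrix (Fin N) (Fin N) A)
    rw [this]; exact zero_mem _
  · intro Y Z _ _ hY hZ
    rw [rtr_add]; exact add_mem hY hZ
  · intro c Y _ hY
    rw [rtr_smul]; exact D.smul_mem hY c

variable (hg : g ∈ D) (hgi : gi ∈ D)
include hg hgi

theorem top_x_neg_mem_Picc (m : ℕ) (hp : ∀ j : ℕ, j ≤ m → t.rtr (h.x j) ∈ D) :
    (∀ j : ℤ, -m ≤ j → j ≤ m → t.rtr (h.x j) ∈ D) ∧
      h.top (h.x (-m)) ∈ h.Picc D (1 - m) (m + 1) := by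
  induction m with
  | zero =>
    constructor
    · intro j hj hj'
      obtain rfl : j = (0 : ℕ) := by push_cast at *; omega
      exact hp 0 le_rfl
    · rw [Nat.cast_zero, neg_zero, x_zero, top_one]
      exact Submodule.smul_mem _ _ (h.M_mem_Picc (by omega) (by omega))
  | succ m ih =>
    obtain ⟨ih1, ih2⟩ := ih fun j hj => hp j (by omega)
    have e0 : (-(m + 1 : ℕ) : ℤ) + 1 = -m := by push_cast; ring
    have ih1' : ∀ j : ℤ, -m ≤ j → j ≤ m + 1 → t.rtr (h.x j) ∈ D := by
      intro j hj hj'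
      rcases hj'.eq_or_lt with rfl | hj'
      · exact_mod_cast hp (m + 1) le_rfl
      · exact ih1 j hj (by omega)
    have r1 : t.rtr (h.x (-(m + 1 : ℕ))) ∈ D := by
      have e := h.rtr_top_x (-(m + 1 : ℕ))
      rw [e0] at e
      have e' : t.rtr (h.x (-(m + 1 : ℕ))) = 𝒟.μ • (gi * t.rtr (h.top (h.x (-m)))) := by
        rw [e, mul_smul_comm, smul_smul, mul_inv_cancel₀ t.bmw.μ_ne, one_smul, ← mul_assoc, h.gi_g,
          one_mul]
      rw [e']
      exact D.smul_mem (mul_mem hgi (h.rtr_mem_of_Picc (fun j hj hj' => ih1' j (by omega) hj') ih2)) _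
    refine ⟨fun j hj hj' => ?_, ?_⟩
    · rcases hj.eq_or_lt with rfl | hj
      · exact r1
      · exact ih1' j (by push_cast at *; omega) (by push_cast at *; omega)
    · have e := h.S_top_x (-(m + 1 : ℕ))
      rw [e0] at e
      have e' : h.top (h.x (-(m + 1 : ℕ))) = rm N gi (h.S (h.top (h.x (-m))) +
          𝒟.lam • rm N g (h.x (-m)) -
          (𝒟.lam * 𝒟.μ⁻¹) • rm N (g * t.rtr (h.x (-(m + 1 : ℕ)))) M) := by
        have e2 : ∀ a b c : Matrix (Fin N) (Fin N) A, a - b + c + b - c = a := fun a b c => by abel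
        rw [e, e2, rm_rm, h.g_gi, rm_one]
      rw [e', show (1 - (m + 1 : ℕ) : ℤ) = -m by push_cast; ring,
        show ((m + 1 : ℕ) + 1 : ℤ) = m + 2 by push_cast; ring]
      exact h.rm_mem_Picc hgi (sub_mem (add_mem
        (h.Picc_mono (by omega) (by omega) (h.S_mem_Picc ih2))
        (Submodule.smul_mem _ _ (h.rm_mem_Picc hg (h.x_mem_Picc le_rfl (by omega)))))
        (Submodule.smul_mem _ _ (h.rm_mem_Picc (mul_mem hg r1)
          (h.M_mem_Picc (by omega) (by omega)))))

omit hgi in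
theorem top_x_pos_mem_Picc (m : ℕ) (hp : ∀ j : ℕ, j ≤ m → t.rtr (h.x j) ∈ D) :
    h.top (h.x (m + 1)) ∈ h.Picc D (-m) m := by
  induction m with
  | zero =>
    rw [Nat.cast_zero, zero_add, x_one, top_M]
    exact Submodule.smul_mem _ _ (h.rm_mem_Picc hg (h.x_mem_Picc (n := 0) (by omega) (by omega)))
  | succ m ih =>
    have e := h.S_top_x (m + 1)
    rw [Nat.cast_succ, ← LinearEquiv.symm_apply_apply h.S (h.top _), e]
    have hi := h.Picc_mono (k' := -m) (l' := m + 2) (by omega) (by omega)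
      (ih fun j hj => hp j (by omega))
    have hpm : t.rtr (h.x (m + 1)) ∈ D := by exact_mod_cast hp (m + 1) le_rfl
    exact h.Picc_mono (by omega) (by omega) (h.S_symm_mem_Picc (add_mem (sub_mem
      (h.rm_mem_Picc hg hi) (Submodule.smul_mem _ _ (h.rm_mem_Picc hg
        (h.x_mem_Picc (by omega) (by omega))))) (Submodule.smul_mem _ _
      (h.rm_mem_Picc (mul_mem hg hpm) (h.M_mem_Picc (by omega) (by omega))))))

theorem top_mem_Picc {m : ℕ} (hp : ∀ j : ℕ, j ≤ m → t.rtr (h.x j) ∈ D)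
    {Y : Matrix (Fin N) (Fin N) A} (hY : Y ∈ h.Picc D (-m) m) :
    h.top Y ∈ h.Picc D (-(m + 1)) (m + 1) := by
  refine map_mem_of_span ?_ hY
  rintro _ ⟨n, ⟨hn, hn'⟩, c, hc, rfl⟩
  rw [top_rm]
  refine h.rm_mem_Picc hc ?_
  rcases le_or_gt n 0 with h0 | h0
  · obtain ⟨j, rfl⟩ : ∃ j : ℕ, n = -j := ⟨n.natAbs, by omega⟩
    exact h.Picc_mono (by omega) (by omega)
      (h.top_x_neg_mem_Picc hg hgi j fun i hi => hp i (by omega)).2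
  · obtain ⟨j, rfl⟩ : ∃ j : ℕ, n = j + 1 := ⟨n.natAbs - 1, by omega⟩
    exact h.Picc_mono (by omega) (by omega)
      (h.top_x_pos_mem_Picc hg j fun i hi => hp i (by omega))

/-- The leading term of `newton`. -/
theorem newton_sub_mem_Picc {a : ℕ → A} (ha0 : a 0 = 1) (n : ℕ) (ha : ∀ j ≤ n, a j ∈ D)
    (hp : ∀ j : ℕ, j ≤ n → t.rtr (h.x j) ∈ D) :
    h.newton a (n + 1) - (-1 : ℂ) ^ n • h.x (n + 1) ∈ h.Picc D (-n) n := by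
  induction n with
  | zero =>
    have : h.newton a (0 + 1) - (-1 : ℂ) ^ 0 • h.x ((0 : ℕ) + 1) = 0 := by
      rw [newton, newton, ha0, rm_one, Nat.cast_zero, zero_add, x_one, map_zero, map_zero]
      simp
    rw [this]
    exact zero_mem _
  | succ n ih =>
    have ih' := ih (fun j hj => ha j (by omega)) (fun j hj => hp j (by omega))
    set Z := h.newton a (n + 1) - (-1 : ℂ) ^ n • h.x (n + 1) with hZ
    have eZ : h.newton a (n + 1) = Z + (-1 : ℂ) ^ n • h.x (n + 1) := by rw [hZ, sub_add_cancel]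
    have e : h.newton a (n + 1 + 1) - (-1 : ℂ) ^ (n + 1) • h.x ((n + 1 : ℕ) + 1) =
        𝒟.q ^ (n + 1) • rm N (a (n + 1)) M - h.S Z -
        (𝒟.lam / (𝒟.q * 𝒟.μ⁻¹ * (𝒟.q ^ (2 * (n + 1)))⁻¹ + 1)) • (h.top Z + (-1 : ℂ) ^ n •
          h.top (h.x (n + 1))) := by
      rw [newton, eZ, map_add, map_add, map_smul, map_smul, S_x, Nat.cast_succ, pow_succ]
      module
    rw [e, Nat.cast_succ]
    refine sub_mem (sub_mem (Submodule.smul_mem _ _ (h.rm_mem_Picc (ha _ le_rfl)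
      (h.M_mem_Picc (by omega) (by omega)))) (h.Picc_mono (by omega) (by omega) (h.S_mem_Picc ih')))
      (Submodule.smul_mem _ _ (add_mem ?_ (Submodule.smul_mem _ _ ?_)))
    · exact h.top_mem_Picc hg hgi (fun j hj => hp j (by omega)) ih'
    · exact h.Picc_mono (by omega) (by omega)
        (h.top_x_pos_mem_Picc hg n fun j hj => hp j (by omega))

/-- The traces of the powers of `M` are polynomials in `g`, its inverse, and `a_1, …, a_k`. -/
theorem rtr_x_nat_mem_of_newton {k : ℕ} (hk : 𝒟.Regular k) (h1 : 1 ≤ k) {a : ℕ → A}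
    (ha : ∀ n ≤ k, t.IsCh M n (t.asym 0 n) (a n))
    (h0 : t.asym 1 k * baxSeq 𝒟 t.R t.K 0 (𝒟.q ^ (2 * k))⁻¹ * t.asym 1 k = 0)
    (haD : ∀ n ≤ k, a n ∈ D) (n : ℕ) : t.rtr (h.x n) ∈ D := by
  have ha0 : a 0 = 1 := t.scal_injective (by
    rw [ha 0 (by omega), trs_zero, prod, asym, asymSeq, mul_one, map_one])
  have hz := h.newton_eq_zero hk h1 ha h0
  have sgn : ∀ n : ℕ, (-1 : ℂ) ^ n * (-1 : ℂ) ^ n = 1 := fun n => by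
    rw [← mul_pow]; norm_num
  induction n using Nat.strong_induction_on with
  | _ n ih =>
    cases n with
    | zero =>
      rw [Nat.cast_zero, x_zero, rtr_one]
      exact D.smul_mem D.one_mem _
    | succ n =>
      have hp : ∀ j : ℕ, j ≤ n → t.rtr (h.x j) ∈ D := fun j hj => ih j (by omega)
      have hp' := (h.top_x_neg_mem_Picc hg hgi n hp).1
      rcases Nat.lt_or_ge n k with hn | hn
      · have hm := h.newton_sub_mem_Picc hg hgi ha0 n (fun j hj => haD j (by omega)) hp
        set Z := h.newton a (n + 1) - (-1 : ℂ) ^ n • h.x (n + 1) with hZ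
        have e : h.x (n + 1 : ℕ) = (-1 : ℂ) ^ n • (h.newton a (n + 1) - Z) := by
          rw [hZ, sub_sub_cancel, smul_smul, sgn, one_smul, Nat.cast_succ]
        have hs : t.rtr (h.newton a (n + 1) - Z) = t.rtr (h.newton a (n + 1)) + (-1 : ℂ) • t.rtr Z := by
          rw [← rtr_smul, ← rtr_add, neg_one_smul, sub_eq_add_neg]
        rw [e, rtr_smul, hs, h.rtr_newton hk ha hn]
        exact D.smul_mem (add_mem (D.smul_mem (haD _ hn) _)
          (D.smul_mem (h.rtr_mem_of_Picc hp' hm) _)) _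
      · have hm := h.newton_sub_mem_Picc hg hgi ha0 k haD fun j hj => hp j (by omega)
        rw [hz, zero_sub, neg_mem_iff] at hm
        have hm' : h.x (k + 1) ∈ h.Picc D (-k) k := by
          have := Submodule.smul_mem _ ((-1 : ℂ) ^ k) hm
          rwa [smul_smul, sgn, one_smul] at this
        have hS : ∀ m : ℕ, h.x (k + 1 + m) ∈ h.Picc D (-k + m) (k + m) := by
          intro m
          induction m with
          | zero => simpa using hm'
          | succ m ihm =>
            have := h.S_mem_Picc ihm
            rw [S_x] at this
            rw [Nat.cast_succ, ← add_assoc, ← add_assoc, ← add_assoc]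
            exact this
        obtain ⟨m, rfl⟩ := Nat.exists_eq_add_of_le hn
        have := hS m
        rw [show ((k : ℤ) + 1 + m) = (k + m + 1 : ℕ) by push_cast; ring] at this
        exact h.rtr_mem_of_Picc (fun j hj hj' => hp' j (by push_cast; omega) (by push_cast; omega))
          this

end Star

end Tower

namespace QMData.Admissible

variable {N : ℕ} {𝒟 : QMData N} (H : 𝒟.Admissible) {A : Type} [Ring A] [Algebra ℂ A]

theorem cHom_bax {n i : ℕ} (h : i + 1 < n) (x : ℂ) :
    cHom n (𝒟.bax n i x) = baxSeq 𝒟 (H.tower A).R (H.tower A).K i x := by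
  rw [QMData.bax, map_add, map_add, map_one, map_smul, map_smul, QMData.cHom_Rop h,
    QMData.cHom_Kop h]
  rfl

theorem cHom_asym {n s i : ℕ} (h : s + i ≤ n) :
    cHom n (𝒟.asym n s i) = (H.tower A).asym s i := by
  induction i with
  | zero => exact map_one _
  | succ i ih =>
    cases i with
    | zero => exact map_one _
    | succ i =>
      rw [QMData.asym, map_smul, map_mul, map_mul, ih (by omega), H.cHom_bax (by omega)]
      rfl

theorem isCh_asym (M : Matrix (Fin N) (Fin N) A) (n : ℕ) :
    (H.tower A).IsCh M n ((H.tower A).asym 0 n) (𝒟.aElt M n) := by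
  have := H.isCh M n (𝒟.asym n 0 n)
  rwa [H.cHom_asym (by omega)] at this

include H in
theorem regular {k : ℕ} (hR : 𝒟.IsOrthogonal k) : 𝒟.Regular k :=
  QMData.regular H.q_ne H.lam_ne hR.2.2.1 hR.2.2.2.2.2.1

theorem asym_succ_eq_zero {k : ℕ} (hR : 𝒟.IsOrthogonal k) (hk : 1 ≤ k) :
    (H.tower A).asym 1 k * baxSeq 𝒟 (H.tower A).R (H.tower A).K 0 (𝒟.q ^ (2 * k))⁻¹ *
      (H.tower A).asym 1 k = 0 := by
  have := congrArg (cHom (A := A) (k + 1)) hR.2.2.2.2.1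
  rwa [map_mul, map_mul, H.cHom_asym (by omega), H.cHom_bax (by omega), map_zero] at this

variable {ℓ : ℕ} {ε : ℂ}

include H in
theorem charAlg_le (hR : 𝒟.IsOrthogonal (2 * ℓ)) (hℓ : 1 ≤ ℓ) : 𝒟.charAlg ℓ ε ≤
    Algebra.adjoin ℂ ({𝒟.gElt (𝒟.genM ℓ ε), 𝒟.gInv ℓ ε} ∪
      {x | ∃ n ≤ 2 * ℓ, x = 𝒟.aElt (𝒟.genM ℓ ε) n}) := by
  set D := Algebra.adjoin ℂ ({𝒟.gElt (𝒟.genM ℓ ε), 𝒟.gInv ℓ ε} ∪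
      {x | ∃ n ≤ 2 * ℓ, x = 𝒟.aElt (𝒟.genM ℓ ε) n}) with hD
  have hg : 𝒟.gElt (𝒟.genM ℓ ε) ∈ D := Algebra.subset_adjoin (Or.inl (Or.inl rfl))
  have hgi : 𝒟.gInv ℓ ε ∈ D := Algebra.subset_adjoin (Or.inl (Or.inr rfl))
  have hle : D ≤ 𝒟.charAlg ℓ ε := by
    refine Algebra.adjoin_le ?_
    rintro _ ((rfl | rfl) | ⟨n, -, rfl⟩)
    exacts [gElt_mem ℓ ε, (H.star ℓ ε).gi_mem, (𝒟.aC ℓ ε n).2]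
  have hs : (H.tower (𝒟.Component ℓ ε)).Star (𝒟.genM ℓ ε) (𝒟.gElt (𝒟.genM ℓ ε)) (𝒟.gInv ℓ ε) D :=
    { toQM := H.qm ℓ ε
      phi_bijective := H.phi_bijective
      rtr_iterate_mem := fun n => by
        rw [← (H.star ℓ ε).x_nat]
        exact (H.star ℓ ε).rtr_x_nat_mem_of_newton hg hgi (H.regular hR) (by omega)
          (fun n _ => H.isCh_asym _ n) (H.asym_succ_eq_zero hR (by omega))
          (fun n hn => Algebra.subset_adjoin (Or.inr ⟨n, hn, rfl⟩)) n
      g_mem := hg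
      gi_mem := hgi
      comm := fun x hx y hy => (H.star ℓ ε).comm x (hle hx) y (hle hy) }
  refine Algebra.adjoin_le ?_
  rintro _ (⟨n, X, hX, rfl⟩ | rfl)
  · exact hs.ch_mem (H.cHom_mem hX) (H.isCh _ n X)
  · exact hgi

end QMData.Admissible

/-! ### Reciprocity of elementary symmetric functions -/

section Reciprocal

open Polynomial

variable {B : Type} [CommRing B]

theorem esymm_cons_succ (a : B) (s : Multiset B) (n : ℕ) :
    (a ::ₘ s).esymm (n + 1) = s.esymm (n + 1) + a * s.esymm n := by
  rw [Multiset.esymm, Multiset.powersetCard_cons, Multiset.map_add, Multiset.sum_add,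
    Multiset.map_map]
  congr 1
  simp only [Function.comp_def, Multiset.prod_cons]
  rw [Multiset.sum_map_mul_left]
  rfl

theorem esymm_zero (s : Multiset B) : s.esymm 0 = 1 := by
  simp [Multiset.esymm]

theorem esymm_map {B' : Type} [CommRing B'] (f : B →+* B') (s : Multiset B) (n : ℕ) :
    (s.map f).esymm n = f (s.esymm n) := by
  rw [Multiset.esymm, Multiset.powersetCard_map, Multiset.map_map, Multiset.esymm,
    map_multiset_sum, Multiset.map_map]
  congr 1
  refine Multiset.map_congr rfl fun t _ => ?_
  simp only [Function.comp_def]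
  exact (map_multiset_prod f t).symm

theorem esymm_recip {r ri : B} (hr : r * ri = 1) {w : Multiset B} {ε : B}
    (h : reflect w.card (w.map fun v => X + C (ri * v)).prod =
      C ε * (w.map fun v => X + C (ri * v)).prod) {i j : ℕ} (hij : i + j = w.card) :
    r ^ j * w.esymm i = ε * r ^ i * w.esymm j := by
  have hc : ∀ a b, a + b = w.card →
      (w.map fun v => X + C (ri * v)).prod.coeff a = ri ^ b * w.esymm b := by
    intro a b hab
    have e : (w.map fun v => X + C (ri * v)) = ((w.map fun v => ri • v).map fun v => X + C v) := by
      rw [Multiset.map_map]; rfl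
    rw [e, Multiset.prod_X_add_C_coeff _ (by rw [Multiset.card_map]; omega), Multiset.card_map,
      ← Multiset.pow_smul_esymm, smul_eq_mul, show w.card - a = b by omega]
  have h' := congrArg (fun p => p.coeff i) h
  simp only [coeff_reflect, coeff_C_mul] at h'
  rw [revAt_le (by omega), show w.card - i = j by omega, hc j i (by omega), hc i j hij] at h'
  have e1 : r ^ i * ri ^ i = 1 := by rw [← mul_pow, hr, one_pow]
  have e2 : r ^ j * ri ^ j = 1 := by rw [← mul_pow, hr, one_pow]
  linear_combination (r ^ i * r ^ j) * h' - (r ^ j * w.esymm i) * e1 + (ε * r ^ i * w.esymm j) * e2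

theorem reflect_X_add_C (a : B) : reflect 1 (X + C a) = C a * X + 1 := by
  have h1 : reflect 1 (X : B[X]) = 1 := by
    have := reflect_monomial (R := B) 1 1
    rwa [pow_one, revAt_le le_rfl, Nat.sub_self, pow_zero] at this
  rw [reflect_add, reflect_C, h1, pow_one, add_comm]

theorem reflect_prod {ι : Type} (s : Finset ι) (f : ι → B) :
    (∏ i ∈ s, (X + C (f i))).natDegree ≤ s.card ∧
    reflect s.card (∏ i ∈ s, (X + C (f i))) = ∏ i ∈ s, (C (f i) * X + 1) := by
  classical
  induction s using Finset.induction_on with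
  | empty => simp
  | insert a s ha ih =>
    have h1 : (X + C (f a)).natDegree ≤ 1 :=
      (natDegree_add_le _ _).trans (by simp [natDegree_X_le])
    rw [Finset.prod_insert ha, Finset.prod_insert ha, Finset.card_insert_of_notMem ha,
      add_comm s.card]
    refine ⟨natDegree_mul_le.trans (Nat.add_le_add h1 ih.1), ?_⟩
    rw [reflect_mul _ _ h1 ih.1, ih.2, reflect_X_add_C]

/-- A product of pairs of factors with reciprocal roots is a reciprocal polynomial. -/
theorem reflect_prod_rev {m : ℕ} (u : Fin (2 * m) → B) (hu : ∀ i, u i * u i.rev = 1) :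
    reflect (2 * m) (∏ i, (X + C (u i))) = ∏ i, (X + C (u i)) := by
  have hp : ∏ i, u i = 1 := Finset.prod_involution (fun i _ => i.rev) (fun i _ => hu i)
    (fun i _ _ h => by
      have := congrArg Fin.val h
      rw [Fin.val_rev] at this
      omega) (fun i _ => Finset.mem_univ _) (fun i _ => Fin.rev_rev i)
  have h := (reflect_prod Finset.univ u).2
  rw [Finset.card_univ, Fintype.card_fin] at h
  rw [h]
  have e : ∀ i, C (u i) * X + 1 = C (u i) * (X + C (u i.rev)) := fun i => by
    rw [mul_add, ← C_mul, hu, C_1]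
  rw [Finset.prod_congr rfl fun i _ => e i, Finset.prod_mul_distrib, ← map_prod, hp, C_1, one_mul]
  exact Equiv.prod_comp Fin.revPerm (fun i => X + C (u i))

end Reciprocal

section Spec

open Polynomial

variable (m : ℕ)

/-- The inverse of `ν_0`. -/
def nuInv : Spec m := Ideal.Quotient.mk (specIdeal m) (MvPolynomial.X none)

theorem nu_mul_nuInv : nu m 0 * nuInv m = 1 := by
  rw [nu, nuInv, ← map_mul, ← map_one (Ideal.Quotient.mk (specIdeal m)), Ideal.Quotient.eq]
  exact Ideal.subset_span (Or.inr rfl)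

theorem nu_mul_nu (i : Fin (2 * m)) : nu m i.succ * nu m i.rev.succ = nu m 0 ^ 2 := by
  have key : ∀ j : Fin m, nu m ⟨m + 1 + j, by omega⟩ * nu m ⟨m - j, by omega⟩ = nu m 0 ^ 2 := by
    intro j
    rw [nu, nu, nu, ← map_mul, ← map_pow, Ideal.Quotient.eq]
    exact Ideal.subset_span (Or.inl ⟨j, rfl⟩)
  rcases Nat.lt_or_ge i m with h | h
  · rw [mul_comm, ← key ⟨m - 1 - i, by omega⟩]
    congr 2 <;> exact Fin.ext (by simp only [Fin.val_succ, Fin.val_rev]; omega)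
  · rw [← key ⟨i - m, by omega⟩]
    congr 2 <;> exact Fin.ext (by simp only [Fin.val_succ, Fin.val_rev]; omega)

theorem card_nuMultiset : (nuMultiset m).card = 2 * m := by
  simp [nuMultiset]

theorem prod_nuMultiset {B : Type} [CommRing B] (f : Spec m → B) :
    ((nuMultiset m).map f).prod = ∏ i : Fin (2 * m), f (nu m i.succ) := by
  rw [nuMultiset, Multiset.map_map]
  rfl

theorem nu_pair (i : Fin (2 * m)) :
    (nuInv m * nu m i.succ) * (nuInv m * nu m i.rev.succ) = 1 := by
  linear_combination nuInv m ^ 2 * nu_mul_nu m i + (nu m 0 * nuInv m + 1) * nu_mul_nuInv m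

theorem esymm_nu {i j : ℕ} (hij : i + j = 2 * m) :
    nu m 0 ^ j * (nuMultiset m).esymm i = nu m 0 ^ i * (nuMultiset m).esymm j := by
  have h := esymm_recip (ε := 1) (nu_mul_nuInv m) (w := nuMultiset m) (i := i) (j := j) (by
    rw [card_nuMultiset, prod_nuMultiset, C_1, one_mul]
    exact reflect_prod_rev _ (nu_pair m)) (by rw [card_nuMultiset, hij])
  rwa [one_mul] at h

/-- The multiset `ν_0, -ν_0, ν_1, …, ν_{2m}`. -/
abbrev nuMultiset' : Multiset (Spec m) := nu m 0 ::ₘ -nu m 0 ::ₘ nuMultiset m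

theorem card_nuMultiset' : (nuMultiset' m).card = 2 * m + 2 := by
  rw [Multiset.card_cons, Multiset.card_cons, card_nuMultiset]

theorem esymm_nu' {i j : ℕ} (hij : i + j = 2 * m + 2) :
    nu m 0 ^ j * (nuMultiset' m).esymm i = -(nu m 0 ^ i * (nuMultiset' m).esymm j) := by
  have e1 : nuInv m * nu m 0 = 1 := by rw [mul_comm, nu_mul_nuInv]
  have e2 : nuInv m * -nu m 0 = -1 := by linear_combination -e1
  have h := esymm_recip (ε := -1) (nu_mul_nuInv m) (w := nuMultiset' m) (i := i) (j := j) (by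
    rw [card_nuMultiset', Multiset.map_cons, Multiset.map_cons, Multiset.prod_cons,
      Multiset.prod_cons, prod_nuMultiset, e1, e2]
    have h2 := (reflect_prod (Finset.univ : Finset (Fin 2)) (fun i => (-1 : Spec m) ^ (i : ℕ)))
    have h3 := (reflect_prod Finset.univ (fun i : Fin (2 * m) => nuInv m * nu m i.succ)).1
    rw [Finset.card_univ, Fintype.card_fin, Fin.prod_univ_two, Fin.prod_univ_two] at h2
    rw [Finset.card_univ, Fintype.card_fin] at h3
    simp only [Fin.val_zero, Fin.val_one, pow_zero, pow_one] at h2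
    rw [← mul_assoc, mul_comm ((X + C 1) * (X + C (-1))), reflect_mul _ _ h3 h2.1, h2.2,
      reflect_prod_rev _ (nu_pair m)]
    simp only [C_neg, C_1]
    ring) (by rw [card_nuMultiset', hij])
  linear_combination h

theorem esymm_nuMultiset'_succ_succ (i : ℕ) : (nuMultiset' m).esymm (i + 2) =
    (nuMultiset m).esymm (i + 2) - nu m 0 ^ 2 * (nuMultiset m).esymm i := by
  rw [esymm_cons_succ, esymm_cons_succ, esymm_cons_succ]
  ring

theorem esymm_nuMultiset'_one : (nuMultiset' m).esymm 1 = (nuMultiset m).esymm 1 := by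
  have h := esymm_cons_succ (nu m 0) (-nu m 0 ::ₘ nuMultiset m) 0
  have h' := esymm_cons_succ (-nu m 0) (nuMultiset m) 0
  rw [esymm_zero] at h h'
  rw [zero_add] at h h'
  rw [h, h']
  ring

end Spec

/-! ### The homomorphism from the characteristic subalgebra to the spectral variables -/

theorem exists_algHom_of_surjective {X B B' : Type} [Semiring X] [Semiring B] [Ring B']
    [Algebra ℂ X]
    [Algebra ℂ B] [Algebra ℂ B'] {f : X →ₐ[ℂ] B} (hf : Function.Surjective f) {g : X →ₐ[ℂ] B'}
    (h : ∀ x, f x = 0 → g x = 0) : ∃ π : B →ₐ[ℂ] B', π.comp f = g := by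
  have h' : ∀ x y, f x = f y → g x = g y := fun x y e => by
    have h0 : f ((1 : ℂ) • x + (-1 : ℂ) • y) = 0 := by
      rw [map_add, map_smul, map_smul, e, ← add_smul, add_neg_cancel, zero_smul]
    have h1 := h _ h0
    rw [map_add, map_smul, map_smul, one_smul, neg_one_smul, ← sub_eq_add_neg] at h1
    exact sub_eq_zero.1 h1
  choose s hs using hf
  refine ⟨AlgHom.ofLinearMap { toFun := fun b => g (s b), map_add' := ?_, map_smul' := ?_ } ?_ ?_,
    AlgHom.ext fun x => h' _ _ (hs _)⟩
  · intro a b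
    rw [← map_add]
    exact h' _ _ (by rw [map_add, hs, hs, hs])
  · intro c a
    rw [RingHom.id_apply, ← map_smul]
    exact h' _ _ (by rw [map_smul, hs, hs])
  · change g (s 1) = 1
    rw [← map_one g]
    exact h' _ _ (by rw [map_one, hs])
  · intro a b
    change g (s (a * b)) = g (s a) * g (s b)
    rw [← map_mul]
    exact h' _ _ (by rw [map_mul, hs, hs, hs])

namespace QMData

variable {N : ℕ} {𝒟 : QMData N} {ℓ : ℕ} {ε : ℂ} {m : ℕ}

/-- `g⁻¹` as an element of the characteristic subalgebra. -/
def gInvC (𝒟 : QMData N) (ℓ : ℕ) (ε : ℂ) : 𝒟.charAlg ℓ ε :=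
  ⟨𝒟.gInv ℓ ε, Algebra.subset_adjoin (Or.inr rfl)⟩

theorem gC_mul_gInvC : 𝒟.gC ℓ ε * 𝒟.gInvC ℓ ε = 1 := Subtype.ext (Admissible.g_mul_gInv ℓ ε)

/-- The images of `g` and the `a_j`. -/
def genC (𝒟 : QMData N) (ℓ : ℕ) (ε : ℂ) (j : Fin (2 * ℓ + 1)) : 𝒟.charAlg ℓ ε :=
  if j = 0 then 𝒟.gC ℓ ε else 𝒟.aC ℓ ε j

/-- The spectral values of `g` and the `a_j`. -/
def genS (ℓ : ℕ) (w : Multiset (Spec m)) (j : Fin (2 * ℓ + 1)) : Spec m :=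
  if j = 0 then nu m 0 ^ 2 else w.esymm j

/-- The presentation of the characteristic subalgebra by a free algebra. -/
def freeC (𝒟 : QMData N) (ℓ : ℕ) (ε : ℂ) :
    FreeAlgebra ℂ (Option (Fin (2 * ℓ + 1))) →ₐ[ℂ] 𝒟.charAlg ℓ ε :=
  FreeAlgebra.lift ℂ fun o => o.elim (𝒟.gInvC ℓ ε) (𝒟.genC ℓ ε)

/-- The corresponding homomorphism to the algebra of spectral variables. -/
def freeS (ℓ : ℕ) (w : Multiset (Spec m)) : FreeAlgebra ℂ (Option (Fin (2 * ℓ + 1))) →ₐ[ℂ] Spec m :=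
  FreeAlgebra.lift ℂ fun o => o.elim (nuInv m ^ 2) (genS ℓ w)

theorem comp_freeC {w : Multiset (Spec m)} {π : 𝒟.charAlg ℓ ε →ₐ[ℂ] Spec m}
    (hπ : 𝒟.IsSpectralHom ℓ ε w π) : π.comp (𝒟.freeC ℓ ε) = freeS ℓ w := by
  refine FreeAlgebra.hom_ext (funext fun o => ?_)
  simp only [Function.comp_apply, AlgHom.comp_apply, freeC, freeS, FreeAlgebra.lift_ι_apply]
  cases o with
  | none =>
    have h := congrArg π (gC_mul_gInvC (𝒟 := 𝒟) (ℓ := ℓ) (ε := ε))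
    rw [map_mul, map_one, hπ.1] at h
    change π (𝒟.gInvC ℓ ε) = nuInv m ^ 2
    have e := nu_mul_nuInv m
    have e2 : nuInv m ^ 2 * nu m 0 ^ 2 = 1 := by
      linear_combination (nu m 0 * nuInv m + 1) * e
    linear_combination nuInv m ^ 2 * h - π (𝒟.gInvC ℓ ε) * e2
  | some j =>
    change π (𝒟.genC ℓ ε j) = genS ℓ w j
    rw [genC, genS]
    split_ifs with h
    · exact hπ.1
    · exact hπ.2 j (Nat.one_le_iff_ne_zero.2 fun h0 => h (Fin.ext h0)) (by omega)

/-- Reciprocity of the spectral values of the `a_j`. -/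
theorem aeval_recipIdeal {w : Multiset (Spec m)}
    (hw : ∀ i ≤ ℓ, w.esymm (ℓ + i) = algebraMap ℂ _ ε * (nu m 0 ^ 2) ^ i * w.esymm (ℓ - i))
    {P : MvPolynomial (Fin (2 * ℓ + 1)) ℂ} (hP : P ∈ recipIdeal ℓ ε) :
    MvPolynomial.aeval (genS ℓ w) P = 0 := by
  have ha : ∀ j, j ≤ 2 * ℓ → MvPolynomial.aeval (genS ℓ w) (aVar ℓ j) = w.esymm j := by
    intro j hj
    rw [aVar]
    split_ifs with h
    · rw [h, esymm_zero, map_one]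
    · have hv : (Fin.ofNat (2 * ℓ + 1) j : ℕ) = j := Nat.mod_eq_of_lt (by omega)
      rw [MvPolynomial.aeval_X, genS, if_neg, hv]
      intro h0
      rw [h0] at hv
      exact h hv.symm
  have hle : recipIdeal ℓ ε ≤ RingHom.ker (MvPolynomial.aeval (R := ℂ) (genS ℓ w)) := by
    refine Ideal.span_le.2 ?_
    rintro _ ⟨i, hi, rfl⟩
    rw [SetLike.mem_coe, RingHom.mem_ker, map_sub, map_mul, map_mul, map_pow, ha _ (by omega),
      ha _ (by omega), hw i hi, MvPolynomial.aeval_X, MvPolynomial.aeval_C, genS, if_pos rfl,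
      sub_self]
  exact hle hP

namespace Admissible

variable (H : 𝒟.Admissible)
include H

theorem aC_zero : 𝒟.aC ℓ ε 0 = 1 := by
  refine Subtype.ext ((H.tower (𝒟.Component ℓ ε)).scal_injective ?_)
  have := H.isCh_asym (𝒟.genM ℓ ε) 0
  rw [Tower.IsCh] at this
  change (H.tower (𝒟.Component ℓ ε)).scal (𝒟.aElt (𝒟.genM ℓ ε) 0) =
    (H.tower (𝒟.Component ℓ ε)).scal 1
  rw [this, Tower.trs_zero, Tower.prod, Tower.asym, asymSeq, mul_one, map_one]

theorem freeC_surjective (hR : 𝒟.IsOrthogonal (2 * ℓ)) (hℓ : 1 ≤ ℓ) :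
    Function.Surjective (𝒟.freeC ℓ ε) := by
  have hle : 𝒟.charAlg ℓ ε ≤ (𝒟.freeC ℓ ε).range.map (𝒟.charAlg ℓ ε).val := by
    refine (H.charAlg_le hR hℓ).trans (Algebra.adjoin_le ?_)
    have hs : ∀ o : Option (Fin (2 * ℓ + 1)), (o.elim (𝒟.gInvC ℓ ε) (𝒟.genC ℓ ε) : 𝒟.charAlg ℓ ε).1 ∈
        (𝒟.freeC ℓ ε).range.map (𝒟.charAlg ℓ ε).val := fun o =>
      ⟨_, ⟨FreeAlgebra.ι ℂ o, FreeAlgebra.lift_ι_apply _ _⟩, rfl⟩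
    rintro _ ((rfl | rfl) | ⟨n, hn, rfl⟩)
    · exact hs (some 0)
    · exact hs none
    · rcases Nat.eq_zero_or_pos n with rfl | h0
      · have : 𝒟.aElt (𝒟.genM ℓ ε) 0 = 1 := congrArg Subtype.val (H.aC_zero (ℓ := ℓ) (ε := ε))
        rw [this]
        exact one_mem _
      · have := hs (some ⟨n, by omega⟩)
        rw [Option.elim_some, genC, if_neg (fun h => by simp [Fin.ext_iff] at h; omega)] at this
        exact this
  intro x
  obtain ⟨y, hy, e⟩ := hle x.2
  obtain ⟨P, rfl⟩ := hy
  exact ⟨P, Subtype.ext e⟩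

omit H in
/-- Clearing powers of `g⁻¹`. -/
theorem exists_clear (hcomm : ∀ x y : 𝒟.charAlg ℓ ε, x * y = y * x) (w : Multiset (Spec m))
    (P : FreeAlgebra ℂ (Option (Fin (2 * ℓ + 1)))) : ∃ (n : ℕ) (Q : FreeAlgebra ℂ (Fin (2 * ℓ + 1))),
      FreeAlgebra.lift ℂ (𝒟.genC ℓ ε) Q = 𝒟.freeC ℓ ε P * 𝒟.gC ℓ ε ^ n ∧
      FreeAlgebra.lift ℂ (genS ℓ w) Q = freeS ℓ w P * (nu m 0 ^ 2) ^ n := by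
  have hC : ∀ n, FreeAlgebra.lift ℂ (𝒟.genC ℓ ε) (FreeAlgebra.ι ℂ 0 ^ n) = 𝒟.gC ℓ ε ^ n := by
    intro n
    rw [map_pow, FreeAlgebra.lift_ι_apply, genC, if_pos rfl]
  have hS : ∀ n, FreeAlgebra.lift ℂ (genS ℓ w) (FreeAlgebra.ι ℂ 0 ^ n) = (nu m 0 ^ 2) ^ n := by
    intro n
    rw [map_pow, FreeAlgebra.lift_ι_apply, genS, if_pos rfl]
  induction P using FreeAlgebra.induction with
  | grade0 r =>
    exact ⟨0, algebraMap _ _ r, by rw [AlgHom.commutes, AlgHom.commutes, pow_zero, mul_one],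
      by rw [AlgHom.commutes, AlgHom.commutes, pow_zero, mul_one]⟩
  | grade1 o =>
    cases o with
    | none =>
      refine ⟨1, 1, ?_, ?_⟩
      · rw [map_one, freeC, FreeAlgebra.lift_ι_apply, Option.elim_none, pow_one, hcomm,
          gC_mul_gInvC]
      · rw [map_one, freeS, FreeAlgebra.lift_ι_apply, Option.elim_none, pow_one]
        linear_combination -(nu m 0 * nuInv m + 1) * nu_mul_nuInv m
    | some j =>
      refine ⟨0, FreeAlgebra.ι ℂ j, ?_, ?_⟩
      · rw [freeC, FreeAlgebra.lift_ι_apply, FreeAlgebra.lift_ι_apply, Option.elim_some, pow_zero,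
          mul_one]
      · rw [freeS, FreeAlgebra.lift_ι_apply, FreeAlgebra.lift_ι_apply, Option.elim_some, pow_zero,
          mul_one]
  | mul a b ha hb =>
    obtain ⟨n, Q, h1, h2⟩ := ha
    obtain ⟨n', Q', h1', h2'⟩ := hb
    refine ⟨n + n', Q * Q', ?_, ?_⟩
    · rw [map_mul, map_mul, h1, h1', pow_add, mul_assoc, ← mul_assoc (𝒟.gC ℓ ε ^ n),
        hcomm (𝒟.gC ℓ ε ^ n)]
      simp only [mul_assoc]
    · rw [map_mul, map_mul, h2, h2']
      ring
  | add a b ha hb =>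
    obtain ⟨n, Q, h1, h2⟩ := ha
    obtain ⟨n', Q', h1', h2'⟩ := hb
    refine ⟨n + n', Q * FreeAlgebra.ι ℂ 0 ^ n' + Q' * FreeAlgebra.ι ℂ 0 ^ n, ?_, ?_⟩
    · rw [map_add, map_mul, map_mul, map_add, hC, hC, h1, h1', mul_assoc, mul_assoc, ← pow_add,
        ← pow_add, add_comm n', ← add_mul]
    · rw [map_add, map_mul, map_mul, map_add, hS, hS, h2, h2']
      ring

theorem existsUnique_spectralHom (hR : 𝒟.IsOrthogonal (2 * ℓ)) (hℓ : 1 ≤ ℓ)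
    (hO : 𝒟.OnlyReciprocal ℓ ε) {w : Multiset (Spec m)}
    (hw : ∀ i ≤ ℓ, w.esymm (ℓ + i) = algebraMap ℂ _ ε * (nu m 0 ^ 2) ^ i * w.esymm (ℓ - i)) :
    ∃! π, 𝒟.IsSpectralHom ℓ ε w π := by
  have hcomm : ∀ x y : 𝒟.charAlg ℓ ε, x * y = y * x := fun x y =>
    Subtype.ext ((H.star ℓ ε).comm x x.2 y y.2)
  have hsurj := H.freeC_surjective (ε := ε) hR hℓ
  have hker : ∀ P, 𝒟.freeC ℓ ε P = 0 → freeS ℓ w P = 0 := by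
    intro P hP
    obtain ⟨n, Q, h1, h2⟩ := exists_clear hcomm w P
    rw [hP, zero_mul] at h1
    have h3 := aeval_recipIdeal hw (hO Q h1)
    have h4 : (MvPolynomial.aeval (genS ℓ w)).comp (FreeAlgebra.lift ℂ
        (fun j : Fin (2 * ℓ + 1) => (MvPolynomial.X j : MvPolynomial (Fin (2 * ℓ + 1)) ℂ))) =
        FreeAlgebra.lift ℂ (genS ℓ w) := by
      refine FreeAlgebra.hom_ext (funext fun j => ?_)
      simp
    have h5 := congrArg (fun f => f Q) h4
    simp only [AlgHom.comp_apply] at h5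
    rw [h3, h2] at h5
    have e : (nu m 0 ^ 2) ^ n * (nuInv m ^ 2) ^ n = 1 := by
      rw [← mul_pow, ← mul_pow, nu_mul_nuInv, one_pow, one_pow]
    calc freeS ℓ w P = freeS ℓ w P * ((nu m 0 ^ 2) ^ n * (nuInv m ^ 2) ^ n) := by rw [e, mul_one]
      _ = 0 := by rw [← mul_assoc, ← h5, zero_mul]
  obtain ⟨π, hπ⟩ := exists_algHom_of_surjective (f := 𝒟.freeC ℓ ε) (g := freeS ℓ w) hsurj hker
  have hf : ∀ P, π (𝒟.freeC ℓ ε P) = freeS ℓ w P := fun P => congrArg (· P) hπ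
  have hg : ∀ j, π (𝒟.genC ℓ ε j) = genS ℓ w j := fun j => by
    have := hf (FreeAlgebra.ι ℂ (some j))
    rwa [freeC, freeS, FreeAlgebra.lift_ι_apply, FreeAlgebra.lift_ι_apply] at this
  refine ⟨π, ⟨?_, fun i h1 h2 => ?_⟩, fun π' hπ' => ?_⟩
  · have := hg 0
    rwa [genC, genS, if_pos rfl, if_pos rfl] at this
  · have hne : (⟨i, by omega⟩ : Fin (2 * ℓ + 1)) ≠ 0 := fun h => by
      simp [Fin.ext_iff] at h; omega
    have := hg ⟨i, by omega⟩
    rwa [genC, genS, if_neg hne, if_neg hne] at this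
  · refine AlgHom.ext fun x => ?_
    obtain ⟨P, rfl⟩ := hsurj x
    exact (congrArg (· P) (comp_freeC hπ')).trans (hf P).symm

theorem existsUnique_spectralHom_plus (hR : 𝒟.IsOrthogonal (2 * ℓ)) (hℓ : 1 ≤ ℓ)
    (hO : 𝒟.OnlyReciprocal ℓ 1) : ∃! π, 𝒟.IsSpectralHom ℓ 1 (nuMultiset ℓ) π := by
  refine H.existsUnique_spectralHom hR hℓ hO fun i hi => ?_
  have h := esymm_nu ℓ (i := ℓ + i) (j := ℓ - i) (by omega)
  have e : nu ℓ 0 ^ (ℓ - i) * nuInv ℓ ^ (ℓ - i) = 1 := by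
    rw [← mul_pow, nu_mul_nuInv, one_pow]
  rw [show ℓ + i = ℓ - i + 2 * i by omega, pow_add, ← show ℓ + i = ℓ - i + 2 * i by omega,
    pow_mul] at h
  rw [map_one]
  linear_combination nuInv ℓ ^ (ℓ - i) * h - ((nuMultiset ℓ).esymm (ℓ + i) -
    (nu ℓ 0 ^ 2) ^ i * (nuMultiset ℓ).esymm (ℓ - i)) * e

theorem existsUnique_spectralHom_minus (hR : 𝒟.IsOrthogonal (2 * ℓ)) (hℓ : 1 ≤ ℓ)
    (hO : 𝒟.OnlyReciprocal ℓ (-1)) :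
    ∃! π, 𝒟.IsSpectralHom ℓ (-1) (nuMultiset' (ℓ - 1)) π := by
  refine H.existsUnique_spectralHom hR hℓ hO fun i hi => ?_
  have h := esymm_nu' (ℓ - 1) (i := ℓ + i) (j := ℓ - i) (by omega)
  have e : nu (ℓ - 1) 0 ^ (ℓ - i) * nuInv (ℓ - 1) ^ (ℓ - i) = 1 := by
    rw [← mul_pow, nu_mul_nuInv, one_pow]
  rw [show ℓ + i = ℓ - i + 2 * i by omega, pow_add, ← show ℓ + i = ℓ - i + 2 * i by omega,
    pow_mul] at h
  rw [map_neg, map_one]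
  linear_combination nuInv (ℓ - 1) ^ (ℓ - i) * h - ((nuMultiset' (ℓ - 1)).esymm (ℓ + i) +
    (nu (ℓ - 1) 0 ^ 2) ^ i * (nuMultiset' (ℓ - 1)).esymm (ℓ - i)) * e

end Admissible

end QMData

/-! ### The solution of the Newton recursion in a commutative ring -/

section Newton

variable {B : Type} [CommRing B]

theorem seq_eq_sum {s a : ℕ → B} {y : B} (h0 : s 0 = 0) (hs : ∀ n, s (n + 1) = a n - y * s n)
    (n : ℕ) : s (n + 1) = ∑ i ∈ Finset.range (n + 1), a i * (-y) ^ (n - i) := by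
  induction n with
  | zero => simp [hs, h0]
  | succ n ih =>
    rw [hs, ih, Finset.sum_range_succ (fun i => a i * (-y) ^ (n + 1 - i)), Nat.sub_self, pow_zero,
      mul_one, Finset.mul_sum, sub_eq_neg_add, ← Finset.sum_neg_distrib]
    congr 1
    refine Finset.sum_congr rfl fun i hi => ?_
    rw [show n + 1 - i = n - i + 1 by have := Finset.mem_range.1 hi; omega, pow_succ]
    ring

theorem prod_sub_eq_sum (w : Multiset B) (x q : B) : (w.map fun v => x - q * v).prod =
    ∑ i ∈ Finset.range (w.card + 1), (-q) ^ i * w.esymm i * x ^ (w.card - i) := by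
  have h := congrArg (Polynomial.eval x)
    (Multiset.prod_X_sub_X_eq_sum_esymm (w.map fun v => q • v))
  rw [Polynomial.eval_multiset_prod, Polynomial.eval_finsetSum, Multiset.map_map,
    Multiset.map_map, Multiset.card_map] at h
  simp only [Function.comp_def, Polynomial.eval_sub, Polynomial.eval_X, Polynomial.eval_C,
    smul_eq_mul, Polynomial.eval_mul, Polynomial.eval_pow, Polynomial.eval_neg,
    Polynomial.eval_one] at h
  rw [h]
  refine Finset.sum_congr rfl fun i _ => ?_
  have := (Multiset.pow_smul_esymm q i w).symm
  simp only [smul_eq_mul] at this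
  rw [this, neg_pow]
  ring

/-- The polynomial part of the solution of the Newton recursion. -/
def uSeq (q x : B) (e : ℕ → B) : ℕ → B
  | 0 => 0
  | n + 1 => q ^ n * e n * x - x * uSeq q x e n

/-- The part of the solution with the inverse variable. -/
def wSeq (q xi g : B) (e : ℕ → B) : ℕ → B
  | 0 => 0
  | n + 1 => q ^ n * e n * (g * xi) - q ^ 2 * g * xi * wSeq q xi g e n

/-- The mixed part of the solution. -/
def vSeq (q x xi g : B) (e : ℕ → B) : ℕ → B
  | 0 => 0
  | n + 1 => -x * (vSeq q x xi g e n + wSeq q xi g e n)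

theorem map_wSeq {B' : Type} [CommRing B'] (f : B →+* B') (q xi g : B) (e : ℕ → B) (n : ℕ) :
    f (wSeq q xi g e n) = wSeq (f q) (f xi) (f g) (fun i => f (e i)) n := by
  induction n with
  | zero => exact map_zero f
  | succ n ih => simp only [wSeq, map_sub, map_mul, map_pow, ih]

theorem map_vSeq {B' : Type} [CommRing B'] (f : B →+* B') (q x xi g : B) (e : ℕ → B) (n : ℕ) :
    f (vSeq q x xi g e n) = vSeq (f q) (f x) (f xi) (f g) (fun i => f (e i)) n := by
  induction n with
  | zero => exact map_zero f
  | succ n ih => simp only [vSeq, map_add, map_mul, map_neg, ih, map_wSeq]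

variable {q x xi g : B} {e : ℕ → B}

theorem sq_mul_v_add_w (hx : x * xi = 1) (n : ℕ) :
    x ^ 2 * (vSeq q x xi g e n + wSeq q xi g e n) =
      g * uSeq q x e n + q ^ 2 * g * vSeq q x xi g e n := by
  induction n with
  | zero => simp [vSeq, wSeq, uSeq]
  | succ n ih =>
    rw [vSeq, wSeq, uSeq]
    linear_combination (-x) * ih + (q ^ n * e n * g * x - q ^ 2 * g * x * wSeq q xi g e n) * hx

theorem uSeq_eq {ℓ : ℕ} : uSeq q x e (2 * ℓ + 1) =
    x * ∑ i ∈ Finset.range (2 * ℓ + 1), (-q) ^ i * e i * x ^ (2 * ℓ - i) := by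
  rw [seq_eq_sum (s := uSeq q x e) rfl (fun n => rfl), Finset.mul_sum]
  refine Finset.sum_congr rfl fun i hi => ?_
  have hi' := Finset.mem_range.1 hi
  have e1 : (-1 : B) ^ (2 * ℓ - i) = (-1) ^ i := by
    have : (-1 : B) ^ (2 * ℓ - i) * (-1) ^ i = 1 := by
      rw [← pow_add, show 2 * ℓ - i + i = 2 * ℓ by omega, pow_mul]; norm_num
    calc _ = (-1 : B) ^ (2 * ℓ - i) * ((-1) ^ i * (-1) ^ i) := by
          rw [← mul_pow]; norm_num
      _ = _ := by rw [← mul_assoc, this, one_mul]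
  rw [neg_pow x, neg_pow q, e1]
  ring

theorem wSeq_eq (hx : x * xi = 1) {r ε : B} {ℓ : ℕ}
    (he : ∀ i j, i + j = 2 * ℓ → r ^ j * e i = ε * (r ^ i * e j)) :
    wSeq q xi (r ^ 2) e (2 * ℓ + 1) =
      ε * q ^ (2 * ℓ) * (r ^ 2 * xi ^ 2) ^ (ℓ + 1) * uSeq q x e (2 * ℓ + 1) := by
  rw [uSeq_eq, seq_eq_sum (s := wSeq q xi (r ^ 2) e) rfl (fun n => rfl), ← Finset.sum_range_reflect,
    Finset.mul_sum, Finset.mul_sum]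
  refine Finset.sum_congr rfl fun i hi => ?_
  have hi' := Finset.mem_range.1 hi
  obtain ⟨j, hj⟩ : ∃ j, i + j = 2 * ℓ := ⟨2 * ℓ - i, by omega⟩
  have hxj : x ^ (j + 1) * xi ^ (j + 1) = 1 := by rw [← mul_pow, hx, one_pow]
  have h := he j i (by omega)
  have e2 : (r ^ 2 * xi ^ 2) ^ (ℓ + 1) = r ^ i * r ^ j * r ^ 2 * xi ^ (j + 1) * xi ^ (i + 1) := by
    have : 2 * (ℓ + 1) = i + j + 2 := by omega
    rw [mul_pow, ← pow_mul, ← pow_mul, this]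
    ring
  rw [show 2 * ℓ + 1 - 1 - i = j by omega, show 2 * ℓ - j = i by omega,
    show 2 * ℓ - i = j by omega, e2, neg_pow q, neg_pow (q ^ 2 * r ^ 2 * xi), ← hj]
  linear_combination ((-1) ^ i * q ^ (j + 2 * i) * r ^ (i + 2) * xi ^ (i + 1)) * h -
    ε * q ^ (2 * i + j) * r ^ (i + j + 2) * xi ^ (i + 1) * (-1) ^ i * e i * hxj

/-- The solution of the Newton recursion. -/
theorem newton_solution [Algebra ℂ B] {p μ : ℂ} (hp : p ≠ 0) {c : ℕ → ℂ}
    (hc : ∀ n, c n = p ^ 2 * c (n + 1)) (hcμ : ∀ n, p * c (n + 1) * p ^ n = (p ^ n)⁻¹ * μ⁻¹) {k : ℕ}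
    (hc0 : p ^ 2 * c 0 + 1 ≠ 0) (hck : ∀ n ≤ k, c n + 1 ≠ 0) (hx : x * xi = 1)
    {γ δ : ℕ → B} (γ0 : γ 0 = 0) (δ0 : δ 0 = 0)
    (hγ : ∀ n ≤ k, γ (n + 1) = p ^ n • (e n * x) - x * γ n - ((p - p⁻¹) / (c n + 1)) • δ n)
    (hδ : ∀ n ≤ k, x * δ (n + 1) = g * (((p ^ n)⁻¹ * μ⁻¹) • (e n * x) - δ n +
      ((p - p⁻¹) * c n / (c n + 1)) • (x * γ n))) {n : ℕ} (hn : n ≤ k + 1) :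
    γ n = uSeq (algebraMap ℂ B p) x e n +
        ((p ^ 2 - 1) * (p ^ 2 * c n) / (p ^ 2 * c n + 1)) • vSeq (algebraMap ℂ B p) x xi g e n ∧
      δ n = (p * c n) • (x * (wSeq (algebraMap ℂ B p) xi g e n -
        ((p ^ 2 - 1) / (p ^ 2 * c n + 1)) • vSeq (algebraMap ℂ B p) x xi g e n)) := by
  induction n with
  | zero => simp [γ0, δ0, uSeq, vSeq, wSeq]
  | succ n ih =>
    obtain ⟨ihγ, ihδ⟩ := ih (by omega)
    have hS := sq_mul_v_add_w (q := algebraMap ℂ B p) (g := g) (e := e) hx n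
    have d1 : c n + 1 ≠ 0 := hck n (by omega)
    have d2 : p ^ 2 * c n + 1 ≠ 0 := by
      cases n with
      | zero => exact hc0
      | succ n => rw [← hc]; exact hck n (by omega)
    have hγ' := hγ n (by omega)
    have hδ' := hδ n (by omega)
    have hcc := hc n
    have hcm := hcμ n
    generalize c (n + 1) = c' at *
    generalize hcn : c n = c₁ at *
    rw [ihγ, ihδ] at hγ' hδ'
    have s1 : (p - p⁻¹) / (c₁ + 1) * (p * c₁) = (p ^ 2 - 1) * c₁ / (c₁ + 1) := by
      field_simp
    have s2 : (p ^ 2 - 1) * (p ^ 2 * c₁) / (p ^ 2 * c₁ + 1) =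
        (p ^ 2 - 1) * c₁ / (c₁ + 1) + (p ^ 2 - 1) * c₁ / (c₁ + 1) *
          ((p ^ 2 - 1) / (p ^ 2 * c₁ + 1)) := by
      field_simp; ring
    have s3 : p * c' * p ^ 2 = p * c₁ := by rw [hcc]; ring
    have s4 : p * c' * ((p ^ 2 - 1) / (c₁ + 1)) = (p - p⁻¹) * c₁ / (c₁ + 1) := by
      rw [hcc]; field_simp
    have s5 : p * c₁ * ((p ^ 2 - 1) / (c₁ + 1)) = p * c₁ * ((p ^ 2 - 1) / (p ^ 2 * c₁ + 1)) +
        (p - p⁻¹) * c₁ / (c₁ + 1) * ((p ^ 2 - 1) * (p ^ 2 * c₁) / (p ^ 2 * c₁ + 1)) := by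
      field_simp; ring
    rw [← hcc]
    have m1 := congrArg (algebraMap ℂ B) s1
    have m2 := congrArg (algebraMap ℂ B) s2
    have m3 := congrArg (algebraMap ℂ B) s3
    have m4 := congrArg (algebraMap ℂ B) s4
    have m5 := congrArg (algebraMap ℂ B) s5
    have m6 := congrArg (algebraMap ℂ B) hcm
    simp only [Algebra.smul_def] at hγ' hδ' ⊢
    generalize (p - p⁻¹) / (c₁ + 1) = z1 at *
    generalize (p ^ 2 - 1) * c₁ / (c₁ + 1) = z2 at *
    generalize (p ^ 2 - 1) * (p ^ 2 * c₁) / (p ^ 2 * c₁ + 1) = z3 at *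
    generalize (p ^ 2 - 1) / (p ^ 2 * c₁ + 1) = z4 at *
    generalize (p ^ 2 - 1) / (c₁ + 1) = z5 at *
    generalize (p - p⁻¹) * c₁ / (c₁ + 1) = z6 at *
    generalize (p ^ n)⁻¹ * μ⁻¹ = z7 at *
    simp only [map_mul, map_add, map_pow] at m1 m2 m3 m4 m5 m6 hγ' hδ' ⊢
    refine ⟨?_, ?_⟩
    · rw [hγ', uSeq, vSeq]
      linear_combination (-x) * (wSeq (algebraMap ℂ B p) xi g e n - algebraMap ℂ B z4 *
        vSeq (algebraMap ℂ B p) x xi g e n) * m1 - x * vSeq (algebraMap ℂ B p) x xi g e n * m2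
    · have key : x * δ (n + 1) = x * (algebraMap ℂ B p * algebraMap ℂ B c' * (x *
          (wSeq (algebraMap ℂ B p) xi g e (n + 1) -
            algebraMap ℂ B z5 * vSeq (algebraMap ℂ B p) x xi g e (n + 1)))) := by
        rw [hδ', wSeq, vSeq]
        generalize uSeq (algebraMap ℂ B p) x e n = u at *
        generalize vSeq (algebraMap ℂ B p) x xi g e n = v at *
        generalize wSeq (algebraMap ℂ B p) xi g e n = w at *
        generalize algebraMap ℂ B p = p at *
        generalize algebraMap ℂ B c' = c' at *
        linear_combination (-(p * c' * p ^ n * g * e n * x - p * c' * p ^ 2 * g * w * x)) * hx -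
          g * e n * x * m6 + g * w * x * m3 - p * c' * algebraMap ℂ B z5 * x * hS -
          (x * g * u) * m4 - x * g * v * algebraMap ℂ B z5 * m3 - x * g * v * m5
      have := congrArg (xi * ·) key
      beta_reduce at this
      rwa [← mul_assoc, ← mul_assoc, mul_comm xi, hx, one_mul, one_mul] at this

end Newton

section Vanishing

variable {B : Type} [CommRing B]

/-- The vanishing of the solution of the Newton recursion at `n = k + 1`. -/
theorem newton_vanishing [Algebra ℂ B] {p μ : ℂ} (hp : p ≠ 0) {k : ℕ} (hμ : μ⁻¹ * p = p ^ k)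
    (hq : p ^ (k + 2) ≠ -1) (hck : ∀ n ≤ k, p * μ⁻¹ * (p ^ (2 * n))⁻¹ + 1 ≠ 0)
    {x xi g : B} {e : ℕ → B} (hx : x * xi = 1)
    {γ δ : ℕ → B} (γ0 : γ 0 = 0) (δ0 : δ 0 = 0)
    (hγ : ∀ n ≤ k, γ (n + 1) = p ^ n • (e n * x) - x * γ n -
      ((p - p⁻¹) / (p * μ⁻¹ * (p ^ (2 * n))⁻¹ + 1)) • δ n)
    (hδ : ∀ n ≤ k, x * δ (n + 1) = g * (((p ^ n)⁻¹ * μ⁻¹) • (e n * x) - δ n +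
      ((p - p⁻¹) * (p * μ⁻¹ * (p ^ (2 * n))⁻¹) / (p * μ⁻¹ * (p ^ (2 * n))⁻¹ + 1)) • (x * γ n)))
    (hγk : γ (k + 1) = 0) (hδk : δ (k + 1) = 0) :
    ∃ z : B, uSeq (algebraMap ℂ B p) x e (k + 1) = -z ∧
      wSeq (algebraMap ℂ B p) xi g e (k + 1) = algebraMap ℂ B p ^ k * z ∧
      (∃ h : B, z = h * vSeq (algebraMap ℂ B p) x xi g e (k + 1)) ∧
      x ^ 2 * vSeq (algebraMap ℂ B p) x xi g e (k + 1) =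
        g * vSeq (algebraMap ℂ B p) x xi g e (k + 1) := by
  have hcn : ∀ n, p * μ⁻¹ * (p ^ (2 * n))⁻¹ = p ^ 2 * (p * μ⁻¹ * (p ^ (2 * (n + 1)))⁻¹) := by
    intro n
    rw [mul_add, pow_add]
    field_simp
  have hpk : p ^ k ≠ 0 := pow_ne_zero _ hp
  have hcl : p ^ 2 * (p * μ⁻¹ * (p ^ (2 * (k + 1)))⁻¹) = (p ^ k)⁻¹ := by
    rw [← hcn, mul_comm p, hμ, two_mul, pow_add]
    field_simp
  have hk1 : 1 + p ^ k ≠ 0 := by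
    have := hck k le_rfl
    rw [hcn, hcl] at this
    intro h
    apply this
    field_simp
    rw [h, mul_zero]
  obtain ⟨h1, h2⟩ := newton_solution (e := e) (g := g) (c := fun n => p * μ⁻¹ * (p ^ (2 * n))⁻¹) hp
    hcn (fun n => by rw [mul_add, pow_add, two_mul, pow_add]; field_simp)
    (by
      rw [mul_zero, pow_zero, inv_one, mul_one, mul_comm p, hμ]
      intro h
      exact hq (by linear_combination h)) hck hx γ0 δ0 hγ hδ (le_refl (k + 1))
  have hS := sq_mul_v_add_w (q := algebraMap ℂ B p) (g := g) (e := e) hx (k + 1)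
  rw [hγk, hcl] at h1
  rw [hδk, hcl] at h2
  generalize uSeq (algebraMap ℂ B p) x e (k + 1) = u at *
  generalize vSeq (algebraMap ℂ B p) x xi g e (k + 1) = v at *
  generalize wSeq (algebraMap ℂ B p) xi g e (k + 1) = w at *
  have e1 : (p ^ 2 - 1) * (p ^ k)⁻¹ / ((p ^ k)⁻¹ + 1) = (p ^ 2 - 1) / (1 + p ^ k) := by
    field_simp
  have e2 : (p ^ 2 - 1) / ((p ^ k)⁻¹ + 1) = p ^ k * ((p ^ 2 - 1) / (1 + p ^ k)) := by
    field_simp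
  rw [e1] at h1
  rw [e2] at h2
  have hw : w = (p ^ k * ((p ^ 2 - 1) / (1 + p ^ k))) • v := by
    have hne : p * (p * μ⁻¹ * (p ^ (2 * (k + 1)))⁻¹) ≠ 0 := by
      intro h
      have : (p ^ k)⁻¹ = 0 := by rw [← hcl]; linear_combination p * h
      exact hpk (inv_eq_zero.1 this)
    have := (smul_eq_zero_iff_right hne).1 h2.symm
    have := congrArg (xi * ·) this
    beta_reduce at this
    rw [← mul_assoc, mul_comm xi, hx, one_mul, mul_zero] at this
    exact sub_eq_zero.1 this
  have hu : u = -(((p ^ 2 - 1) / (1 + p ^ k)) • v) := by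
    rw [eq_neg_iff_add_eq_zero]; exact h1.symm
  refine ⟨((p ^ 2 - 1) / (1 + p ^ k)) • v, hu, ?_, ⟨algebraMap ℂ B ((p ^ 2 - 1) / (1 + p ^ k)),
    Algebra.smul_def _ _⟩, ?_⟩
  · rw [hw, mul_smul, Algebra.smul_def (p ^ k), map_pow]
  · have hb : (1 + p ^ (k + 2)) / (1 + p ^ k) ≠ 0 := by
      refine div_ne_zero ?_ hk1
      intro h
      exact hq (by linear_combination h)
    have e3 : 1 + p ^ k * ((p ^ 2 - 1) / (1 + p ^ k)) = (1 + p ^ (k + 2)) / (1 + p ^ k) := by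
      rw [pow_add]; field_simp; ring
    have e4 : p ^ 2 - (p ^ 2 - 1) / (1 + p ^ k) = (1 + p ^ (k + 2)) / (1 + p ^ k) := by
      rw [pow_add]; field_simp; ring
    have m3 := congrArg (algebraMap ℂ B) e3
    have m4 := congrArg (algebraMap ℂ B) e4
    have : ((1 + p ^ (k + 2)) / (1 + p ^ k)) • (x ^ 2 * v - g * v) = 0 := by
      rw [hw, hu] at hS
      rw [Algebra.smul_def] at hS ⊢
      rw [Algebra.smul_def] at hS
      generalize (1 + p ^ (k + 2)) / (1 + p ^ k) = b at *
      generalize (p ^ 2 - 1) / (1 + p ^ k) = h at *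
      simp only [map_mul, map_add, map_sub, map_pow, map_one] at m3 m4 hS
      linear_combination hS - x ^ 2 * v * m3 + g * v * m4
    exact sub_eq_zero.1 ((smul_eq_zero_iff_right hb).1 this)

theorem laurent_regular {S : Type} [CommRing S] (a : S) {f : LaurentPolynomial S}
    (h : (LaurentPolynomial.T 1 ^ 2 - LaurentPolynomial.C a) * f = 0) : f = 0 := by
  obtain ⟨n, f', hf⟩ := LaurentPolynomial.exists_T_pow f
  have h1 : Polynomial.toLaurent ((Polynomial.X ^ 2 - Polynomial.C a) * f') = 0 := by
    rw [map_mul, hf, map_sub, map_pow, Polynomial.toLaurent_X, Polynomial.toLaurent_C, ← mul_assoc,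
      h, zero_mul]
  have h2 := Polynomial.toLaurent_injective (h1.trans (map_zero _).symm)
  have h3 : f' = 0 := by
    have hm := (Polynomial.monic_X_pow_sub_C a (two_ne_zero)).isRegular.left
    exact hm (h2.trans (mul_zero _).symm)
  rw [h3, map_zero] at hf
  exact (LaurentPolynomial.isUnit_T (R := S) n).mul_left_eq_zero.1 hf.symm

variable {q x xi r : B} {ℓ : ℕ}

theorem sum_uSeq {W : Multiset B} (hW : W.card = 2 * ℓ) :
    uSeq q x W.esymm (2 * ℓ + 1) = x * (W.map fun v => x - q * v).prod := by
  rw [uSeq_eq, prod_sub_eq_sum, hW]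

theorem prod_eq_zero_of_plus (h2 : IsUnit (2 : B)) (hqu : IsUnit q) (hx : x * xi = 1)
    {W : Multiset B} (hW : W.card = 2 * ℓ)
    (he : ∀ i j, i + j = 2 * ℓ → r ^ j * W.esymm i = r ^ i * W.esymm j)
    {z : B} (hu : uSeq q x W.esymm (2 * ℓ + 1) = -z)
    (hw : wSeq q xi (r ^ 2) W.esymm (2 * ℓ + 1) = q ^ (2 * ℓ) * z)
    (hz : ∃ h, z = h * vSeq q x xi (r ^ 2) W.esymm (2 * ℓ + 1))
    (hv : x ^ 2 * vSeq q x xi (r ^ 2) W.esymm (2 * ℓ + 1) =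
      r ^ 2 * vSeq q x xi (r ^ 2) W.esymm (2 * ℓ + 1)) :
    (W.map fun v => x - q * v).prod = 0 := by
  have h := wSeq_eq (q := q) (e := W.esymm) (ε := 1) hx (fun i j hij => by rw [one_mul, he i j hij])
  have ht : (r ^ 2 * xi ^ 2) * z = z := by
    obtain ⟨c, rfl⟩ := hz
    linear_combination (-c * xi ^ 2) * hv + c * vSeq q x xi (r ^ 2) W.esymm (2 * ℓ + 1) *
      (x * xi + 1) * hx
  have ht' : ∀ n, (r ^ 2 * xi ^ 2) ^ n * z = z := by
    intro n
    induction n with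
    | zero => simp
    | succ n ih => rw [pow_succ, mul_assoc, ht, ih]
  rw [hu, hw] at h
  have hz0 : z = 0 := by
    have : 2 * (q ^ (2 * ℓ) * z) = 0 := by
      linear_combination h - q ^ (2 * ℓ) * ht' (ℓ + 1)
    exact (hqu.pow _).mul_right_eq_zero.1 (h2.mul_right_eq_zero.1 this)
  rw [hz0, neg_zero, sum_uSeq hW] at hu
  exact (IsUnit.of_mul_eq_one xi hx).mul_right_eq_zero.1 hu

theorem vSeq_eq_of_regular (hx : x * xi = 1)
    (hreg : ∀ f, (x ^ 2 - (q * r) ^ 2) * f = 0 → f = 0)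
    {W : Multiset B} (hW : W.card = 2 * ℓ)
    (he : ∀ i j, i + j = 2 * (ℓ + 1) → r ^ j * (r ::ₘ -r ::ₘ W).esymm i =
      -(r ^ i * (r ::ₘ -r ::ₘ W).esymm j)) :
    vSeq q x xi (r ^ 2) (r ::ₘ -r ::ₘ W).esymm (2 * (ℓ + 1) + 1) =
      r ^ 2 * x * (1 + q ^ (2 * (ℓ + 1)) * (r ^ 2 * xi ^ 2) ^ (ℓ + 1)) *
        (W.map fun v => x - q * v).prod := by
  have hS := sq_mul_v_add_w (q := q) (g := r ^ 2) (e := (r ::ₘ -r ::ₘ W).esymm) hx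
    (2 * (ℓ + 1) + 1)
  have h := wSeq_eq (q := q) (e := (r ::ₘ -r ::ₘ W).esymm) (ε := -1) (ℓ := ℓ + 1) hx
    (fun i j hij => by rw [neg_one_mul, he i j hij])
  have hu := sum_uSeq (q := q) (x := x) (W := r ::ₘ -r ::ₘ W) (ℓ := ℓ + 1) (by simp [hW]; ring)
  rw [Multiset.map_cons, Multiset.map_cons, Multiset.prod_cons, Multiset.prod_cons] at hu
  rw [h, hu] at hS
  have e1 : x ^ 2 * (r ^ 2 * xi ^ 2) ^ (ℓ + 1 + 1) = r ^ 2 * (r ^ 2 * xi ^ 2) ^ (ℓ + 1) := by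
    rw [pow_succ]
    linear_combination (r ^ 2 * xi ^ 2) ^ (ℓ + 1) * r ^ 2 * (x * xi + 1) * hx
  generalize (W.map fun v => x - q * v).prod = Q at *
  rw [← sub_eq_zero]
  apply hreg
  linear_combination hS - (- q ^ (2 * (ℓ + 1)) * (x * ((x - q * r) * ((x - q * -r) * Q)))) * e1

theorem vSeq_eq {S : Type} [CommRing S] (E : S →+* B) {q r : S} (hx : x * xi = 1)
    {W : Multiset S} (hW : W.card = 2 * ℓ)
    (he : ∀ i j, i + j = 2 * (ℓ + 1) → r ^ j * (r ::ₘ -r ::ₘ W).esymm i =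
      -(r ^ i * (r ::ₘ -r ::ₘ W).esymm j)) :
    vSeq (E q) x xi (E r ^ 2) (fun i => E ((r ::ₘ -r ::ₘ W).esymm i)) (2 * (ℓ + 1) + 1) =
      E r ^ 2 * x * (1 + E q ^ (2 * (ℓ + 1)) * (E r ^ 2 * xi ^ 2) ^ (ℓ + 1)) *
        ((W.map E).map fun v => x - E q * v).prod := by
  let C : S →+* LaurentPolynomial S := LaurentPolynomial.C
  have hmap : (C r ::ₘ -C r ::ₘ W.map C).esymm = fun i => C ((r ::ₘ -r ::ₘ W).esymm i) := by
    funext i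
    rw [← esymm_map, Multiset.map_cons, Multiset.map_cons, map_neg]
  have h := vSeq_eq_of_regular (q := C q) (x := LaurentPolynomial.T 1) (r := C r)
    (xi := LaurentPolynomial.T (-1)) (W := W.map C) (ℓ := ℓ)
    (by rw [← LaurentPolynomial.T_add]; rfl)
    (fun f hf => laurent_regular ((q * r) ^ 2) (by rwa [map_pow, map_mul]))
    (by rw [Multiset.card_map, hW])
    (fun i j hij => by
      rw [hmap]
      beta_reduce
      rw [← map_pow, ← map_mul, he i j hij, map_neg, map_mul, map_pow])
  let u : Bˣ := ⟨x, xi, hx, (mul_comm _ _).trans hx⟩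
  let Φ := LaurentPolynomial.eval₂ E u
  have hC : ∀ a, Φ (C a) = E a := LaurentPolynomial.eval₂_C E u
  have hT : Φ (LaurentPolynomial.T 1) = x :=
    (LaurentPolynomial.eval₂_T E u 1).trans (by rw [zpow_one])
  have hT' : Φ (LaurentPolynomial.T (-1)) = xi :=
    (LaurentPolynomial.eval₂_T E u (-1)).trans (by rw [zpow_neg_one]; rfl)
  have h' := congrArg Φ h
  rw [map_vSeq, hmap] at h'
  simp only [map_mul, map_add, map_pow, map_one, map_multiset_prod, hC, hT, hT', Multiset.map_map,
    Function.comp_def, map_sub] at h' ⊢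
  exact h'

theorem prod_eq_zero_of_minus {S : Type} [CommRing S] (E : S →+* B) {q r : S} (h2 : IsUnit (2 : B))
    (hr : IsUnit r) (hx : x * xi = 1)
    {W : Multiset S} (hW : W.card = 2 * ℓ)
    (he : ∀ i j, i + j = 2 * (ℓ + 1) → r ^ j * (r ::ₘ -r ::ₘ W).esymm i =
      -(r ^ i * (r ::ₘ -r ::ₘ W).esymm j))
    {z : B} (hu : uSeq (E q) x (fun i => E ((r ::ₘ -r ::ₘ W).esymm i)) (2 * (ℓ + 1) + 1) = -z)
    (hz : ∃ h, z = h * vSeq (E q) x xi (E r ^ 2) (fun i => E ((r ::ₘ -r ::ₘ W).esymm i))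
      (2 * (ℓ + 1) + 1))
    (hv : x ^ 2 * vSeq (E q) x xi (E r ^ 2) (fun i => E ((r ::ₘ -r ::ₘ W).esymm i))
        (2 * (ℓ + 1) + 1) =
      E r ^ 2 * vSeq (E q) x xi (E r ^ 2) (fun i => E ((r ::ₘ -r ::ₘ W).esymm i))
        (2 * (ℓ + 1) + 1)) :
    (x ^ 2 - E r ^ 2) * ((W.map E).map fun v => x - E q * v).prod = 0 := by
  obtain ⟨h, rfl⟩ := hz
  have hU := sum_uSeq (q := E q) (x := x) (W := (r ::ₘ -r ::ₘ W).map E) (ℓ := ℓ + 1)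
    (by simp [hW]; ring)
  have hmap : ((r ::ₘ -r ::ₘ W).map E).esymm = fun i => E ((r ::ₘ -r ::ₘ W).esymm i) :=
    funext fun i => esymm_map E _ i
  rw [hmap, hu, Multiset.map_cons, Multiset.map_cons, Multiset.map_cons, Multiset.map_cons,
    Multiset.prod_cons, Multiset.prod_cons, map_neg] at hU
  rw [vSeq_eq E hx hW he] at hv hU
  generalize ((W.map E).map fun v => x - E q * v).prod = Q at *
  have hur : IsUnit (E r ^ 2 * x) := ((hr.map E).pow 2).mul (IsUnit.of_mul_eq_one xi hx)
  have hux : IsUnit x := IsUnit.of_mul_eq_one xi hx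
  have h1 : (1 + E q ^ (2 * (ℓ + 1)) * (E r ^ 2 * xi ^ 2) ^ (ℓ + 1)) *
      ((x ^ 2 - E r ^ 2) * Q) = 0 := by
    refine hur.mul_right_eq_zero.1 ?_
    linear_combination hv
  have h3 : (E q ^ 2 * (E r ^ 2 * xi ^ 2)) * ((x ^ 2 - E r ^ 2) * Q) = (x ^ 2 - E r ^ 2) * Q := by
    have : x * ((x ^ 2 - E q ^ 2 * E r ^ 2) * ((x ^ 2 - E r ^ 2) * Q)) = 0 := by
      linear_combination (-(x ^ 2 - E r ^ 2)) * hU - h * hv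
    have := hux.mul_right_eq_zero.1 this
    linear_combination (-xi ^ 2) * this + ((x ^ 2 - E r ^ 2) * Q) * (x * xi + 1) * hx
  have h4 : ∀ n, (E q ^ 2 * (E r ^ 2 * xi ^ 2)) ^ n * ((x ^ 2 - E r ^ 2) * Q) =
      (x ^ 2 - E r ^ 2) * Q := by
    intro n
    induction n with
    | zero => simp
    | succ n ih => rw [pow_succ, mul_assoc, h3, ih]
  have h5 := h4 (ℓ + 1)
  rw [mul_pow, ← pow_mul] at h5
  refine h2.mul_right_eq_zero.1 ?_
  linear_combination h1 - h5

end Vanishing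

theorem exists_commRing {Ω : Type} [AddCommGroup Ω] [Module ℂ Ω] (s : Ω →ₗ[ℂ] Ω →ₗ[ℂ] Ω) (e : Ω)
    (assoc : ∀ x y z, s (s x y) z = s x (s y z)) (comm : ∀ x y, s x y = s y x)
    (one : ∀ x, s e x = x) :
    ∃ (B : Type) (_ : CommRing B) (_ : Algebra ℂ B) (Φ : Ω ≃ₗ[ℂ] B),
      Φ e = 1 ∧ ∀ x y, Φ (s x y) = Φ x * Φ y := by
  let r : CommRing Ω := 
    { (inferInstance : AddCommGroup Ω) with
      mul := fun x y => s x y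
      one := e
      mul_assoc := assoc
      mul_comm := comm
      one_mul := one
      mul_one := fun x => (comm x e).trans (one x)
      left_distrib := fun x y z => map_add (s x) y z
      right_distrib := fun x y z => by
        change s (x + y) z = s x z + s y z
        rw [map_add, LinearMap.add_apply]
      zero_mul := fun x => by
        change s 0 x = 0
        rw [map_zero, LinearMap.zero_apply]
      mul_zero := fun x => map_zero (s x) }
  let al : Algebra ℂ Ω := Algebra.ofModule
    (fun c x y => by
      change s (c • x) y = c • s x y
      rw [map_smul, LinearMap.smul_apply])
    (fun c x y => map_smul (s x) c y)
  exact ⟨Ω, r, al, LinearEquiv.refl ℂ Ω, rfl, fun _ _ => rfl⟩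

namespace QMData

variable {N : ℕ} {𝒟 : QMData N} {ℓ m : ℕ} {ε : ℂ} {π : 𝒟.charAlg ℓ ε →ₐ[ℂ] Spec m}

theorem pure_rmul (Y : 𝒟.powMod ℓ ε) (c : 𝒟.charAlg ℓ ε) (e : Spec m) :
    𝒟.pure π (𝒟.rmul ℓ ε Y c) e = 𝒟.pure π Y (π c * e) :=
  (Submodule.Quotient.eq _).2 (Submodule.subset_span ⟨Y, c, e, rfl⟩)

theorem pure_add_left (Y Y' : 𝒟.powMod ℓ ε) (e : Spec m) :
    𝒟.pure π (Y + Y') e = 𝒟.pure π Y e + 𝒟.pure π Y' e := by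
  rw [pure, TensorProduct.add_tmul, map_add]; rfl

theorem pure_add (Y : 𝒟.powMod ℓ ε) (e e' : Spec m) :
    𝒟.pure π Y (e + e') = 𝒟.pure π Y e + 𝒟.pure π Y e' := by
  rw [pure, TensorProduct.tmul_add, map_add]; rfl

theorem pure_smul_left (c : ℂ) (Y : 𝒟.powMod ℓ ε) (e : Spec m) :
    𝒟.pure π (c • Y) e = c • 𝒟.pure π Y e := by
  rw [pure, ← TensorProduct.smul_tmul', map_smul]; rfl

theorem pure_smul (c : ℂ) (Y : 𝒟.powMod ℓ ε) (e : Spec m) :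
    𝒟.pure π Y (c • e) = c • 𝒟.pure π Y e := by
  rw [pure, TensorProduct.tmul_smul, map_smul]; rfl

theorem completion_hom_ext {Z : Type} [AddCommGroup Z] [Module ℂ Z] {f f' : 𝒟.Completion π →ₗ[ℂ] Z}
    (h : ∀ Y e, f (𝒟.pure π Y e) = f' (𝒟.pure π Y e)) : f = f' :=
  Submodule.linearMap_qext _ (TensorProduct.ext' h)

/-- A linear map on the tensor product that respects the relations descends to the completion. -/
theorem exists_completion_lift {Z : Type} [AddCommGroup Z] [Module ℂ Z]
    (f : 𝒟.powMod ℓ ε ⊗[ℂ] Spec m →ₗ[ℂ] Z)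
    (h : ∀ Y c e, f (𝒟.rmul ℓ ε Y c ⊗ₜ e) = f (Y ⊗ₜ (π c * e))) :
    ∃ f' : 𝒟.Completion π →ₗ[ℂ] Z, ∀ Y e, f' (𝒟.pure π Y e) = f (Y ⊗ₜ e) := by
  refine ⟨(𝒟.balanced π).liftQ f (Submodule.span_le.2 ?_), fun Y e => rfl⟩
  rintro _ ⟨Y, c, e, rfl⟩
  change f (_ - _) = 0
  rw [map_sub, h, sub_self]

namespace IsStarProduct

variable {star : 𝒟.powMod ℓ ε →ₗ[ℂ] 𝒟.powMod ℓ ε →ₗ[ℂ] 𝒟.powMod ℓ ε}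
  (hs : 𝒟.IsStarProduct ℓ ε star)
include hs

theorem star_rmul (X Y : 𝒟.powMod ℓ ε) (c : 𝒟.charAlg ℓ ε) :
    star X (𝒟.rmul ℓ ε Y c) = 𝒟.rmul ℓ ε (star X Y) c := by
  rw [← hs.scalar_right c Y, ← hs.assoc, hs.scalar_right]

theorem rmul_star (X Y : 𝒟.powMod ℓ ε) (c : 𝒟.charAlg ℓ ε) :
    star (𝒟.rmul ℓ ε X c) Y = 𝒟.rmul ℓ ε (star X Y) c := by
  rw [← hs.scalar_left c X, hs.assoc, hs.scalar_left]

theorem one_star (Y : 𝒟.powMod ℓ ε) : star (𝒟.oneP ℓ ε) Y = Y := by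
  have h1 : ∀ Y : 𝒟.powMod ℓ ε, 𝒟.rmul ℓ ε Y 1 = Y := fun Y => Subtype.ext (by
    ext a b
    exact mul_one _)
  have := hs.scalar_left 1 Y
  rwa [h1, h1] at this

theorem exists_completedStar (π : 𝒟.charAlg ℓ ε →ₐ[ℂ] Spec m) :
    ∃ s, 𝒟.IsCompletedStar star π s := by
  have ex : ∀ X d, ∃ f : 𝒟.Completion π →ₗ[ℂ] 𝒟.Completion π, ∀ Y e,
      f (𝒟.pure π Y e) = 𝒟.pure π (star X Y) (d * e) := by
    intro X d
    refine exists_completion_lift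
      ((𝒟.balanced π).mkQ ∘ₗ TensorProduct.map (star X) (LinearMap.mul ℂ (Spec m) d))
      fun Y c e => ?_
    change 𝒟.pure π (star X (𝒟.rmul ℓ ε Y c)) (d * e) = 𝒟.pure π (star X Y) (d * (π c * e))
    rw [hs.star_rmul, pure_rmul, mul_left_comm]
  choose F hF using ex
  let G₀ : 𝒟.powMod ℓ ε →ₗ[ℂ] Spec m →ₗ[ℂ] 𝒟.Completion π →ₗ[ℂ] 𝒟.Completion π := LinearMap.mk₂ ℂ F
    (fun X X' d => completion_hom_ext fun Y e => by
      rw [hF, LinearMap.add_apply, hF, hF, map_add, LinearMap.add_apply, pure_add_left])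
    (fun c X d => completion_hom_ext fun Y e => by
      rw [hF, LinearMap.smul_apply, hF, map_smul, LinearMap.smul_apply, pure_smul_left])
    (fun X d d' => completion_hom_ext fun Y e => by
      rw [hF, LinearMap.add_apply, hF, hF, add_mul, pure_add])
    (fun c X d => completion_hom_ext fun Y e => by
      rw [hF, LinearMap.smul_apply, hF, smul_mul_assoc, pure_smul])
  have hG : ∀ X d, TensorProduct.lift G₀ (X ⊗ₜ d) = F X d := fun X d => TensorProduct.lift.tmul X d
  generalize TensorProduct.lift G₀ = G at hG
  obtain ⟨s, h⟩ := exists_completion_lift (π := π) G (fun X c d => by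
    rw [hG, hG]
    refine completion_hom_ext fun Y e => ?_
    rw [hF, hF, hs.rmul_star, pure_rmul, mul_assoc])
  refine ⟨s, fun Y Y' e e' => ?_⟩
  exact (congrArg (fun f : 𝒟.Completion π →ₗ[ℂ] 𝒟.Completion π => f (𝒟.pure π Y' e'))
    ((h Y e).trans (hG Y e))).trans (hF Y e Y' e')

theorem existsUnique_completedStar (π : 𝒟.charAlg ℓ ε →ₐ[ℂ] Spec m) :
    ∃! s, 𝒟.IsCompletedStar star π s := by
  obtain ⟨s, h⟩ := hs.exists_completedStar π
  exact ⟨s, h, fun s' h' => completion_hom_ext fun Y e => completion_hom_ext fun Y' e' =>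
    (h' Y Y' e e').trans (h Y Y' e e').symm⟩

/-- The completion as a commutative algebra. -/
theorem exists_algebra (hcomm : ∀ X Y, star X Y = star Y X)
    {s : 𝒟.Completion π →ₗ[ℂ] 𝒟.Completion π →ₗ[ℂ] 𝒟.Completion π}
    (hC : 𝒟.IsCompletedStar star π s) :
    ∃ (B : Type) (_ : CommRing B) (_ : Algebra ℂ B) (Φ : 𝒟.Completion π ≃ₗ[ℂ] B)
      (ψ : 𝒟.powMod ℓ ε →ₗ[ℂ] B) (E : Spec m →ₐ[ℂ] B),
      (∀ x y, Φ (s x y) = Φ x * Φ y) ∧ (∀ Y e, Φ (𝒟.pure π Y e) = ψ Y * E e) ∧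
      (∀ X Y, ψ (star X Y) = ψ X * ψ Y) ∧ ψ (𝒟.oneP ℓ ε) = 1 ∧
      ∀ Y c, ψ (𝒟.rmul ℓ ε Y c) = ψ Y * E (π c) := by
  have assoc : ∀ x y z, s (s x y) z = s x (s y z) := by
    intro x y z
    have : s ∘ₗ s x = (LinearMap.llcomp ℂ _ _ _ (s x)) ∘ₗ s :=
      completion_hom_ext fun Y' e' => completion_hom_ext fun Y'' e'' => by
        change s (s x (𝒟.pure π Y' e')) (𝒟.pure π Y'' e'') =
          s x (s (𝒟.pure π Y' e') (𝒟.pure π Y'' e''))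
        have : (LinearMap.flip s (𝒟.pure π Y'' e'')) ∘ₗ (LinearMap.flip s (𝒟.pure π Y' e')) =
            LinearMap.flip s (s (𝒟.pure π Y' e') (𝒟.pure π Y'' e'')) :=
          completion_hom_ext fun Y e => by
            change s (s (𝒟.pure π Y e) (𝒟.pure π Y' e')) (𝒟.pure π Y'' e'') =
              s (𝒟.pure π Y e) (s (𝒟.pure π Y' e') (𝒟.pure π Y'' e''))
            rw [hC, hC, hC, hC, hs.assoc, mul_assoc]
        exact congrArg (fun f : 𝒟.Completion π →ₗ[ℂ] 𝒟.Completion π => f x) this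
    exact congrArg (fun f : 𝒟.Completion π →ₗ[ℂ] 𝒟.Completion π →ₗ[ℂ] 𝒟.Completion π => f y z) this
  have comm : ∀ x y, s x y = s y x := by
    have : s = s.flip := completion_hom_ext fun Y e => completion_hom_ext fun Y' e' => by
      rw [LinearMap.flip_apply, hC, hC, hcomm, mul_comm]
    intro x y
    exact congrArg (fun f : 𝒟.Completion π →ₗ[ℂ] 𝒟.Completion π →ₗ[ℂ] 𝒟.Completion π => f x y) this
  have one : ∀ x, s (𝒟.pure π (𝒟.oneP ℓ ε) 1) x = x := by
    have : s (𝒟.pure π (𝒟.oneP ℓ ε) 1) = LinearMap.id := completion_hom_ext fun Y e => by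
      rw [hC, hs.one_star, one_mul]; rfl
    intro x
    rw [this]; rfl
  obtain ⟨B, iB, iA, Φ, h1, hm⟩ := exists_commRing s _ assoc comm one
  let ψ : 𝒟.powMod ℓ ε →ₗ[ℂ] B :=
    { toFun := fun Y => Φ (𝒟.pure π Y 1)
      map_add' := fun Y Y' => by rw [pure_add_left, map_add]
      map_smul' := fun c Y => by
        rw [pure_smul_left, map_smul]; rfl }
  let E : Spec m →ₐ[ℂ] B := AlgHom.ofLinearMap
    { toFun := fun e => Φ (𝒟.pure π (𝒟.oneP ℓ ε) e)
      map_add' := fun e e' => by rw [pure_add, map_add]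
      map_smul' := fun c e => by rw [pure_smul, map_smul]; rfl } h1
    (fun e e' => by
      change Φ _ = Φ _ * Φ _
      rw [← hm, hC, hs.one_star])
  have hp : ∀ Y e, Φ (𝒟.pure π Y e) = ψ Y * E e := fun Y e => by
    change _ = Φ _ * Φ _
    rw [← hm, hC, one_mul, hcomm, hs.one_star]
  refine ⟨B, iB, iA, Φ, ψ, E, hm, hp, fun X Y => ?_, h1, fun Y c => ?_⟩
  · change Φ _ = Φ _ * Φ _
    rw [← hm, hC, mul_one]
  · rw [← hp]
    change Φ _ = _
    rw [pure_rmul, mul_one]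

end IsStarProduct

end QMData

namespace QMData.Admissible

variable {N : ℕ} {𝒟 : QMData N} (H : 𝒟.Admissible) {ℓ m : ℕ} {ε : ℂ}
  {star : 𝒟.powMod ℓ ε →ₗ[ℂ] 𝒟.powMod ℓ ε →ₗ[ℂ] 𝒟.powMod ℓ ε}

include H in
theorem powP_one_star (hs : 𝒟.IsStarProduct ℓ ε star) (Y : 𝒟.powMod ℓ ε) :
    (star (𝒟.powP ℓ ε 1) Y : Matrix (Fin N) (Fin N) (𝒟.Component ℓ ε)) = (H.star ℓ ε).S Y :=
  H.isStarProduct_iff.1 hs _ Y _ (H.star ℓ ε).S_mem_ops (H.x_eq ℓ ε 1)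

include H in
theorem powP_one_star_powP (hs : 𝒟.IsStarProduct ℓ ε star) (n : ℤ) :
    star (𝒟.powP ℓ ε 1) (𝒟.powP ℓ ε n) = 𝒟.powP ℓ ε (n + 1) := by
  refine Subtype.ext ((H.powP_one_star hs _).trans ?_)
  change (H.star ℓ ε).S (𝒟.starPow ℓ ε n) = 𝒟.starPow ℓ ε (n + 1)
  rw [← H.x_eq, ← H.x_eq, Tower.Star.S_x]

variable {w : Multiset (Spec m)} {π : 𝒟.charAlg ℓ ε →ₐ[ℂ] Spec m}
  {B : Type} [CommRing B] [Algebra ℂ B] {ψ : 𝒟.powMod ℓ ε →ₗ[ℂ] B} {E : Spec m →ₐ[ℂ] B}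

theorem map_powMod_sub {B : Type} [AddCommGroup B] [Module ℂ B] (ψ : 𝒟.powMod ℓ ε →ₗ[ℂ] B)
    (X Y : 𝒟.powMod ℓ ε) : ψ (X - Y) = ψ X - ψ Y :=
  eq_sub_of_add_eq ((map_add ψ _ _).symm.trans
    (congrArg ψ (Subtype.ext (sub_add_cancel X.1 Y.1))))

include H in
theorem powP_nat (hs : 𝒟.IsStarProduct ℓ ε star) (hψ : ∀ X Y, ψ (star X Y) = ψ X * ψ Y)
    (h1 : ψ (𝒟.oneP ℓ ε) = 1) (n : ℕ) : ψ (𝒟.powP ℓ ε n) = ψ (𝒟.powP ℓ ε 1) ^ n := by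
  induction n with
  | zero => rw [pow_zero]; exact h1
  | succ n ih => rw [Nat.cast_succ, ← H.powP_one_star_powP hs, hψ, ih, pow_succ']

include H in
/-- The Newton recursion in the completion. -/
theorem exists_vanishing (hR : 𝒟.IsOrthogonal (2 * ℓ)) (hℓ : 1 ≤ ℓ)
    (hq : 𝒟.q ^ (2 * ℓ + 2) ≠ -1) (hs : 𝒟.IsStarProduct ℓ ε star)
    (hπ : 𝒟.IsSpectralHom ℓ ε w π) (hψ : ∀ X Y, ψ (star X Y) = ψ X * ψ Y)
    (h1 : ψ (𝒟.oneP ℓ ε) = 1) (hE : ∀ Y c, ψ (𝒟.rmul ℓ ε Y c) = ψ Y * E (π c)) :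
    ∃ xi, ψ (𝒟.powP ℓ ε 1) * xi = 1 ∧
    ∃ z : B, uSeq (algebraMap ℂ B 𝒟.q) (ψ (𝒟.powP ℓ ε 1)) (fun i => E (w.esymm i)) (2 * ℓ + 1) = -z ∧
      wSeq (algebraMap ℂ B 𝒟.q) xi (E (nu m 0) ^ 2) (fun i => E (w.esymm i)) (2 * ℓ + 1) =
        algebraMap ℂ B 𝒟.q ^ (2 * ℓ) * z ∧
      (∃ h : B, z = h * vSeq (algebraMap ℂ B 𝒟.q) (ψ (𝒟.powP ℓ ε 1)) xi (E (nu m 0) ^ 2)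
        (fun i => E (w.esymm i)) (2 * ℓ + 1)) ∧
      ψ (𝒟.powP ℓ ε 1) ^ 2 * vSeq (algebraMap ℂ B 𝒟.q) (ψ (𝒟.powP ℓ ε 1)) xi (E (nu m 0) ^ 2)
        (fun i => E (w.esymm i)) (2 * ℓ + 1) =
        E (nu m 0) ^ 2 * vSeq (algebraMap ℂ B 𝒟.q) (ψ (𝒟.powP ℓ ε 1)) xi (E (nu m 0) ^ 2)
          (fun i => E (w.esymm i)) (2 * ℓ + 1) := by
  have hk := H.regular hR
  have ha : ∀ n ≤ 2 * ℓ, (H.tower (𝒟.Component ℓ ε)).IsCh (𝒟.genM ℓ ε) n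
    ((H.tower (𝒟.Component ℓ ε)).asym 0 n) (𝒟.aElt (𝒟.genM ℓ ε) n) := fun n _ => H.isCh_asym _ n
  have haC : ∀ n, 𝒟.aElt (𝒟.genM ℓ ε) n ∈ 𝒟.charAlg ℓ ε := fun n => (𝒟.aC ℓ ε n).2
  have hW := (H.powMod_eq ℓ ε).ge
  have ha' : ∀ n ≤ 2 * ℓ, π (𝒟.aC ℓ ε n) = w.esymm n := by
    intro n hn
    cases n with
    | zero => rw [H.aC_zero, map_one, esymm_zero]
    | succ n => exact hπ.2 _ (by omega) hn
  let Y : ℕ → 𝒟.powMod ℓ ε := fun n =>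
    ⟨(H.star ℓ ε).newton (𝒟.aElt (𝒟.genM ℓ ε)) n, hW ((H.star ℓ ε).newton_mem haC n)⟩
  let Z : ℕ → 𝒟.powMod ℓ ε := fun n =>
    ⟨(H.star ℓ ε).top ((H.star ℓ ε).newton (𝒟.aElt (𝒟.genM ℓ ε)) n),
      hW ((H.star ℓ ε).top_mem ((H.star ℓ ε).newton_mem haC n))⟩
  have hM : (𝒟.powP ℓ ε 1 : Matrix (Fin N) (Fin N) (𝒟.Component ℓ ε)) = 𝒟.genM ℓ ε :=
    (H.x_eq ℓ ε 1).symm.trans (H.star ℓ ε).x_one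
  have hY : ∀ n, Y (n + 1) = 𝒟.q ^ n • 𝒟.rmul ℓ ε (𝒟.powP ℓ ε 1) (𝒟.aC ℓ ε n) -
      star (𝒟.powP ℓ ε 1) (Y n) -
      ((𝒟.q - 𝒟.q⁻¹) / (𝒟.q * 𝒟.μ⁻¹ * (𝒟.q ^ (2 * n))⁻¹ + 1)) • Z n := by
    intro n
    refine Subtype.ext ?_
    rw [Submodule.coe_sub, Submodule.coe_sub, H.powP_one_star hs]
    change _ = 𝒟.q ^ n • Tower.rm N _ (𝒟.powP ℓ ε 1 : Matrix (Fin N) (Fin N) (𝒟.Component ℓ ε)) - _ - _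
    rw [hM]
    rfl
  have hZ : ∀ n ≤ 2 * ℓ, star (𝒟.powP ℓ ε 1) (Z (n + 1)) =
      𝒟.rmul ℓ ε (((𝒟.q ^ n)⁻¹ * 𝒟.μ⁻¹) • 𝒟.rmul ℓ ε (𝒟.powP ℓ ε 1) (𝒟.aC ℓ ε n) - Z n +
      ((𝒟.q - 𝒟.q⁻¹) * (𝒟.q * 𝒟.μ⁻¹ * (𝒟.q ^ (2 * n))⁻¹) /
        (𝒟.q * 𝒟.μ⁻¹ * (𝒟.q ^ (2 * n))⁻¹ + 1)) • star (𝒟.powP ℓ ε 1) (Y n)) (𝒟.gC ℓ ε) := by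
    intro n hn
    refine Subtype.ext ?_
    rw [H.powP_one_star hs]
    refine ((H.star ℓ ε).top_newton hk ha haC hn).trans ?_
    change _ = Tower.rm N _ (_ • Tower.rm N _ (𝒟.powP ℓ ε 1 :
      Matrix (Fin N) (Fin N) (𝒟.Component ℓ ε)) - _ + _ • (star (𝒟.powP ℓ ε 1) (Y n) :
      Matrix (Fin N) (Fin N) (𝒟.Component ℓ ε)))
    rw [hM, H.powP_one_star hs]
    rfl
  have hYk : Y (2 * ℓ + 1) = 0 := Subtype.ext
    ((H.star ℓ ε).newton_eq_zero hk (by omega) ha (H.asym_succ_eq_zero hR (by omega)))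
  have hZk : Z (2 * ℓ + 1) = 0 := Subtype.ext (by
    change (H.star ℓ ε).top (Y (2 * ℓ + 1)).1 = 0
    rw [hYk]
    exact map_zero _)
  have hY0 : Y 0 = 0 := rfl
  have hZ0 : Z 0 = 0 := Subtype.ext (map_zero (H.star ℓ ε).top)
  clear_value Y Z
  have hx : ψ (𝒟.powP ℓ ε 1) * ψ (𝒟.powP ℓ ε (-1)) = 1 := by
    rw [← hψ, H.powP_one_star_powP hs, neg_add_cancel, h1]
  have hμ : 𝒟.μ⁻¹ * 𝒟.q = 𝒟.q ^ (2 * ℓ) := by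
    rw [hR.2.2.2.2.2.1, ← zpow_neg, ← zpow_add_one₀ H.q_ne, ← zpow_natCast]
    congr 1
    ring
  refine ⟨_, hx, newton_vanishing H.q_ne hμ hq hk.den_ne (γ := fun n => ψ (Y n))
    (δ := fun n => ψ (Z n)) hx (by rw [hY0, map_zero]) (by rw [hZ0, map_zero]) (fun n hn => ?_)
    (fun n hn => ?_) (by rw [hYk, map_zero]) (by rw [hZk, map_zero])⟩
  · rw [hY, map_powMod_sub, map_powMod_sub, map_smul, map_smul, hψ, hE, ha' n hn, mul_comm (E _)]
  · rw [← hψ, hZ n hn, hE, hπ.1, map_add, map_powMod_sub, map_smul, map_smul, hψ, hE, ha' n hn,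
      mul_comm (E (w.esymm n)), map_pow, mul_comm (_ ^ 2)]

/-- The factorization of products of factors. -/
theorem map_listProd {s : 𝒟.Completion π →ₗ[ℂ] 𝒟.Completion π →ₗ[ℂ] 𝒟.Completion π}
    {Φ : 𝒟.Completion π ≃ₗ[ℂ] B} (hm : ∀ x y, Φ (s x y) = Φ x * Φ y)
    (h1 : Φ (𝒟.pure π (𝒟.oneP ℓ ε) 1) = 1) (L : List (𝒟.Completion π)) :
    Φ (𝒟.listProd s L) = (L.map Φ).prod := by
  induction L with
  | nil => exact h1
  | cons a L ih => rw [List.map_cons, List.prod_cons, ← ih, ← hm]; rfl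

theorem map_factor {Φ : 𝒟.Completion π ≃ₗ[ℂ] B} (h1 : ψ (𝒟.oneP ℓ ε) = 1)
    (hΦ : ∀ Y e, Φ (𝒟.pure π Y e) = ψ Y * E e) (e : Spec m) :
    Φ (𝒟.factor π e) = ψ (𝒟.powP ℓ ε 1) - E e := by
  rw [QMData.factor, map_sub, hΦ, hΦ, map_one, mul_one, h1, one_mul]

theorem map_factors {Φ : 𝒟.Completion π ≃ₗ[ℂ] B} (h1 : ψ (𝒟.oneP ℓ ε) = 1)
    (hΦ : ∀ Y e, Φ (𝒟.pure π Y e) = ψ Y * E e) :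
    ((𝒟.factors π).map Φ).prod = (((nuMultiset m).map E).map fun v =>
      ψ (𝒟.powP ℓ ε 1) - algebraMap ℂ B 𝒟.q * v).prod := by
  rw [QMData.factors, List.map_ofFn, List.prod_ofFn, nuMultiset, Multiset.map_map, Multiset.map_map]
  refine Finset.prod_congr rfl fun i _ => ?_
  simp only [Function.comp_apply]
  rw [map_factor h1 hΦ, map_smul, Algebra.smul_def]

end QMData.Admissible

theorem sum_esymm_nuMultiset' (m : ℕ) : ∀ i, ∑ j ∈ Finset.range (i / 2 + 1),
    (nuMultiset' m).esymm (i - 2 * j) * (nu m 0 ^ 2) ^ j = (nuMultiset m).esymm i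
  | 0 => by simp [esymm_zero]
  | 1 => by simp [esymm_nuMultiset'_one]
  | i + 2 => by
    have h : ∀ j, i + 2 - 2 * (j + 1) = i - 2 * j := fun j => by omega
    rw [show (i + 2) / 2 + 1 = i / 2 + 1 + 1 by omega, Finset.sum_range_succ']
    simp only [h, pow_succ _ _, ← mul_assoc]
    rw [← Finset.sum_mul, ← Finset.sum_mul]
    have := sum_esymm_nuMultiset' m i
    have h' := esymm_nuMultiset'_succ_succ m i
    simp only [pow_two] at this h'
    simp only [mul_zero, tsub_zero, pow_zero, mul_one, one_mul] at this ⊢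
    rw [this, h']
    ring

namespace QMData.Admissible

variable {N : ℕ} {𝒟 : QMData N} (H : 𝒟.Admissible) {ℓ m : ℕ}

theorem isUnit_two (B : Type) [CommRing B] [Algebra ℂ B] : IsUnit (2 : B) := by
  have := (isUnit_iff_ne_zero.2 (two_ne_zero : (2 : ℂ) ≠ 0)).map (algebraMap ℂ B)
  rwa [map_ofNat] at this

include H

theorem factorization_plus (hR : 𝒟.IsOrthogonal (2 * ℓ)) (hℓ : 1 ≤ ℓ)
    (hq : 𝒟.q ^ (2 * ℓ + 2) ≠ -1)
    {star : 𝒟.powMod ℓ 1 →ₗ[ℂ] 𝒟.powMod ℓ 1 →ₗ[ℂ] 𝒟.powMod ℓ 1} (hs : 𝒟.IsStarProduct ℓ 1 star)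
    {π : 𝒟.charAlg ℓ 1 →ₐ[ℂ] Spec ℓ} (hπ : 𝒟.IsSpectralHom ℓ 1 (nuMultiset ℓ) π)
    {s : 𝒟.Completion π →ₗ[ℂ] 𝒟.Completion π →ₗ[ℂ] 𝒟.Completion π}
    (hC : 𝒟.IsCompletedStar star π s) :
    𝒟.pure π (𝒟.chPlus ℓ) 1 = 𝒟.listProd s (𝒟.factors π) ∧
      𝒟.listProd s (𝒟.factors π) = 0 := by
  obtain ⟨B, iB, iA, Φ, ψ, E, hm, hΦ, hψ, h1, hE⟩ := hs.exists_algebra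
    ((H.isStarProduct_iff.1 hs).comm (H.powMod_eq ℓ 1)) hC
  obtain ⟨xi, hx, z, hu, hw, hz, hv⟩ := H.exists_vanishing hR hℓ hq hs hπ hψ h1 hE
  have hmap : ((nuMultiset ℓ).map E).esymm = fun i => E ((nuMultiset ℓ).esymm i) :=
    funext fun i => esymm_map E.toRingHom _ i
  have hcard : ((nuMultiset ℓ).map E).card = 2 * ℓ := by rw [Multiset.card_map, card_nuMultiset]
  have h1' : Φ (𝒟.pure π (𝒟.oneP ℓ 1) 1) = 1 := by rw [hΦ, h1, map_one, one_mul]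
  have hL := (map_listProd hm h1' (𝒟.factors π)).trans (map_factors h1 hΦ)
  refine ⟨Φ.injective ?_, Φ.injective ?_⟩
  · rw [hL, hΦ, map_one, mul_one, prod_sub_eq_sum, hcard, hmap, QMData.chPlus, map_sum]
    refine Finset.sum_congr rfl fun i hi => ?_
    have e : π (𝒟.aC ℓ 1 i) = (nuMultiset ℓ).esymm i := by
      cases i with
      | zero => rw [H.aC_zero, map_one, esymm_zero]
      | succ i => exact hπ.2 _ (by omega) (by have := Finset.mem_range.1 hi; omega)
    rw [map_smul, hE, H.powP_nat hs hψ h1, e, Algebra.smul_def, map_pow, map_neg]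
    ring
  · rw [hL, map_zero]
    rw [← hmap] at hu hw hz hv
    refine prod_eq_zero_of_plus (isUnit_two B)
      ((isUnit_iff_ne_zero.2 H.q_ne).map (algebraMap ℂ B)) hx hcard
      (fun i j hij => ?_) hu hw hz hv
    rw [hmap]
    have := congrArg E (esymm_nu ℓ hij)
    rwa [map_mul, map_mul, map_pow, map_pow] at this

theorem map_epsC {π : 𝒟.charAlg (m + 1) (-1) →ₐ[ℂ] Spec m}
    (hπ : 𝒟.IsSpectralHom (m + 1) (-1) (nuMultiset' m) π) {i : ℕ} (hi : i ≤ 2 * m) :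
    π (𝒟.epsC (m + 1) i) = (nuMultiset m).esymm i := by
  have low : ∀ i ≤ m, π (𝒟.epsLow (m + 1) i) = (nuMultiset m).esymm i := by
    intro i hi
    rw [QMData.epsLow, map_sum, ← sum_esymm_nuMultiset']
    refine Finset.sum_congr rfl fun j _ => ?_
    rw [map_mul, map_pow, hπ.1]
    congr 1
    cases h : i - 2 * j with
    | zero => rw [H.aC_zero, map_one, esymm_zero]
    | succ n => exact hπ.2 _ (by omega) (by omega)
  rw [QMData.epsC]
  split_ifs with h
  · exact low i h
  · rw [Nat.add_sub_cancel] at h ⊢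
    obtain ⟨j, hj⟩ : ∃ j, i + j = 2 * m := ⟨2 * m - i, by omega⟩
    have h2 := esymm_nu m hj
    have e : nu m 0 ^ j * nuInv m ^ j = 1 := by rw [← mul_pow, nu_mul_nuInv, one_pow]
    rw [show 2 * (m + 1) - 2 - i = j by omega, map_mul, map_pow, hπ.1, low j (by omega)]
    have h3 : nu m 0 ^ i = nu m 0 ^ j * (nu m 0 ^ 2) ^ (i - m) := by
      rw [← pow_mul, ← pow_add]
      congr 1
      omega
    rw [h3] at h2
    linear_combination (-nuInv m ^ j) * h2 + ((nuMultiset m).esymm i -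
      (nu m 0 ^ 2) ^ (i - m) * (nuMultiset m).esymm j) * e

theorem factorization_minus (hR : 𝒟.IsOrthogonal (2 * (m + 1)))
    (hq : 𝒟.q ^ (2 * (m + 1) + 2) ≠ -1)
    {star : 𝒟.powMod (m + 1) (-1) →ₗ[ℂ] 𝒟.powMod (m + 1) (-1) →ₗ[ℂ] 𝒟.powMod (m + 1) (-1)}
    (hs : 𝒟.IsStarProduct (m + 1) (-1) star)
    {π : 𝒟.charAlg (m + 1) (-1) →ₐ[ℂ] Spec m}
    (hπ : 𝒟.IsSpectralHom (m + 1) (-1) (nuMultiset' m) π)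
    {s : 𝒟.Completion π →ₗ[ℂ] 𝒟.Completion π →ₗ[ℂ] 𝒟.Completion π}
    (hC : 𝒟.IsCompletedStar star π s) :
    𝒟.pure π (𝒟.chMinus (m + 1) star) 1 = 𝒟.listProd s (𝒟.factor π (nu m 0) ::
        𝒟.factor π (-nu m 0) :: 𝒟.factors π) ∧
      𝒟.listProd s (𝒟.factor π (nu m 0) :: 𝒟.factor π (-nu m 0) :: 𝒟.factors π) = 0 := by
  obtain ⟨B, iB, iA, Φ, ψ, E, hm, hΦ, hψ, h1, hE⟩ := hs.exists_algebra
    ((H.isStarProduct_iff.1 hs).comm (H.powMod_eq (m + 1) (-1))) hC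
  obtain ⟨xi, hx, z, hu, -, hz, hv⟩ := H.exists_vanishing hR (by omega) hq hs hπ hψ h1 hE
  have h1' : Φ (𝒟.pure π (𝒟.oneP (m + 1) (-1)) 1) = 1 := by rw [hΦ, h1, map_one, one_mul]
  have hL := map_listProd hm h1' (𝒟.factor π (nu m 0) :: 𝒟.factor π (-nu m 0) :: 𝒟.factors π)
  rw [List.map_cons, List.map_cons, List.prod_cons, List.prod_cons, map_factors h1 hΦ,
    map_factor h1 hΦ, map_factor h1 hΦ, map_neg, ← mul_assoc, sub_neg_eq_add,
    mul_comm (_ - _), ← sq_sub_sq] at hL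
  refine ⟨Φ.injective ?_, Φ.injective ?_⟩
  · rw [hL, hΦ, map_one, mul_one, prod_sub_eq_sum, QMData.chMinus, hψ, map_powMod_sub, hE, h1,
      one_mul, hπ.1, map_pow, map_sum]
    congr 1
    · rw [show (2 : ℤ) = (2 : ℕ) from rfl, H.powP_nat hs hψ h1]
    · rw [Multiset.card_map, card_nuMultiset]
      refine Finset.sum_congr rfl fun i hi => ?_
      have hi' := Finset.mem_range.1 hi
      rw [map_smul, hE, H.powP_nat hs hψ h1, H.map_epsC hπ (by omega), Algebra.smul_def, map_pow,
        map_neg, show 2 * (m + 1) - 2 - i = 2 * m - i by omega,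
        show ((nuMultiset m).map E).esymm i = E ((nuMultiset m).esymm i) from
          esymm_map E.toRingHom _ i]
      ring
  · rw [hL, map_zero]
    have hq' : algebraMap ℂ B 𝒟.q = E.toRingHom (algebraMap ℂ (Spec m) 𝒟.q) :=
      (E.commutes _).symm
    rw [hq'] at hu hz hv ⊢
    exact prod_eq_zero_of_minus E.toRingHom (isUnit_two B)
      (IsUnit.of_mul_eq_one _ (nu_mul_nuInv m)) hx (card_nuMultiset m)
      (fun i j hij => esymm_nu' m (by omega)) hu hz hv

end QMData.Admissible

end OrthQM

end

theorem corollary5p7 {N : ℕ} (𝒟 : OrthQM.QMData N) (ℓ : ℕ) (hℓ : 1 ≤ ℓ)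
    (hR : 𝒟.IsOrthogonal (2 * ℓ))
    (hF : OrthQM.IsRMatrix 𝒟.F) (hFskew : OrthQM.StrictSkewInvertible 𝒟.F)
    (hRF : OrthQM.Compatible 𝒟.R 𝒟.F)
    (hq : 𝒟.q ^ (2 * ℓ + 2) ≠ -1) :
    -- the component `O^+(2ℓ)`
    ((∃! star, 𝒟.IsStarProduct ℓ 1 star) ∧
      ∀ star, 𝒟.IsStarProduct ℓ 1 star → 𝒟.OnlyReciprocal ℓ 1 →
        (∃! π, 𝒟.IsSpectralHom ℓ 1 (OrthQM.nuMultiset ℓ) π) ∧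
        ∀ π, 𝒟.IsSpectralHom ℓ 1 (OrthQM.nuMultiset ℓ) π →
          (∃! s, 𝒟.IsCompletedStar star π s) ∧
          ∀ s, 𝒟.IsCompletedStar star π s →
            𝒟.pure π (𝒟.chPlus ℓ) 1 = 𝒟.listProd s (𝒟.factors π) ∧
            𝒟.listProd s (𝒟.factors π) = 0) ∧
    -- the component `O^-(2ℓ)`
    ((∃! star, 𝒟.IsStarProduct ℓ (-1) star) ∧
      ∀ star, 𝒟.IsStarProduct ℓ (-1) star → 𝒟.OnlyReciprocal ℓ (-1) →
        (∃! π, 𝒟.IsSpectralHom ℓ (-1) (OrthQM.nu (ℓ - 1) 0 ::ₘ -OrthQM.nu (ℓ - 1) 0 ::ₘ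
            OrthQM.nuMultiset (ℓ - 1)) π) ∧
        ∀ π, 𝒟.IsSpectralHom ℓ (-1) (OrthQM.nu (ℓ - 1) 0 ::ₘ -OrthQM.nu (ℓ - 1) 0 ::ₘ
            OrthQM.nuMultiset (ℓ - 1)) π →
          (∃! s, 𝒟.IsCompletedStar star π s) ∧
          ∀ s, 𝒟.IsCompletedStar star π s →
            𝒟.pure π (𝒟.chMinus ℓ star) 1 =
              𝒟.listProd s (𝒟.factor π (OrthQM.nu (ℓ - 1) 0) ::
                𝒟.factor π (-OrthQM.nu (ℓ - 1) 0) :: 𝒟.factors π) ∧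
            𝒟.listProd s (𝒟.factor π (OrthQM.nu (ℓ - 1) 0) ::
                𝒟.factor π (-OrthQM.nu (ℓ - 1) 0) :: 𝒟.factors π) = 0) := by
  have H := OrthQM.QMData.admissible 𝒟 hR hF hFskew hRF
  refine ⟨⟨H.existsUnique_star, fun star hs hO => ⟨H.existsUnique_spectralHom_plus hR hℓ hO,
    fun π hπ => ⟨hs.existsUnique_completedStar π, fun s hC =>
      H.factorization_plus hR hℓ hq hs hπ hC⟩⟩⟩,
    ⟨H.existsUnique_star, fun star hs hO => ⟨H.existsUnique_spectralHom_minus hR hℓ hO,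
    fun π hπ => ⟨hs.existsUnique_completedStar π, fun s hC => ?_⟩⟩⟩⟩
  obtain ⟨m, rfl⟩ : ∃ m, ℓ = m + 1 := ⟨ℓ - 1, by omega⟩
  exact H.factorization_minus hR hq hs hπ hC
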